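/- **Theorem (quantum uniform random $k$-subset sampling).** *Model.* A quantum algorithm is a fixed program, the same for all inputs, run by a classical processor with word registers and a random access memory, with words of $L=\Theta(\log n)$ bits, and with $O(\log n)$ qubits. It can apply the gates $H$, $T$, $X$, CNOT, Toffoli and single-qubit measurements, chosen adaptively by the classical control; it can query the oracle $\mathcal O_w:|j\rangle|y\rangle\mapsto|j\rangle|y\oplus w_j\rangle$; and it can write its memory classically and read it classically or in superposition (quantum-read/classical-write RAM). Its time is the number of elementary classical and quantum operations, queries and single-bit memory accesses. For $w\in\mathbb N^n$ let $\|w\|_1=\sum_j w_j$ and $S_w=\{(j,\ell): j\in[n],\ \ell\in\{1,\dots,w_j\}\}$, a set of $\|w\|_1$ elements. *Claim.* For all constants $C,c\in\mathbb N$ there are a quantum algorithm $\mathsf{MultiSample}$ in this model and constants $A,d$ such that the following holds for all integers $1\le k\le n$ and all $w\in\mathbb N^n$ with $k\le\|w\|_1\le C n^{C}$. Given $n$, $k$ and query access to $w$, the algorithm returns, with probability at least $1-(n+1)^{-c}$, a uniformly random $k$-subset of $S_w$, in the sense that $$\Pr[\text{output}=S]\ \ge\ \bigl(1-(n+1)^{-c}\bigr)\Big/\binom{\|w\|_1}{k}\qquad\text{for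 every } S\subseteq S_w \text{ with } |S|=k$$ (that is, the law of the output is a mixture of the uniform law on the $k$-subsets of $S_w$, with weight $1-(n+1)^{-c}$, and some other law). In every run, the number of queries to $\mathcal O_w$, the time, and the number of bits of memory used are at most $$A\,\sqrt{nk}\,(1+\log n)^{d}=\widetilde O(\sqrt{nk}).$$ -/

import Mathlib

/-!
# Quantum algorithms with classical control, quantum queries and a quantum-read memory

A program is a finite piece of code, the same for all inputs.  It controls

* word registers `r₀, r₁, …` and a random access memory of words, all words having `L` bits;
* `Q` qubits, on which it can apply elementary gates and measurements, one at a time;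
* the oracle `|j⟩|y⟩ ↦ |j⟩|y ⊕ w_j⟩` of the input vector `w`, the only access to `w`;
* quantum reads `|a⟩|y⟩ ↦ |a⟩|y ⊕ RAM[a]⟩` of the memory, which is written classically.

All loops are bounded, so every program halts.
-/

namespace QMachine

/-- Binary operations of the classical word processor. -/
inductive BinOp where
  | add | sub | mul | div | mod | lt | eq | bit

/-- The value of an operation on words of `L` bits.  Sums and products are reduced modulo `2 ^ L`,
subtraction is truncated at `0`, truth values are `0` and `1`, and `bit a i` is the bit of weight
`2 ^ i` of `a`. -/
def BinOp.eval (L : ℕ) : BinOp → ℕ → ℕ → ℕ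
  | .add, a, b => (a + b) % 2 ^ L
  | .sub, a, b => a - b
  | .mul, a, b => (a * b) % 2 ^ L
  | .div, a, b => a / b
  | .mod, a, b => a % b
  | .lt, a, b => (if a < b then 1 else 0) % 2 ^ L
  | .eq, a, b => (if a = b then 1 else 0) % 2 ^ L
  | .bit, a, i => (if a.testBit i then 1 else 0) % 2 ^ L

/-- Classical expressions over the word registers. -/
inductive Expr where
  | lit (v : ℕ)
  | reg (x : ℕ)
  | bin (op : BinOp) (e₁ e₂ : Expr)

/-- Value of an expression, for the contents `r` of the registers. -/
def Expr.eval (L : ℕ) (r : ℕ → ℕ) : Expr → ℕ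
  | .lit v => v % 2 ^ L
  | .reg x => r x
  | .bin op e₁ e₂ => op.eval L (e₁.eval L r) (e₂.eval L r)

/-- Number of bit operations charged for an expression: `L` for fetching a word, and `L ^ 2` for
an arithmetical operation. -/
def Expr.cost (L : ℕ) : Expr → ℕ
  | .lit _ => L
  | .reg _ => L
  | .bin _ e₁ e₂ => L ^ 2 + e₁.cost L + e₂.cost L

/-- Elementary one-qubit gates: Hadamard, `T = diag(1, exp(iπ/4))` and NOT. -/
inductive Gate where
  | H | T | X

/-- Programs.  The positions of qubits and the memory addresses are values of classical
expressions, so that the classical control generates the quantum circuits. -/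
inductive Cmd where
  | skip
  /-- `r_x := e` -/
  | assign (x : ℕ) (e : Expr)
  /-- `r_x := RAM[a]` -/
  | load (x : ℕ) (a : Expr)
  /-- `RAM[a] := e` -/
  | store (a e : Expr)
  /-- apply `g` to qubit `i` -/
  | gate (g : Gate) (i : Expr)
  /-- controlled NOT with control `c` and target `t` -/
  | cnot (c t : Expr)
  /-- Toffoli gate with controls `c₁`, `c₂` and target `t` -/
  | ccnot (c₁ c₂ t : Expr)
  /-- measure qubit `i` in the computational basis and put the outcome into `r_x` -/
  | measure (x : ℕ) (i : Expr)
  /-- query the oracle, with the index in the `L` qubits from position `a` on, and the answer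
  added to the `L` qubits from position `t` on -/
  | query (a t : Expr)
  /-- quantum read of the memory, with the address in the `L` qubits from position `a` on, and the
  answer added to the `L` qubits from position `t` on -/
  | qread (a t : Expr)
  | seq (p₁ p₂ : Cmd)
  /-- if `e ≠ 0` then `p₁` else `p₂` -/
  | ite (e : Expr) (p₁ p₂ : Cmd)
  /-- run `p` as many times as the value that `e` has on entry -/
  | loop (e : Expr) (p : Cmd)

/-- Labels of the computational basis of `Q` qubits. -/
abbrev Basis (Q : ℕ) : Type := Fin Q → Bool

/-- State vectors of `Q` qubits.  They need not be normalized: the squared norm of the state vector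
of a branch is the probability of that branch. -/
abbrev Vec (Q : ℕ) : Type := Basis Q → ℂ

section Quantum

variable {Q : ℕ}

/-- The bit at position `i`; `false` if there is no such position. -/
def bitAt (x : Basis Q) (i : ℕ) : Bool := if h : i < Q then x ⟨i, h⟩ else false

/-- Replace the bit at position `i` by `v`. -/
def setBit (i : ℕ) (v : Bool) (x : Basis Q) : Basis Q :=
  fun j => if (j : ℕ) = i then v else x j

/-- The number written in binary in the positions `a, …, a + L - 1`, lowest bit first. -/
def blockVal (L a : ℕ) (x : Basis Q) : ℕ :=
  ∑ i ∈ Finset.range L, if bitAt x (a + i) then 2 ^ i else 0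

/-- Add the lowest `L` bits of `v`, modulo two, to the positions `t, …, t + L - 1`. -/
def xorBlock (L t v : ℕ) (x : Basis Q) : Basis Q :=
  fun j => if t ≤ (j : ℕ) ∧ (j : ℕ) < t + L then xor (x j) (v.testBit (j - t)) else x j

/-- A one-qubit gate on qubit `i`; nothing happens if there is no such qubit. -/
noncomputable def Gate.apply (i : ℕ) (ψ : Vec Q) : Gate → Vec Q
  | .H => if i < Q then fun x =>
        (ψ (setBit i false x) + (if bitAt x i then -1 else 1) * ψ (setBit i true x)) / (√2 : ℝ)
      else ψ
  | .T => if i < Q then fun x =>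
        (if bitAt x i then Complex.exp (Complex.I * Real.pi / 4) else 1) * ψ x
      else ψ
  | .X => if i < Q then fun x => ψ (setBit i (!bitAt x i) x) else ψ

/-- Controlled NOT; nothing happens unless `c` and `t` are two different qubits. -/
def cnotApply (c t : ℕ) (ψ : Vec Q) : Vec Q :=
  if c < Q ∧ t < Q ∧ c ≠ t then
    fun x => ψ (setBit t (xor (bitAt x t) (bitAt x c)) x)
  else ψ

/-- Toffoli gate; nothing happens unless `c₁`, `c₂` and `t` are three different qubits. -/
def ccnotApply (c₁ c₂ t : ℕ) (ψ : Vec Q) : Vec Q :=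
  if c₁ < Q ∧ c₂ < Q ∧ t < Q ∧ c₁ ≠ c₂ ∧ c₁ ≠ t ∧ c₂ ≠ t then
    fun x => ψ (setBit t (xor (bitAt x t) (bitAt x c₁ && bitAt x c₂)) x)
  else ψ

/-- The unitary `|a⟩|y⟩ ↦ |a⟩|y ⊕ f a⟩` on two disjoint blocks of `L` qubits, from the positions `a`
and `t` on; nothing happens if the blocks overlap or leave the range of the qubits.  The map of
basis labels is an involution, so composing with it applies the unitary. -/
def lookupApply (L : ℕ) (f : ℕ → ℕ) (a t : ℕ) (ψ : Vec Q) : Vec Q :=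
  if a + L ≤ Q ∧ t + L ≤ Q ∧ (a + L ≤ t ∨ t + L ≤ a) then
    fun x => ψ (xorBlock L t (f (blockVal L a x)) x)
  else ψ

/-- The unnormalized state after qubit `i` was measured with outcome `v`.  Measuring a position
without a qubit gives `false`. -/
def project (i : ℕ) (v : Bool) (ψ : Vec Q) : Vec Q :=
  fun x => if bitAt x i = v then ψ x else 0

/-- Squared norm. -/
noncomputable def normSq (ψ : Vec Q) : ℝ := ∑ x, ‖ψ x‖ ^ 2

end Quantum

/-- The state of the machine on one branch of the computation.  `space` is the number of memory
cells in use, i.e. the least number above all addresses that were written. -/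
structure Config (Q : ℕ) where
  reg : ℕ → ℕ
  ram : ℕ → ℕ
  psi : Vec Q
  time : ℕ
  queries : ℕ
  space : ℕ

/-- Spend `m` units of time. -/
def Config.tick {Q : ℕ} (m : ℕ) (s : Config Q) : Config Q := { s with time := s.time + m }

/-- The vector `w` as a function on all natural numbers, zero outside the index range. -/
def extend {n : ℕ} (w : Fin n → ℕ) (j : ℕ) : ℕ := if h : j < n then w ⟨j, h⟩ else 0

/-- The branches of the execution of a program from a given state.  Classical evaluation costs its
number of bit operations; gates, measurements and queries cost one unit each; memory access to
a word of `L` bits costs `L` units; a test and each round of a loop cost one more unit. -/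
noncomputable def Cmd.run {n : ℕ} (w : Fin n → ℕ) (L : ℕ) {Q : ℕ} :
    Cmd → Config Q → List (Config Q)
  | .skip, s => [s.tick 1]
  | .assign x e, s =>
      [{ s with
          reg := Function.update s.reg x (e.eval L s.reg)
          time := s.time + (e.cost L + L) }]
  | .load x a, s =>
      [{ s with
          reg := Function.update s.reg x (s.ram (a.eval L s.reg))
          time := s.time + (a.cost L + L) }]
  | .store a e, s =>
      [{ s with
          ram := Function.update s.ram (a.eval L s.reg) (e.eval L s.reg)
          space := max s.space (a.eval L s.reg + 1)
          time := s.time + (a.cost L + e.cost L + L) }]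
  | .gate g i, s =>
      [{ s with
          psi := g.apply (i.eval L s.reg) s.psi
          time := s.time + (i.cost L + 1) }]
  | .cnot c t, s =>
      [{ s with
          psi := cnotApply (c.eval L s.reg) (t.eval L s.reg) s.psi
          time := s.time + (c.cost L + t.cost L + 1) }]
  | .ccnot c₁ c₂ t, s =>
      [{ s with
          psi := ccnotApply (c₁.eval L s.reg) (c₂.eval L s.reg) (t.eval L s.reg) s.psi
          time := s.time + (c₁.cost L + c₂.cost L + t.cost L + 1) }]
  | .measure x i, s =>
      [false, true].map fun v =>
        { s with
          reg := Function.update s.reg x (v.toNat % 2 ^ L)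
          psi := project (i.eval L s.reg) v s.psi
          time := s.time + (i.cost L + 1) }
  | .query a t, s =>
      [{ s with
          psi := lookupApply L (extend w) (a.eval L s.reg) (t.eval L s.reg) s.psi
          queries := s.queries + 1
          time := s.time + (a.cost L + t.cost L + 1) }]
  | .qread a t, s =>
      [{ s with
          psi := lookupApply L s.ram (a.eval L s.reg) (t.eval L s.reg) s.psi
          time := s.time + (a.cost L + t.cost L + L) }]
  | .seq p₁ p₂, s => (p₁.run w L s).flatMap (p₂.run w L)
  | .ite e p₁ p₂, s =>
      if e.eval L s.reg ≠ 0 then p₁.run w L (s.tick (e.cost L + 1))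
      else p₂.run w L (s.tick (e.cost L + 1))
  | .loop e p, s =>
      (fun l : List (Config Q) => l.flatMap fun s' => p.run w L (s'.tick 1))^[e.eval L s.reg]
        [s.tick (e.cost L + 1)]

/-- The initial state: `r₀ = n`, `r₁ = k`, `r₂ = L` (the word length), everything else is zero, and
all qubits are in the state `|0⟩`. -/
def init (n k L Q : ℕ) : Config Q where
  reg x := (if x = 0 then n else if x = 1 then k else if x = 2 then L else 0) % 2 ^ L
  ram _ := 0
  psi x := if x = fun _ => false then 1 else 0
  time := 0
  queries := 0
  space := 0

/-- The branches of the execution of `P` on the input `(w, k)`. -/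
noncomputable def Cmd.branches (P : Cmd) {n : ℕ} (w : Fin n → ℕ) (k L Q : ℕ) : List (Config Q) :=
  P.run w L (init n k L Q)

/-- The set of pairs returned by a halted machine: `k` pairs of words, written into the
first `2 * k` memory cells. -/
def Config.output {Q : ℕ} (k : ℕ) (s : Config Q) : Finset (ℕ × ℕ) :=
  (Finset.range k).image fun i => (s.ram (2 * i), s.ram (2 * i + 1))

/-- The probability that `P` returns the set `S` on the input `(w, k)`. -/
noncomputable def Cmd.outputProb (P : Cmd) {n : ℕ} (w : Fin n → ℕ) (k L Q : ℕ)
    (S : Finset (ℕ × ℕ)) : ℝ :=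
  ((P.branches w k L Q).map fun s => if s.output k = S then normSq s.psi else 0).sum

/-- The set `S_w = {(j, ℓ) : j an index, 1 ≤ ℓ ≤ w_j}`; indices run from `0` to `n - 1`. -/
def pairSet {n : ℕ} (w : Fin n → ℕ) : Finset (ℕ × ℕ) :=
  Finset.univ.biUnion fun j : Fin n => (Finset.Icc 1 (w j)).image fun l => ((j : ℕ), l)

/-- Word length `b (⌊log₂ n⌋ + 1)`. -/
def wordLength (b n : ℕ) : ℕ := b * (Nat.log 2 n + 1)

end QMachine

/-! The sample is drawn by repeated amplitude amplification. An attempt returns every marked item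
with exactly the same probability, and attempts are repeated until `k` different items have been
seen. Whatever the success probabilities of the attempts are, the law of the collected set is
invariant under permutations of the marked items, so all `k`-subsets are equally likely
(`draws_symm`, `draws_rounds_uniform`). It remains to present the elements of `S_w` as marked items
of density at least of order `k / n`: then about `√(n / k)` rounds of amplification per attempt and
about `k` attempts give `√(nk)` up to logarithms.

Search space. Write `W = ‖w‖₁` and fix a level `m`. A row is a pair `(j, o)` with `2 ^ m ∣ o` and `o
≤ w_j`; its value is `w_j - o`. A slot is a row with `m` further low bits, forming a number `l`, and
stands for the pair `(j, o + 2 ^ m - l)`. This pair lies in `S_w` iff `l` plus the value is at least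
`2 ^ m`, a condition that a carry computes, and every element of `S_w` comes from exactly one such
slot (`marked_bijection`). Rows with `o = 0` are answered by the oracle, rows with `o > 0` by a
table in the quantum-read memory, which must have at most `k` entries. There are `2 ^ (m + u + 1)`
slots with `n < 2 ^ u ≤ 2 n`, so the density suffices as soon as `k * 2 ^ m ≤ 2 W`.

Choice of the level. At a level with `2 ^ m > W` the table is empty. To pass from level `m + 1` to
level `m`, the odd multiples of `2 ^ m` have to be added; they are the `(j, o + 2 ^ m)` for the rows
`(j, o)` of level `m + 1` with value at least `2 ^ m`, and they are found by the same search without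
low bits. If more than `k` multiples of `2 ^ m` turn up, then `k * 2 ^ m ≤ W`, so level `m + 1`
satisfies the density condition and its table is complete. If this never happens, level `0` is
reached, where `k ≤ W` is enough.

Attempts. The number of marked slots is not known in the search for the level, so `0, 1, 3, 7, …, T
- 1` rounds are tried in turn, where `T` is the power of two with `T² k ≤ 2 ^ u < 4 T² k`; one of
these numbers has a sufficient success probability (`exists_rate`). The expected number of missing
items then contracts by the factor `1 - 1 / (40 k)` (`draws_potential`), and a multiple of `k L`
repetitions makes a failure polynomially unlikely (`draws_rounds_full`). A binary trie on the keys
of the slots recognizes repetitions.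

Layout. Entry `e` of the lists uses cell `8 e + 1` for `j`, `8 e + 2` for `o`, `8 e + 3` for a value
found in the current collection and `8 e + 7` for the value visible to quantum reads; the trie uses
the multiples of `8`. In the label, the slot occupies the lowest positions (low bits, three ones,
row), position `2 L` starts the value of the row, `3 L` a block of ones, `4 L` the ladder of carries
of the comparison, and `6 L` and `7 L` the test for the start label.

Verification. Weighted sums over branches are computed backwards (`Cmd.wp`, `sum_run`). Apart from
Hadamard and phase gates everything acts on basis labels, so circuits are verified by the classical
execution `Cmd.det` (`sum_det_le_wp`, `leads_perm`), and amplification by `grover`. The pieces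
return all qubits to zero, so lower bounds for `Cmd.ex` compose, and `sim_attempt` ties an attempt
of the program to the abstract `draw`. Time, queries and space are bounded on all branches by the
syntax alone (`Cmd.within`): loops are bounded through registers that the program does not change.
-/

namespace QMachine

/-! ### Backward and classical semantics of programs -/

section Semantics

variable {Q : ℕ}

/-- The part of a configuration that influences the further run. -/
@[ext] structure Core (Q : ℕ) where
  reg : ℕ → ℕ
  ram : ℕ → ℕ
  psi : Vec Q

/-- Forget the resource counters. -/
def Config.core (s : Config Q) : Core Q := ⟨s.reg, s.ram, s.psi⟩

/-- A classical state together with a label of the computational basis. -/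
@[ext] structure DState (Q : ℕ) where
  reg : ℕ → ℕ
  ram : ℕ → ℕ
  lab : Basis Q

/-- The label map of a NOT gate. -/
def flipB (i : ℕ) (x : Basis Q) : Basis Q := setBit i (!bitAt x i) x

/-- The label map of a controlled NOT gate. -/
def cnotB (c t : ℕ) (x : Basis Q) : Basis Q :=
  if c < Q ∧ t < Q ∧ c ≠ t then setBit t (xor (bitAt x t) (bitAt x c)) x else x

/-- The label map of a Toffoli gate. -/
def ccnotB (c₁ c₂ t : ℕ) (x : Basis Q) : Basis Q :=
  if c₁ < Q ∧ c₂ < Q ∧ t < Q ∧ c₁ ≠ c₂ ∧ c₁ ≠ t ∧ c₂ ≠ t then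
    setBit t (xor (bitAt x t) (bitAt x c₁ && bitAt x c₂)) x else x

/-- The label map of a table lookup. -/
def lookupB (L : ℕ) (f : ℕ → ℕ) (a t : ℕ) (x : Basis Q) : Basis Q :=
  if a + L ≤ Q ∧ t + L ≤ Q ∧ (a + L ≤ t ∨ t + L ≤ a) then
    xorBlock L t (f (blockVal L a x)) x else x

lemma bitAt_setBit (i j : ℕ) (v : Bool) (x : Basis Q) :
    bitAt (setBit i v x) j = if j = i ∧ i < Q then v else bitAt x j := by
  unfold bitAt setBit
  by_cases h : j < Q <;> by_cases hj : j = i <;> simp [h, hj] <;> (try subst hj) <;> simp [h]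

lemma basis_ext {x y : Basis Q} (h : ∀ i < Q, bitAt x i = bitAt y i) : x = y := by
  funext j
  have := h j j.2
  simpa [bitAt] using this

lemma bitAt_xorBlock (L t v : ℕ) (x : Basis Q) (i : ℕ) (hi : i < Q) :
    bitAt (xorBlock L t v x) i =
      if t ≤ i ∧ i < t + L then xor (bitAt x i) (v.testBit (i - t)) else bitAt x i := by
  simp [bitAt, xorBlock, hi]

lemma blockVal_congr {L a : ℕ} {x y : Basis Q} (h : ∀ i < L, bitAt x (a + i) = bitAt y (a + i)) :
    blockVal L a x = blockVal L a y := by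
  unfold blockVal
  exact Finset.sum_congr rfl fun i hi => by rw [h i (Finset.mem_range.1 hi)]

lemma bitAt_flipB (i j : ℕ) (x : Basis Q) :
    bitAt (flipB i x) j = if j = i ∧ i < Q then !bitAt x j else bitAt x j := by
  unfold flipB
  rw [bitAt_setBit]
  split_ifs with h
  · rw [h.1]
  · rfl

lemma flipB_flipB (i : ℕ) (x : Basis Q) : flipB i (flipB i x) = x := by
  refine basis_ext fun j hj => ?_
  rw [bitAt_flipB, bitAt_flipB]
  split_ifs <;> simp

lemma cnotB_cnotB (c t : ℕ) (x : Basis Q) : cnotB c t (cnotB c t x) = x := by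
  unfold cnotB
  split_ifs with h
  · refine basis_ext fun j hj => ?_
    simp only [bitAt_setBit]
    have := h.2.2
    by_cases hj : j = t <;> simp [hj, h.2.1, this]
  · rfl

lemma ccnotB_ccnotB (c d t : ℕ) (x : Basis Q) : ccnotB c d t (ccnotB c d t x) = x := by
  unfold ccnotB
  split_ifs with h
  · refine basis_ext fun j hj => ?_
    simp only [bitAt_setBit]
    obtain ⟨h1, h2, h3, h4, h5, h6⟩ := h
    by_cases hj : j = t <;> simp [hj, h3, h5, h6]
  · rfl

/-- The address block is disjoint from the target block, so the second lookup sees the same address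
and adds the same word again. -/
lemma lookupB_lookupB (L : ℕ) (f : ℕ → ℕ) (a t : ℕ) (x : Basis Q) :
    lookupB L f a t (lookupB L f a t x) = x := by
  unfold lookupB
  split_ifs with h
  · obtain ⟨h1, h2, h3⟩ := h
    have e : blockVal L a (xorBlock L t (f (blockVal L a x)) x) = blockVal L a x := by
      refine blockVal_congr fun i hi => ?_
      rw [bitAt_xorBlock _ _ _ _ _ (by omega), if_neg (by omega)]
    rw [e]
    refine basis_ext fun j hj => ?_
    simp only [bitAt_xorBlock _ _ _ _ _ hj]
    split_ifs <;> simp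
  · rfl

lemma X_apply (i : ℕ) (ψ : Vec Q) : Gate.X.apply i ψ = fun x => ψ (flipB i x) := by
  unfold Gate.apply
  split_ifs with h
  · rfl
  · funext x
    have : flipB i x = x := basis_ext fun j hj => by rw [bitAt_flipB, if_neg (by omega)]
    rw [this]

lemma cnotApply_eq (c t : ℕ) (ψ : Vec Q) : cnotApply c t ψ = fun x => ψ (cnotB c t x) := by
  unfold cnotApply cnotB
  split_ifs <;> rfl

lemma ccnotApply_eq (c d t : ℕ) (ψ : Vec Q) :
    ccnotApply c d t ψ = fun x => ψ (ccnotB c d t x) := by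
  unfold ccnotApply ccnotB
  split_ifs <;> rfl

lemma lookupApply_eq (L : ℕ) (f : ℕ → ℕ) (a t : ℕ) (ψ : Vec Q) :
    lookupApply L f a t ψ = fun x => ψ (lookupB L f a t x) := by
  unfold lookupApply lookupB
  split_ifs <;> rfl

variable {n : ℕ} (w : Fin n → ℕ) (L : ℕ)

/-- Weighted sum of `g` over the branches of a program, computed backwards. -/
noncomputable def Cmd.wp : Cmd → (Core Q → ℝ) → Core Q → ℝ
  | .skip, g => g
  | .assign x e, g => fun s => g { s with reg := Function.update s.reg x (e.eval L s.reg) }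
  | .load x a, g => fun s =>
      g { s with reg := Function.update s.reg x (s.ram (a.eval L s.reg)) }
  | .store a e, g => fun s =>
      g { s with ram := Function.update s.ram (a.eval L s.reg) (e.eval L s.reg) }
  | .gate γ i, g => fun s => g { s with psi := γ.apply (i.eval L s.reg) s.psi }
  | .cnot c t, g => fun s =>
      g { s with psi := cnotApply (c.eval L s.reg) (t.eval L s.reg) s.psi }
  | .ccnot c d t, g => fun s =>
      g { s with psi := ccnotApply (c.eval L s.reg) (d.eval L s.reg) (t.eval L s.reg) s.psi }
  | .measure x i, g => fun s =>
      g { s with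
          reg := Function.update s.reg x (false.toNat % 2 ^ L)
          psi := project (i.eval L s.reg) false s.psi } +
      g { s with
          reg := Function.update s.reg x (true.toNat % 2 ^ L)
          psi := project (i.eval L s.reg) true s.psi }
  | .query a t, g => fun s =>
      g { s with psi := lookupApply L (extend w) (a.eval L s.reg) (t.eval L s.reg) s.psi }
  | .qread a t, g => fun s =>
      g { s with psi := lookupApply L s.ram (a.eval L s.reg) (t.eval L s.reg) s.psi }
  | .seq p q, g => Cmd.wp p (Cmd.wp q g)
  | .ite e p q, g => fun s => if e.eval L s.reg ≠ 0 then Cmd.wp p g s else Cmd.wp q g s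
  | .loop e p, g => fun s => (Cmd.wp p)^[e.eval L s.reg] g s

/-- Classical execution on a basis state.  Gates `H` and `T` are ignored. -/
def Cmd.det : Cmd → DState Q → DState Q
  | .skip, s => s
  | .assign x e, s => { s with reg := Function.update s.reg x (e.eval L s.reg) }
  | .load x a, s => { s with reg := Function.update s.reg x (s.ram (a.eval L s.reg)) }
  | .store a e, s =>
      { s with ram := Function.update s.ram (a.eval L s.reg) (e.eval L s.reg) }
  | .gate γ i, s => match γ with
      | .X => { s with lab := flipB (i.eval L s.reg) s.lab }
      | _ => s
  | .cnot c t, s => { s with lab := cnotB (c.eval L s.reg) (t.eval L s.reg) s.lab }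
  | .ccnot c d t, s =>
      { s with lab := ccnotB (c.eval L s.reg) (d.eval L s.reg) (t.eval L s.reg) s.lab }
  | .measure x i, s =>
      { s with reg := Function.update s.reg x ((bitAt s.lab (i.eval L s.reg)).toNat % 2 ^ L) }
  | .query a t, s =>
      { s with lab := lookupB L (extend w) (a.eval L s.reg) (t.eval L s.reg) s.lab }
  | .qread a t, s =>
      { s with lab := lookupB L s.ram (a.eval L s.reg) (t.eval L s.reg) s.lab }
  | .seq p q, s => Cmd.det q (Cmd.det p s)
  | .ite e p q, s => if e.eval L s.reg ≠ 0 then Cmd.det p s else Cmd.det q s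
  | .loop e p, s => (Cmd.det p)^[e.eval L s.reg] s

/-- No gates `H` and `T`; measurements only if `m` is true. -/
def Cmd.classical (m : Bool) : Cmd → Bool
  | .gate γ _ => match γ with
      | .X => true
      | _ => false
  | .measure _ _ => m
  | .seq p q => p.classical m && q.classical m
  | .ite _ p q => p.classical m && q.classical m
  | .loop _ p => p.classical m
  | _ => true

lemma sum_flatMap' {α : Type*} (l : List α) (f : α → List ℝ) :
    (l.flatMap f).sum = (l.map fun a => (f a).sum).sum := by
  induction l with
  | nil => rfl
  | cons a l ih => simp [ih]

/-- No instruction reads the counters, so a functional of the cores can be pulled back instruction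
by instruction. Statements about the list of branches become statements about one function of the
initial state. -/
theorem sum_run (P : Cmd) (g : Core Q → ℝ) (s : Config Q) :
    ((P.run w L s).map fun s' => g s'.core).sum = P.wp w L g s.core := by
  induction P generalizing g s with
  | seq p q hp hq =>
    simp only [Cmd.run, Cmd.wp]
    rw [← hp, List.map_flatMap, sum_flatMap']
    congr 1
    refine List.map_congr_left fun s' _ => ?_
    exact hq g s'
  | ite e p q hp hq =>
    have h1 : s.core.reg = s.reg := rfl
    simp only [Cmd.run, Cmd.wp, h1]
    split_ifs
    · exact hp g _
    · exact hq g _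
  | loop e p hp =>
    simp only [Cmd.run, Cmd.wp]
    have key : ∀ (N : ℕ) (l : List (Config Q)),
        ((((fun l : List (Config Q) => l.flatMap fun s' => p.run w L (s'.tick 1))^[N] l)).map
          fun s' => g s'.core).sum = (l.map fun s' => (p.wp w L)^[N] g s'.core).sum := by
      intro N
      induction N with
      | zero => intro l; rfl
      | succ N ih =>
        intro l
        rw [Function.iterate_succ_apply, ih, List.map_flatMap, sum_flatMap']
        congr 1
        refine List.map_congr_left fun s' _ => ?_
        rw [Function.iterate_succ_apply']
        exact hp _ (s'.tick 1)
    rw [key]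
    simp [Config.core, Config.tick]
  | measure x i => simp [Cmd.run, Cmd.wp, Config.core]
  | _ => simp [Cmd.run, Cmd.wp, Config.core, Config.tick]

lemma wp_mono (P : Cmd) {g g' : Core Q → ℝ} (h : ∀ s, g s ≤ g' s) (s : Core Q) :
    P.wp w L g s ≤ P.wp w L g' s := by
  induction P generalizing g g' s with
  | seq p q hp hq => exact hp (hq h) s
  | ite e p q hp hq =>
    simp only [Cmd.wp]
    split_ifs
    · exact hp h s
    · exact hq h s
  | loop e p hp =>
    simp only [Cmd.wp]
    have key : ∀ (N : ℕ) (s : Core Q), (p.wp w L)^[N] g s ≤ (p.wp w L)^[N] g' s := by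
      intro N
      induction N with
      | zero => exact h
      | succ N ih =>
        intro s
        rw [Function.iterate_succ_apply', Function.iterate_succ_apply']
        exact hp ih s
    exact key _ s
  | measure x i => exact add_le_add (h _) (h _)
  | _ => exact h _

lemma wp_zero (P : Cmd) (s : Core Q) : P.wp w L (fun _ => 0) s = 0 := by
  induction P generalizing s with
  | seq p q hp hq =>
    have : q.wp w L (fun _ : Core Q => (0 : ℝ)) = fun _ => 0 := funext hq
    simp only [Cmd.wp, this, hp]
  | ite e p q hp hq =>
    simp only [Cmd.wp, hp, hq, ite_self]
  | loop e p hp =>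
    simp only [Cmd.wp]
    have key : ∀ (N : ℕ), (p.wp w L)^[N] (fun _ : Core Q => (0 : ℝ)) = fun _ => 0 := by
      intro N
      induction N with
      | zero => rfl
      | succ N ih => rw [Function.iterate_succ_apply', ih]; exact funext hp
    rw [key]
  | measure x i => simp [Cmd.wp]
  | _ => rfl

lemma wp_nonneg (P : Cmd) {g : Core Q → ℝ} (h : ∀ s, 0 ≤ g s) (s : Core Q) :
    0 ≤ P.wp w L g s := by
  have := wp_mono w L P h s
  rwa [wp_zero] at this

/-- An involution of the labels only reindexes the sum, and the condition `D` on the support travels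
along. This covers the reversible gates, queries and memory reads at once. -/
lemma sum_perm_le {g : Core Q → ℝ} {h : DState Q → ℝ} {D : DState Q → Prop}
    (H : ∀ reg ram ψ, (∀ x, ψ x ≠ 0 → D ⟨reg, ram, x⟩) →
      ∑ x, ‖ψ x‖ ^ 2 * h ⟨reg, ram, x⟩ ≤ g ⟨reg, ram, ψ⟩)
    (σ : Basis Q → Basis Q) (hσ : ∀ x, σ (σ x) = x) (reg ram) (ψ : Vec Q)
    (hψ : ∀ x, ψ x ≠ 0 → D ⟨reg, ram, σ x⟩) :
    ∑ x, ‖ψ x‖ ^ 2 * h ⟨reg, ram, σ x⟩ ≤ g ⟨reg, ram, fun x => ψ (σ x)⟩ := by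
  refine le_trans (le_of_eq ?_) (H reg ram (fun x => ψ (σ x)) fun x hx => by
    simpa [hσ] using hψ _ hx)
  refine Fintype.sum_equiv ⟨σ, σ, hσ, hσ⟩ _ _ fun x => ?_
  simp [hσ]

/-- For a program without `H` and `T`, the weight of the branches is at least what the classical
execution on the basis states gives. -/
theorem sum_det_le_wp {m : Bool} (P : Cmd) (hP : P.classical m = true) {g : Core Q → ℝ}
    {h : DState Q → ℝ} {D : DState Q → Prop}
    (H : ∀ reg ram ψ, (∀ x, ψ x ≠ 0 → D ⟨reg, ram, x⟩) →
      ∑ x, ‖ψ x‖ ^ 2 * h ⟨reg, ram, x⟩ ≤ g ⟨reg, ram, ψ⟩) (reg ram ψ)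
    (hψ : ∀ x, ψ x ≠ 0 → D (P.det w L ⟨reg, ram, x⟩)) :
    ∑ x, ‖ψ x‖ ^ 2 * h (P.det w L ⟨reg, ram, x⟩) ≤ P.wp w L g ⟨reg, ram, ψ⟩ := by
  induction P generalizing g h D reg ram ψ with
  | seq p q hp hq =>
    simp only [Cmd.classical, Bool.and_eq_true] at hP
    exact hp hP.1 (h := fun s => h (q.det w L s)) (D := fun s => D (q.det w L s))
      (fun reg ram ψ hψ => hq hP.2 H reg ram ψ hψ) reg ram ψ hψ
  | ite e p q hp hq =>
    simp only [Cmd.classical, Bool.and_eq_true] at hP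
    simp only [Cmd.wp, Cmd.det] at hψ ⊢
    split_ifs with hc
    · simp only [if_pos hc] at hψ ⊢
      exact hp hP.1 H reg ram ψ hψ
    · simp only [if_neg hc] at hψ ⊢
      exact hq hP.2 H reg ram ψ hψ
  | loop e p hp =>
    simp only [Cmd.classical] at hP
    simp only [Cmd.wp, Cmd.det] at hψ ⊢
    generalize e.eval L reg = N at hψ ⊢
    induction N generalizing reg ram ψ with
    | zero => exact H _ _ _ hψ
    | succ N ih =>
      simp only [Function.iterate_succ_apply] at hψ ⊢
      rw [← Function.iterate_succ_apply (p.wp w L), Function.iterate_succ_apply']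
      exact hp hP (g := (p.wp w L)^[N] g) (h := fun s => h ((p.det w L)^[N] s))
        (D := fun s => D ((p.det w L)^[N] s)) (fun reg ram ψ hψ => ih reg ram ψ hψ)
        reg ram ψ hψ
  | measure x i =>
    simp only [Cmd.wp, Cmd.det] at hψ ⊢
    have hv : ∀ v : Bool, ∀ y, project (i.eval L reg) v ψ y ≠ 0 →
        D ⟨Function.update reg x (v.toNat % 2 ^ L), ram, y⟩ := by
      intro v y hy
      unfold project at hy
      split_ifs at hy with hb
      · simpa [hb] using hψ y hy
      · exact absurd rfl hy
    -- The two projections split the labels according to the measured bit, and on each part the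
    -- classical execution records exactly that bit.
    refine le_trans (le_of_eq ?_) (add_le_add (H _ _ _ (hv false)) (H _ _ _ (hv true)))
    rw [← Finset.sum_add_distrib]
    refine Finset.sum_congr rfl fun y _ => ?_
    unfold project
    cases hb : bitAt y (i.eval L reg) <;> simp
  | gate γ i =>
    cases γ with
    | X =>
      simp only [Cmd.wp, Cmd.det, X_apply] at hψ ⊢
      exact sum_perm_le H _ (flipB_flipB _) reg ram ψ hψ
    | _ => simp [Cmd.classical] at hP
  | cnot c t =>
    simp only [Cmd.wp, Cmd.det, cnotApply_eq] at hψ ⊢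
    exact sum_perm_le H _ (cnotB_cnotB _ _) reg ram ψ hψ
  | ccnot c d t =>
    simp only [Cmd.wp, Cmd.det, ccnotApply_eq] at hψ ⊢
    exact sum_perm_le H _ (ccnotB_ccnotB _ _ _) reg ram ψ hψ
  | query a t =>
    simp only [Cmd.wp, Cmd.det, lookupApply_eq] at hψ ⊢
    exact sum_perm_le H _ (lookupB_lookupB _ _ _ _) reg ram ψ hψ
  | qread a t =>
    simp only [Cmd.wp, Cmd.det, lookupApply_eq] at hψ ⊢
    exact sum_perm_le H _ (lookupB_lookupB _ _ _ _) reg ram ψ hψ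
  | skip => exact H _ _ _ hψ
  | assign x e => exact H (Function.update reg x (e.eval L reg)) ram ψ hψ
  | load x a => exact H (Function.update reg x (ram (a.eval L reg))) ram ψ hψ
  | store a e => exact H reg (Function.update ram (a.eval L reg) (e.eval L reg)) ψ hψ

/-- From `s` the program has the single branch `s'`. -/
def Leads (P : Cmd) (s s' : Core Q) : Prop := ∀ g : Core Q → ℝ, P.wp w L g s = g s'

variable {w L}

lemma Leads.seq {p q : Cmd} {s s' s'' : Core Q} (hp : Leads w L p s s') (hq : Leads w L q s' s'') :
    Leads w L (.seq p q) s s'' := fun g => by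
  simp only [Cmd.wp]; rw [hp, hq]

lemma Leads.loop {e : Expr} {p : Cmd} (f : ℕ → Core Q)
    (h : ∀ i < e.eval L (f 0).reg, Leads w L p (f i) (f (i + 1))) :
    Leads w L (.loop e p) (f 0) (f (e.eval L (f 0).reg)) := fun g => by
  simp only [Cmd.wp]
  generalize hN : e.eval L (f 0).reg = N at h ⊢
  clear hN
  induction N generalizing g with
  | zero => rfl
  | succ N ih =>
    rw [Function.iterate_succ_apply, ih _ (fun i hi => h i (by omega)), h N (by omega)]

/-- A program without measurements and without `H` and `T` permutes the basis labels. -/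
theorem leads_perm (P : Cmd) (hP : P.classical false = true) (reg ram : ℕ → ℕ) (ψ : Vec Q) :
    ∃ (reg' ram' : ℕ → ℕ) (F : Basis Q → Basis Q) (ψ' : Vec Q),
      Leads w L P ⟨reg, ram, ψ⟩ ⟨reg', ram', ψ'⟩ ∧
        ∀ x, P.det w L ⟨reg, ram, x⟩ = ⟨reg', ram', F x⟩ ∧ ψ' (F x) = ψ x := by
  induction P generalizing reg ram ψ with
  | seq p q hp hq =>
    simp only [Cmd.classical, Bool.and_eq_true] at hP
    obtain ⟨r1, m1, F, ψ1, h1, h2⟩ := hp hP.1 reg ram ψ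
    obtain ⟨r2, m2, G, ψ2, h3, h4⟩ := hq hP.2 r1 m1 ψ1
    refine ⟨r2, m2, G ∘ F, ψ2, h1.seq h3, fun x => ?_⟩
    simp only [Cmd.det, (h2 x).1, (h4 (F x)).1, Function.comp, (h4 (F x)).2, (h2 x).2, and_self]
  | ite e p q hp hq =>
    simp only [Cmd.classical, Bool.and_eq_true] at hP
    by_cases hc : e.eval L reg ≠ 0
    · obtain ⟨r1, m1, F, ψ1, h1, h2⟩ := hp hP.1 reg ram ψ
      exact ⟨r1, m1, F, ψ1, fun g => by simp only [Cmd.wp, if_pos hc]; exact h1 g,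
        fun x => by simp only [Cmd.det, if_pos hc]; exact h2 x⟩
    · obtain ⟨r1, m1, F, ψ1, h1, h2⟩ := hq hP.2 reg ram ψ
      exact ⟨r1, m1, F, ψ1, fun g => by simp only [Cmd.wp, if_neg hc]; exact h1 g,
        fun x => by simp only [Cmd.det, if_neg hc]; exact h2 x⟩
  | loop e p hp =>
    simp only [Cmd.classical] at hP
    simp only [Leads, Cmd.wp, Cmd.det]
    generalize e.eval L reg = N
    induction N generalizing reg ram ψ with
    | zero => exact ⟨reg, ram, id, ψ, fun g => rfl, fun x => ⟨rfl, rfl⟩⟩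
    | succ N ih =>
      obtain ⟨r1, m1, F, ψ1, h1, h2⟩ := hp hP reg ram ψ
      obtain ⟨r2, m2, G, ψ2, h3, h4⟩ := ih r1 m1 ψ1
      refine ⟨r2, m2, G ∘ F, ψ2, fun g => ?_, fun x => ?_⟩
      · rw [Function.iterate_succ_apply', h1, h3]
      · simp only [Function.iterate_succ_apply, (h2 x).1, (h4 (F x)).1, Function.comp,
          (h4 (F x)).2, (h2 x).2, and_self]
  | measure x i => simp [Cmd.classical] at hP
  | gate γ i =>
    cases γ with
    | X =>
      exact ⟨_, _, flipB (i.eval L reg), _, fun g => rfl, fun x => ⟨rfl, by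
        simp [X_apply, flipB_flipB]⟩⟩
    | _ => simp [Cmd.classical] at hP
  | cnot c t =>
    exact ⟨_, _, cnotB (c.eval L reg) (t.eval L reg), _, fun g => rfl, fun x => ⟨rfl, by
      simp [cnotApply_eq, cnotB_cnotB]⟩⟩
  | ccnot c d t =>
    exact ⟨_, _, ccnotB (c.eval L reg) (d.eval L reg) (t.eval L reg), _, fun g => rfl,
      fun x => ⟨rfl, by simp [ccnotApply_eq, ccnotB_ccnotB]⟩⟩
  | query a t =>
    exact ⟨_, _, lookupB L (extend w) (a.eval L reg) (t.eval L reg), _, fun g => rfl,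
      fun x => ⟨rfl, by simp [lookupApply_eq, lookupB_lookupB]⟩⟩
  | qread a t =>
    exact ⟨_, _, lookupB L ram (a.eval L reg) (t.eval L reg), _, fun g => rfl,
      fun x => ⟨rfl, by simp [lookupApply_eq, lookupB_lookupB]⟩⟩
  | _ => exact ⟨_, _, id, _, fun g => rfl, fun x => ⟨rfl, rfl⟩⟩

/-- The label with all bits zero. -/
def zeroB : Basis Q := fun _ => false

/-- The basis state `|0…0⟩`. -/
def ket0 : Vec Q := fun x => if x = zeroB then 1 else 0

open Classical in
/-- A function of the classical state, weighted by the squared norm, on the states in which all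
qubits are zero. -/
noncomputable def lift (h : (ℕ → ℕ) × (ℕ → ℕ) → ℝ) (s : Core Q) : ℝ :=
  if ∀ x, s.psi x ≠ 0 → x = zeroB then ‖s.psi zeroB‖ ^ 2 * h (s.reg, s.ram) else 0

variable (w L Q) in
/-- Expectation of `h` over the branches that end with all qubits zero, started with all qubits
zero. -/
noncomputable def Cmd.ex (P : Cmd) (h : (ℕ → ℕ) × (ℕ → ℕ) → ℝ) (cs : (ℕ → ℕ) × (ℕ → ℕ)) : ℝ :=
  P.wp w L (lift (Q := Q) h) ⟨cs.1, cs.2, ket0⟩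

lemma lift_nonneg {h : (ℕ → ℕ) × (ℕ → ℕ) → ℝ} (hh : ∀ cs, 0 ≤ h cs) (s : Core Q) :
    0 ≤ lift h s := by
  unfold lift
  split_ifs
  · exact mul_nonneg (sq_nonneg _) (hh _)
  · exact le_rfl

lemma ex_nonneg (P : Cmd) {h : (ℕ → ℕ) × (ℕ → ℕ) → ℝ} (hh : ∀ cs, 0 ≤ h cs) (cs) :
    0 ≤ P.ex Q w L h cs := wp_nonneg w L P (lift_nonneg hh) _

/-- `g` scales with the squared norm. -/
def Homog (g : Core Q → ℝ) : Prop :=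
  ∀ reg ram ψ (β : ℂ), g ⟨reg, ram, β • ψ⟩ = ‖β‖ ^ 2 * g ⟨reg, ram, ψ⟩

/-- Every instruction is linear in the state vector and the control depends on the registers only,
so a scalar passes through each branch and comes out as its squared modulus. -/
lemma Homog.wp (P : Cmd) {g : Core Q → ℝ} (hg : Homog g) : Homog (P.wp w L g) := by
  induction P generalizing g with
  | seq p q hp hq => exact hp (hq hg)
  | ite e p q hp hq =>
    intro reg ram ψ β
    simp only [Cmd.wp]
    split_ifs
    · exact hp hg reg ram ψ β
    · exact hq hg reg ram ψ β
  | loop e p hp =>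
    intro reg ram ψ β
    simp only [Cmd.wp]
    have key : ∀ N : ℕ, Homog ((p.wp w L)^[N] g) := by
      intro N
      induction N with
      | zero => exact hg
      | succ N ih => rw [Function.iterate_succ_apply']; exact hp ih
    exact key _ reg ram ψ β
  | measure x i =>
    intro reg ram ψ β
    have hv : ∀ v, project (i.eval L reg) v (β • ψ) = β • project (i.eval L reg) v ψ := by
      intro v; funext x; simp [project]
    simp only [Cmd.wp, hv, mul_add]
    rw [hg, hg]
  | gate γ i =>
    intro reg ram ψ β
    have hv : γ.apply (i.eval L reg) (β • ψ) = β • γ.apply (i.eval L reg) ψ := by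
      cases γ <;> simp only [Gate.apply] <;> split_ifs <;> funext x <;>
        simp only [Pi.smul_apply, smul_eq_mul] <;> ring
    simp only [Cmd.wp, hv]
    exact hg _ _ _ _
  | cnot c t =>
    intro reg ram ψ β
    have hv : ∀ c t, cnotApply c t (β • ψ) = β • cnotApply c t ψ := by
      intro c t; rw [cnotApply_eq, cnotApply_eq]; rfl
    simp only [Cmd.wp, hv]
    exact hg _ _ _ _
  | ccnot c d t =>
    intro reg ram ψ β
    have hv : ∀ c d t, ccnotApply c d t (β • ψ) = β • ccnotApply c d t ψ := by
      intro c d t; rw [ccnotApply_eq, ccnotApply_eq]; rfl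
    simp only [Cmd.wp, hv]
    exact hg _ _ _ _
  | query a t =>
    intro reg ram ψ β
    have hv : ∀ f c t, lookupApply L f c t (β • ψ) = β • lookupApply L f c t ψ := by
      intro f c t; rw [lookupApply_eq, lookupApply_eq]; rfl
    simp only [Cmd.wp, hv]
    exact hg _ _ _ _
  | qread a t =>
    intro reg ram ψ β
    have hv : ∀ f c t, lookupApply L f c t (β • ψ) = β • lookupApply L f c t ψ := by
      intro f c t; rw [lookupApply_eq, lookupApply_eq]; rfl
    simp only [Cmd.wp, hv]
    exact hg _ _ _ _
  | _ => exact fun reg ram ψ β => hg _ _ _ _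

lemma homog_lift (h : (ℕ → ℕ) × (ℕ → ℕ) → ℝ) : Homog (lift (Q := Q) h) := by
  intro reg ram ψ β
  by_cases hβ : β = 0
  · simp [lift, hβ]
  · simp [lift, hβ, mul_pow, mul_assoc]

/-- A state supported on the zero label is a multiple of `ket0`, so homogeneity reduces it to the
normalized start of `Cmd.ex`; on all other states the left side is zero. This makes expectations of
consecutive pieces compose. -/
lemma lift_ex_le_wp (P : Cmd) {g : Core Q → ℝ} {h : (ℕ → ℕ) × (ℕ → ℕ) → ℝ} (hh : ∀ cs, 0 ≤ h cs)
    (hg : ∀ s, lift h s ≤ g s) (s : Core Q) : lift (P.ex Q w L h) s ≤ P.wp w L g s := by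
  refine le_trans ?_ (wp_mono w L P hg s)
  unfold lift
  split_ifs with hs
  · have e : s = ⟨s.reg, s.ram, s.psi zeroB • ket0⟩ := by
      ext1
      · rfl
      · rfl
      · funext x
        by_cases hx : x = zeroB
        · simp [ket0, hx]
        · have : s.psi x = 0 := by_contra fun h => hx (hs x h)
          simp [ket0, hx, this]
    conv_rhs => rw [e]
    change _ ≤ P.wp w L (lift h) _
    rw [Homog.wp P (homog_lift h)]
    rfl
  · exact wp_nonneg w L P (lift_nonneg hh) s

lemma lift_ket0 (h : (ℕ → ℕ) × (ℕ → ℕ) → ℝ) (reg ram) :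
    lift h (⟨reg, ram, ket0⟩ : Core Q) = h (reg, ram) := by
  unfold lift
  rw [if_pos]
  · simp [ket0]
  · intro x hx
    by_contra hne
    simp [ket0, hne] at hx

/-- Only an inequality, because branches whose qubits are not all zero between the two pieces are
discarded on the left. -/
lemma ex_seq_le (p q : Cmd) {h : (ℕ → ℕ) × (ℕ → ℕ) → ℝ} (hh : ∀ cs, 0 ≤ h cs) (cs) :
    p.ex Q w L (q.ex Q w L h) cs ≤ (Cmd.seq p q).ex Q w L h cs :=
  wp_mono w L p (lift_ex_le_wp q hh fun _ => le_rfl) _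

lemma ex_loop_le (e : Expr) (p : Cmd) {h : (ℕ → ℕ) × (ℕ → ℕ) → ℝ} (hh : ∀ cs, 0 ≤ h cs) (cs) :
    (p.ex Q w L)^[e.eval L cs.1] h cs ≤ (Cmd.loop e p).ex Q w L h cs := by
  have e1 : (Cmd.loop e p).ex Q w L h cs =
      (p.wp w L)^[e.eval L cs.1] (lift h) ⟨cs.1, cs.2, ket0⟩ := rfl
  rw [e1]
  generalize e.eval L _ = N
  have key : ∀ N : ℕ, (∀ cs, 0 ≤ (p.ex Q w L)^[N] h cs) ∧
      ∀ s : Core Q, lift ((p.ex Q w L)^[N] h) s ≤ (p.wp w L)^[N] (lift h) s := by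
    intro N
    induction N with
    | zero => exact ⟨hh, fun _ => le_rfl⟩
    | succ N ih =>
      simp only [Function.iterate_succ_apply']
      exact ⟨ex_nonneg p ih.1, lift_ex_le_wp p ih.1 ih.2⟩
  exact (lift_ket0 _ cs.1 cs.2).ge.trans ((key N).2 _)

lemma ex_ite (e : Expr) (p q : Cmd) (h : (ℕ → ℕ) × (ℕ → ℕ) → ℝ) (cs) :
    (Cmd.ite e p q).ex Q w L h cs =
      if e.eval L cs.1 ≠ 0 then p.ex Q w L h cs else q.ex Q w L h cs := rfl

lemma ex_skip (h : (ℕ → ℕ) × (ℕ → ℕ) → ℝ) (cs) : Cmd.skip.ex Q w L h cs = h cs :=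
  lift_ket0 h cs.1 cs.2

lemma ex_assign (x : ℕ) (e : Expr) (h : (ℕ → ℕ) × (ℕ → ℕ) → ℝ) (cs) :
    (Cmd.assign x e).ex Q w L h cs = h (Function.update cs.1 x (e.eval L cs.1), cs.2) :=
  lift_ket0 h _ cs.2

/-- Programs that act classically and have reset all qubits at the end. -/
lemma le_ex_of_leads {P R : Cmd} {m : Bool} (hR : R.classical m = true)
    {h : (ℕ → ℕ) × (ℕ → ℕ) → ℝ} {cs : (ℕ → ℕ) × (ℕ → ℕ)} {reg ram}
    {ψ : Vec Q} (hP : Leads w L P ⟨cs.1, cs.2, ket0⟩ ⟨reg, ram, ψ⟩)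
    (hz : ∀ x, ψ x ≠ 0 → (R.det w L ⟨reg, ram, x⟩).lab = zeroB) :
    ∑ x, ‖ψ x‖ ^ 2 * h ((R.det w L ⟨reg, ram, x⟩).reg, (R.det w L ⟨reg, ram, x⟩).ram) ≤
      (Cmd.seq P R).ex Q w L h cs := by
  simp only [Cmd.ex, Cmd.wp]
  rw [hP]
  refine sum_det_le_wp w L R hR (h := fun s : DState Q => h (s.reg, s.ram))
    (D := fun s => s.lab = zeroB) ?_ reg ram ψ hz
  intro reg ram ψ hψ
  rw [Finset.sum_eq_single zeroB]
  · simp only [lift]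
    rw [if_pos hψ]
  · intro y _ hy
    have : ψ y = 0 := by_contra fun h => hy (hψ y h)
    simp [this]
  · simp

/-- The special case in which the superposition consists of the zero label alone; it serves all the
classical housekeeping of the algorithm. -/
lemma le_ex_of_det {P : Cmd} {m : Bool} (hP : P.classical m = true)
    {h : (ℕ → ℕ) × (ℕ → ℕ) → ℝ} {reg ram reg' ram' : ℕ → ℕ}
    (hz : P.det w L (⟨reg, ram, zeroB⟩ : DState Q) = ⟨reg', ram', zeroB⟩)
    : h (reg', ram') ≤ P.ex Q w L h (reg, ram) := by
  have := le_ex_of_leads (w := w) (L := L) (P := .skip) (cs := (reg, ram)) (h := h) (ψ := (ket0 : Vec Q)) hP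
    (fun g => rfl) (fun x hx => by
      have : x = zeroB := by
        by_contra hne
        simp [ket0, hne] at hx
      rw [this, hz])
  rw [Finset.sum_eq_single zeroB] at this
  · rw [hz] at this
    rw [show (ket0 : Vec Q) zeroB = 1 by simp [ket0], norm_one, one_pow, one_mul] at this
    exact this
  · intro b _ hb
    simp [ket0, hb]
  · simp

end Semantics

/-! ### Time, queries and space from the syntax of a program -/

section Resources

/-- Values of the expression are bounded in terms of the registers `1, …, 4` below `K`. -/
def Expr.bdd (K : ℕ) : Expr → Bool
  | .lit _ => true
  | .reg x => decide (x < K ∧ 1 ≤ x ∧ x ≤ 4)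
  | .bin op e₁ e₂ => match op with
      | .add => e₁.bdd K && e₂.bdd K
      | .mul => e₁.bdd K && e₂.bdd K
      | .sub => e₁.bdd K
      | .div => e₁.bdd K
      | .mod => match e₂ with
          | .reg x => decide (x < K ∧ 1 ≤ x ∧ x ≤ 4)
          | _ => false
      | _ => true

/-- Degree of the bound of an expression in the register `y`. -/
def Expr.deg (y : ℕ) : Expr → ℕ
  | .lit _ => 0
  | .reg x => if x = y then 1 else 0
  | .bin op e₁ e₂ => match op with
      | .add => max (e₁.deg y) (e₂.deg y)
      | .mul => e₁.deg y + e₂.deg y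
      | .sub => e₁.deg y
      | .div => e₁.deg y
      | .mod => e₂.deg y
      | _ => 0

/-- The registers below `K` are not changed, the loops are bounded in terms of them, and addresses
of stores are reduced modulo register `5`. -/
def Cmd.wf (K : ℕ) : Cmd → Bool
  | .assign x _ => decide (K ≤ x)
  | .load x _ => decide (K ≤ x)
  | .measure x _ => decide (K ≤ x)
  | .store a _ => match a with
      | .bin .mod _ (.reg 5) => decide (5 < K)
      | _ => false
  | .seq p q => p.wf K && q.wf K
  | .ite _ p q => p.wf K && q.wf K
  | .loop e p => e.bdd K && p.wf K
  | _ => true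

/-- Degree of the running time in the register `y`. -/
def Cmd.deg (y : ℕ) : Cmd → ℕ
  | .seq p q => max (p.deg y) (q.deg y)
  | .ite _ p q => max (p.deg y) (q.deg y)
  | .loop e p => e.deg y + p.deg y
  | _ => 0

/-- Bounds of the registers `1, …, 5`. -/
def RegBd (K L k T S : ℕ) (r : ℕ → ℕ) : Prop :=
  ∀ x < K, 1 ≤ x → x ≤ 5 → 1 ≤ r x ∧ r x ≤ (if x = 1 then k else if x = 4 then T else
    if x = 5 then S else L)

lemma bound_mono {L k T a d i j a' d' i' j' : ℕ} (hL : 1 ≤ L) (hk : 1 ≤ k) (hT : 1 ≤ T)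
    (ha : a ≤ a') (hd : d ≤ d') (hi : i ≤ i') (hj : j ≤ j') :
    a * L ^ d * k ^ i * T ^ j ≤ a' * L ^ d' * k ^ i' * T ^ j' := by
  gcongr

/-- Registers `2` and `3` are paid by the power of `L`, registers `1` and `4` by their degrees in
`k` and `T`. The degenerate alternatives replace positivity hypotheses. -/
lemma Expr.reg_le {K L k T S : ℕ} {r : ℕ → ℕ} (h : RegBd K L k T S r) {x : ℕ}
    (hx : x < K ∧ 1 ≤ x ∧ x ≤ 4) : 1 ≤ r x ∧
      r x ≤ 1 * L ^ 1 * k ^ (Expr.deg 1 (.reg x)) * T ^ (Expr.deg 4 (.reg x)) ∨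
      L = 0 ∨ k = 0 ∨ T = 0 := by
  by_cases h0 : L = 0 ∨ k = 0 ∨ T = 0
  · exact Or.inr h0
  · left
    obtain ⟨h1, h2⟩ := h x hx.1 hx.2.1 (by omega)
    refine ⟨h1, h2.trans ?_⟩
    have hL : 1 ≤ L := by omega
    have hk : 1 ≤ k := by omega
    have hT : 1 ≤ T := by omega
    simp only [Expr.deg]
    split_ifs <;> first | omega | nlinarith

/-- Only the exponents of `k` and `T` have to be exact; constants and powers of `L` are merely
uniform in the input. A remainder is bounded through its modulus whatever the dividend is, which
allows loop bounds that involve changing registers. -/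
lemma Expr.eval_le (K : ℕ) (e : Expr) (he : e.bdd K = true) :
    ∃ a d : ℕ, ∀ (L k T S : ℕ) (r : ℕ → ℕ), 1 ≤ L → 1 ≤ k → 1 ≤ T → RegBd K L k T S r →
      e.eval L r ≤ a * L ^ d * k ^ e.deg 1 * T ^ e.deg 4 := by
  induction e with
  | lit v => exact ⟨v, 0, fun L k T S r _ _ _ _ => by simp [Expr.eval, Expr.deg, Nat.mod_le]⟩
  | reg x =>
    simp only [Expr.bdd, decide_eq_true_eq] at he
    exact ⟨1, 1, fun L k T S r hL hk hT h => ((Expr.reg_le h he).resolve_right (by omega)).2⟩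
  | bin op e₁ e₂ h₁ h₂ =>
    cases op with
    | add =>
      simp only [Expr.bdd, Bool.and_eq_true] at he
      obtain ⟨a₁, d₁, h₁⟩ := h₁ he.1
      obtain ⟨a₂, d₂, h₂⟩ := h₂ he.2
      refine ⟨a₁ + a₂, d₁ + d₂, fun L k T S r hL hk hT h => ?_⟩
      refine (Nat.mod_le _ _).trans ?_
      rw [add_mul, add_mul, add_mul]
      exact Nat.add_le_add
        ((h₁ L k T S r hL hk hT h).trans (bound_mono hL hk hT le_rfl (by omega)
          (le_max_left _ _) (le_max_left _ _)))
        ((h₂ L k T S r hL hk hT h).trans (bound_mono hL hk hT le_rfl (by omega)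
          (le_max_right _ _) (le_max_right _ _)))
    | mul =>
      simp only [Expr.bdd, Bool.and_eq_true] at he
      obtain ⟨a₁, d₁, h₁⟩ := h₁ he.1
      obtain ⟨a₂, d₂, h₂⟩ := h₂ he.2
      refine ⟨a₁ * a₂, d₁ + d₂, fun L k T S r hL hk hT h => ?_⟩
      refine (Nat.mod_le _ _).trans ((Nat.mul_le_mul (h₁ L k T S r hL hk hT h)
        (h₂ L k T S r hL hk hT h)).trans (le_of_eq ?_))
      simp only [Expr.deg, pow_add]
      ring
    | sub =>
      simp only [Expr.bdd] at he
      obtain ⟨a₁, d₁, h₁⟩ := h₁ he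
      exact ⟨a₁, d₁, fun L k T S r hL hk hT h => (Nat.sub_le _ _).trans (h₁ L k T S r hL hk hT h)⟩
    | div =>
      simp only [Expr.bdd] at he
      obtain ⟨a₁, d₁, h₁⟩ := h₁ he
      exact ⟨a₁, d₁, fun L k T S r hL hk hT h =>
        (Nat.div_le_self _ _).trans (h₁ L k T S r hL hk hT h)⟩
    | mod =>
      cases e₂ with
      | reg x =>
        simp only [Expr.bdd, decide_eq_true_eq] at he
        refine ⟨1, 1, fun L k T S r hL hk hT h => ?_⟩
        have := (Expr.reg_le h he).resolve_right (by omega)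
        exact (Nat.mod_lt _ this.1).le.trans this.2
      | _ => simp [Expr.bdd] at he
    | lt =>
      refine ⟨1, 0, fun L k T S r hL hk hT h => ?_⟩
      simp only [Expr.eval, BinOp.eval, Expr.deg, pow_zero, mul_one]
      exact (Nat.mod_le _ _).trans (by split_ifs <;> simp)
    | eq =>
      refine ⟨1, 0, fun L k T S r hL hk hT h => ?_⟩
      simp only [Expr.eval, BinOp.eval, Expr.deg, pow_zero, mul_one]
      exact (Nat.mod_le _ _).trans (by split_ifs <;> simp)
    | bit =>
      refine ⟨1, 0, fun L k T S r hL hk hT h => ?_⟩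
      simp only [Expr.eval, BinOp.eval, Expr.deg, pow_zero, mul_one]
      exact (Nat.mod_le _ _).trans (by split_ifs <;> simp)

lemma Expr.cost_le (e : Expr) : ∃ a : ℕ, ∀ L : ℕ, 1 ≤ L → e.cost L ≤ a * L ^ 2 := by
  induction e with
  | bin op e₁ e₂ h₁ h₂ =>
    obtain ⟨a₁, h₁⟩ := h₁
    obtain ⟨a₂, h₂⟩ := h₂
    refine ⟨1 + a₁ + a₂, fun L hL => ?_⟩
    have := h₁ L hL
    have := h₂ L hL
    simp only [Expr.cost]
    nlinarith
  | _ => exact ⟨1, fun L hL => by simp only [Expr.cost]; nlinarith⟩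

/-- What a run may change: the registers from `K` on, at most `m` units of time, at most as many
queries as units of time, and memory cells below `S`. -/
def Within {Q : ℕ} (K m S : ℕ) (s s' : Config Q) : Prop :=
  (∀ x < K, s'.reg x = s.reg x) ∧ s.time ≤ s'.time ∧ s'.time ≤ s.time + m ∧
    s'.queries + s.time ≤ s.queries + s'.time ∧ s'.space ≤ max s.space S

lemma Within.trans {Q : ℕ} {K m m' S : ℕ} {s s' s'' : Config Q} (h : Within K m S s s')
    (h' : Within K m' S s' s'') : Within K (m + m') S s s'' :=
  ⟨fun x hx => (h'.1 x hx).trans (h.1 x hx), by have := h.2.1; have := h'.2.1; omega,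
    by have := h.2.2.1; have := h'.2.2.1; omega,
    by have := h.2.2.2.1; have := h'.2.2.2.1; omega,
    h'.2.2.2.2.trans (max_le h.2.2.2.2 (le_max_right _ _))⟩

lemma Within.mono {Q : ℕ} {K m m' S : ℕ} {s s' : Config Q} (h : Within K m S s s')
    (hm : m ≤ m') : Within K m' S s s' :=
  ⟨h.1, h.2.1, h.2.2.1.trans (by omega), h.2.2.2⟩

lemma Within.tick {Q : ℕ} {K m S : ℕ} (s : Config Q) : Within K m S s (s.tick m) :=
  ⟨fun _ _ => rfl, by simp [Config.tick], le_rfl, by simp [Config.tick], le_max_left _ _⟩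

lemma RegBd.congr {Q : ℕ} {K L k T S m : ℕ} {s s' : Config Q} (h : RegBd K L k T S s.reg)
    (hw : Within K m S s s') : RegBd K L k T S s'.reg := fun x hx h1 h2 => by
  rw [hw.1 x hx]; exact h x hx h1 h2

/-- Time, queries and space of a well-formed program. -/
theorem Cmd.within (K : ℕ) (P : Cmd) (hP : P.wf K = true) :
    ∃ a d : ℕ, ∀ (n : ℕ) (w : Fin n → ℕ) (L Q k T S : ℕ) (s : Config Q), 1 ≤ L → 1 ≤ k → 1 ≤ T →
      RegBd K L k T S s.reg → ∀ s' ∈ P.run w L s,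
        Within K (a * L ^ d * k ^ P.deg 1 * T ^ P.deg 4) S s s' := by
  have upd : ∀ {x : ℕ} (_ : K ≤ x) (f : ℕ → ℕ) (v : ℕ), ∀ y < K, Function.update f x v y = f y :=
    fun hx f v y hy => Function.update_of_ne (by omega) _ _
  induction P with
  | skip =>
    refine ⟨1, 0, fun n w L Q k T S s hL hk hT h s' hs' => ?_⟩
    simp only [Cmd.run, List.mem_singleton] at hs'
    subst hs'
    simpa [Cmd.deg] using Within.tick (m := 1) s
  | assign x e =>
    obtain ⟨a, ha⟩ := e.cost_le
    refine ⟨a + 1, 2, fun n w L Q k T S s hL hk hT h s' hs' => ?_⟩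
    simp only [Cmd.run, List.mem_singleton] at hs'
    subst hs'
    have := ha L hL
    simp only [Cmd.wf, decide_eq_true_eq] at hP
    refine ⟨upd hP _ _, by simp, ?_, by dsimp only; omega, le_max_left _ _⟩
    simp only [Cmd.deg]; nlinarith
  | load x e =>
    obtain ⟨a, ha⟩ := e.cost_le
    refine ⟨a + 1, 2, fun n w L Q k T S s hL hk hT h s' hs' => ?_⟩
    simp only [Cmd.run, List.mem_singleton] at hs'
    subst hs'
    have := ha L hL
    simp only [Cmd.wf, decide_eq_true_eq] at hP
    refine ⟨upd hP _ _, by simp, ?_, by dsimp only; omega, le_max_left _ _⟩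
    simp only [Cmd.deg]; nlinarith
  | store e f =>
    obtain ⟨a, ha⟩ := e.cost_le
    obtain ⟨b, hb⟩ := f.cost_le
    refine ⟨a + b + 1, 2, fun n w L Q k T S s hL hk hT h s' hs' => ?_⟩
    simp only [Cmd.run, List.mem_singleton] at hs'
    subst hs'
    have := ha L hL
    have := hb L hL
    refine ⟨fun _ _ => rfl, by dsimp only; omega, ?_, by dsimp only; omega, ?_⟩
    · simp only [Cmd.deg]; nlinarith
    · unfold Cmd.wf at hP
      split at hP
      · rename_i e' 
        simp only [decide_eq_true_eq] at hP
        have := h 5 hP (by norm_num) le_rfl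
        simp only [Nat.reduceEqDiff, if_false, if_true] at this
        refine max_le_max_left _ ?_
        -- The address is a remainder modulo register `5`, which is positive and at most `S`.
        have h2 : Expr.eval L s.reg (.bin .mod e' (.reg 5)) < s.reg 5 := Nat.mod_lt _ this.1
        omega
      · simp at hP
  | gate g e =>
    obtain ⟨a, ha⟩ := e.cost_le
    refine ⟨a + 1, 2, fun n w L Q k T S s hL hk hT h s' hs' => ?_⟩
    simp only [Cmd.run, List.mem_singleton] at hs'
    subst hs'
    have := ha L hL
    refine ⟨fun _ _ => rfl, by simp, ?_, by dsimp only; omega, le_max_left _ _⟩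
    simp only [Cmd.deg]; nlinarith
  | cnot e f =>
    obtain ⟨a, ha⟩ := e.cost_le
    obtain ⟨b, hb⟩ := f.cost_le
    refine ⟨a + b + 1, 2, fun n w L Q k T S s hL hk hT h s' hs' => ?_⟩
    simp only [Cmd.run, List.mem_singleton] at hs'
    subst hs'
    have := ha L hL
    have := hb L hL
    refine ⟨fun _ _ => rfl, by dsimp only; omega, ?_, by dsimp only; omega, le_max_left _ _⟩
    simp only [Cmd.deg]; nlinarith
  | ccnot e f g =>
    obtain ⟨a, ha⟩ := e.cost_le
    obtain ⟨b, hb⟩ := f.cost_le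
    obtain ⟨c, hc⟩ := g.cost_le
    refine ⟨a + b + c + 1, 2, fun n w L Q k T S s hL hk hT h s' hs' => ?_⟩
    simp only [Cmd.run, List.mem_singleton] at hs'
    subst hs'
    have := ha L hL
    have := hb L hL
    have := hc L hL
    refine ⟨fun _ _ => rfl, by dsimp only; omega, ?_, by dsimp only; omega, le_max_left _ _⟩
    simp only [Cmd.deg]; nlinarith
  | measure x e =>
    obtain ⟨a, ha⟩ := e.cost_le
    refine ⟨a + 1, 2, fun n w L Q k T S s hL hk hT h s' hs' => ?_⟩
    simp only [Cmd.run, List.mem_map] at hs'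
    obtain ⟨v, -, rfl⟩ := hs'
    have := ha L hL
    simp only [Cmd.wf, decide_eq_true_eq] at hP
    refine ⟨upd hP _ _, by simp, ?_, by dsimp only; omega, le_max_left _ _⟩
    simp only [Cmd.deg]; nlinarith
  | query e f =>
    obtain ⟨a, ha⟩ := e.cost_le
    obtain ⟨b, hb⟩ := f.cost_le
    refine ⟨a + b + 1, 2, fun n w L Q k T S s hL hk hT h s' hs' => ?_⟩
    simp only [Cmd.run, List.mem_singleton] at hs'
    subst hs'
    have := ha L hL
    have := hb L hL
    refine ⟨fun _ _ => rfl, by dsimp only; omega, ?_, by dsimp only; omega, le_max_left _ _⟩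
    simp only [Cmd.deg]; nlinarith
  | qread e f =>
    obtain ⟨a, ha⟩ := e.cost_le
    obtain ⟨b, hb⟩ := f.cost_le
    refine ⟨a + b + 1, 2, fun n w L Q k T S s hL hk hT h s' hs' => ?_⟩
    simp only [Cmd.run, List.mem_singleton] at hs'
    subst hs'
    have := ha L hL
    have := hb L hL
    refine ⟨fun _ _ => rfl, by dsimp only; omega, ?_, by dsimp only; omega, le_max_left _ _⟩
    simp only [Cmd.deg]; nlinarith
  | seq p q hp hq =>
    simp only [Cmd.wf, Bool.and_eq_true] at hP
    obtain ⟨a, d, hp⟩ := hp hP.1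
    obtain ⟨b, e, hq⟩ := hq hP.2
    refine ⟨a + b, d + e, fun n w L Q k T S s hL hk hT h s' hs' => ?_⟩
    simp only [Cmd.run, List.mem_flatMap] at hs'
    obtain ⟨s1, h1, h2⟩ := hs'
    have w1 := hp n w L Q k T S s hL hk hT h s1 h1
    have w2 := hq n w L Q k T S s1 hL hk hT (h.congr w1) s' h2
    rw [add_mul, add_mul, add_mul]
    exact (w1.trans w2).mono (Nat.add_le_add
      (bound_mono hL hk hT le_rfl (by omega) (le_max_left _ _) (le_max_left _ _))
      (bound_mono hL hk hT le_rfl (by omega) (le_max_right _ _) (le_max_right _ _)))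
  | ite c p q hp hq =>
    simp only [Cmd.wf, Bool.and_eq_true] at hP
    obtain ⟨a, d, hp⟩ := hp hP.1
    obtain ⟨b, e, hq⟩ := hq hP.2
    obtain ⟨f, hf⟩ := c.cost_le
    refine ⟨f + 1 + (a + b), 2 + (d + e), fun n w L Q k T S s hL hk hT h s' hs' => ?_⟩
    simp only [Cmd.run] at hs'
    have hf := hf L hL
    have w1 : Within K (c.cost L + 1) S s (s.tick (c.cost L + 1)) := Within.tick s
    have hb : c.cost L + 1 ≤ (f + 1) * L ^ (2 + (d + e)) * k ^ (max (p.deg 1) (q.deg 1)) *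
        T ^ (max (p.deg 4) (q.deg 4)) := by
      have e1 : c.cost L + 1 ≤ (f + 1) * L ^ 2 * k ^ 0 * T ^ 0 := by
        simp only [pow_zero, mul_one]; nlinarith
      exact e1.trans (bound_mono hL hk hT le_rfl (by omega) (by omega) (by omega))
    rw [add_mul, add_mul, add_mul]
    split_ifs at hs'
    · exact (w1.trans (hp n w L Q k T S _ hL hk hT (h.congr w1) s' hs')).mono (Nat.add_le_add hb
        (bound_mono hL hk hT (by omega) (by omega) (le_max_left _ _) (le_max_left _ _)))
    · exact (w1.trans (hq n w L Q k T S _ hL hk hT (h.congr w1) s' hs')).mono (Nat.add_le_add hb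
        (bound_mono hL hk hT (by omega) (by omega) (le_max_right _ _) (le_max_right _ _)))
  | loop c p hp =>
    simp only [Cmd.wf, Bool.and_eq_true] at hP
    obtain ⟨a, d, hp⟩ := hp hP.2
    obtain ⟨b, e, hc⟩ := c.eval_le K hP.1
    obtain ⟨f, hf⟩ := c.cost_le
    refine ⟨f + 1 + b * (1 + a), 2 + (e + d), fun n w L Q k T S s hL hk hT h s' hs' => ?_⟩
    simp only [Cmd.run] at hs'
    have hf := hf L hL
    have hc := hc L k T S s.reg hL hk hT h
    generalize c.eval L s.reg = N at hs' hc
    have w1 : Within K (c.cost L + 1) S s (s.tick (c.cost L + 1)) := Within.tick s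
    -- The summand `1` pays for the unit of time spent on each round of the loop.
    set m := 1 + a * L ^ d * k ^ p.deg 1 * T ^ p.deg 4 with hm
    have key : ∀ (N : ℕ) (s1 : Config Q), RegBd K L k T S s1.reg →
        ∀ s' ∈ (fun l : List (Config Q) => l.flatMap fun s' => p.run w L (s'.tick 1))^[N] [s1],
          Within K (N * m) S s1 s' := by
      intro N
      induction N with
      | zero =>
        intro s1 h1 s' hs'
        simp only [Function.iterate_zero, id, List.mem_singleton] at hs'
        subst hs'
        exact ⟨fun _ _ => rfl, le_rfl, by omega, le_rfl, le_max_left _ _⟩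
      | succ N ih =>
        intro s1 h1 s' hs'
        rw [Function.iterate_succ_apply', List.mem_flatMap] at hs'
        obtain ⟨s2, hs2, hs'⟩ := hs'
        have v1 := ih s1 h1 s2 hs2
        have v2 : Within K 1 S s2 (s2.tick 1) := Within.tick s2
        have v3 := hp n w L Q k T S _ hL hk hT ((h1.congr v1).congr v2) s' hs'
        exact (v1.trans (v2.trans v3)).mono (by rw [Nat.succ_mul])
    have w2 := key N _ (h.congr w1) s' hs'
    refine (w1.trans w2).mono ?_
    have hb : c.cost L + 1 ≤ (f + 1) * L ^ (2 + (e + d)) * k ^ (c.deg 1 + p.deg 1) *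
        T ^ (c.deg 4 + p.deg 4) := by
      have e1 : c.cost L + 1 ≤ (f + 1) * L ^ 2 * k ^ 0 * T ^ 0 := by
        simp only [pow_zero, mul_one]; nlinarith
      exact e1.trans (bound_mono hL hk hT le_rfl (by omega) (by omega) (by omega))
    rw [add_mul (f + 1), add_mul, add_mul]
    refine Nat.add_le_add hb ?_
    have hm1 : m ≤ (1 + a) * L ^ d * k ^ p.deg 1 * T ^ p.deg 4 := by
      rw [hm, add_mul, add_mul, add_mul]
      refine Nat.add_le_add_right ?_ _
      have := bound_mono (a := 1) (a' := 1) (Nat.one_le_iff_ne_zero.2 (by omega)) hk hT le_rfl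
        (Nat.zero_le d) (Nat.zero_le (p.deg 1)) (Nat.zero_le (p.deg 4)) (L := L)
      simpa using this
    calc N * m ≤ (b * L ^ e * k ^ c.deg 1 * T ^ c.deg 4) *
          ((1 + a) * L ^ d * k ^ p.deg 1 * T ^ p.deg 4) := Nat.mul_le_mul hc hm1
      _ = b * (1 + a) * L ^ (e + d) * k ^ (c.deg 1 + p.deg 1) * T ^ (c.deg 4 + p.deg 4) := by
        simp only [pow_add]; ring
      _ ≤ _ := bound_mono hL hk hT le_rfl (by omega) le_rfl le_rfl

end Resources

/-! ### Hadamard transforms and amplitude amplification -/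

section Grover

variable {Q : ℕ}

open scoped ComplexConjugate

/-- The sign of `x` in the action of a Hadamard gate on qubit `i`. -/
def sgn (i : ℕ) (x : Basis Q) : ℂ := if bitAt x i then -1 else 1

/-- In this form the gate couples a label with its flip only, and later computations need just
`sgn_flip` and `sgn_sq` instead of cases on the bit. -/
lemma H_apply {i : ℕ} (hi : i < Q) (ψ : Vec Q) (x : Basis Q) :
    Gate.H.apply i ψ x = (sgn i x * ψ x + ψ (flipB i x)) / (√2 : ℝ) := by
  have h0 : ∀ v, bitAt x i = v → setBit i v x = x := fun v hv => basis_ext fun j hj => by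
    rw [bitAt_setBit]
    split_ifs with h
    · rw [h.1, hv]
    · rfl
  simp only [Gate.apply, if_pos hi, sgn, flipB]
  cases hb : bitAt x i
  · rw [h0 _ hb]; simp
  · rw [h0 _ hb]; simp; ring

lemma sgn_flip {i : ℕ} (hi : i < Q) (x : Basis Q) : sgn i (flipB i x) = - sgn i x := by
  unfold sgn
  rw [show bitAt (flipB i x) i = !bitAt x i by simp [bitAt_flipB, hi]]
  cases bitAt x i <;> simp

lemma sgn_sq (i : ℕ) (x : Basis Q) : sgn i x * sgn i x = 1 := by
  unfold sgn; split_ifs <;> norm_num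

lemma sqrt2_sq : ((√2 : ℝ) : ℂ) * ((√2 : ℝ) : ℂ) = 2 := by
  rw [← Complex.ofReal_mul, Real.mul_self_sqrt (by norm_num)]; norm_num

lemma sqrt2_ne : ((√2 : ℝ) : ℂ) ≠ 0 := by
  rw [Complex.ofReal_ne_zero]; positivity

lemma H_H (i : ℕ) (ψ : Vec Q) : Gate.H.apply i (Gate.H.apply i ψ) = ψ := by
  by_cases hi : i < Q
  · funext x
    rw [H_apply hi, H_apply hi, H_apply hi, sgn_flip hi, flipB_flipB]
    have h1 := sgn_sq i x
    have h2 := sqrt2_sq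
    have h3 := sqrt2_ne
    field_simp
    rw [pow_two, h2]
    linear_combination ψ x * h1
  · simp [Gate.apply, hi]

lemma H_add_smul (i : ℕ) (ψ φ : Vec Q) (c : ℂ) :
    Gate.H.apply i (fun x => ψ x + c * φ x) =
      fun x => Gate.H.apply i ψ x + c * Gate.H.apply i φ x := by
  by_cases hi : i < Q
  · funext x
    rw [H_apply hi, H_apply hi, H_apply hi]
    ring
  · simp [Gate.apply, hi]

/-- The inner product of two state vectors. -/
noncomputable def ip (φ ψ : Vec Q) : ℂ := ∑ x, conj (φ x) * ψ x

lemma ip_H_left (i : ℕ) (φ ψ : Vec Q) : ip (Gate.H.apply i φ) ψ = ip φ (Gate.H.apply i ψ) := by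
  by_cases hi : i < Q
  · unfold ip
    simp only [H_apply hi, map_div₀, map_add, map_mul, Complex.conj_ofReal]
    have hs : ∀ x : Basis Q, conj (sgn i x) = sgn i x := by
      intro x; unfold sgn; split_ifs <;> simp
    have e : ∑ x : Basis Q, conj (φ (flipB i x)) * ψ x = ∑ x, conj (φ x) * ψ (flipB i x) :=
      Fintype.sum_equiv ⟨flipB i, flipB i, flipB_flipB i, flipB_flipB i⟩ _ _ fun x => by
        simp [flipB_flipB]
    have e1 : ∀ x : Basis Q, (conj (sgn i x) * conj (φ x) + conj (φ (flipB i x))) / (√2 : ℝ) * ψ x =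
        (sgn i x * (conj (φ x) * ψ x) + conj (φ (flipB i x)) * ψ x) / (√2 : ℝ) := by
      intro x; rw [hs]; ring
    have e2 : ∀ x : Basis Q, conj (φ x) * ((sgn i x * ψ x + ψ (flipB i x)) / (√2 : ℝ)) =
        (sgn i x * (conj (φ x) * ψ x) + conj (φ x) * ψ (flipB i x)) / (√2 : ℝ) := by
      intro x; ring
    simp only [e1, e2, ← Finset.sum_div, Finset.sum_add_distrib, e]
  · simp [Gate.apply, hi]

/-- Hadamard gates on the qubits of a list, the first one first. -/
noncomputable def hadList (l : List ℕ) (ψ : Vec Q) : Vec Q :=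
  l.foldl (fun ψ i => Gate.H.apply i ψ) ψ

lemma hadList_cons (i : ℕ) (l : List ℕ) (ψ : Vec Q) :
    hadList (i :: l) ψ = hadList l (Gate.H.apply i ψ) := rfl

lemma hadList_append (l l' : List ℕ) (ψ : Vec Q) :
    hadList (l ++ l') ψ = hadList l' (hadList l ψ) := by simp [hadList]

lemma hadList_reverse (l : List ℕ) (ψ : Vec Q) : hadList l (hadList l.reverse ψ) = ψ := by
  induction l generalizing ψ with
  | nil => rfl
  | cons i l ih =>
    rw [List.reverse_cons, hadList_append, hadList_cons]
    change hadList l (Gate.H.apply i (Gate.H.apply i (hadList l.reverse ψ))) = ψ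
    rw [H_H, ih]

lemma hadList_add_smul (l : List ℕ) (ψ φ : Vec Q) (c : ℂ) :
    hadList l (fun x => ψ x + c * φ x) = fun x => hadList l ψ x + c * hadList l φ x := by
  induction l generalizing ψ φ with
  | nil => rfl
  | cons i l ih => rw [hadList_cons, H_add_smul, ih]; rfl

/-- Unitarity: each Hadamard gate is self-adjoint and its own inverse. -/
lemma ip_hadList (l : List ℕ) (φ ψ : Vec Q) : ip (hadList l φ) (hadList l ψ) = ip φ ψ := by
  induction l generalizing ψ φ with
  | nil => rfl
  | cons i l ih => rw [hadList_cons, hadList_cons, ih, ip_H_left, H_H]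

/-- `x` agrees with `y` outside the positions in `l`. -/
def AgreeOff (l : List ℕ) (y x : Basis Q) : Prop := ∀ i, i ∉ l → bitAt x i = bitAt y i

lemma agreeOff_flip {l : List ℕ} {i : ℕ} (hi : i ∈ l) (y x : Basis Q) :
    AgreeOff l y (flipB i x) ↔ AgreeOff l y x := by
  unfold AgreeOff
  refine forall_congr' fun j => imp_congr_right fun hj => ?_
  have : j ≠ i := fun h => hj (h ▸ hi)
  rw [bitAt_flipB, if_neg (by tauto)]

lemma hadList_support {l l' : List ℕ} (hl : ∀ i ∈ l', i ∈ l) {y : Basis Q} {ψ : Vec Q}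
    (h : ∀ x, ψ x ≠ 0 → AgreeOff l y x) (x : Basis Q) (hx : hadList l' ψ x ≠ 0) :
    AgreeOff l y x := by
  induction l' generalizing ψ with
  | nil => exact h x hx
  | cons i l' ih =>
    refine ih (fun j hj => hl j (List.mem_cons_of_mem _ hj)) (ψ := Gate.H.apply i ψ) ?_ hx
    intro x hx
    by_cases hi : i < Q
    · rw [H_apply hi] at hx
      by_contra hne
      have h1 : ψ x = 0 := by_contra fun h' => hne (h x h')
      have h2 : ψ (flipB i x) = 0 := by_contra fun h' => hne (by
        have := h _ h'
        rwa [agreeOff_flip (hl i (by simp))] at this)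
      simp [h1, h2] at hx
    · rw [Gate.apply, if_neg hi] at hx
      exact h x hx

/-- The basis state with label `y`. -/
def ket (y : Basis Q) : Vec Q := fun x => if x = y then 1 else 0

-- When a new position `i` joins the list, at most one of `x` and its flip at `i` agrees with `y`
-- off the old list. So amplitudes never interfere, and each gate halves the weight and doubles the
-- support.
open Classical in
lemma norm_hadList_ket (l : List ℕ) (hl : ∀ i ∈ l, i < Q) (hd : l.Nodup) (y x : Basis Q) :
    ‖hadList l (ket y) x‖ ^ 2 = if AgreeOff l y x then (1 / 2 : ℝ) ^ l.length else 0 := by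
  induction l using List.reverseRecOn generalizing x with
  | nil =>
    have : AgreeOff [] y x ↔ x = y := ⟨fun h => basis_ext fun i _ => h i (by simp),
      fun h i _ => by rw [h]⟩
    simp only [hadList, ket, List.foldl_nil, this, List.length_nil, pow_zero]
    split_ifs <;> simp
  | append_singleton l i ih =>
    have hi : i < Q := hl i (by simp)
    have hil : i ∉ l := by
      intro h
      have := List.nodup_append.1 hd
      exact this.2.2 i h i (by simp) rfl
    have ih := ih (fun j hj => hl j (by simp [hj])) (List.nodup_append.1 hd).1
    rw [hadList_append]
    change ‖Gate.H.apply i (hadList l (ket y)) x‖ ^ 2 = _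
    rw [H_apply hi]
    have hsg : ‖sgn i x‖ = 1 := by unfold sgn; split_ifs <;> simp
    have h2 : ‖((√2 : ℝ) : ℂ)‖ ^ 2 = 2 := by
      rw [Complex.norm_real, Real.norm_eq_abs, sq_abs, Real.sq_sqrt (by norm_num)]
    have hor : AgreeOff (l ++ [i]) y x ↔ AgreeOff l y x ∨ AgreeOff l y (flipB i x) := by
      constructor
      · intro h
        by_cases hb : bitAt x i = bitAt y i
        · left
          intro j hj
          by_cases hji : j = i
          · rw [hji, hb]
          · exact h j (by simp [hj, hji])
        · right
          intro j hj
          rw [bitAt_flipB]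
          by_cases hji : j = i
          · rw [if_pos ⟨hji, hi⟩, hji]
            revert hb; cases bitAt x i <;> cases bitAt y i <;> simp
          · rw [if_neg (by tauto)]
            exact h j (by simp [hj, hji])
      · rintro (h | h) j hj
        · exact h j (by simp at hj; tauto)
        · have := h j (by simp at hj; tauto)
          rwa [bitAt_flipB, if_neg (by simp at hj; tauto)] at this
    have hex : ¬ (AgreeOff l y x ∧ AgreeOff l y (flipB i x)) := by
      rintro ⟨h1, h2⟩
      have a := h1 i hil
      have b := h2 i hil
      rw [bitAt_flipB, if_pos ⟨rfl, hi⟩, a] at b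
      simp at b
    have z1 := ih x
    have z2 := ih (flipB i x)
    rw [List.length_append, List.length_singleton, pow_succ (1 / 2 : ℝ), norm_div, div_pow, h2]
    by_cases c1 : AgreeOff l y x
    · have c2 : ¬ AgreeOff l y (flipB i x) := fun h => hex ⟨c1, h⟩
      rw [if_neg c2] at z2
      rw [if_pos c1] at z1
      have z2' : hadList l (ket y) (flipB i x) = 0 := by simpa using z2
      rw [if_pos (hor.2 (Or.inl c1)), z2', add_zero, norm_mul, hsg, one_mul, z1]
      ring
    · rw [if_neg c1] at z1
      have z1' : hadList l (ket y) x = 0 := by simpa using z1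
      rw [z1', mul_zero, zero_add, z2]
      by_cases c2 : AgreeOff l y (flipB i x)
      · rw [if_pos c2, if_pos (hor.2 (Or.inr c2))]; ring
      · rw [if_neg c2, if_neg (by rw [hor]; tauto)]; simp

/-- Change of sign on the labels where `f` is true. -/
def phase (f : Basis Q → Bool) (ψ : Vec Q) : Vec Q := fun x => (if f x then -1 else 1) * ψ x

/-- One round of amplitude amplification, up to a sign. -/
noncomputable def groverStep (l : List ℕ) (f z : Basis Q → Bool) (ψ : Vec Q) : Vec Q :=
  hadList l (phase z (hadList l.reverse (phase f ψ)))

/-- The factors of the good and of the bad part of the start vector after `t` rounds, where `p` is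
the weight of the good part. -/
noncomputable def ampl (p : ℝ) : ℕ → ℝ × ℝ
  | 0 => (1, 1)
  | t + 1 => ((1 - 2 * p) * (ampl p t).1 + 2 * (1 - p) * (ampl p t).2,
      (1 - 2 * p) * (ampl p t).2 - 2 * p * (ampl p t).1)

/-- With `p = sin² θ`, one round rotates by `2 θ` in the plane of the good and the bad part, and the
addition theorems apply. Multiplying by `sin θ` and `cos θ` avoids dividing by zero when one part is
empty. -/
lemma ampl_sin (θ : ℝ) (t : ℕ) :
    (ampl (Real.sin θ ^ 2) t).1 * Real.sin θ = Real.sin ((2 * t + 1) * θ) ∧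
      (ampl (Real.sin θ ^ 2) t).2 * Real.cos θ = Real.cos ((2 * t + 1) * θ) := by
  induction t with
  | zero => simp [ampl]
  | succ t ih =>
    have e : (2 * ((t + 1 : ℕ) : ℝ) + 1) * θ = (2 * t + 1) * θ + 2 * θ := by push_cast; ring
    have hc := Real.sin_sq_add_cos_sq θ
    rw [e, Real.sin_add, Real.cos_add, Real.sin_two_mul, Real.cos_two_mul, ← ih.1, ← ih.2]
    have : Real.cos θ ^ 2 = 1 - Real.sin θ ^ 2 := by linarith
    simp only [ampl]
    constructor
    · linear_combination (-2 * (ampl (Real.sin θ ^ 2) t).1 * Real.sin θ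
        -2 * (ampl (Real.sin θ ^ 2) t).2 * Real.sin θ) * this
    · linear_combination (-2 * (ampl (Real.sin θ ^ 2) t).2 * Real.cos θ) * this

lemma ip_ket (y : Basis Q) (ψ : Vec Q) : ip (ket y) ψ = ψ y := by
  unfold ip ket
  rw [Finset.sum_eq_single y] <;> simp +contextual

open Classical in
/-- The set of labels that agree with `y` outside `l`. -/
noncomputable def coset (l : List ℕ) (y : Basis Q) : Finset (Basis Q) :=
  Finset.univ.filter (AgreeOff l y)

lemma mem_coset {l : List ℕ} {y x : Basis Q} : x ∈ coset l y ↔ AgreeOff l y x := by simp [coset]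

/-- Conjugated by the Hadamard gates, the sign change at `y` is the reflection `ψ ↦ ψ - 2 ⟨s, ψ⟩ s`
in the start vector `s`. On vectors that are `s` times a factor constant on good and on bad labels,
only the overlap with `s` matters, and this depends on `f` through `p` alone. The signs of the
entries of `s` are irrelevant, since only their squared moduli enter. The factor `-c` is the global
sign of the round. -/
lemma groverStep_eq {l : List ℕ} {f z : Basis Q → Bool} {y : Basis Q}
    (hl : ∀ i ∈ l, i < Q) (hd : l.Nodup)
    (hz : ∀ x ∈ coset l y, z x = true ↔ x = y) (c a b p : ℝ)
    (hp : p = (((coset l y).filter fun x => f x).card : ℝ) * (1 / 2) ^ l.length) :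
    groverStep l f z (fun x => (c * (if f x then a else b) : ℝ) * hadList l (ket y) x) =
      fun x => ((-c) * (if f x then (1 - 2 * p) * a + 2 * (1 - p) * b
        else (1 - 2 * p) * b - 2 * p * a) : ℝ) * hadList l (ket y) x := by
  set s := hadList l (ket y) with hs
  have hsup : ∀ x, s x ≠ 0 → AgreeOff l y x := hadList_support (fun i h => h) (fun x hx i _ => by
    have : x = y := by
      by_contra h
      simp [ket, h] at hx
    rw [this])
  set ψ₁ : Vec Q := phase f (fun x => (c * (if f x then a else b) : ℝ) * s x) with h1
  set ψ₂ := hadList l.reverse ψ₁ with h2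
  have hsup2 : ∀ x, ψ₂ x ≠ 0 → AgreeOff l y x := by
    refine hadList_support (fun i h => List.mem_reverse.1 h) fun x hx => hsup x fun h => hx ?_
    simp [h1, phase, h]
  -- Off the coset `ψ₂` vanishes, and on it `z` singles out `y`; so the sign change subtracts twice
  -- the component at `y`.
  have h3 : phase z ψ₂ = fun x => ψ₂ x + (-2 * ψ₂ y) * ket y x := by
    funext x
    by_cases hx : AgreeOff l y x
    · have := hz x (mem_coset.2 hx)
      by_cases hxy : x = y
      · subst hxy
        simp only [phase, this.2 rfl, if_true, ket]; ring
      · have hzf : z x = false := by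
          rw [← Bool.not_eq_true, this]; exact hxy
        simp [phase, hzf, ket, hxy]
    · have h0 : ψ₂ x = 0 := by_contra fun h => hx (hsup2 x h)
      have hxy : x ≠ y := fun h => hx (by rw [h]; exact fun i _ => rfl)
      simp [phase, h0, ket, hxy]
  have hn : ∀ x, conj (s x) * s x = ((if x ∈ coset l y then (1 / 2 : ℝ) ^ l.length else 0 : ℝ) : ℂ) := by
    intro x
    rw [← Complex.normSq_eq_conj_mul_self, Complex.normSq_eq_norm_sq, norm_hadList_ket l hl hd]
    by_cases hx : AgreeOff l y x
    · rw [if_pos hx, if_pos (mem_coset.2 hx)]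
    · rw [if_neg hx, if_neg (fun h => hx (mem_coset.1 h))]
  have hN : (∑ x : Basis Q, if x ∈ coset l y then (1 / 2 : ℝ) ^ l.length else 0) = 1 := by
    have e : ip s s = 1 := by
      rw [hs, ip_hadList, ip_ket]; simp [ket]
    unfold ip at e
    simp only [hn] at e
    exact_mod_cast e
  -- By unitarity the component at `y` before the last Hadamard gates is the overlap of `ψ₁` with
  -- `s`.
  have h4 : ψ₂ y = ((-c * a * p + c * b * (1 - p) : ℝ) : ℂ) := by
    have : ψ₂ y = ip s ψ₁ := by
      rw [← ip_ket y ψ₂, ← ip_hadList l, ← hs, h2, hadList_reverse]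
    rw [this]
    unfold ip
    have e : ∀ x, conj (s x) * ψ₁ x = ((if x ∈ coset l y then
        (if f x then -c * a - c * b else 0) * (1 / 2 : ℝ) ^ l.length +
          (c * b) * (1 / 2 : ℝ) ^ l.length else 0 : ℝ) : ℂ) := by
      intro x
      have e1 : conj (s x) * ψ₁ x = ((if f x then -(c * a) else c * b : ℝ) : ℂ) *
          (conj (s x) * s x) := by
        rw [h1]; unfold phase
        by_cases hf : f x = true
        · simp only [hf, if_true]; push_cast; ring
        · simp only [hf]; push_cast; simp; ring
      rw [e1, hn, ← Complex.ofReal_mul]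
      congr 1
      split_ifs <;> ring
    simp only [e]
    rw [← Complex.ofReal_sum]
    congr 1
    rw [Finset.sum_ite_mem, Finset.univ_inter, Finset.sum_add_distrib]
    rw [Finset.sum_ite_mem, Finset.univ_inter] at hN
    rw [← Finset.mul_sum, hN, ← Finset.sum_mul, ← Finset.sum_filter, Finset.sum_const, nsmul_eq_mul]
    rw [hp]
    ring
  unfold groverStep
  rw [← h1, ← h2, h3, hadList_add_smul, ← hs, h2, hadList_reverse, ← h2, h4]
  funext x
  rw [h1]; unfold phase
  by_cases hf : f x = true
  · simp only [hf, if_true]; push_cast; ring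
  · simp only [hf]; push_cast; simp; ring

/-- The outcome of amplitude amplification: all good labels get the same probability. -/
theorem grover {l : List ℕ} {f z : Basis Q → Bool} {y : Basis Q}
    (hl : ∀ i ∈ l, i < Q) (hd : l.Nodup)
    (hz : ∀ x ∈ coset l y, z x = true ↔ x = y) (t : ℕ) :
    ∃ q : ℝ, 0 ≤ q ∧
      (∀ x ∈ coset l y, f x = true → ‖(groverStep l f z)^[t] (hadList l (ket y)) x‖ ^ 2 = q) ∧
      q * ((coset l y).filter fun x => f x).card = Real.sin ((2 * t + 1) * Real.arcsin
        √((((coset l y).filter fun x => f x).card : ℝ) * (1 / 2) ^ l.length)) ^ 2 ∧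
      (∑ x ∈ coset l y, ‖(groverStep l f z)^[t] (hadList l (ket y)) x‖ ^ 2 = 1) ∧
      ∀ x, (groverStep l f z)^[t] (hadList l (ket y)) x ≠ 0 → x ∈ coset l y := by
  set s := hadList l (ket y) with hs
  set p := (((coset l y).filter fun x => f x).card : ℝ) * (1 / 2) ^ l.length with hp
  have hsup : ∀ x, s x ≠ 0 → AgreeOff l y x := hadList_support (fun i h => h) (fun x hx i _ => by
    have : x = y := by
      by_contra h
      simp [ket, h] at hx
    rw [this])
  have hit : ∀ t : ℕ, (groverStep l f z)^[t] s =
      fun x => ((-1) ^ t * (if f x then (ampl p t).1 else (ampl p t).2) : ℝ) * s x := by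
    intro t
    induction t with
    | zero => funext x; simp [ampl]
    | succ t ih =>
      rw [Function.iterate_succ_apply', ih, groverStep_eq hl hd hz _ _ _ p hp]
      funext x
      simp only [ampl, pow_succ]
      congr 3
      ring
  have hns : ∀ x ∈ coset l y, ‖s x‖ ^ 2 = (1 / 2 : ℝ) ^ l.length := fun x hx => by
    rw [hs, norm_hadList_ket l hl hd, if_pos (mem_coset.1 hx)]
  have hsum : ∀ t, ip ((groverStep l f z)^[t] s) ((groverStep l f z)^[t] s) = 1 := by
    have hph : ∀ (f : Basis Q → Bool) (ψ : Vec Q), ip (phase f ψ) (phase f ψ) = ip ψ ψ := by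
      intro f ψ
      unfold ip phase
      refine Finset.sum_congr rfl fun x _ => ?_
      split_ifs <;> simp
    intro t
    induction t with
    | zero => simp only [Function.iterate_zero, id]; rw [hs, ip_hadList, ip_ket]; simp [ket]
    | succ t ih =>
      rw [Function.iterate_succ_apply']
      unfold groverStep
      rw [ip_hadList, hph, ip_hadList, hph]
      exact ih
  have hsupt : ∀ x, (groverStep l f z)^[t] s x ≠ 0 → x ∈ coset l y := by
    intro x hx
    refine mem_coset.2 (hsup x fun h => hx ?_)
    rw [hit]; simp [h]
  have hone : (∑ x ∈ coset l y, ‖(groverStep l f z)^[t] s x‖ ^ 2) = 1 := by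
    have e := hsum t
    unfold ip at e
    simp only [← Complex.normSq_eq_conj_mul_self, Complex.normSq_eq_norm_sq] at e
    have e' : (∑ x, ‖(groverStep l f z)^[t] s x‖ ^ 2) = 1 := by exact_mod_cast e
    rw [← e']
    refine Finset.sum_subset (Finset.subset_univ _) fun x _ hx => ?_
    have : (groverStep l f z)^[t] s x = 0 := by_contra fun h => hx (hsupt x h)
    simp [this]
  have hp0 : 0 ≤ p := by positivity
  -- `p` is the weight of the good labels in a unit vector; the bound is needed to write `√p` as a
  -- sine.
  have hp1 : p ≤ 1 := by
    have e := hsum 0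
    simp only [Function.iterate_zero, id] at e
    unfold ip at e
    simp only [← Complex.normSq_eq_conj_mul_self, Complex.normSq_eq_norm_sq] at e
    have e' : (∑ x, ‖s x‖ ^ 2) = 1 := by exact_mod_cast e
    rw [← e', hp, ← nsmul_eq_mul, ← Finset.sum_const]
    rw [← Finset.sum_congr rfl (fun x hx => hns x (Finset.mem_filter.1 hx).1)]
    exact Finset.sum_le_sum_of_subset_of_nonneg (Finset.subset_univ _) fun _ _ _ => by positivity
  refine ⟨(ampl p t).1 ^ 2 * (1 / 2) ^ l.length, by positivity, fun x hx hf => ?_, ?_, hone, hsupt⟩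
  · rw [hit]
    simp only [hf, if_true]
    rw [norm_mul, mul_pow, hns x hx, Complex.norm_real, Real.norm_eq_abs, sq_abs, mul_pow,
      ← pow_mul, mul_comm t 2, pow_mul]
    norm_num
  · have hθ : Real.sin (Real.arcsin √p) = √p :=
      Real.sin_arcsin (by have := Real.sqrt_nonneg p; linarith) (Real.sqrt_le_one.2 hp1)
    have := (ampl_sin (Real.arcsin √p) t).1
    rw [← this, hθ, Real.sq_sqrt hp0, mul_pow, Real.sq_sqrt hp0, hp]
    ring

end Grover

/-! ### Collecting elements by random attempts -/

section Coupon

variable {α : Type*} [DecidableEq α]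

/-- One attempt to collect a new element of `M`: each element is found with probability `q`, and
nothing happens once `K` elements have been collected. -/
noncomputable def draw (M : Finset α) (K : ℕ) (q : ℝ) (g : Finset α → ℝ) (A : Finset α) : ℝ :=
  if A.card < K then ∑ x ∈ M, q * g (insert x A) + (1 - q * M.card) * g A else g A

/-- Several attempts in a row. -/
noncomputable def draws (M : Finset α) (K : ℕ) : List ℝ → (Finset α → ℝ) → Finset α → ℝ
  | [], g => g
  | q :: qs, g => draw M K q (draws M K qs g)

variable {M : Finset α} {K : ℕ}

/-- A probability for each element of `M`. -/
def IsRate (M : Finset α) (q : ℝ) : Prop := 0 ≤ q ∧ q * M.card ≤ 1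

lemma draw_mono {q : ℝ} (hq : IsRate M q) {g g' : Finset α → ℝ}
    (h : ∀ A ⊆ M, A.card ≤ K → g A ≤ g' A) {A : Finset α} (hA : A ⊆ M) (hK : A.card ≤ K) :
    draw M K q g A ≤ draw M K q g' A := by
  unfold draw
  split_ifs with hc
  · refine add_le_add (Finset.sum_le_sum fun x hx => mul_le_mul_of_nonneg_left ?_ hq.1)
      (mul_le_mul_of_nonneg_left (h A hA hK) (by linarith [hq.2]))
    exact h _ (Finset.insert_subset hx hA) ((Finset.card_insert_le _ _).trans hc)
  · exact h A hA hK

lemma draws_mono {qs : List ℝ} (hq : ∀ q ∈ qs, IsRate M q) {g g' : Finset α → ℝ}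
    (h : ∀ A ⊆ M, A.card ≤ K → g A ≤ g' A) {A : Finset α} (hA : A ⊆ M) (hK : A.card ≤ K) :
    draws M K qs g A ≤ draws M K qs g' A := by
  induction qs generalizing A with
  | nil => exact h A hA hK
  | cons q qs ih =>
    exact draw_mono (hq q (by simp)) (fun A hA hK => ih (fun q hq' => hq q (by simp [hq'])) hA hK)
      hA hK

lemma draws_append (qs qs' : List ℝ) (g : Finset α → ℝ) :
    draws M K (qs ++ qs') g = draws M K qs (draws M K qs' g) := by
  induction qs with
  | nil => rfl
  | cons q qs ih => simp [draws, ih]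

lemma draws_linear (qs : List ℝ) (g g' : Finset α → ℝ) (a b : ℝ) (A : Finset α) :
    draws M K qs (fun A => a * g A + b * g' A) A = a * draws M K qs g A + b * draws M K qs g' A := by
  induction qs generalizing A with
  | nil => rfl
  | cons q qs ih =>
    simp only [draws]
    have : draws M K qs (fun A => a * g A + b * g' A) =
        fun A => a * draws M K qs g A + b * draws M K qs g' A := funext ih
    rw [this]
    unfold draw
    split_ifs
    · simp only [← Finset.mul_sum, Finset.sum_add_distrib]
      ring
    · rfl

lemma draws_one (qs : List ℝ) (A : Finset α) : draws M K qs (fun _ => 1) A = 1 := by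
  induction qs generalizing A with
  | nil => rfl
  | cons q qs ih =>
    simp only [draws]
    have : draws M K qs (fun _ => 1) = fun _ => 1 := funext ih
    rw [this]
    unfold draw
    split_ifs
    · simp; ring
    · rfl

lemma draws_zero (qs : List ℝ) (A : Finset α) : draws M K qs (fun _ => 0) A = 0 := by
  have := draws_linear (M := M) (K := K) qs (fun _ => 0) (fun _ => 0) 0 0 A
  simpa using this

lemma draws_sum {ι : Type*} (I : Finset ι) (qs : List ℝ) (g : ι → Finset α → ℝ) (A : Finset α) :
    draws M K qs (fun A => ∑ i ∈ I, g i A) A = ∑ i ∈ I, draws M K qs (g i) A := by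
  classical
  induction I using Finset.induction_on with
  | empty => simpa using draws_zero qs A
  | insert i I hi ih =>
    simp only [Finset.sum_insert hi]
    rw [← ih]
    simpa using draws_linear (M := M) (K := K) qs (g i) (fun A => ∑ i ∈ I, g i A) 1 1 A

/-- An attempt treats all elements of `M` alike, so it commutes with every relabelling that
preserves `M`. -/
lemma draws_equiv (π : Equiv.Perm α) (hπ : M.map π.toEmbedding = M) (qs : List ℝ)
    (g : Finset α → ℝ) (A : Finset α) :
    draws M K qs g (A.map π.toEmbedding) =
      draws M K qs (fun A => g (A.map π.toEmbedding)) A := by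
  induction qs generalizing A with
  | nil => rfl
  | cons q qs ih =>
    simp only [draws]
    unfold draw
    rw [Finset.card_map]
    split_ifs
    · rw [ih]
      congr 1
      have e := Finset.sum_map M π.toEmbedding
        (fun x => q * draws M K qs g (insert x (A.map π.toEmbedding)))
      rw [hπ] at e
      rw [e]
      refine Finset.sum_congr rfl fun x _ => ?_
      rw [← ih, Finset.map_insert]
    · exact ih A

/-- The set of the collected elements is uniformly distributed. -/
lemma draws_symm (qs : List ℝ) {B B' : Finset α} (hB : B ⊆ M) (hB' : B' ⊆ M)
    (hc : B.card = B'.card) :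
    draws M K qs (fun A => if A = B then 1 else 0) ∅ =
      draws M K qs (fun A => if A = B' then 1 else 0) ∅ := by
  classical
  have h1 : (M \ B).card = (M \ B').card := by
    rw [Finset.card_sdiff_of_subset hB, Finset.card_sdiff_of_subset hB', hc]
  let e : {x // x ∈ B} ≃ {x // x ∈ B'} := Finset.equivOfCardEq hc
  let e' : {x // x ∈ M \ B} ≃ {x // x ∈ M \ B'} := Finset.equivOfCardEq h1
  obtain ⟨π, hπB, hπM⟩ : ∃ π : Equiv.Perm α, B.map π.toEmbedding = B' ∧
      M.map π.toEmbedding = M := by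
    -- A bijection `B ≃ B'` and one of the complements in `M` are glued to a permutation of `M`,
    -- which is then extended by the identity.
    let f : {x // x ∈ M} → α := fun x => if hx : x.1 ∈ B then (e ⟨x.1, hx⟩).1
      else (e' ⟨x.1, Finset.mem_sdiff.2 ⟨x.2, hx⟩⟩).1
    have hfM : ∀ x, f x ∈ M := by
      intro x
      simp only [f]
      split_ifs with hx
      · exact hB' (e _).2
      · exact (Finset.mem_sdiff.1 (e' _).2).1
    have hfB : ∀ x : {x // x ∈ M}, f x ∈ B' ↔ x.1 ∈ B := by
      intro x
      simp only [f]
      split_ifs with hx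
      · exact ⟨fun _ => hx, fun _ => (e _).2⟩
      · exact ⟨fun h => absurd h (Finset.mem_sdiff.1 (e' _).2).2, fun h => absurd h hx⟩
    have hfi : Function.Injective f := by
      intro x y hxy
      have hb : x.1 ∈ B ↔ y.1 ∈ B := by rw [← hfB, ← hfB, hxy]
      simp only [f] at hxy
      by_cases hx : x.1 ∈ B
      · rw [dif_pos hx, dif_pos (hb.1 hx)] at hxy
        have := e.injective (Subtype.ext hxy)
        exact Subtype.ext (congrArg (fun z => z.1) this)
      · rw [dif_neg hx, dif_neg (fun h => hx (hb.2 h))] at hxy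
        have := e'.injective (Subtype.ext hxy)
        exact Subtype.ext (congrArg (fun z => z.1) this)
    let F : {x // x ∈ M} → {x // x ∈ M} := fun x => ⟨f x, hfM x⟩
    have hF : Function.Bijective F := Finite.injective_iff_bijective.1 fun x y h =>
      hfi (congrArg (fun z => z.1) h)
    let π := Equiv.Perm.extendDomain (Equiv.ofBijective F hF) (Equiv.refl {x // x ∈ M})
    have hπ : ∀ x (hx : x ∈ M), π x = f ⟨x, hx⟩ := by
      intro x hx
      have := Equiv.Perm.extendDomain_apply_subtype (Equiv.ofBijective F hF)
        (Equiv.refl {x // x ∈ M}) hx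
      simpa using this
    refine ⟨π, Finset.eq_of_subset_of_card_le ?_ (by rw [Finset.card_map, hc]),
      Finset.eq_of_subset_of_card_le ?_ (by rw [Finset.card_map])⟩
    · intro y hy
      obtain ⟨x, hx, rfl⟩ := Finset.mem_map.1 hy
      change π x ∈ B'
      rw [hπ x (hB hx), hfB]
      exact hx
    · intro y hy
      obtain ⟨x, hx, rfl⟩ := Finset.mem_map.1 hy
      change π x ∈ M
      rw [hπ x hx]
      exact hfM _
  have := draws_equiv (K := K) π hπM qs (fun A => if A = B' then 1 else 0) ∅
  rw [Finset.map_empty] at this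
  rw [this]
  congr 1
  funext A
  rw [← hπB]
  simp only [Finset.map_inj]

/-- Write `κ = min K |M|`. With `a < K` elements collected, an attempt adds a new one with
probability `q (|M| - a)`, and `(κ - a) |M| ≤ κ (|M| - a)` because `κ ≤ |M|`. So the expected
decrease is at least `δ (κ - a)`. Once `K` elements have been collected, both sides are zero. -/
lemma draw_potential {q : ℝ} (hq : 0 ≤ q) {δ : ℝ} (h0 : 0 ≤ δ)
    (hδ : δ * (min K M.card : ℕ) ≤ q * M.card) {A : Finset α} (hA : A ⊆ M) (hK : A.card ≤ K) :
    draw M K q (fun A => (min K M.card : ℕ) - A.card) A ≤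
      (1 - δ) * ((min K M.card : ℕ) - A.card) := by
  have hAM : A.card ≤ M.card := Finset.card_le_card hA
  unfold draw
  split_ifs with hc
  · have hsum : ∑ x ∈ M, q * (((min K M.card : ℕ) : ℝ) - (insert x A).card) =
        q * (M.card * ((min K M.card : ℕ) - A.card) - (M.card - A.card)) := by
      rw [← Finset.mul_sum]
      congr 1
      have : ∀ x ∈ M, (((min K M.card : ℕ) : ℝ) - (insert x A).card) =
          ((min K M.card : ℕ) - A.card) - (if x ∈ A then 0 else 1) := by
        intro x _
        by_cases hx : x ∈ A
        · simp [hx]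
        · rw [Finset.card_insert_of_notMem hx, if_neg hx]; push_cast; ring
      rw [Finset.sum_congr rfl this, Finset.sum_sub_distrib, Finset.sum_const, nsmul_eq_mul]
      congr 1
      have : ∀ x, (if x ∈ A then (0 : ℝ) else 1) = if ¬ x ∈ A then 1 else 0 := by
        intro x; split_ifs <;> simp_all
      simp only [this]
      rw [← Finset.sum_filter, Finset.sum_const, nsmul_eq_mul, mul_one,
        Finset.filter_notMem_eq_sdiff, Finset.card_sdiff_of_subset hA, Nat.cast_sub hAM]
    rw [hsum]
    set k : ℝ := ((min K M.card : ℕ) : ℝ)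
    have hk : k ≤ M.card := Nat.cast_le.2 (min_le_right K M.card)
    have hk0 : 0 ≤ k := Nat.cast_nonneg _
    have hAk : (A.card : ℝ) ≤ k := Nat.cast_le.2 (le_min hK hAM)
    have ha : (0 : ℝ) ≤ A.card := Nat.cast_nonneg _
    by_cases hM : (M.card : ℝ) = 0
    · have : k = 0 := le_antisymm (hM ▸ hk) hk0
      have : (A.card : ℝ) = 0 := le_antisymm (this ▸ hAk) ha
      rw [hM, this]; nlinarith
    · have hM' : 0 < (M.card : ℝ) := lt_of_le_of_ne (Nat.cast_nonneg _) (Ne.symm hM)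
      have key : δ * (k - A.card) ≤ q * (M.card - A.card) := by
        have h2 : δ * (k - A.card) * M.card ≤ q * (M.card - A.card) * M.card := by
          have : (k - A.card) * M.card ≤ k * (M.card - A.card) := by nlinarith
          calc δ * (k - A.card) * M.card = δ * ((k - A.card) * M.card) := by ring
            _ ≤ δ * (k * (M.card - A.card)) := mul_le_mul_of_nonneg_left this h0
            _ = (δ * k) * (M.card - A.card) := by ring
            _ ≤ (q * M.card) * (M.card - A.card) :=
                mul_le_mul_of_nonneg_right hδ (by linarith)
            _ = _ := by ring
        exact le_of_mul_le_mul_right h2 hM'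
      nlinarith
  · have : A.card = K := by omega
    have h2 : min K M.card = K := by omega
    simp only [h2, this, sub_self, mul_zero, le_refl]

/-- The case `δ = 0`: the attempts of a round for which no lower bound is known at least do no harm.
-/
lemma draws_potential_le {qs : List ℝ} (hq : ∀ q ∈ qs, IsRate M q) {A : Finset α} (hA : A ⊆ M)
    (hK : A.card ≤ K) : draws M K qs (fun A => (min K M.card : ℕ) - A.card) A ≤
      (min K M.card : ℕ) - A.card := by
  induction qs generalizing A with
  | nil => exact le_rfl
  | cons q qs ih =>
    refine (draw_mono (hq q (by simp)) (fun A hA hK => ih (fun q hq' => hq q (by simp [hq'])) hA hK)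
      hA hK).trans ?_
    have := draw_potential (M := M) (K := K) (hq q (by simp)).1 le_rfl
      (by rw [zero_mul]; exact mul_nonneg (hq q (by simp)).1 (Nat.cast_nonneg _)) hA hK
    simpa using this

/-- One round contracts the expected number of missing elements if one of its attempts has a good
chance. -/
lemma draws_potential {qs : List ℝ} (hq : ∀ q ∈ qs, IsRate M q) {δ : ℝ} (h0 : 0 ≤ δ) (h1 : δ ≤ 1)
    (hδ : ∃ q ∈ qs, δ * (min K M.card : ℕ) ≤ q * M.card) {A : Finset α} (hA : A ⊆ M)
    (hK : A.card ≤ K) : draws M K qs (fun A => (min K M.card : ℕ) - A.card) A ≤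
      (1 - δ) * ((min K M.card : ℕ) - A.card) := by
  induction qs generalizing A with
  | nil => simp at hδ
  | cons q qs ih =>
    have hq' : ∀ q ∈ qs, IsRate M q := fun q hq' => hq q (by simp [hq'])
    obtain ⟨q₀, hq₀, hb⟩ := hδ
    rcases List.mem_cons.1 hq₀ with rfl | hm
    · exact (draw_mono (hq q₀ (by simp)) (fun A hA hK => draws_potential_le hq' hA hK)
        hA hK).trans (draw_potential (hq q₀ (by simp)).1 h0 hb hA hK)
    · have e1 := draw_mono (hq q (by simp)) (fun A hA hK => ih hq' ⟨q₀, hm, hb⟩ hA hK) hA hK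
      refine e1.trans ?_
      have := draws_linear (M := M) (K := K) [q] (fun A => ((min K M.card : ℕ) : ℝ) - A.card)
        (fun _ => 0) (1 - δ) 0 A
      simp only [zero_mul, add_zero] at this
      rw [draws, draws] at this
      rw [this]
      refine mul_le_mul_of_nonneg_left ?_ (by linarith)
      exact draws_potential_le (qs := [q]) (fun q' h => by
        rw [List.mem_singleton.1 h]; exact hq q (by simp)) hA hK

/-- The attempts of `R` equal rounds. -/
def rounds (R : ℕ) (qs : List ℝ) : List ℝ := (List.replicate R qs).flatten

lemma draws_rounds_potential {qs : List ℝ} (hq : ∀ q ∈ qs, IsRate M q) {δ : ℝ} (h0 : 0 ≤ δ)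
    (h1 : δ ≤ 1) (hδ : ∃ q ∈ qs, δ * (min K M.card : ℕ) ≤ q * M.card) (R : ℕ) {A : Finset α}
    (hA : A ⊆ M) (hK : A.card ≤ K) :
    draws M K (rounds R qs) (fun A => (min K M.card : ℕ) - A.card) A ≤
      (1 - δ) ^ R * ((min K M.card : ℕ) - A.card) := by
  induction R generalizing A with
  | zero => simp [rounds, draws]
  | succ R ih =>
    have e : rounds (R + 1) qs = qs ++ rounds R qs := by
      simp [rounds, List.replicate_succ]
    rw [e, draws_append]
    refine (draws_mono hq (fun A hA hK => ih hA hK) hA hK).trans ?_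
    have := draws_linear (M := M) (K := K) qs (fun A => ((min K M.card : ℕ) : ℝ) - A.card)
        (fun _ => 0) ((1 - δ) ^ R) 0 A
    simp only [zero_mul, add_zero] at this
    rw [this, pow_succ, mul_assoc]
    exact mul_le_mul_of_nonneg_left (draws_potential hq h0 h1 hδ hA hK)
      (pow_nonneg (by linarith) _)

lemma mem_rounds {R : ℕ} {qs : List ℝ} {q : ℝ} (h : q ∈ rounds R qs) : q ∈ qs := by
  simp only [rounds, List.mem_flatten, List.mem_replicate] at h
  obtain ⟨l, ⟨_, rfl⟩, hq⟩ := h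
  exact hq

/-- With high probability everything has been collected. -/
lemma draws_rounds_full {qs : List ℝ} (hq : ∀ q ∈ qs, IsRate M q) {δ : ℝ} (h0 : 0 ≤ δ)
    (h1 : δ ≤ 1) (hδ : ∃ q ∈ qs, δ * (min K M.card : ℕ) ≤ q * M.card) (R : ℕ) :
    1 - (1 - δ) ^ R * K ≤
      draws M K (rounds R qs) (fun A => if min K M.card ≤ A.card then 1 else 0) ∅ := by
  have hq' : ∀ q ∈ rounds R qs, IsRate M q := fun q h => hq q (mem_rounds h)
  -- Markov's inequality: an incomplete collection misses at least one element, so the indicator of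
  -- completeness is at least one minus the number of missing elements.
  have e1 := draws_mono (K := K) hq' (g := fun A => 1 * 1 + (-1) * (((min K M.card : ℕ) : ℝ) - A.card))
    (g' := fun A => if min K M.card ≤ A.card then 1 else 0) (fun A hA hK => by
      split_ifs with h
      · have : A.card ≤ min K M.card := le_min hK (Finset.card_le_card hA)
        have : A.card = min K M.card := le_antisymm this h
        rw [this]; simp
      · have : ((A.card + 1 : ℕ) : ℝ) ≤ (min K M.card : ℕ) := by exact_mod_cast Nat.lt_of_not_le h
        push_cast at this ⊢
        linarith) (Finset.empty_subset M) (by simp)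
  refine le_trans ?_ e1
  rw [draws_linear (M := M) (K := K) (rounds R qs) (fun _ => 1), draws_one]
  have := draws_rounds_potential (K := K) hq h0 h1 hδ R (Finset.empty_subset M) (by simp)
  simp only [Finset.card_empty, Nat.cast_zero, sub_zero] at this
  have hm : (1 - δ) ^ R * ((min K M.card : ℕ) : ℝ) ≤ (1 - δ) ^ R * K :=
    mul_le_mul_of_nonneg_left (by exact_mod_cast min_le_left K M.card) (pow_nonneg (by linarith) _)
  linarith

/-- Each set of `K` elements is obtained with almost the uniform probability. -/
lemma draws_rounds_uniform {qs : List ℝ} (hq : ∀ q ∈ qs, IsRate M q) {δ : ℝ} (h0 : 0 ≤ δ)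
    (h1 : δ ≤ 1) (hδ : ∃ q ∈ qs, δ * (min K M.card : ℕ) ≤ q * M.card) (R : ℕ) (hKM : K ≤ M.card)
    {B : Finset α} (hB : B ∈ M.powersetCard K) :
    (1 - (1 - δ) ^ R * K) / (M.powersetCard K).card ≤
      draws M K (rounds R qs) (fun A => if A = B then 1 else 0) ∅ := by
  have hq' : ∀ q ∈ rounds R qs, IsRate M q := fun q h => hq q (mem_rounds h)
  have hpos : (0 : ℝ) < (M.powersetCard K).card := by
    exact_mod_cast Finset.card_pos.2 ⟨B, hB⟩
  rw [div_le_iff₀ hpos]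
  refine (draws_rounds_full (K := K) hq h0 h1 hδ R).trans ?_
  -- The complete collections are the `K`-subsets of `M`, and by symmetry all of them have the same
  -- probability.
  have e : draws M K (rounds R qs) (fun A => if min K M.card ≤ A.card then 1 else 0) ∅ ≤
      draws M K (rounds R qs) (fun A => ∑ B ∈ M.powersetCard K, if A = B then 1 else 0) ∅ := by
    refine draws_mono hq' (fun A hA hK => ?_) (Finset.empty_subset M) (by simp)
    rw [Finset.sum_ite_eq]
    split_ifs with h1 h2
    · exact le_rfl
    · exact absurd (Finset.mem_powersetCard.2 ⟨hA, by omega⟩) h2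
    · exact zero_le_one
    · exact le_rfl
  refine e.trans (le_of_eq ?_)
  rw [draws_sum]
  have hB1 := Finset.mem_powersetCard.1 hB
  rw [Finset.sum_congr rfl (g := fun _ => draws M K (rounds R qs) (fun A => if A = B then 1 else 0) ∅)
    (fun B' hB' => ?_)]
  · rw [Finset.sum_const, nsmul_eq_mul, mul_comm]
  · have hB2 := Finset.mem_powersetCard.1 hB'
    exact draws_symm _ hB2.1 hB1.1 (by rw [hB1.2, hB2.2])

end Coupon

/-! ### The program -/

section Program

instance : Add Expr := ⟨.bin .add⟩
instance : Sub Expr := ⟨.bin .sub⟩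
instance : Mul Expr := ⟨.bin .mul⟩
instance : Div Expr := ⟨.bin .div⟩
instance : Mod Expr := ⟨.bin .mod⟩
instance (v : ℕ) : OfNat Expr v := ⟨.lit v⟩

infixr:60 " ⨾ " => Cmd.seq

/-- Run `p` for the values `0, 1, …, len - 1` of register `11`. -/
def up (len : Expr) (p : Cmd) : Cmd :=
  .assign 11 0 ⨾ .loop len (p ⨾ .assign 11 (.reg 11 + 1))

/-- Run `p` for the values `len - 1, …, 1, 0` of register `11`. -/
def down (len : Expr) (p : Cmd) : Cmd :=
  .assign 11 len ⨾ .loop len (.assign 11 (.reg 11 - 1) ⨾ p)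

/-- The loop index. -/
abbrev ix : Expr := .reg 11

/-- The word length. -/
abbrev wl : Expr := .reg 2

/-- The number of low bits in superposition. -/
abbrev lowLen : Expr := .reg 9 % .reg 2

/-- The level. -/
abbrev lev : Expr := .reg 7 % .reg 2

/-- Length of the block that holds low bits, three ones and the row. -/
abbrev slotLen : Expr := .reg 9 % .reg 2 + .reg 3 + 4

/-- Position of the result of the comparison. -/
abbrev outPos : Expr := 4 * .reg 2 + .reg 9 % .reg 2 + (.reg 2 - .reg 7 % .reg 2)

/-- Position of the result of the test for the start state. -/
abbrev andPos : Expr := 7 * .reg 2 + (.reg 9 % .reg 2 + .reg 3 + 4)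

/-- One carry bit of a sum. -/
def carry (a b c : Expr) : Cmd :=
  .ccnot (a + ix) (b + ix) (c + ix + 1) ⨾ .ccnot (a + ix) (c + ix) (c + ix + 1) ⨾
    .ccnot (b + ix) (c + ix) (c + ix + 1)

/-- Look up the value of the row. -/
def fetch : Cmd :=
  .query (lowLen + 3) (2 * wl) ⨾ .gate .X (lowLen + 3 + .reg 3) ⨾ .qread lowLen (2 * wl) ⨾
    .gate .X (lowLen + 3 + .reg 3)

/-- Inverse of `fetch`. -/
def unfetch : Cmd :=
  .gate .X (lowLen + 3 + .reg 3) ⨾ .qread lowLen (2 * wl) ⨾ .gate .X (lowLen + 3 + .reg 3) ⨾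
    .query (lowLen + 3) (2 * wl)

/-- Look up the value of the row and compare. -/
def compute : Cmd :=
  fetch ⨾ up lowLen (carry (2 * wl) 0 (4 * wl)) ⨾
    up (wl - lev) (carry (2 * wl + lev) (3 * wl) (4 * wl + lowLen))

/-- Inverse of `compute`. -/
def uncompute : Cmd :=
  down (wl - lev) (carry (2 * wl + lev) (3 * wl) (4 * wl + lowLen)) ⨾
    down lowLen (carry (2 * wl) 0 (4 * wl)) ⨾ unfetch

/-- The gate `Z = T ^ 4`. -/
def zGate (e : Expr) : Cmd := .gate .T e ⨾ .gate .T e ⨾ .gate .T e ⨾ .gate .T e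

/-- Prepare the label at which amplitude amplification starts. -/
def prep : Cmd := up slotLen (.gate .X ix) ⨾ up wl (.gate .X (3 * wl + ix)) ⨾ .gate .X (7 * wl)

/-- Bring the low bits and the row into superposition. -/
def spread : Cmd := up lowLen (.gate .H ix) ⨾ up (.reg 3 + 1) (.gate .H (lowLen + 3 + ix))

/-- Inverse of `spread`. -/
def unspread : Cmd := down (.reg 3 + 1) (.gate .H (lowLen + 3 + ix)) ⨾ down lowLen (.gate .H ix)

/-- One round of amplitude amplification. -/
def iter : Cmd :=
  (compute ⨾ zGate outPos ⨾ uncompute) ⨾ unspread ⨾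
    (up slotLen (carry 0 (6 * wl) (7 * wl)) ⨾ zGate andPos ⨾
      down slotLen (carry 0 (6 * wl) (7 * wl))) ⨾ spread

/-- Amplitude amplification with as many rounds as register `13` says. -/
def amplify : Cmd := prep ⨾ spread ⨾ .loop (.reg 13 % .reg 4) iter

/-- Measure a block of qubits and put the number into register `x`. -/
def measWord (x : ℕ) (base len : Expr) : Cmd :=
  .assign x 0 ⨾ down len (.measure 12 (base + ix) ⨾ .assign x (2 * .reg x + .reg 12))

/-- Measure all qubits and put them into the state zero. -/
def resetAll : Cmd := up (9 * wl) (.measure 12 ix ⨾ .ite (.reg 12) (.gate .X ix) .skip)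

/-- Measure the slot, its value and whether it is good. -/
def readout : Cmd :=
  compute ⨾ measWord 16 0 slotLen ⨾ measWord 17 (2 * wl) wl ⨾ .measure 18 outPos ⨾ resetAll

/-- Descend one level in the binary tree of the known keys, and add a node if there is none. -/
def treeStep : Cmd :=
  .assign 28 (8 * (2 * .reg 19 + .bin .bit (.reg 16) ix)) ⨾ .load 29 (.reg 28) ⨾
    .ite (.reg 29) .skip (.assign 29 (.reg 21) ⨾ .store (.reg 28 % .reg 5) (.reg 21) ⨾
      .assign 21 (.reg 21 + 1) ⨾ .assign 20 1) ⨾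
    .assign 19 (.reg 29)

/-- Append what belongs to the slot that was found to the lists. -/
def record : Cmd :=
  .assign 24 (.reg 16 / (8 * .reg 10)) ⨾
    .ite (.bin .lt (.reg 24) (.reg 6)) (.assign 25 (.reg 24) ⨾ .assign 26 0)
      (.load 25 (8 * (.reg 24 - .reg 6) + 1) ⨾ .load 26 (8 * (.reg 24 - .reg 6) + 2)) ⨾
    .store ((8 * .reg 14 + 1) % .reg 5) (.reg 25) ⨾
    .store ((8 * .reg 14 + 2) % .reg 5) (.reg 26 + .reg 8 - .reg 16 % .reg 10) ⨾
    .store ((8 * .reg 14 + 3) % .reg 5) (.reg 17 - .reg 8) ⨾ .assign 14 (.reg 14 + 1)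

/-- Record the slot if it is good, new and needed. -/
def keep : Cmd :=
  .ite (.reg 18 * .bin .lt (.reg 14) (.reg 15))
    (.assign 19 (.reg 30) ⨾ .assign 20 0 ⨾ up wl treeStep ⨾ .ite (.reg 20) record .skip) .skip

/-- Attempts with increasing numbers of rounds of amplitude amplification. -/
def searchRound : Cmd :=
  .assign 13 0 ⨾ .loop wl ((amplify ⨾ readout ⨾ keep) ⨾
    .ite (.bin .lt (2 * .reg 13 + 1) (.reg 4)) (.assign 13 (2 * .reg 13 + 1)) .skip)

/-- Collect good slots. -/
def collect (a : ℕ) : Cmd :=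
  .assign 30 (.reg 21) ⨾ .assign 21 (.reg 21 + 1) ⨾ .assign 14 (.reg 22) ⨾
    .loop (.reg 1) (.loop (.lit a * wl) searchRound)

/-- Make the new rows visible to the quantum memory access. -/
def commit : Cmd :=
  .assign 11 (.reg 22) ⨾ .loop (.reg 1) (.ite (.bin .lt ix (.reg 14))
    (.load 28 (8 * ix + 3) ⨾ .store ((8 * ix + 7) % .reg 5) (.reg 28) ⨾ .assign 11 (ix + 1))
    .skip) ⨾ .assign 22 (.reg 14)

/-- Halve the size of the rows, unless there would be too many of them. -/
def levelStep (a : ℕ) : Cmd :=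
  .ite (.reg 7 * (1 - .reg 23))
    ((.assign 7 (.reg 7 - 1) ⨾ .assign 8 (.reg 8 / 2) ⨾ .assign 9 0 ⨾ .assign 10 1 ⨾
      .assign 15 (.reg 1 + 1)) ⨾ collect a ⨾
      .ite (.bin .lt (.reg 14) (.reg 1 + 1)) commit
        (.assign 23 1 ⨾ .assign 7 (.reg 7 + 1) ⨾ .assign 8 (.reg 8 * 2))) .skip

/-- Copy the result to the first memory cells. -/
def output : Cmd :=
  up (.reg 1) (.load 25 (8 * (.reg 22 + ix) + 1) ⨾ .load 26 (8 * (.reg 22 + ix) + 2) ⨾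
    .store ((2 * ix) % .reg 5) (.reg 25) ⨾ .store ((2 * ix + 1) % .reg 5) (.reg 26))

/-- Constants. -/
def preamble (b : ℕ) : Cmd :=
  .assign 3 (wl / .lit b) ⨾ .assign 6 1 ⨾ .loop (wl / .lit b) (.assign 6 (.reg 6 * 2)) ⨾
    .assign 4 1 ⨾
    .loop wl (.ite (.bin .lt (.reg 6) (4 * .reg 4 * .reg 4 * .reg 1)) .skip
      (.assign 4 (2 * .reg 4))) ⨾
    .assign 5 (128 * .reg 1 * wl * wl)

/-- Initial values of the variables. -/
def start (b : ℕ) : Cmd :=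
  .assign 7 (.lit (b - 5) * .reg 3) ⨾ .assign 8 1 ⨾
    .loop (.lit (b - 5) * .reg 3) (.assign 8 (2 * .reg 8)) ⨾
    .assign 22 0 ⨾ .assign 23 0 ⨾ .assign 21 1

/-- The sampling algorithm after the preamble. -/
def mainPart (a b : ℕ) : Cmd :=
  start b ⨾ .loop wl (levelStep a) ⨾
    (.assign 9 (.reg 7) ⨾ .assign 10 (.reg 8) ⨾ .assign 15 (.reg 22 + .reg 1)) ⨾
    collect a ⨾ output

/-- Sampling of a random subset. -/
def multiSample (a b : ℕ) : Cmd := preamble b ⨾ mainPart a b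

/-- The preamble still assigns registers `3` to `6` and stores nothing, so only the registers below
`3` are protected. -/
lemma preamble_wf (b : ℕ) : (preamble b).wf 3 = true := by rfl

/-- The constants in the registers below `7` stay fixed from here on, and every store address is
reduced modulo register `5`. -/
lemma mainPart_wf (a b : ℕ) : (mainPart a b).wf 7 = true := by rfl

lemma preamble_deg (b : ℕ) : (preamble b).deg 1 = 0 ∧ (preamble b).deg 4 = 0 := by
  constructor <;> rfl

/-- Only loops over register `1` and the amplification loop, cut off at register `4`, count. No loop
is nested in another one of the same kind, so the time is `k * T` up to a power of `L`. -/
lemma mainPart_deg (a b : ℕ) : (mainPart a b).deg 1 = 1 ∧ (mainPart a b).deg 4 = 1 := by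
  constructor <;> rfl

end Program

/-! ### A reversible ladder of carries -/

section Ladder

variable {Q : ℕ}

lemma bitAt_ccnotB (c d t j : ℕ) (x : Basis Q) : bitAt (ccnotB c d t x) j =
    if (c < Q ∧ d < Q ∧ t < Q ∧ c ≠ d ∧ c ≠ t ∧ d ≠ t) ∧ j = t then
      xor (bitAt x t) (bitAt x c && bitAt x d) else bitAt x j := by
  unfold ccnotB
  by_cases h : c < Q ∧ d < Q ∧ t < Q ∧ c ≠ d ∧ c ≠ t ∧ d ≠ t
  · rw [if_pos h, bitAt_setBit]
    simp [h.2.2.1, h]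
  · rw [if_neg h, if_neg (by tauto)]

lemma ccnotB_comm (a b c d t : ℕ) (x : Basis Q) :
    ccnotB a b t (ccnotB c d t x) = ccnotB c d t (ccnotB a b t x) := by
  refine basis_ext fun j _ => ?_
  simp only [bitAt_ccnotB]
  by_cases hj : j = t
  · subst hj
    by_cases h1 : a < Q ∧ b < Q ∧ j < Q ∧ a ≠ b ∧ a ≠ j ∧ b ≠ j
    · by_cases h2 : c < Q ∧ d < Q ∧ j < Q ∧ c ≠ d ∧ c ≠ j ∧ d ≠ j
      · simp only [h1, h2, and_true, and_false, if_true, if_false, ne_eq, not_false_eq_true]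
        cases bitAt x j <;> cases bitAt x a <;> cases bitAt x b <;> cases bitAt x c <;>
          cases bitAt x d <;> rfl
      · simp only [if_neg (fun h : _ ∧ _ => h2 h.1)]
    · simp only [if_neg (fun h : _ ∧ _ => h1 h.1)]
  · simp only [if_neg (fun h : _ ∧ _ => hj h.2)]

/-- The label map of `carry`. -/
def carryB (a b c j : ℕ) (x : Basis Q) : Basis Q :=
  ccnotB (b + j) (c + j) (c + j + 1) (ccnotB (a + j) (c + j) (c + j + 1)
    (ccnotB (a + j) (b + j) (c + j + 1) x))

/-- Toffoli gates with a common target commute and are involutions, so the six gates cancel in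
pairs. -/
lemma carryB_carryB (a b c j : ℕ) (x : Basis Q) : carryB a b c j (carryB a b c j x) = x := by
  unfold carryB
  rw [ccnotB_comm (a + j) (b + j) (b + j) (c + j), ccnotB_comm (a + j) (c + j) (b + j) (c + j),
    ccnotB_ccnotB, ccnotB_comm (a + j) (b + j) (a + j) (c + j), ccnotB_ccnotB, ccnotB_ccnotB]

/-- Apply `σ 0, …, σ (N - 1)` in this order. -/
def runUp {α : Type*} (σ : ℕ → α → α) : ℕ → α → α
  | 0, x => x
  | N + 1, x => σ N (runUp σ N x)

/-- Apply `σ (N - 1), …, σ 0` in this order. -/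
def runDown {α : Type*} (σ : ℕ → α → α) : ℕ → α → α
  | 0, x => x
  | N + 1, x => runDown σ N (σ N x)

lemma runDown_runUp {α : Type*} {σ : ℕ → α → α} (h : ∀ j x, σ j (σ j x) = x) (N : ℕ) (x : α) :
    runDown σ N (runUp σ N x) = x := by
  induction N with
  | zero => rfl
  | succ N ih => rw [runUp, runDown, h, ih]

lemma blockVal_succ (N a : ℕ) (x : Basis Q) :
    blockVal (N + 1) a x = blockVal N a x + (bitAt x (a + N)).toNat * 2 ^ N := by
  unfold blockVal
  rw [Finset.sum_range_succ]
  congr 1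
  cases bitAt x (a + N) <;> simp

lemma blockVal_lt (N a : ℕ) (x : Basis Q) : blockVal N a x < 2 ^ N := by
  induction N with
  | zero => simp [blockVal]
  | succ N ih =>
    rw [blockVal_succ, pow_succ]
    have : (bitAt x (a + N)).toNat ≤ 1 := Bool.toNat_le _
    nlinarith [pow_pos (show 0 < 2 by norm_num) N]

lemma testBit_blockVal (N a : ℕ) (x : Basis Q) (i : ℕ) (hi : i < N) :
    (blockVal N a x).testBit i = bitAt x (a + i) := by
  induction N with
  | zero => omega
  | succ N ih =>
    rw [blockVal_succ]
    have h := blockVal_lt N a x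
    by_cases hiN : i = N
    · subst hiN
      cases hb : bitAt x (a + i)
      · simp [Nat.testBit_lt_two_pow h]
      · simp only [Bool.toNat_true, one_mul]
        rw [add_comm, Nat.testBit_two_pow_add_eq, Nat.testBit_lt_two_pow h]; rfl
    · rw [← ih (by omega)]
      cases hb : bitAt x (a + N)
      · simp
      · simp only [Bool.toNat_true, one_mul]
        rw [add_comm, Nat.testBit_two_pow_add_gt (by omega)]

lemma blockVal_eq_of_testBit {N a v : ℕ} {x : Basis Q} (hv : v < 2 ^ N)
    (h : ∀ i < N, bitAt x (a + i) = v.testBit i) : blockVal N a x = v := by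
  refine Nat.eq_of_testBit_eq fun i => ?_
  by_cases hi : i < N
  · rw [testBit_blockVal _ _ _ _ hi, h i hi]
  · rw [Nat.testBit_lt_two_pow ((blockVal_lt N a x).trans_le
      (Nat.pow_le_pow_right (by norm_num) (by omega))),
      Nat.testBit_lt_two_pow (hv.trans_le (Nat.pow_le_pow_right (by norm_num) (by omega)))]

lemma blockVal_add (N M a : ℕ) (x : Basis Q) :
    blockVal (N + M) a x = blockVal N a x + 2 ^ N * blockVal M (a + N) x := by
  induction M with
  | zero => simp [blockVal]
  | succ M ih =>
    rw [← add_assoc, blockVal_succ, ih, blockVal_succ, pow_add, ← add_assoc a N M]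
    ring

lemma blockVal_one {N a : ℕ} {x : Basis Q} (h : ∀ i < N, bitAt x (a + i) = true) :
    blockVal N a x = 2 ^ N - 1 :=
  blockVal_eq_of_testBit (by have := Nat.two_pow_pos N; omega)
    fun i hi => by rw [h i hi, Nat.testBit_two_pow_sub_one]; simp [hi]

lemma blockVal_zero {N a : ℕ} {x : Basis Q} (h : ∀ i < N, bitAt x (a + i) = false) :
    blockVal N a x = 0 :=
  blockVal_eq_of_testBit (by positivity) fun i hi => by rw [h i hi]; simp

/-- The new carry is the majority of the two bits and the old carry, that is `ab ⊕ ac ⊕ bc`, one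
Toffoli gate for each product. -/
lemma carry_step {N A B c : ℕ} (hA : A < 2 ^ N) (hB : B < 2 ^ N) (hc : c ≤ 1) (a b : Bool) :
    (xor (xor (a && b) (a && decide (2 ^ N ≤ A + B + c))) (b && decide (2 ^ N ≤ A + B + c))) =
      decide (2 ^ (N + 1) ≤ (A + a.toNat * 2 ^ N) + (B + b.toNat * 2 ^ N) + c) := by
  rw [pow_succ]
  generalize 2 ^ N = M at *
  by_cases h : M ≤ A + B + c <;> cases a <;> cases b <;>
    simp only [h, decide_true, decide_false, Bool.toNat_true, Bool.toNat_false, Bool.and_self,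
      Bool.and_true, Bool.and_false, Bool.xor_self, Bool.xor_false,
      Bool.xor_true, Bool.not_false] <;>
    symm <;> first
      | (rw [decide_eq_true_eq]; omega)
      | (rw [decide_eq_false_iff_not]; omega)

lemma bitAt_runUp_carryB_of_notMem (a b c N i : ℕ) (x : Basis Q) (h : ¬ (c < i ∧ i ≤ c + N)) :
    bitAt (runUp (carryB a b c) N x) i = bitAt x i := by
  induction N with
  | zero => rfl
  | succ N ih =>
    rw [runUp, carryB]
    rw [bitAt_ccnotB, if_neg (by omega), bitAt_ccnotB, if_neg (by omega), bitAt_ccnotB,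
      if_neg (by omega), ih (by omega)]

lemma blockVal_runUp_carryB (a b c N i M : ℕ) (x : Basis Q) (h : i + M ≤ c + 1 ∨ c + N < i) :
    blockVal M i (runUp (carryB a b c) N x) = blockVal M i x :=
  blockVal_congr fun j hj => bitAt_runUp_carryB_of_notMem _ _ _ _ _ _ (by omega)

/-- The ladder computes the carry of a sum. -/
lemma bitAt_runUp_carryB (a b c N : ℕ) (x : Basis Q) (ha : a + N ≤ Q) (hb : b + N ≤ Q)
    (hc : c + N < Q) (hab : a + N ≤ b ∨ b + N ≤ a) (hac : a + N ≤ c ∨ c + N < a)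
    (hbc : b + N ≤ c ∨ c + N < b) (hz : ∀ j < N, bitAt x (c + j + 1) = false) :
    bitAt (runUp (carryB a b c) N x) (c + N) =
      decide (2 ^ N ≤ blockVal N a x + blockVal N b x + (bitAt x c).toNat) := by
  induction N with
  | zero => simp only [runUp, blockVal]; cases bitAt x (c + 0) <;> cases h : bitAt x c <;> simp_all
  | succ N ih =>
    have ih := ih (by omega) (by omega) (by omega) (by omega) (by omega) (by omega)
      (fun j hj => hz j (by omega))
    rw [blockVal_succ, blockVal_succ,
      ← carry_step (blockVal_lt N a x) (blockVal_lt N b x) (Bool.toNat_le _), ← ih]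
    have h1 := bitAt_runUp_carryB_of_notMem a b c N (c + N + 1) x (by omega)
    rw [hz N (by omega)] at h1
    have h2 := bitAt_runUp_carryB_of_notMem a b c N (a + N) x (by omega)
    have h3 := bitAt_runUp_carryB_of_notMem a b c N (b + N) x (by omega)
    rw [runUp, carryB, ← h2, ← h3]
    generalize runUp (carryB a b c) N x = y at *
    have g1 : b + N < Q := by omega
    have g2 : a + N < Q := by omega
    have g3 : c + N < Q := by omega
    have g4 : c + N + 1 < Q := by omega
    have g5 : a + N ≠ b + N := by omega
    have g6 : a + N ≠ c + N := by omega
    have g7 : b + N ≠ c + N := by omega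
    have g8 : a + N ≠ c + N + 1 := by omega
    have g9 : b + N ≠ c + N + 1 := by omega
    have g10 : c + N ≠ c + N + 1 := by omega
    rw [show c + (N + 1) = c + N + 1 by ring]
    simp only [bitAt_ccnotB, g1, g2, g3, g4, g5, g6, g7, g8, g9, g10, h1, ne_eq, not_false_eq_true,
      and_true, and_false, if_true, if_false, Bool.false_xor]

end Ladder

/-! ### Invariants of counted loops -/

section Loops

variable {Q n : ℕ} {w : Fin n → ℕ} {L : ℕ}

@[simp] lemma eval_add (a b : Expr) (r : ℕ → ℕ) :
    (a + b).eval L r = (a.eval L r + b.eval L r) % 2 ^ L := rfl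
@[simp] lemma eval_sub (a b : Expr) (r : ℕ → ℕ) :
    (a - b).eval L r = a.eval L r - b.eval L r := rfl
@[simp] lemma eval_mul (a b : Expr) (r : ℕ → ℕ) :
    (a * b).eval L r = (a.eval L r * b.eval L r) % 2 ^ L := rfl
@[simp] lemma eval_div (a b : Expr) (r : ℕ → ℕ) :
    (a / b).eval L r = a.eval L r / b.eval L r := rfl
@[simp] lemma eval_mod (a b : Expr) (r : ℕ → ℕ) :
    (a % b).eval L r = a.eval L r % b.eval L r := rfl
@[simp] lemma eval_reg (x : ℕ) (r : ℕ → ℕ) : (Expr.reg x).eval L r = r x := rfl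
@[simp] lemma eval_lit (v : ℕ) (r : ℕ → ℕ) : (Expr.lit v).eval L r = v % 2 ^ L := rfl
@[simp] lemma eval_0 (r : ℕ → ℕ) : (0 : Expr).eval L r = 0 % 2 ^ L := rfl
@[simp] lemma eval_1 (r : ℕ → ℕ) : (1 : Expr).eval L r = 1 % 2 ^ L := rfl
@[simp] lemma eval_2 (r : ℕ → ℕ) : (2 : Expr).eval L r = 2 % 2 ^ L := rfl
@[simp] lemma eval_3 (r : ℕ → ℕ) : (3 : Expr).eval L r = 3 % 2 ^ L := rfl
@[simp] lemma eval_4 (r : ℕ → ℕ) : (4 : Expr).eval L r = 4 % 2 ^ L := rfl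
@[simp] lemma eval_6 (r : ℕ → ℕ) : (6 : Expr).eval L r = 6 % 2 ^ L := rfl
@[simp] lemma eval_7 (r : ℕ → ℕ) : (7 : Expr).eval L r = 7 % 2 ^ L := rfl
@[simp] lemma eval_8 (r : ℕ → ℕ) : (8 : Expr).eval L r = 8 % 2 ^ L := rfl
@[simp] lemma eval_9 (r : ℕ → ℕ) : (9 : Expr).eval L r = 9 % 2 ^ L := rfl
@[simp] lemma eval_128 (r : ℕ → ℕ) : (128 : Expr).eval L r = 128 % 2 ^ L := rfl
@[simp] lemma eval_lt (a b : Expr) (r : ℕ → ℕ) : (Expr.bin .lt a b).eval L r =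
    (if a.eval L r < b.eval L r then 1 else 0) % 2 ^ L := rfl
@[simp] lemma eval_bit (a b : Expr) (r : ℕ → ℕ) : (Expr.bin .bit a b).eval L r =
    (if (a.eval L r).testBit (b.eval L r) then 1 else 0) % 2 ^ L := rfl

lemma det_loop {e : Expr} {p : Cmd} (I : ℕ → DState Q → Prop) (s : DState Q)
    (h0 : I 0 s) (h : ∀ j < e.eval L s.reg, ∀ s, I j s → I (j + 1) (p.det w L s)) :
    I (e.eval L s.reg) ((Cmd.loop e p).det w L s) := by
  simp only [Cmd.det]
  generalize e.eval L s.reg = N at h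
  induction N with
  | zero => exact h0
  | succ N ih =>
    rw [Function.iterate_succ_apply']
    exact h N (by omega) _ (ih fun j hj => h j (by omega))

lemma det_up {len : Expr} {p : Cmd} {N : ℕ} (I : ℕ → DState Q → Prop) (s : DState Q)
    (hlen : len.eval L (Function.update s.reg 11 0) = N)
    (h0 : I 0 ⟨Function.update s.reg 11 0, s.ram, s.lab⟩)
    (h : ∀ j < N, ∀ s, I j s → I (j + 1) ((p ⨾ .assign 11 (ix + 1)).det w L s)) :
    I N ((up len p).det w L s) := by
  have e : (0 : Expr).eval L s.reg = 0 := by simp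
  have := det_loop (w := w) (L := L) (e := len) (p := p ⨾ .assign 11 (ix + 1)) I
    ⟨Function.update s.reg 11 0, s.ram, s.lab⟩ h0 (fun j hj s => h j (hlen ▸ hj) s)
  rw [hlen] at this
  unfold up
  rw [Cmd.det]
  simp only [Cmd.det, e]
  exact this

lemma det_down {len : Expr} {p : Cmd} {N : ℕ} (I : ℕ → DState Q → Prop) (s : DState Q)
    (hlen' : len.eval L s.reg = N) (hlen : len.eval L (Function.update s.reg 11 N) = N)
    (h0 : I N ⟨Function.update s.reg 11 N, s.ram, s.lab⟩)
    (h : ∀ j < N, ∀ s, I (j + 1) s → I j ((Cmd.assign 11 (ix - 1) ⨾ p).det w L s)) :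
    I 0 ((down len p).det w L s) := by
  have := det_loop (w := w) (L := L) (e := len) (p := .assign 11 (ix - 1) ⨾ p) (fun j => I (N - j))
    ⟨Function.update s.reg 11 N, s.ram, s.lab⟩ h0 (fun j hj s hs => by
      rw [hlen] at hj
      refine h (N - (j + 1)) (by omega) s ?_
      rwa [show N - (j + 1) + 1 = N - j by omega])
  rw [hlen, Nat.sub_self] at this
  unfold down
  rw [Cmd.det]
  simp only [Cmd.det.eq_2, hlen']
  exact this

lemma det_up_label {len : Expr} {p : Cmd} {N : ℕ} {reg ram : ℕ → ℕ} (x : Basis Q)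
    (σ : ℕ → Basis Q → Basis Q) (hlen : len.eval L (Function.update reg 11 0) = N) (hN : N < 2 ^ L)
    (h : ∀ j < N, ∀ x, p.det w L ⟨Function.update reg 11 j, ram, x⟩ =
      ⟨Function.update reg 11 j, ram, σ j x⟩) :
    (up len p).det w L ⟨reg, ram, x⟩ = ⟨Function.update reg 11 N, ram, runUp σ N x⟩ := by
  refine det_up (fun j s => s = ⟨Function.update reg 11 j, ram, runUp σ j x⟩) _ hlen rfl ?_
  rintro j hj s rfl
  rw [Cmd.det, h j hj]
  simp only [Cmd.det, eval_add, eval_reg, eval_1, Function.update_self, Function.update_idem]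
  rw [Nat.mod_eq_of_lt (a := 1) (by omega), Nat.mod_eq_of_lt (by omega)]
  rfl

lemma det_down_label {len : Expr} {p : Cmd} {N : ℕ} {reg ram : ℕ → ℕ} (x : Basis Q)
    (σ : ℕ → Basis Q → Basis Q) (hlen' : len.eval L reg = N)
    (hlen : len.eval L (Function.update reg 11 N) = N) (hN : N < 2 ^ L)
    (h : ∀ j < N, ∀ x, p.det w L ⟨Function.update reg 11 j, ram, x⟩ =
      ⟨Function.update reg 11 j, ram, σ j x⟩) :
    (down len p).det w L ⟨reg, ram, x⟩ = ⟨Function.update reg 11 0, ram, runDown σ N x⟩ := by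
  have := det_down (w := w) (L := L) (len := len) (p := p) (fun j s => ∃ y, runDown σ j y = runDown σ N x ∧
    s = ⟨Function.update reg 11 j, ram, y⟩) ⟨reg, ram, x⟩ hlen' hlen ⟨x, rfl, rfl⟩ (by
      rintro j hj s ⟨y, hy, rfl⟩
      refine ⟨σ j y, hy, ?_⟩
      have e : (Cmd.assign 11 (ix - 1)).det w L
          (⟨Function.update reg 11 (j + 1), ram, y⟩ : DState Q) =
          ⟨Function.update reg 11 j, ram, y⟩ := by
        simp only [Cmd.det, eval_sub, eval_reg, eval_1, Function.update_self,
          Function.update_idem]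
        rw [Nat.mod_eq_of_lt (a := 1) (by omega)]; rfl
      rw [Cmd.det, e, h j hj])
  obtain ⟨y, hy, h⟩ := this
  rw [h, ← hy]; rfl

end Loops

/-! ### Parameters of the algorithm -/

/-- The numbers that control the algorithm. -/
structure Par where
  n : ℕ
  k : ℕ
  u : ℕ
  L : ℕ
  T : ℕ
  one_le_k : 1 ≤ k
  k_le_n : k ≤ n
  n_lt : n < 2 ^ u
  pow_le : 2 ^ u ≤ 2 * n
  u_pos : 1 ≤ u
  five_u : 5 * u + 1 ≤ L
  big : 128 * k * L * L + 64 * L < 2 ^ L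
  T_pow : ∃ τ < L, T = 2 ^ τ
  T_le : T * T * k ≤ 2 ^ u
  lt_T : 2 ^ u < 4 * T * T * k

/-- Number of memory cells. -/
def Par.S (p : Par) : ℕ := 128 * p.k * p.L * p.L

/-- The registers hold the constants, the level `m` and the number `μ` of low bits. -/
structure QReg (p : Par) (m μ : ℕ) (r : ℕ → ℕ) : Prop where
  r1 : r 1 = p.k
  r2 : r 2 = p.L
  r3 : r 3 = p.u
  r4 : r 4 = p.T
  r5 : r 5 = p.S
  r6 : r 6 = 2 ^ p.u
  r7 : r 7 = m
  r8 : r 8 = 2 ^ m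
  r9 : r 9 = μ
  r10 : r 10 = 2 ^ μ
  hm : m + 5 * p.u ≤ p.L
  hμ : μ ≤ m

lemma QReg.update {p : Par} {m μ : ℕ} {r : ℕ → ℕ} (h : QReg p m μ r) {x : ℕ} (hx : 11 ≤ x)
    (v : ℕ) : QReg p m μ (Function.update r x v) := by
  have e : ∀ y ≤ 10, Function.update r x v y = r y := fun y hy =>
    Function.update_of_ne (by omega) _ _
  constructor <;> (try rw [e _ (by norm_num)])
  exacts [h.r1, h.r2, h.r3, h.r4, h.r5, h.r6, h.r7, h.r8, h.r9, h.r10, h.hm, h.hμ]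

/-! ### Evaluation of qubit positions -/

section Positions

variable {p : Par} {m μ : ℕ} {r : ℕ → ℕ}

lemma Par.L_big (p : Par) : 64 * p.L < 2 ^ p.L := by have := p.big; omega

/-- All qubit positions lie below `64 L`, so their arithmetic never wraps around. -/
lemma Par.mod_eq (p : Par) {v : ℕ} (h : v < 64 * p.L) : v % 2 ^ p.L = v :=
  Nat.mod_eq_of_lt (h.trans p.L_big)

lemma QReg.lowLen (h : QReg p m μ r) : lowLen.eval p.L r = μ := by
  have := h.hm; have := h.hμ; have := p.u_pos
  simp only [eval_mod, eval_reg, h.r9, h.r2]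
  exact Nat.mod_eq_of_lt (by omega)

lemma QReg.lev (h : QReg p m μ r) : lev.eval p.L r = m := by
  have := h.hm; have := p.u_pos
  simp only [eval_mod, eval_reg, h.r7, h.r2]
  exact Nat.mod_eq_of_lt (by omega)

lemma Par.eval_add (p : Par) {a b : Expr} {x y : ℕ} (ha : a.eval p.L r = x) (hb : b.eval p.L r = y)
    (h : x + y < 64 * p.L) : (a + b).eval p.L r = x + y := by
  rw [QMachine.eval_add, ha, hb, p.mod_eq h]

lemma Par.eval_mul (p : Par) {a b : Expr} {x y : ℕ} (ha : a.eval p.L r = x) (hb : b.eval p.L r = y)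
    (h : x * y < 64 * p.L) : (a * b).eval p.L r = x * y := by
  rw [QMachine.eval_mul, ha, hb, p.mod_eq h]

lemma Par.eval_sub (p : Par) {a b : Expr} {x y : ℕ} (ha : a.eval p.L r = x)
    (hb : b.eval p.L r = y) : (a - b).eval p.L r = x - y := by
  rw [QMachine.eval_sub, ha, hb]

lemma Par.eval_lit (p : Par) {v : ℕ} (h : v ≤ 10) : (Expr.lit v).eval p.L r = v :=
  p.mod_eq (by have := p.five_u; omega)

lemma QReg.wl (h : QReg p m μ r) : wl.eval p.L r = p.L := h.r2

lemma QReg.bounds (h : QReg p m μ r) : m + 5 * p.u ≤ p.L ∧ μ ≤ m ∧ 1 ≤ p.u := ⟨h.hm, h.hμ, p.u_pos⟩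

lemma QReg.mul_wl (h : QReg p m μ r) {v : ℕ} (hv : v ≤ 10) :
    (Expr.lit v * QMachine.wl).eval p.L r = v * p.L :=
  p.eval_mul (p.eval_lit hv) h.wl (by have := p.five_u; nlinarith)

lemma QReg.slotLen (h : QReg p m μ r) : slotLen.eval p.L r = μ + p.u + 4 := by
  have := h.bounds
  exact p.eval_add (p.eval_add h.lowLen h.r3 (by omega)) (p.eval_lit (by norm_num)) (by omega)

lemma QReg.outPos (h : QReg p m μ r) : outPos.eval p.L r = 4 * p.L + μ + (p.L - m) := by
  have := h.bounds
  exact p.eval_add (p.eval_add (h.mul_wl (by norm_num)) h.lowLen (by omega))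
    (p.eval_sub h.wl h.lev) (by omega)

lemma QReg.andPos (h : QReg p m μ r) : andPos.eval p.L r = 7 * p.L + (μ + p.u + 4) := by
  have := h.bounds
  exact p.eval_add (h.mul_wl (by norm_num)) h.slotLen (by omega)

lemma QReg.rowPos (h : QReg p m μ r) : (QMachine.lowLen + 3).eval p.L r = μ + 3 := by
  have := h.bounds
  exact p.eval_add h.lowLen (p.eval_lit (by norm_num)) (by omega)

lemma QReg.flagPos (h : QReg p m μ r) :
    (QMachine.lowLen + 3 + .reg 3).eval p.L r = μ + 3 + p.u := by
  have := h.bounds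
  exact p.eval_add h.rowPos h.r3 (by omega)

lemma QReg.cmpLen (h : QReg p m μ r) : (QMachine.wl - QMachine.lev).eval p.L r = p.L - m :=
  p.eval_sub h.wl h.lev

lemma QReg.cmpPos (h : QReg p m μ r) :
    (2 * QMachine.wl + QMachine.lev).eval p.L r = 2 * p.L + m := by
  have := h.bounds
  exact p.eval_add (h.mul_wl (by norm_num)) h.lev (by omega)

lemma QReg.cmpCarry (h : QReg p m μ r) :
    (4 * QMachine.wl + QMachine.lowLen).eval p.L r = 4 * p.L + μ := by
  have := h.bounds
  exact p.eval_add (h.mul_wl (by norm_num)) h.lowLen (by omega)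

end Positions

/-! ### Circuits for the lookup, the comparison and the test for the start label -/

section Circuits

variable {Q n : ℕ} {w : Fin n → ℕ} {p : Par} {m μ : ℕ} {reg : ℕ → ℕ} {ram : ℕ → ℕ}

lemma det_carry {a b c : Expr} {A B C j : ℕ} (x : Basis Q) (h : reg 11 = j)
    (ha : a.eval p.L reg = A) (hb : b.eval p.L reg = B) (hc : c.eval p.L reg = C)
    (h1 : A + j + 1 < 64 * p.L) (h2 : B + j + 1 < 64 * p.L) (h3 : C + j + 1 < 64 * p.L) :
    (carry a b c).det w p.L ⟨reg, ram, x⟩ = ⟨reg, ram, carryB A B C j x⟩ := by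
  have hi : ix.eval p.L reg = j := h
  have ea := p.eval_add ha hi (by omega)
  have eb := p.eval_add hb hi (by omega)
  have ec := p.eval_add hc hi (by omega)
  have ec1 := p.eval_add ec (p.eval_lit (v := 1) (by norm_num)) h3
  unfold carry carryB
  simp only [Cmd.det]
  rw [ea, eb, ec, show (c + ix + 1).eval p.L reg = C + j + 1 from ec1]

/-- The label map of `fetch`. -/
def fetchB (w : Fin n → ℕ) (p : Par) (μ : ℕ) (ram : ℕ → ℕ) (x : Basis Q) : Basis Q :=
  flipB (μ + 3 + p.u) (lookupB p.L ram μ (2 * p.L)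
    (flipB (μ + 3 + p.u) (lookupB p.L (extend w) (μ + 3) (2 * p.L) x)))

/-- The label map of `unfetch`. -/
def unfetchB (w : Fin n → ℕ) (p : Par) (μ : ℕ) (ram : ℕ → ℕ) (x : Basis Q) : Basis Q :=
  lookupB p.L (extend w) (μ + 3) (2 * p.L) (flipB (μ + 3 + p.u) (lookupB p.L ram μ (2 * p.L)
    (flipB (μ + 3 + p.u) x)))

lemma det_fetch (h : QReg p m μ reg) (x : Basis Q) :
    fetch.det w p.L ⟨reg, ram, x⟩ = ⟨reg, ram, fetchB w p μ ram x⟩ := by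
  have e2 : (2 * wl).eval p.L reg = 2 * p.L := h.mul_wl (by norm_num)
  unfold fetch fetchB
  simp only [Cmd.det, h.rowPos, h.flagPos, h.lowLen, e2]

lemma det_unfetch (h : QReg p m μ reg) (x : Basis Q) :
    unfetch.det w p.L ⟨reg, ram, x⟩ = ⟨reg, ram, unfetchB w p μ ram x⟩ := by
  have e2 : (2 * wl).eval p.L reg = 2 * p.L := h.mul_wl (by norm_num)
  unfold unfetch unfetchB
  simp only [Cmd.det, h.rowPos, h.flagPos, h.lowLen, e2]

/-- The label map of `compute`. -/
def computeB (w : Fin n → ℕ) (p : Par) (m μ : ℕ) (ram : ℕ → ℕ) (x : Basis Q) : Basis Q :=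
  runUp (carryB (2 * p.L + m) (3 * p.L) (4 * p.L + μ)) (p.L - m)
    (runUp (carryB (2 * p.L) 0 (4 * p.L)) μ (fetchB w p μ ram x))

/-- The label map of `uncompute`. -/
def uncomputeB (w : Fin n → ℕ) (p : Par) (m μ : ℕ) (ram : ℕ → ℕ) (x : Basis Q) : Basis Q :=
  unfetchB w p μ ram (runDown (carryB (2 * p.L) 0 (4 * p.L)) μ
    (runDown (carryB (2 * p.L + m) (3 * p.L) (4 * p.L + μ)) (p.L - m) x))

lemma uncomputeB_computeB (x : Basis Q) :
    uncomputeB w p m μ ram (computeB w p m μ ram x) = x := by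
  unfold uncomputeB computeB
  rw [runDown_runUp (fun j x => carryB_carryB _ _ _ j x),
    runDown_runUp (fun j x => carryB_carryB _ _ _ j x)]
  unfold unfetchB fetchB
  rw [flipB_flipB, lookupB_lookupB, flipB_flipB, lookupB_lookupB]

lemma det_carry1 (h : QReg p m μ reg) (j : ℕ) (hj : j < p.L) (x : Basis Q) :
    (carry (2 * wl) 0 (4 * wl)).det w p.L ⟨Function.update reg 11 j, ram, x⟩ =
      ⟨Function.update reg 11 j, ram, carryB (2 * p.L) 0 (4 * p.L) j x⟩ := by
  have h' := h.update (le_refl 11) j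
  exact det_carry x (Function.update_self _ _ _) (h'.mul_wl (by norm_num))
    (p.eval_lit (by norm_num)) (h'.mul_wl (by norm_num)) (by omega) (by omega) (by omega)

lemma det_carry2 (h : QReg p m μ reg) (j : ℕ) (hj : j < p.L) (x : Basis Q) :
    (carry (2 * wl + lev) (3 * wl) (4 * wl + lowLen)).det w p.L
        ⟨Function.update reg 11 j, ram, x⟩ =
      ⟨Function.update reg 11 j, ram,
        carryB (2 * p.L + m) (3 * p.L) (4 * p.L + μ) j x⟩ := by
  have h' := h.update (le_refl 11) j
  have := h.bounds
  exact det_carry x (Function.update_self _ _ _) h'.cmpPos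
    (h'.mul_wl (by norm_num)) h'.cmpCarry (by omega) (by omega) (by omega)

lemma det_carry3 (h : QReg p m μ reg) (j : ℕ) (hj : j < p.L) (x : Basis Q) :
    (carry 0 (6 * wl) (7 * wl)).det w p.L ⟨Function.update reg 11 j, ram, x⟩ =
      ⟨Function.update reg 11 j, ram, carryB 0 (6 * p.L) (7 * p.L) j x⟩ := by
  have h' := h.update (le_refl 11) j
  exact det_carry x (Function.update_self _ _ _) (p.eval_lit (by norm_num))
    (h'.mul_wl (by norm_num)) (h'.mul_wl (by norm_num)) (by omega) (by omega) (by omega)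

lemma Par.L_lt (p : Par) : p.L < 2 ^ p.L := Nat.lt_two_pow_self

lemma det_compute (h : QReg p m μ reg) (x : Basis Q) :
    compute.det w p.L ⟨reg, ram, x⟩ =
      ⟨Function.update reg 11 (p.L - m), ram, computeB w p m μ ram x⟩ := by
  have hb := h.bounds
  have hL := p.L_lt
  unfold compute computeB
  rw [Cmd.det, Cmd.det, det_fetch h,
    det_up_label _ _ (h.update (le_refl 11) 0).lowLen (by omega)
      (fun j hj x => det_carry1 h j (by omega) x),
    det_up_label _ _ ((h.update (le_refl 11) _).update (le_refl 11) 0).cmpLen (by omega)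
      (fun j hj x => det_carry2 (h.update (le_refl 11) _) j (by omega) x),
    Function.update_idem]

lemma det_uncompute (h : QReg p m μ reg) (x : Basis Q) :
    uncompute.det w p.L ⟨reg, ram, x⟩ =
      ⟨Function.update reg 11 0, ram, uncomputeB w p m μ ram x⟩ := by
  have hb := h.bounds
  have hL := p.L_lt
  unfold uncompute uncomputeB
  rw [Cmd.det, Cmd.det,
    det_down_label _ _ h.cmpLen (h.update (le_refl 11) _).cmpLen (by omega)
      (fun j hj x => det_carry2 h j (by omega) x),
    det_down_label _ _ (h.update (le_refl 11) _).lowLen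
      ((h.update (le_refl 11) _).update (le_refl 11) _).lowLen (by omega)
      (fun j hj x => det_carry1 (h.update (le_refl 11) _) j (by omega) x),
    Function.update_idem, det_unfetch (h.update (le_refl 11) _)]

lemma det_andUp (h : QReg p m μ reg) (x : Basis Q) :
    (up slotLen (carry 0 (6 * wl) (7 * wl))).det w p.L ⟨reg, ram, x⟩ =
      ⟨Function.update reg 11 (μ + p.u + 4), ram,
        runUp (carryB 0 (6 * p.L) (7 * p.L)) (μ + p.u + 4) x⟩ := by
  have hb := h.bounds
  have hL := p.L_lt
  exact det_up_label _ _ (h.update (le_refl 11) _).slotLen (by omega)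
    fun j hj x => det_carry3 h j (by omega) x

lemma det_andDown (h : QReg p m μ reg) (x : Basis Q) :
    (down slotLen (carry 0 (6 * wl) (7 * wl))).det w p.L ⟨reg, ram, x⟩ =
      ⟨Function.update reg 11 0, ram,
        runDown (carryB 0 (6 * p.L) (7 * p.L)) (μ + p.u + 4) x⟩ := by
  have hb := h.bounds
  have hL := p.L_lt
  exact det_down_label _ _ h.slotLen (h.update (le_refl 11) _).slotLen (by omega)
    fun j hj x => det_carry3 h j (by omega) x

/-- The label at which amplitude amplification starts. -/
def baseB (p : Par) (μ : ℕ) : Basis Q := fun i =>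
  decide ((i : ℕ) < μ + p.u + 4 ∨ 3 * p.L ≤ i ∧ (i : ℕ) < 4 * p.L ∨ (i : ℕ) = 7 * p.L)

lemma bitAt_baseB (p : Par) (μ i : ℕ) (hi : i < Q) : bitAt (baseB p μ : Basis Q) i =
    decide (i < μ + p.u + 4 ∨ 3 * p.L ≤ i ∧ i < 4 * p.L ∨ i = 7 * p.L) := by
  simp [bitAt, baseB, hi]

lemma bitAt_runUp_flipB (a N i : ℕ) (x : Basis Q) (hi : i < Q) :
    bitAt (runUp (fun j => flipB (a + j)) N x) i =
      if a ≤ i ∧ i < a + N then !bitAt x i else bitAt x i := by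
  induction N with
  | zero => rw [if_neg (by omega)]; rfl
  | succ N ih =>
    rw [runUp, bitAt_flipB, ih]
    by_cases h : i = a + N
    · rw [if_pos (by omega), if_neg (by omega), if_pos (by omega)]
    · rw [if_neg (by omega)]
      by_cases h2 : a ≤ i ∧ i < a + N
      · rw [if_pos h2, if_pos (by omega)]
      · rw [if_neg h2, if_neg (by omega)]

lemma det_prep (h : QReg p m μ reg) (hQ : Q = 9 * p.L) :
    prep.det w p.L (⟨reg, ram, zeroB⟩ : DState Q) =
      ⟨Function.update reg 11 p.L, ram, baseB p μ⟩ := by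
  have hb := h.bounds
  have hL := p.L_lt
  unfold prep
  rw [Cmd.det, det_up_label (N := μ + p.u + 4) _ (fun j => flipB (0 + j))
      (h.update (le_refl 11) 0).slotLen (by omega)
      (fun j hj x => by simp [Cmd.det]), Cmd.det,
    det_up_label (N := p.L) _ (fun j => flipB (3 * p.L + j))
      ((h.update (le_refl 11) _).update (le_refl 11) 0).wl (by omega)
      (fun j hj x => by
        have h' := (h.update (le_refl 11) (μ + p.u + 4)).update (le_refl 11) j
        have : (3 * wl + ix).eval p.L (Function.update (Function.update reg 11 (μ + p.u + 4)) 11 j)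
            = 3 * p.L + j := p.eval_add (h'.mul_wl (by norm_num)) (Function.update_self _ _ _)
              (by omega)
        simp only [Cmd.det, this])]
  have e7 : (7 * wl).eval p.L (Function.update reg 11 p.L) = 7 * p.L :=
    (h.update (le_refl 11) _).mul_wl (by norm_num)
  rw [Function.update_idem, Cmd.det]
  simp only [e7, DState.mk.injEq, true_and]
  refine basis_ext fun i hi => ?_
  rw [bitAt_flipB, bitAt_runUp_flipB _ _ _ _ hi, bitAt_runUp_flipB _ _ _ _ hi, bitAt_baseB _ _ _ hi]
  have hz : bitAt (zeroB : Basis Q) i = false := by simp [bitAt, zeroB]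
  rw [hz]
  by_cases h1 : i < μ + p.u + 4
  · simp [h1, show ¬ i = 7 * p.L by omega, show ¬ 3 * p.L ≤ i by omega]
  · by_cases h2 : 3 * p.L ≤ i ∧ i < 4 * p.L
    · simp [h1, show ¬ i = 7 * p.L by omega, h2, show i < 3 * p.L + p.L by omega]
    · by_cases h3 : i = 7 * p.L
      · have : 7 * p.L < Q := by omega
        simp [h3, this, show ¬ 7 * p.L < μ + p.u + 4 by omega,
          show ¬ 7 * p.L < 3 * p.L + p.L by omega]
      · simp [h1, h3, h2, show ¬ (3 * p.L ≤ i ∧ i < 3 * p.L + p.L) by omega]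

/-- The positions in superposition. -/
def freeList (p : Par) (μ : ℕ) : List ℕ :=
  List.range μ ++ (List.range (p.u + 1)).map fun i => μ + 3 + i

lemma mem_freeList {i : ℕ} :
    i ∈ freeList p μ ↔ i < μ ∨ μ + 3 ≤ i ∧ i < μ + p.u + 4 := by
  simp only [freeList, List.mem_append, List.mem_range, List.mem_map]
  refine or_congr Iff.rfl ⟨?_, fun h => ⟨i - (μ + 3), by omega, by omega⟩⟩
  rintro ⟨a, h, rfl⟩
  omega

lemma freeList_nodup : (freeList p μ).Nodup := by
  refine List.Nodup.append List.nodup_range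
    (List.nodup_range.map fun a b h => by simpa using h) ?_
  intro a h1 h2
  simp only [List.mem_range, List.mem_map] at h1 h2
  obtain ⟨b, _, rfl⟩ := h2
  omega

lemma length_freeList : (freeList p μ).length = μ + p.u + 1 := by
  simp [freeList]; ring

/-- The slots: labels in the support of the start state. -/
noncomputable def slots (Q : ℕ) (p : Par) (μ : ℕ) : Finset (Basis Q) :=
  coset (freeList p μ) (baseB p μ)

/-- Off the superposed positions every slot agrees with the start label. This supplies the three
ones, the block of ones, the incoming carry of the test and the zeros of the work space. -/
lemma slots_bit {x : Basis Q} (hx : x ∈ slots Q p μ) {i : ℕ} (hi : i < Q)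
    (h : ¬ (i < μ ∨ μ + 3 ≤ i ∧ i < μ + p.u + 4)) : bitAt x i =
      decide (i < μ + p.u + 4 ∨ 3 * p.L ≤ i ∧ i < 4 * p.L ∨ i = 7 * p.L) := by
  rw [← bitAt_baseB p μ i hi]
  exact mem_coset.1 hx i (by rw [mem_freeList]; exact h)

/-- The row of a slot. -/
def rowOf (p : Par) (μ : ℕ) (x : Basis Q) : ℕ := blockVal (p.u + 1) (μ + 3) x

/-- The low bits of a slot. -/
def lowOf (μ : ℕ) (x : Basis Q) : ℕ := blockVal μ 0 x

/-- The value of a row. -/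
def rowVal (w : Fin n → ℕ) (p : Par) (ram : ℕ → ℕ) (r : ℕ) : ℕ :=
  if r < 2 ^ p.u then extend w r else ram (8 * (r - 2 ^ p.u) + 7)

/-- The tables fit the word length. -/
structure Tables (w : Fin n → ℕ) (p : Par) (ram : ℕ → ℕ) : Prop where
  n_eq : n = p.n
  w_lt : ∀ j, extend w j < 2 ^ p.L
  tab_lt : ∀ e, ram (8 * e + 7) < 2 ^ p.L
  tab_zero : ∀ e, p.k ≤ e → ram (8 * e + 7) = 0

/-- The condition that amplitude amplification searches for. -/
def good (w : Fin n → ℕ) (p : Par) (m μ : ℕ) (ram : ℕ → ℕ) (x : Basis Q) : Prop :=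
  2 ^ m ≤ rowVal w p ram (rowOf p μ x) ∨
    2 ^ μ ≤ rowVal w p ram (rowOf p μ x) % 2 ^ μ + lowOf μ x

lemma rowOf_lt (x : Basis Q) : rowOf p μ x < 2 ^ (p.u + 1) := blockVal_lt _ _ _

lemma extend_of_ge (w : Fin n → ℕ) {j : ℕ} (h : n ≤ j) : extend w j = 0 := by
  simp [extend, Nat.not_lt.2 h]

lemma rowVal_lt (ht : Tables w p ram) (r : ℕ) : rowVal w p ram r < 2 ^ p.L := by
  unfold rowVal
  split_ifs
  · exact ht.w_lt _
  · exact ht.tab_lt _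

lemma bitAt_lookupB {L a t : ℕ} {f : ℕ → ℕ} {x : Basis Q} (h : a + L ≤ t) (ht : t + L ≤ Q) {i : ℕ}
    (hi : i < Q) : bitAt (lookupB L f a t x) i = if t ≤ i ∧ i < t + L then
      xor (bitAt x i) ((f (blockVal L a x)).testBit (i - t)) else bitAt x i := by
  unfold lookupB
  rw [if_pos ⟨by omega, ht, Or.inl h⟩, bitAt_xorBlock _ _ _ _ _ hi]

/-- Of the two words added to the value block, at most one is nonzero. The oracle gives zero at
indices from `2 ^ u > n` on. After the flip of the flag, the memory is read at `8 r' + 7`, where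
`r'` is the row with its top bit changed and the three ones below the row supply the `7`. For a
table row `2 ^ u + e` this is the visible cell of entry `e`; for an oracle row, `r' ≥ 2 ^ u > k`
lies behind all entries, where the cells are zero. -/
lemma bitAt_fetchB (hQ : Q = 9 * p.L) (hm : m + 5 * p.u ≤ p.L) (hμ : μ ≤ m)
    (ht : Tables w p ram) {x : Basis Q} (hx : x ∈ slots Q p μ) {i : ℕ} (hi : i < Q) :
    bitAt (fetchB w p μ ram x) i = if 2 * p.L ≤ i ∧ i < 2 * p.L + p.L then
      (rowVal w p ram (rowOf p μ x)).testBit (i - 2 * p.L) else bitAt x i := by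
  have hu := p.u_pos
  have hkn := p.k_le_n
  have hn := p.n_lt
  set x1 := lookupB p.L (extend w) (μ + 3) (2 * p.L) x with h1
  set x2 := flipB (μ + 3 + p.u) x1 with h2
  have b1 : ∀ j < 2 * p.L, bitAt x1 j = bitAt x j := fun j hj => by
    rw [h1, bitAt_lookupB (by omega) (by omega) (by omega), if_neg (by omega)]
  -- The index word reaches beyond the row, but the label is zero there.
  have hq : blockVal p.L (μ + 3) x = rowOf p μ x := by
    rw [show p.L = (p.u + 1) + (p.L - (p.u + 1)) by omega, blockVal_add, rowOf,
      blockVal_zero (N := p.L - (p.u + 1)) fun j hj => by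
        rw [slots_bit hx (by omega) (by omega), decide_eq_false_iff_not]; omega]
    simp
  have hrow : rowOf p μ x = blockVal p.u (μ + 3) x + (bitAt x (μ + 3 + p.u)).toNat * 2 ^ p.u :=
    blockVal_succ _ _ _
  have hrl := blockVal_lt p.u (μ + 3) x
  have ha : blockVal p.L μ x2 = 8 * (blockVal p.u (μ + 3) x +
      (!bitAt x (μ + 3 + p.u)).toNat * 2 ^ p.u) + 7 := by
    have e : blockVal p.L μ x2 = blockVal (3 + ((p.u + 1) + (p.L - (p.u + 4)))) μ x2 := by
      congr 1; omega
    rw [e, blockVal_add, blockVal_add, blockVal_one (N := 3) (fun j hj => by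
        rw [h2, bitAt_flipB, if_neg (by omega), b1 _ (by omega), slots_bit hx (by omega) (by omega),
          decide_eq_true_eq]; omega),
      blockVal_zero (N := p.L - (p.u + 4)) (fun j hj => by
        rw [h2, bitAt_flipB, if_neg (by omega), b1 _ (by omega), slots_bit hx (by omega) (by omega),
          decide_eq_false_iff_not]; omega), blockVal_succ,
      blockVal_congr (y := x) (fun j hj => by
        rw [h2, bitAt_flipB, if_neg (by omega), b1 _ (by omega)]),
      h2, bitAt_flipB, if_pos ⟨rfl, by omega⟩, b1 _ (by omega)]
    ring
  have hfe : fetchB w p μ ram x = flipB (μ + 3 + p.u) (lookupB p.L ram μ (2 * p.L) x2) := rfl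
  rw [hfe, bitAt_flipB]
  by_cases hV : 2 * p.L ≤ i ∧ i < 2 * p.L + p.L
  · rw [if_neg (by omega), bitAt_lookupB (by omega) (by omega) hi, if_pos hV, if_pos hV, h2,
      bitAt_flipB, if_neg (by omega), ← h2, h1, bitAt_lookupB (by omega) (by omega) hi, if_pos hV,
      hq, ha, slots_bit hx hi (by omega),
      show decide (i < μ + p.u + 4 ∨ 3 * p.L ≤ i ∧ i < 4 * p.L ∨ i = 7 * p.L) = false by
        rw [decide_eq_false_iff_not]; omega, Bool.false_xor, rowVal, hrow]
    cases bitAt x (μ + 3 + p.u)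
    · simp only [Bool.toNat_false, Bool.not_false, Bool.toNat_true, zero_mul, one_mul, add_zero]
      rw [if_pos hrl, ht.tab_zero _ (by omega), Nat.zero_testBit, Bool.xor_false]
    · simp only [Bool.toNat_false, Bool.not_true, Bool.toNat_true, zero_mul, one_mul, add_zero]
      rw [if_neg (by omega), extend_of_ge w (by have := ht.n_eq; omega), Nat.zero_testBit,
        Bool.false_xor, Nat.add_sub_cancel]
  · rw [if_neg hV, bitAt_lookupB (by omega) (by omega) hi, if_neg hV]
    by_cases hf : i = μ + 3 + p.u
    · rw [if_pos ⟨hf, by omega⟩, h2, bitAt_flipB, if_pos ⟨hf, by omega⟩, b1 _ (by omega),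
        Bool.not_not]
    · rw [if_neg (by omega), h2, bitAt_flipB, if_neg (by omega), h1,
        bitAt_lookupB (by omega) (by omega) hi, if_neg hV]

lemma bitAt_computeB_of_lt (hQ : Q = 9 * p.L) (hm : m + 5 * p.u ≤ p.L) (hμ : μ ≤ m)
    (ht : Tables w p ram) {x : Basis Q} (hx : x ∈ slots Q p μ) {i : ℕ} (hi : i < 4 * p.L) :
    bitAt (computeB w p m μ ram x) i = if 2 * p.L ≤ i ∧ i < 2 * p.L + p.L then
      (rowVal w p ram (rowOf p μ x)).testBit (i - 2 * p.L) else bitAt x i := by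
  unfold computeB
  rw [bitAt_runUp_carryB_of_notMem _ _ _ _ _ _ (by omega),
    bitAt_runUp_carryB_of_notMem _ _ _ _ _ _ (by omega), bitAt_fetchB hQ hm hμ ht hx (by omega)]

/-- The outcome of the comparison. -/
lemma bitAt_computeB_out (hQ : Q = 9 * p.L) (hm : m + 5 * p.u ≤ p.L) (hμ : μ ≤ m)
    (ht : Tables w p ram) {x : Basis Q} (hx : x ∈ slots Q p μ) :
    bitAt (computeB w p m μ ram x) (4 * p.L + μ + (p.L - m)) = true ↔ good w p m μ ram x := by
  have hu := p.u_pos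
  set v := rowVal w p ram (rowOf p μ x) with hv
  have hvl : v < 2 ^ p.L := rowVal_lt ht _
  set y := fetchB w p μ ram x with hy
  have yb : ∀ i < Q, bitAt y i = _ := fun i hi => bitAt_fetchB hQ hm hμ ht hx hi
  have yz : ∀ i < Q, 4 * p.L ≤ i → i < 7 * p.L → bitAt y i = false := fun i hi h1 h2 => by
    rw [yb i hi, if_neg (by omega), slots_bit hx hi (by omega), decide_eq_false_iff_not]; omega
  have hlow : ∀ a, a ≤ p.L → blockVal a (2 * p.L) y = v % 2 ^ a := fun a ha =>
    blockVal_eq_of_testBit (Nat.mod_lt _ (by positivity)) fun i hi => by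
      rw [yb _ (by omega), if_pos (by omega), Nat.testBit_mod_two_pow]
      simp [hi, hv]
  have hhigh : blockVal (p.L - m) (2 * p.L + m) y = v / 2 ^ m := by
    have e := blockVal_add m (p.L - m) (2 * p.L) y
    rw [show m + (p.L - m) = p.L by omega, hlow _ le_rfl, hlow m (by omega),
      Nat.mod_eq_of_lt hvl] at e
    have e2 := Nat.mod_add_div v (2 ^ m)
    exact Nat.eq_of_mul_eq_mul_left (show 0 < 2 ^ m by positivity) (by omega)
  have hl : blockVal μ 0 y = lowOf μ x := blockVal_congr fun i hi => by
    rw [yb _ (by omega), if_neg (by omega)]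
  set y1 := runUp (carryB (2 * p.L) 0 (4 * p.L)) μ y with hy1
  have c1 : bitAt y1 (4 * p.L + μ) = decide (2 ^ μ ≤ v % 2 ^ μ + lowOf μ x) := by
    rw [hy1, bitAt_runUp_carryB _ _ _ _ _ (by omega) (by omega) (by omega) (by omega) (by omega)
      (by omega) (fun j hj => yz _ (by omega) (by omega) (by omega)), hlow _ (by omega), hl,
      yz _ (by omega) (by omega) (by omega)]
    simp
  -- Adding `2 ^ (L - m) - 1` and the first carry to `v / 2 ^ m` overflows iff `v / 2 ^ m ≥ 1` or
  -- the first carry is set. The block of ones thus computes the disjunction in `good`.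
  have c2 : bitAt (computeB w p m μ ram x) (4 * p.L + μ + (p.L - m)) = decide (2 ^ (p.L - m) ≤
      v / 2 ^ m + (2 ^ (p.L - m) - 1) + (decide (2 ^ μ ≤ v % 2 ^ μ + lowOf μ x)).toNat) := by
    unfold computeB
    rw [← hy, ← hy1, bitAt_runUp_carryB _ _ _ _ _ (by omega) (by omega) (by omega) (by omega)
      (by omega) (by omega) (fun j hj => by
        rw [hy1, bitAt_runUp_carryB_of_notMem _ _ _ _ _ _ (by omega)]
        exact yz _ (by omega) (by omega) (by omega)), c1, hy1,
      blockVal_runUp_carryB _ _ _ _ _ _ _ (by omega), hhigh,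
      blockVal_runUp_carryB _ _ _ _ _ _ _ (by omega), blockVal_one (N := p.L - m) fun j hj => by
        rw [yb _ (by omega), if_neg (by omega), slots_bit hx (by omega) (by omega),
          decide_eq_true_eq]; omega]
  rw [c2, decide_eq_true_eq, good, ← hv]
  have hp := Nat.two_pow_pos (p.L - m)
  have hd : 2 ^ m ≤ v ↔ 1 ≤ v / 2 ^ m := by rw [Nat.le_div_iff_mul_le (by positivity), one_mul]
  rw [hd]
  by_cases h : 2 ^ μ ≤ v % 2 ^ μ + lowOf μ x
  · simp only [h, decide_true, Bool.toNat_true, or_true, iff_true]; omega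
  · simp only [h, decide_false, Bool.toNat_false, or_false]; omega

/-- The test for the start label. -/
lemma bitAt_and (hQ : Q = 9 * p.L) (hm : m + 5 * p.u ≤ p.L) (hμ : μ ≤ m)
    {x : Basis Q} (hx : x ∈ slots Q p μ) :
    bitAt (runUp (carryB 0 (6 * p.L) (7 * p.L)) (μ + p.u + 4) x) (7 * p.L + (μ + p.u + 4)) = true ↔
      x = baseB p μ := by
  have hu := p.u_pos
  rw [bitAt_runUp_carryB _ _ _ _ _ (by omega) (by omega) (by omega) (by omega) (by omega)
    (by omega) (fun j hj => by
      rw [slots_bit hx (by omega) (by omega), decide_eq_false_iff_not]; omega),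
    blockVal_zero (a := 6 * p.L) (fun j hj => by
      rw [slots_bit hx (by omega) (by omega), decide_eq_false_iff_not]; omega),
    slots_bit hx (i := 7 * p.L) (by omega) (by omega), decide_eq_true_eq]
  -- Adding one to the slot overflows only if all its bits are one. This is why amplification starts
  -- from a slot of ones: the ladder then serves as the test.
  have h1 := blockVal_lt (μ + p.u + 4) 0 x
  rw [show decide (7 * p.L < μ + p.u + 4 ∨ 3 * p.L ≤ 7 * p.L ∧ 7 * p.L < 4 * p.L ∨
    7 * p.L = 7 * p.L) = true by simp, Bool.toNat_true]
  constructor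
  · intro h
    have h2 : blockVal (μ + p.u + 4) 0 x = 2 ^ (μ + p.u + 4) - 1 := by omega
    refine basis_ext fun i hi => ?_
    rw [bitAt_baseB _ _ _ hi]
    by_cases hi2 : i < μ + p.u + 4
    · have := testBit_blockVal (μ + p.u + 4) 0 x i hi2
      rw [h2, Nat.testBit_two_pow_sub_one, zero_add] at this
      rw [← this]; simp [hi2]
    · exact slots_bit hx hi (by omega)
  · rintro rfl
    rw [blockVal_one fun i hi => by
      rw [zero_add, bitAt_baseB _ _ _ (by omega), decide_eq_true_eq]; omega]
    omega

end Circuits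

/-! ### State vectors under loops and phase gates -/

section LeadsLoops

variable {Q n : ℕ} {w : Fin n → ℕ} {L : ℕ} {reg ram : ℕ → ℕ}

lemma Leads.assign (x : ℕ) (e : Expr) (ψ : Vec Q) : Leads w L (.assign x e) ⟨reg, ram, ψ⟩
    ⟨Function.update reg x (e.eval L reg), ram, ψ⟩ := fun _ => rfl

lemma leads_up {len : Expr} {p : Cmd} {N : ℕ} (ψ : Vec Q) (σ : ℕ → Vec Q → Vec Q)
    (hlen : len.eval L (Function.update reg 11 0) = N) (hN : N < 2 ^ L)
    (h : ∀ j < N, ∀ ψ, Leads w L p ⟨Function.update reg 11 j, ram, ψ⟩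
      ⟨Function.update reg 11 j, ram, σ j ψ⟩) :
    Leads w L (up len p) ⟨reg, ram, ψ⟩ ⟨Function.update reg 11 N, ram, runUp σ N ψ⟩ := by
  have e : (0 : Expr).eval L reg = 0 := by simp
  have h1 := Leads.assign (w := w) (L := L) (reg := reg) (ram := ram) 11 0 ψ
  rw [e] at h1
  refine h1.seq ?_
  have h2 := Leads.loop (w := w) (L := L) (e := len) (p := p ⨾ .assign 11 (ix + 1))
    (fun j => (⟨Function.update reg 11 j, ram, runUp σ j ψ⟩ : Core Q)) (fun j hj => by
      rw [hlen] at hj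
      refine (h j hj _).seq ?_
      have h3 := Leads.assign (w := w) (L := L) (reg := Function.update reg 11 j) (ram := ram) 11
        (ix + 1) (σ j (runUp σ j ψ))
      have e3 : (ix + 1).eval L (Function.update reg 11 j) = j + 1 := by
        simp only [eval_add, eval_reg, eval_1, Function.update_self]
        rw [Nat.mod_eq_of_lt (a := 1) (by omega), Nat.mod_eq_of_lt (by omega)]
      rw [e3, Function.update_idem] at h3
      exact h3)
  simp only [hlen] at h2
  exact h2

lemma leads_down {len : Expr} {p : Cmd} {N : ℕ} (ψ : Vec Q) (σ : ℕ → Vec Q → Vec Q)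
    (hlen' : len.eval L reg = N) (hlen : len.eval L (Function.update reg 11 N) = N)
    (hN : N < 2 ^ L)
    (h : ∀ j < N, ∀ ψ, Leads w L p ⟨Function.update reg 11 j, ram, ψ⟩
      ⟨Function.update reg 11 j, ram, σ j ψ⟩) :
    Leads w L (down len p) ⟨reg, ram, ψ⟩ ⟨Function.update reg 11 0, ram, runDown σ N ψ⟩ := by
  have h1 := Leads.assign (w := w) (L := L) (reg := reg) (ram := ram) 11 len ψ
  rw [hlen'] at h1
  refine h1.seq ?_
  have h2 := Leads.loop (w := w) (L := L) (e := len) (p := .assign 11 (ix - 1) ⨾ p)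
    (fun j => (⟨Function.update reg 11 (N - j), ram,
      runUp (fun i => σ (N - (i + 1))) j ψ⟩ : Core Q)) (fun j hj => by
      simp only [Nat.sub_zero, hlen] at hj
      have h3 := Leads.assign (w := w) (L := L) (reg := Function.update reg 11 (N - j)) (ram := ram)
        11 (ix - 1) (runUp (fun i => σ (N - (i + 1))) j ψ)
      have e3 : (ix - 1).eval L (Function.update reg 11 (N - j)) = N - (j + 1) := by
        simp only [eval_sub, eval_reg, eval_1, Function.update_self]
        rw [Nat.mod_eq_of_lt (a := 1) (by omega)]; omega
      rw [e3, Function.update_idem] at h3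
      exact h3.seq (h _ (by omega) _))
  simp only [hlen, Nat.sub_zero, Nat.sub_self] at h2
  -- A loop composes its rounds from the first one on, whereas `runDown` peels off the largest
  -- index; both orders are `N - 1, …, 0`.
  have e : ∀ M, ∀ ψ : Vec Q, runUp (fun i => σ (M - (i + 1))) M ψ = runDown σ M ψ := by
    intro M
    induction M with
    | zero => intro ψ; rfl
    | succ M ih =>
      intro ψ
      rw [runDown, ← ih]
      have : ∀ J ≤ M, runUp (fun i => σ (M + 1 - (i + 1))) (J + 1) ψ =
          runUp (fun i => σ (M - (i + 1))) J (σ M ψ) := by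
        intro J
        induction J with
        | zero => intro _; rfl
        | succ J ihJ =>
          intro hJ
          rw [runUp, ihJ (by omega), runUp]
          rw [show M + 1 - (J + 1 + 1) = M - (J + 1) by omega]
      exact this M le_rfl
  rw [← e N ψ]
  exact h2

lemma runUp_H (a N : ℕ) (ψ : Vec Q) :
    runUp (fun j ψ => Gate.H.apply (a + j) ψ) N ψ = hadList ((List.range N).map fun i => a + i) ψ := by
  induction N with
  | zero => rfl
  | succ N ih => rw [runUp, ih, List.range_succ, List.map_append, hadList_append]; rfl

lemma runDown_H (a N : ℕ) (ψ : Vec Q) : runDown (fun j ψ => Gate.H.apply (a + j) ψ) N ψ =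
    hadList ((List.range N).map fun i => a + i).reverse ψ := by
  induction N generalizing ψ with
  | zero => rfl
  | succ N ih =>
    rw [runDown, ih, List.range_succ, List.map_append, List.reverse_append, hadList_append]; rfl

/-- The program transports `ket x` so that its entry at the image of a label is the entry at the
label. A collision of `x` and `y` would force the values `0` and `1` at the same place. -/
lemma det_injective {P : Cmd} (hP : P.classical false = true) {x y : Basis Q}
    (h : (P.det w L ⟨reg, ram, x⟩).lab = (P.det w L ⟨reg, ram, y⟩).lab) : x = y := by
  obtain ⟨r, m, F, ψ, -, hF⟩ := leads_perm (w := w) (L := L) P hP reg ram (ket y)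
  rw [(hF x).1, (hF y).1] at h
  have h1 := (hF x).2
  have h2 := (hF y).2
  change F x = F y at h
  rw [h, h2] at h1
  by_contra hne
  simp [ket, hne] at h1

lemma leads_ket {P : Cmd} (hP : P.classical false = true) {reg' ram' : ℕ → ℕ} {x y : Basis Q}
    (h : P.det w L ⟨reg, ram, x⟩ = ⟨reg', ram', y⟩) :
    Leads w L P ⟨reg, ram, ket x⟩ ⟨reg', ram', ket y⟩ := by
  obtain ⟨r, m, F, ψ, h1, hF⟩ := leads_perm (w := w) (L := L) P hP reg ram (ket x)
  have hi : Function.Injective F := fun a b hab => det_injective (w := w) (L := L) (reg := reg) (ram := ram) hP (by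
    rw [(hF a).1, (hF b).1]; exact hab)
  have hx := (hF x).1
  rw [h] at hx
  injection hx with e1 e2 e3
  subst e1 e2
  have : ψ = ket y := by
    funext z
    obtain ⟨a, rfl⟩ := (Finite.injective_iff_surjective.1 hi) z
    rw [(hF a).2, e3]
    simp [ket, hi.eq_iff]
  rwa [this] at h1

/-- Four phases `exp(iπ/4)` multiply to `exp(iπ) = -1`. -/
lemma leads_zGate {e : Expr} {i : ℕ} (he : e.eval L reg = i) (hi : i < Q) (ψ : Vec Q) :
    Leads w L (zGate e) ⟨reg, ram, ψ⟩
      ⟨reg, ram, fun x => (if bitAt x i then -1 else 1) * ψ x⟩ := by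
  intro g
  simp only [zGate, Cmd.wp, he, Gate.apply, if_pos hi]
  congr 2
  funext x
  cases bitAt x i
  · simp
  · simp only [if_true, ← mul_assoc, ← Complex.exp_add]
    congr 1
    rw [show Complex.I * ↑Real.pi / 4 + (Complex.I * ↑Real.pi / 4 + (Complex.I * ↑Real.pi / 4 +
      Complex.I * ↑Real.pi / 4)) = ↑Real.pi * Complex.I by ring, Complex.exp_pi_mul_I]

/-- Compute a bit, change the sign where it is set, and uncompute: only the sign survives. The
registers after `P` are the same for all labels, so the phase gate acts at one fixed position. -/
lemma leads_phase {P R : Cmd} {e : Expr} {i : ℕ} {reg₁ reg₂ : ℕ → ℕ} {F F' : Basis Q → Basis Q}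
    (hP : P.classical false = true) (hR : R.classical false = true)
    (h₁ : ∀ x, P.det w L ⟨reg, ram, x⟩ = ⟨reg₁, ram, F x⟩)
    (h₂ : ∀ x, R.det w L ⟨reg₁, ram, x⟩ = ⟨reg₂, ram, F' x⟩) (hF : ∀ x, F' (F x) = x)
    (he : e.eval L reg₁ = i) (hi : i < Q) (ψ : Vec Q) :
    Leads w L (P ⨾ zGate e ⨾ R) ⟨reg, ram, ψ⟩ ⟨reg₂, ram, phase (fun x => bitAt (F x) i) ψ⟩ := by
  obtain ⟨r, m, G, ψ₁, l1, hG⟩ := leads_perm (w := w) (L := L) P hP reg ram ψ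
  have e1 := (hG zeroB).1
  rw [h₁] at e1
  injection e1 with e1 e2 _
  subst e1 e2
  have hGF : ∀ x, G x = F x := fun x => by
    have := (hG x).1
    rw [h₁] at this
    injection this with _ _ h; exact h.symm
  obtain ⟨r', m', G', ψ₂, l2, hG'⟩ := leads_perm (w := w) (L := L) R hR reg₁ ram
    (fun x => (if bitAt x i then -1 else 1) * ψ₁ x)
  have e1 := (hG' zeroB).1
  rw [h₂] at e1
  injection e1 with e1 e2 _
  subst e1 e2
  have hGF' : ∀ x, G' x = F' x := fun x => by
    have := (hG' x).1
    rw [h₂] at this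
    injection this with _ _ h; exact h.symm
  have : ψ₂ = phase (fun x => bitAt (F x) i) ψ := by
    funext x
    have h3 := (hG' (F x)).2
    rw [hGF', hF, ← hGF, (hG x).2, hGF] at h3
    exact h3
  rw [← this]
  exact l1.seq ((leads_zGate he hi ψ₁).seq l2)

end LeadsLoops

/-! ### Amplitude amplification as a program -/

section Amplify

variable {Q n : ℕ} {w : Fin n → ℕ} {p : Par} {m μ : ℕ} {reg : ℕ → ℕ} {ram : ℕ → ℕ}

lemma leads_spread (h : QReg p m μ reg) (ψ : Vec Q) :
    Leads w p.L spread ⟨reg, ram, ψ⟩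
      ⟨Function.update reg 11 (p.u + 1), ram, hadList (freeList p μ) ψ⟩ := by
  have hb := h.bounds
  have hL := p.L_lt
  have h1 := leads_up (w := w) (L := p.L) (reg := reg) (ram := ram) (len := lowLen)
    (p := .gate .H ix) (N := μ) ψ (fun j ψ => Gate.H.apply (0 + j) ψ)
    (h.update (le_refl 11) 0).lowLen (by omega) (fun j hj ψ g => by
      simp only [Cmd.wp, eval_reg, Function.update_self, zero_add])
  have h' := h.update (le_refl 11) μ
  have h2 := leads_up (w := w) (L := p.L) (reg := Function.update reg 11 μ) (ram := ram)
    (len := .reg 3 + 1) (p := .gate .H (lowLen + 3 + ix)) (N := p.u + 1)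
    (runUp (fun j ψ => Gate.H.apply (0 + j) ψ) μ ψ) (fun j ψ => Gate.H.apply (μ + 3 + j) ψ)
    (p.eval_add (h'.update (le_refl 11) 0).r3 (p.eval_lit (by norm_num)) (by omega)) (by omega)
    (fun j hj ψ g => by
      have e := p.eval_add (h'.update (le_refl 11) j).rowPos
        (show ix.eval p.L _ = j from Function.update_self _ _ _) (by omega)
      simp only [Cmd.wp]
      rw [e])
  rw [Function.update_idem, runUp_H, runUp_H, ← hadList_append] at h2
  have e : (List.range μ).map (fun i => 0 + i) = List.range μ := by simp
  rw [e] at h2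
  rw [runUp_H, e] at h1
  exact h1.seq h2

lemma leads_unspread (h : QReg p m μ reg) (ψ : Vec Q) :
    Leads w p.L unspread ⟨reg, ram, ψ⟩
      ⟨Function.update reg 11 0, ram, hadList (freeList p μ).reverse ψ⟩ := by
  have hb := h.bounds
  have hL := p.L_lt
  have e3 : ∀ {r}, QReg p m μ r → (Expr.reg 3 + 1).eval p.L r = p.u + 1 := fun h =>
    p.eval_add h.r3 (p.eval_lit (by norm_num)) (by omega)
  have h2 := leads_down (w := w) (L := p.L) (reg := reg) (ram := ram)
    (len := .reg 3 + 1) (p := .gate .H (lowLen + 3 + ix)) (N := p.u + 1) ψ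
    (fun j ψ => Gate.H.apply (μ + 3 + j) ψ) (e3 h) (e3 (h.update (le_refl 11) _)) (by omega)
    (fun j hj ψ g => by
      have e := p.eval_add (h.update (le_refl 11) j).rowPos
        (show ix.eval p.L _ = j from Function.update_self _ _ _) (by omega)
      simp only [Cmd.wp]
      rw [e])
  have h' := h.update (le_refl 11) 0
  have h1 := leads_down (w := w) (L := p.L) (reg := Function.update reg 11 0) (ram := ram)
    (len := lowLen) (p := .gate .H ix) (N := μ)
    (runDown (fun j ψ => Gate.H.apply (μ + 3 + j) ψ) (p.u + 1) ψ)
    (fun j ψ => Gate.H.apply (0 + j) ψ) h'.lowLen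
    (h'.update (le_refl 11) _).lowLen (by omega) (fun j hj ψ g => by
      simp only [Cmd.wp, eval_reg, Function.update_self, zero_add])
  rw [Function.update_idem, runDown_H, runDown_H, ← hadList_append] at h1
  have e : (List.range μ).map (fun i => 0 + i) = List.range μ := by simp
  rw [e, ← List.reverse_append] at h1
  rw [runDown_H] at h2
  exact h2.seq h1

/-- The bit that marks the good slots. -/
def goodBit (w : Fin n → ℕ) (p : Par) (m μ : ℕ) (ram : ℕ → ℕ) (x : Basis Q) : Bool :=
  bitAt (computeB w p m μ ram x) (4 * p.L + μ + (p.L - m))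

/-- The bit that marks the start label. -/
def startBit (p : Par) (μ : ℕ) (x : Basis Q) : Bool :=
  bitAt (runUp (carryB 0 (6 * p.L) (7 * p.L)) (μ + p.u + 4) x) (7 * p.L + (μ + p.u + 4))

lemma leads_iter (h : QReg p m μ reg) (hQ : Q = 9 * p.L) (ψ : Vec Q) :
    Leads w p.L iter ⟨reg, ram, ψ⟩ ⟨Function.update reg 11 (p.u + 1), ram,
      groverStep (freeList p μ) (goodBit w p m μ ram) (startBit p μ) ψ⟩ := by
  have hb := h.bounds
  have u := fun v => h.update (le_refl 11) v
  have h1 := leads_phase (w := w) (L := p.L) (P := compute) (R := uncompute) (e := outPos)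
    (reg := reg) (ram := ram) rfl rfl (fun x => det_compute h x) (fun x => det_uncompute (u _) x)
    uncomputeB_computeB (u _).outPos (by omega) ψ
  rw [Function.update_idem] at h1
  have h2 := leads_unspread (w := w) (ram := ram) (u 0)
    (phase (goodBit w p m μ ram) ψ)
  rw [Function.update_idem] at h2
  have h3 := leads_phase (w := w) (L := p.L) (P := up slotLen (carry 0 (6 * wl) (7 * wl)))
    (R := down slotLen (carry 0 (6 * wl) (7 * wl))) (e := andPos)
    (reg := Function.update reg 11 0) (ram := ram) rfl rfl (fun x => det_andUp (u _) x)
    (fun x => det_andDown ((u _).update (le_refl 11) _) x)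
    (fun x => runDown_runUp (fun j x => carryB_carryB _ _ _ j x) _ x)
    ((u _).update (le_refl 11) _).andPos (by omega)
    (hadList (freeList p μ).reverse (phase (goodBit w p m μ ram) ψ))
  simp only [Function.update_idem] at h3
  have h4 := leads_spread (w := w) (ram := ram) (u 0) (phase (startBit p μ)
    (hadList (freeList p μ).reverse (phase (goodBit w p m μ ram) ψ)))
  rw [Function.update_idem] at h4
  exact h1.seq (h2.seq (h3.seq h4))

/-- The reduction modulo register `4` in the loop bound has no effect, since the number of rounds is
below `T`; it makes the loop bound visible to the time analysis. -/
lemma leads_amplify (h : QReg p m μ reg) (hQ : Q = 9 * p.L) (ht : reg 13 < p.T) :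
    ∃ v, Leads w p.L amplify ⟨reg, ram, ket0⟩ ⟨Function.update reg 11 v, ram,
      (groverStep (freeList p μ) (goodBit w p m μ ram) (startBit p μ))^[reg 13]
        (hadList (freeList p μ) (ket (baseB p μ)) : Vec Q)⟩ := by
  have u := fun v => h.update (le_refl 11) v
  have h1 := leads_ket (w := w) (L := p.L) (P := prep) rfl (det_prep (w := w) (ram := ram) h hQ)
  have h2 := leads_spread (w := w) (ram := ram) (u p.L) (ket (baseB p μ : Basis Q))
  rw [Function.update_idem] at h2
  set G := groverStep (Q := Q) (freeList p μ) (goodBit w p m μ ram) (startBit p μ)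
  have h3 := Leads.loop (w := w) (L := p.L) (e := .reg 13 % .reg 4) (p := iter)
    (fun j => (⟨Function.update reg 11 (p.u + 1), ram,
      G^[j] (hadList (freeList p μ) (ket (baseB p μ)))⟩ : Core Q)) (fun j hj => by
      have := leads_iter (w := w) (ram := ram) (u (p.u + 1)) hQ
        (G^[j] (hadList (freeList p μ) (ket (baseB p μ))))
      rw [Function.update_idem] at this
      rw [Function.iterate_succ_apply']
      exact this)
  have e : (Expr.reg 13 % Expr.reg 4).eval p.L (Function.update reg 11 (p.u + 1)) = reg 13 := by
    simp only [eval_mod, eval_reg, (u _).r4]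
    rw [Function.update_of_ne (by norm_num), Nat.mod_eq_of_lt ht]
  simp only [e] at h3
  exact ⟨p.u + 1, h1.seq (h2.seq h3)⟩

end Amplify

/-! ### Measurement and reset of the qubits -/

section Readout

variable {Q n : ℕ} {w : Fin n → ℕ} {p : Par} {m μ : ℕ} {reg : ℕ → ℕ} {ram : ℕ → ℕ}

lemma blockVal_succ_left (N a : ℕ) (x : Basis Q) :
    blockVal (N + 1) a x = (bitAt x a).toNat + 2 * blockVal N (a + 1) x := by
  rw [add_comm, blockVal_add, blockVal_succ]
  simp [blockVal]

/-- The registers agree outside a finite set. -/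
def AgreeReg (S : Finset ℕ) (r r' : ℕ → ℕ) : Prop := ∀ y, y ∉ S → r' y = r y

/-- The bits are read from the highest one down, so doubling and adding builds the number; when
position `j` is reached, the register holds the number formed by the bits from `j` on. -/
lemma det_measWord {x : ℕ} (hx : 13 ≤ x) {base len : Expr} {N B : ℕ} (hN : N ≤ p.L)
    (hB : B + N < 64 * p.L)
    (hlen : ∀ r, AgreeReg {11, 12, x} reg r → len.eval p.L r = N)
    (hbase : ∀ r, AgreeReg {11, 12, x} reg r → base.eval p.L r = B) (y : Basis Q) :
    ∃ reg', (measWord x base len).det w p.L ⟨reg, ram, y⟩ = ⟨reg', ram, y⟩ ∧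
      AgreeReg {11, 12, x} reg reg' ∧ reg' x = blockVal N B y := by
  have hu : ∀ {r : ℕ → ℕ} {z v : ℕ}, z ∈ ({11, 12, x} : Finset ℕ) → AgreeReg {11, 12, x} reg r →
      AgreeReg {11, 12, x} reg (Function.update r z v) := by
    intro r z v hz hr y' hy'
    rw [Function.update_of_ne (fun h => hy' (by rw [h]; exact hz))]
    exact hr y' hy'
  have h1 : AgreeReg {11, 12, x} reg (Function.update reg x 0) := hu (by simp) (fun _ _ => rfl)
  have key := det_down (w := w) (L := p.L) (len := len)
    (p := .measure 12 (base + ix) ⨾ .assign x (2 * .reg x + .reg 12)) (N := N)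
    (fun j s => s.ram = ram ∧ s.lab = y ∧ AgreeReg {11, 12, x} reg s.reg ∧ s.reg 11 = j ∧
      s.reg x = blockVal (N - j) (B + j) y) (⟨Function.update reg x 0, ram, y⟩ : DState Q)
    (hlen _ h1) (hlen _ (hu (by simp) h1))
    ⟨rfl, rfl, hu (by simp) h1, by simp only [Function.update_self], by
      simp only
      rw [Function.update_of_ne (by omega), Function.update_self]; simp [blockVal]⟩ (by
      rintro j hj ⟨r, m', y'⟩ ⟨hm, hy, hr, h11, hrx⟩
      simp only at hm hy hr h11 hrx
      subst hm hy
      have e1 : (ix - 1).eval p.L r = j := by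
        simp only [eval_sub, eval_reg, eval_1, h11]
        rw [p.mod_eq (by omega)]; omega
      set r1 := Function.update r 11 j with hr1
      have a1 : AgreeReg {11, 12, x} reg r1 := hu (by simp) hr
      have e2 : (base + ix).eval p.L r1 = B + j :=
        p.eval_add (hbase _ a1) (by rw [eval_reg, hr1, Function.update_self]) (by omega)
      set r2 := Function.update r1 12 ((bitAt y' (B + j)).toNat % 2 ^ p.L) with hr2
      have e3 : (2 * Expr.reg x + Expr.reg 12).eval p.L r2 = blockVal (N - j) (B + j) y' := by
        have h2x : r2 x = blockVal (N - (j + 1)) (B + (j + 1)) y' := by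
          rw [hr2, Function.update_of_ne (by omega), hr1, Function.update_of_ne (by omega), hrx]
        have h212 : r2 12 = (bitAt y' (B + j)).toNat := by
          rw [hr2, Function.update_self]
          exact p.mod_eq (by have := Bool.toNat_le (bitAt y' (B + j)); omega)
        have hs := blockVal_succ_left (N - (j + 1)) (B + j) y'
        rw [show N - (j + 1) + 1 = N - j by omega] at hs
        have hl := blockVal_lt (N - j) (B + j) y'
        have hpw : 2 ^ (N - j) ≤ 2 ^ p.L := Nat.pow_le_pow_right (by norm_num) (by omega)
        simp only [eval_add, eval_mul, eval_reg, eval_2, h2x, h212]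
        rw [p.mod_eq (v := 2) (by omega), show B + (j + 1) = B + j + 1 by ring,
          Nat.mod_eq_of_lt (a := 2 * blockVal (N - (j + 1)) (B + j + 1) y') (by omega),
          Nat.mod_eq_of_lt (by omega), hs]
        ring
      simp only [Cmd.det, e1, ← hr1, e2, ← hr2, e3]
      refine ⟨trivial, trivial, hu (by simp) (hu (by simp) a1), ?_, Function.update_self _ _ _⟩
      rw [Function.update_of_ne (by omega), hr2, Function.update_of_ne (by norm_num), hr1,
        Function.update_self])
  obtain ⟨k1, k2, k3, -, k5⟩ := key
  have e0 : (0 : Expr).eval p.L reg = 0 := by simp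
  refine ⟨_, ?_, k3, by simpa using k5⟩
  unfold measWord
  simp only [Cmd.det, e0]
  ext1
  · rfl
  · exact k1
  · exact k2

lemma det_resetAll (hQ : Q = 9 * p.L) (h2 : reg 2 = p.L) (y : Basis Q) :
    ∃ reg', resetAll.det w p.L ⟨reg, ram, y⟩ = ⟨reg', ram, zeroB⟩ ∧ AgreeReg {11, 12} reg reg' := by
  have key := det_up (w := w) (L := p.L) (len := 9 * wl)
    (p := .measure 12 ix ⨾ .ite (.reg 12) (.gate .X ix) .skip) (N := Q)
    (fun j s => s.ram = ram ∧ AgreeReg {11, 12} reg s.reg ∧ s.reg 11 = j ∧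
      ∀ i < j, bitAt s.lab i = false) (⟨reg, ram, y⟩ : DState Q)
    (by
      have hL := p.L_big
      have h5 := p.five_u
      have := p.eval_mul (r := Function.update reg 11 0) (a := 9) (b := wl) (p.eval_lit (v := 9) (by norm_num))
        (show wl.eval p.L _ = p.L by rw [wl, eval_reg, Function.update_of_ne (by norm_num), h2])
        (by omega)
      exact this.trans hQ.symm)
    ⟨rfl, fun z hz => Function.update_of_ne (fun h => hz (by simp [h])) _ _,
      by simp only [Function.update_self], fun i hi => by omega⟩ (by
      rintro j hj ⟨r, m', y'⟩ ⟨hm, hr, h11, hz⟩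
      simp only at hm hr h11 hz
      subst hm
      have hLb := p.L_big
      have e1 : ix.eval p.L r = j := h11
      set r2 := Function.update r 12 ((bitAt y' j).toNat % 2 ^ p.L) with hr2
      have e2 : ix.eval p.L r2 = j := by
        rw [hr2, eval_reg, Function.update_of_ne (by norm_num), h11]
      have e3 : (ix + 1).eval p.L r2 = j + 1 := p.eval_add e2 (p.eval_lit (by norm_num)) (by omega)
      have e4 : (Expr.reg 12).eval p.L r2 = (bitAt y' j).toNat := by
        rw [hr2, eval_reg, Function.update_self]
        exact p.mod_eq (by have := Bool.toNat_le (bitAt y' j); omega)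
      have a2 : AgreeReg {11, 12} reg (Function.update r2 11 (j + 1)) := by
        intro z hz'
        simp only [Finset.mem_insert, Finset.mem_singleton, not_or] at hz'
        rw [Function.update_of_ne hz'.1, hr2, Function.update_of_ne hz'.2]
        exact hr z (by simp [hz'])
      simp only [Cmd.det, e1, ← hr2, e4]
      cases hb : bitAt y' j
      · simp only [Bool.toNat_false, ne_eq, not_true_eq_false, if_false, e3]
        refine ⟨trivial, a2, Function.update_self _ _ _, fun i hi => ?_⟩
        by_cases hij : i = j
        · rw [hij, hb]
        · exact hz i (by omega)
      · simp only [Bool.toNat_true, ne_eq, one_ne_zero, not_false_eq_true, if_true, e3, e2]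
        refine ⟨trivial, a2, Function.update_self _ _ _, fun i hi => ?_⟩
        rw [bitAt_flipB]
        by_cases hij : i = j
        · rw [if_pos ⟨hij, hj⟩, hij, hb]; rfl
        · rw [if_neg (by tauto)]
          exact hz i (by omega))
  obtain ⟨k1, k2, -, k4⟩ := key
  refine ⟨_, ?_, k2⟩
  unfold resetAll
  ext1
  · rfl
  · exact k1
  · exact basis_ext fun i hi => by rw [k4 i hi]; simp [bitAt, zeroB]

/-- The key of a slot. -/
def keyOf (p : Par) (μ : ℕ) (x : Basis Q) : ℕ := blockVal (μ + p.u + 4) 0 x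

lemma AgreeReg.trans {S S' S'' : Finset ℕ} {r r' r'' : ℕ → ℕ} (h : AgreeReg S r r')
    (h' : AgreeReg S' r' r'') (hS : S ∪ S' ⊆ S'') : AgreeReg S'' r r'' := fun y hy =>
  (h' y fun hm => hy (hS (Finset.mem_union_right _ hm))).trans
    (h y fun hm => hy (hS (Finset.mem_union_left _ hm)))

lemma AgreeReg.update (r : ℕ → ℕ) (x v : ℕ) : AgreeReg {x} r (Function.update r x v) :=
  fun y hy => Function.update_of_ne (by simpa using hy) _ _

lemma QReg.agree {r r' : ℕ → ℕ} (h : QReg p m μ r) {S : Finset ℕ} (hS : ∀ x ∈ S, 11 ≤ x)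
    (h' : AgreeReg S r r') : QReg p m μ r' := by
  have e : ∀ y ≤ 10, r' y = r y := fun y hy => h' y fun hm => by have := hS y hm; omega
  constructor <;> (try rw [e _ (by norm_num)])
  exacts [h.r1, h.r2, h.r3, h.r4, h.r5, h.r6, h.r7, h.r8, h.r9, h.r10, h.hm, h.hμ]

/-- On a single label all outcomes are determined: slot, value and mark. The concluding reset leads
to the zero label, which allows the next attempt to be appended. -/
lemma det_readout (h : QReg p m μ reg) (hQ : Q = 9 * p.L) (ht : Tables w p ram) {x : Basis Q}
    (hx : x ∈ slots Q p μ) :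
    ∃ reg', readout.det w p.L ⟨reg, ram, x⟩ = ⟨reg', ram, zeroB⟩ ∧
      AgreeReg {11, 12, 16, 17, 18} reg reg' ∧ reg' 16 = keyOf p μ x ∧
      reg' 17 = rowVal w p ram (rowOf p μ x) ∧ reg' 18 = (goodBit w p m μ ram x).toNat := by
  have hb := h.bounds
  have hL := p.L_big
  set r0 := Function.update reg 11 (p.L - m) with hr0
  have q0 : QReg p m μ r0 := h.update (le_refl 11) _
  set y := computeB w p m μ ram x with hy
  obtain ⟨r1, d1, a1, v1⟩ := det_measWord (w := w) (p := p) (reg := r0) (ram := ram) (x := 16)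
    (by norm_num) (base := 0) (len := slotLen) (N := μ + p.u + 4) (B := 0) (by omega) (by omega)
    (fun r hr => (q0.agree (by simp) hr).slotLen) (fun r hr => p.eval_lit (by norm_num)) y
  have q1 : QReg p m μ r1 := q0.agree (by simp) a1
  obtain ⟨r2, d2, a2, v2⟩ := det_measWord (w := w) (p := p) (reg := r1) (ram := ram) (x := 17)
    (by norm_num) (base := 2 * wl) (len := wl) (N := p.L) (B := 2 * p.L) (by omega) (by omega)
    (fun r hr => (q1.agree (by simp) hr).wl)
    (fun r hr => (q1.agree (by simp) hr).mul_wl (by norm_num)) y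
  have q2 : QReg p m μ r2 := q1.agree (by simp) a2
  set r3 := Function.update r2 18 ((bitAt y (4 * p.L + μ + (p.L - m))).toNat % 2 ^ p.L) with hr3
  have q3 : QReg p m μ r3 := q2.update (by norm_num) _
  obtain ⟨r4, d4, a4⟩ := det_resetAll (w := w) (ram := ram) hQ q3.r2 y
  have a3 : AgreeReg {18} r2 r3 := AgreeReg.update _ _ _
  have b1 : AgreeReg {11, 12, 16} reg r1 := (AgreeReg.update reg 11 (p.L - m)).trans a1 (by decide)
  have b2 : AgreeReg {11, 12, 16, 17} reg r2 := b1.trans a2 (by decide)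
  have b3 : AgreeReg {11, 12, 16, 17, 18} reg r3 := b2.trans a3 (by decide)
  refine ⟨r4, ?_, b3.trans a4 (by decide), ?_, ?_, ?_⟩
  · unfold readout
    rw [Cmd.det, det_compute h, ← hr0, ← hy, Cmd.det, d1, Cmd.det, d2, Cmd.det]
    rw [show (Cmd.measure 18 outPos).det w p.L (⟨r2, ram, y⟩ : DState Q) = ⟨r3, ram, y⟩ by
      simp only [Cmd.det, q2.outPos, hr3], d4]
  · rw [a4 _ (by decide), a3 _ (by decide), a2 _ (by decide), v1]
    exact blockVal_congr fun i hi => by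
      rw [hy, bitAt_computeB_of_lt hQ hb.1 hb.2.1 ht hx (by omega), if_neg (by omega)]
  · rw [a4 _ (by decide), a3 _ (by decide), v2]
    exact blockVal_eq_of_testBit (rowVal_lt ht _) fun i hi => by
      rw [hy, bitAt_computeB_of_lt hQ hb.1 hb.2.1 ht hx (by omega), if_pos (by omega),
        Nat.add_sub_cancel_left]
  · rw [a4 _ (by decide), hr3, Function.update_self]
    exact p.mod_eq (by have := Bool.toNat_le (bitAt y (4 * p.L + μ + (p.L - m))); omega)

end Readout

/-! ### Binary tries in memory -/

section Trie

/-- A binary tree stored in the memory `t`: the children of node `x` are in the cells `2 * x` and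
`2 * x + 1`, and `ν d r` is the node for the word whose first `d` bits form the number `r`, or zero
if there is none. -/
structure Trie (t : ℕ → ℕ) (root f : ℕ) (ν : ℕ → ℕ → ℕ) : Prop where
  root_eq : ν 0 0 = root
  root_ne : root ≠ 0
  child : ∀ d r b, r < 2 ^ d → b < 2 → ν d r ≠ 0 → t (2 * ν d r + b) = ν (d + 1) (r + b * 2 ^ d)
  lt : ∀ d r, ν d r < f
  inj : ∀ d r d' r', ν d r = ν d' r' → ν d r ≠ 0 → d = d' ∧ r = r'
  closed : ∀ d r b, r < 2 ^ d → b < 2 → ν d r = 0 → ν (d + 1) (r + b * 2 ^ d) = 0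
  fresh : ∀ i, 2 * f ≤ i → t i = 0

/-- The cells from `2 f` on are zero, so `f` has no children and a new trie needs no initialization.
Every collection opens one, because the same key means another slot there. -/
lemma trie_root {t : ℕ → ℕ} {f : ℕ} (hf : f ≠ 0) (ht : ∀ i, 2 * f ≤ i → t i = 0) :
    Trie t f (f + 1) fun d r => if d = 0 ∧ r = 0 then f else 0 where
  root_eq := by simp
  root_ne := hf
  child d r b hr hb h := by
    have h0 : d = 0 ∧ r = 0 := by by_contra h0; rw [if_neg h0] at h; exact h rfl
    rw [if_pos h0, if_neg (by omega)]
    exact ht _ (by omega)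
  lt d r := by split_ifs <;> omega
  inj d r d' r' h hne := by
    have h0 : d = 0 ∧ r = 0 := by by_contra h0; rw [if_neg h0] at hne; exact hne rfl
    rw [if_pos h0] at h hne
    have h1 : d' = 0 ∧ r' = 0 := by by_contra h1; rw [if_neg h1] at h; exact hne h
    omega
  closed d r b hr hb h := by rw [if_neg (by omega)]
  fresh i hi := ht i (by omega)

lemma add_mul_two_pow_inj {d r r' b b' : ℕ} (hr : r < 2 ^ d) (hr' : r' < 2 ^ d)
    (h : r + b * 2 ^ d = r' + b' * 2 ^ d) : r = r' ∧ b = b' := by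
  have h1 := congrArg (· % 2 ^ d) h
  simp only [Nat.add_mul_mod_self_right, Nat.mod_eq_of_lt hr, Nat.mod_eq_of_lt hr'] at h1
  refine ⟨h1, ?_⟩
  rw [h1] at h
  exact Nat.eq_of_mul_eq_mul_right (Nat.two_pow_pos d) (Nat.add_left_cancel h)

/-- The next free node `f` becomes the missing child. Its own two child cells are still zero, which
agrees with the absence of longer words recorded by `closed`. -/
lemma Trie.extend {t : ℕ → ℕ} {root f : ℕ} {ν : ℕ → ℕ → ℕ} (h : Trie t root f ν) {d r b : ℕ}
    (hr : r < 2 ^ d) (hb : b < 2) (h0 : ν d r ≠ 0) (hz : ν (d + 1) (r + b * 2 ^ d) = 0) :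
    Trie (Function.update t (2 * ν d r + b) f) root (f + 1)
      fun d' r' => if d' = d + 1 ∧ r' = r + b * 2 ^ d then f else ν d' r' where
  root_eq := by rw [if_neg (by omega)]; exact h.root_eq
  root_ne := h.root_ne
  child d' r' b' hr' hb' hne := by
    by_cases h1 : d' = d + 1 ∧ r' = r + b * 2 ^ d
    · obtain ⟨rfl, rfl⟩ := h1
      have hl := h.lt d r
      rw [if_pos ⟨rfl, rfl⟩, if_neg (by omega), Function.update_of_ne (by omega),
        h.fresh _ (by omega), h.closed _ _ _ hr' hb' hz]
    · rw [if_neg h1] at hne ⊢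
      by_cases h2 : 2 * ν d' r' + b' = 2 * ν d r + b
      · obtain ⟨rfl, rfl⟩ := h.inj d' r' d r (by omega) hne
        have : b' = b := by omega
        subst this
        rw [if_pos ⟨rfl, rfl⟩, Function.update_self]
      · rw [Function.update_of_ne h2, if_neg, h.child d' r' b' hr' hb' hne]
        rintro ⟨h3, h4⟩
        obtain rfl : d' = d := by omega
        obtain ⟨rfl, rfl⟩ := add_mul_two_pow_inj hr' hr h4
        exact h2 rfl
  lt d' r' := by
    have := h.lt d' r'
    split_ifs <;> omega
  inj d₁ r₁ d₂ r₂ he hne := by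
    have l1 := h.lt d₁ r₁
    have l2 := h.lt d₂ r₂
    split_ifs at he hne with h1 h2 h2
    · omega
    · omega
    · omega
    · exact h.inj _ _ _ _ he hne
  closed d' r' b' hr' hb' he := by
    have hl := h.lt d r
    split_ifs at he with h1
    · omega
    · rw [if_neg, h.closed _ _ _ hr' hb' he]
      rintro ⟨h3, h4⟩
      obtain rfl : d' = d := by omega
      obtain ⟨rfl, rfl⟩ := add_mul_two_pow_inj hr' hr h4
      exact h0 he
  fresh i hi := by
    have hl := h.lt d r
    rw [Function.update_of_ne (by omega), h.fresh _ (by omega)]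

end Trie

/-! ### Inserting a key into the trie -/

section TreeWalk

variable {Q n : ℕ} {w : Fin n → ℕ} {p : Par} {m μ : ℕ} {reg : ℕ → ℕ} {ram : ℕ → ℕ}

lemma mod_two_pow_succ (κ d : ℕ) :
    κ % 2 ^ (d + 1) = κ % 2 ^ d + (κ.testBit d).toNat * 2 ^ d := by
  rw [Nat.mod_pow_succ, Nat.toNat_testBit, mul_comm]

lemma eval_add_of_lt {L : ℕ} {r : ℕ → ℕ} {a b : Expr} {x y : ℕ} (ha : a.eval L r = x)
    (hb : b.eval L r = y) (h : x + y < 2 ^ L) : (a + b).eval L r = x + y := by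
  rw [QMachine.eval_add, ha, hb, Nat.mod_eq_of_lt h]

lemma eval_mul_of_lt {L : ℕ} {r : ℕ → ℕ} {a b : Expr} {x y : ℕ} (ha : a.eval L r = x)
    (hb : b.eval L r = y) (h : x * y < 2 ^ L) : (a * b).eval L r = x * y := by
  rw [QMachine.eval_mul, ha, hb, Nat.mod_eq_of_lt h]

lemma Par.S_lt (p : Par) : p.S + 64 * p.L < 2 ^ p.L := p.big

/-- Walking down the tree. -/
lemma det_walk {root f₀ κ : ℕ} {ν₀ : ℕ → ℕ → ℕ} (h2 : reg 2 = p.L) (h5 : reg 5 = p.S)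
    (h16 : reg 16 = κ) (h19 : reg 19 = root) (h20 : reg 20 = 0) (h21 : reg 21 = f₀)
    (hν : Trie (fun i => ram (8 * i)) root f₀ ν₀) (hf : 16 * (f₀ + p.L + 1) ≤ p.S) (y : Basis Q) :
    ∃ reg' ram', (up wl treeStep).det w p.L ⟨reg, ram, y⟩ = ⟨reg', ram', y⟩ ∧
      AgreeReg {11, 19, 20, 21, 28, 29} reg reg' ∧ (∀ a, a % 8 ≠ 0 → ram' a = ram a) ∧
      (reg' 20 = if ν₀ p.L (κ % 2 ^ p.L) = 0 then 1 else 0) ∧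
      (reg' 21 ≤ f₀ + p.L ∧ (reg' 20 = 0 → reg' 21 = f₀)) ∧
      ∃ ν, Trie (fun i => ram' (8 * i)) root (reg' 21) ν ∧ ν p.L (κ % 2 ^ p.L) ≠ 0 ∧
        ∀ r, r ≠ κ % 2 ^ p.L → ν p.L r = ν₀ p.L r := by
  have hS := p.S_lt
  have hL := p.L_lt
  have h5u := p.five_u
  -- After `d` steps the trie differs from the original one at most along the path of the lowest `d`
  -- bits of the key, and register `20` tells whether the original trie lacks the node reached.
  have key := det_up (w := w) (L := p.L) (len := wl) (p := treeStep) (N := p.L)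
    (fun d s => s.lab = y ∧ AgreeReg {11, 19, 20, 21, 28, 29} reg s.reg ∧
      (∀ a, a % 8 ≠ 0 → s.ram a = ram a) ∧ s.reg 11 = d ∧
      (s.reg 20 = if ν₀ d (κ % 2 ^ d) = 0 then 1 else 0) ∧
      (s.reg 21 ≤ f₀ + d ∧ (s.reg 20 = 0 → s.reg 21 = f₀)) ∧
      ∃ ν, Trie (fun i => s.ram (8 * i)) root (s.reg 21) ν ∧ ν d (κ % 2 ^ d) = s.reg 19 ∧
        s.reg 19 ≠ 0 ∧ ∀ d' r, ¬ (d' ≤ d ∧ r = κ % 2 ^ d') → ν d' r = ν₀ d' r)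
    (⟨reg, ram, y⟩ : DState Q)
    (by simp only [eval_reg]; rw [Function.update_of_ne (by norm_num), h2])
    ⟨rfl, fun z hz => Function.update_of_ne (fun h => hz (by simp [h])) _ _, fun _ _ => rfl,
      by simp only [Function.update_self], by
        simp only
        rw [Function.update_of_ne (by norm_num), h20, pow_zero, Nat.mod_one, if_neg]
        rw [hν.root_eq]; exact hν.root_ne, by
        simp only
        rw [Function.update_of_ne (by norm_num), h21]
        exact ⟨le_rfl, fun _ => rfl⟩, ν₀, by
        simp only
        rw [Function.update_of_ne (by norm_num), h21]
        exact hν, by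
        simp only
        rw [Function.update_of_ne (by norm_num), h19, pow_zero, Nat.mod_one, hν.root_eq], by
        simp only
        rw [Function.update_of_ne (by norm_num), h19]
        exact hν.root_ne, fun _ _ _ => rfl⟩ (by
      rintro d hd ⟨r, m', y'⟩ ⟨hy, hr, hm, h11, hr20, ⟨hf1, hf2⟩, ν, hT, hν19, hne, hνe⟩
      simp only at hy hr hm h11 hr20 hf1 hf2 hT hν19 hne hνe
      subst hy
      have r16 : r 16 = κ := (hr 16 (by decide)).trans h16
      have r5 : r 5 = p.S := (hr 5 (by decide)).trans h5
      set b := (κ.testBit d).toNat with hb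
      have hb2 : b < 2 := by rw [hb]; cases κ.testBit d <;> simp
      have hlt := hT.lt d (κ % 2 ^ d)
      rw [hν19] at hlt
      have e28 : (8 * (2 * Expr.reg 19 + Expr.bin .bit (.reg 16) ix)).eval p.L r =
          8 * (2 * r 19 + b) := by
        refine eval_mul_of_lt (p.eval_lit (by norm_num)) (eval_add_of_lt (eval_mul_of_lt
          (p.eval_lit (by norm_num)) rfl (by omega)) ?_ (by omega)) (by omega)
        simp only [eval_bit, eval_reg, r16, h11]
        rw [hb]
        cases κ.testBit d
        · simp
        · exact p.mod_eq (by simp; omega)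
      have hmod := mod_two_pow_succ κ d
      rw [← hb] at hmod
      have hml : κ % 2 ^ d < 2 ^ d := Nat.mod_lt _ (by positivity)
      have hch := hT.child d (κ % 2 ^ d) b hml hb2 (by rw [hν19]; exact hne)
      rw [hν19, ← hmod, hνe (d + 1) _ (by omega)] at hch
      have hcl := hν.closed d (κ % 2 ^ d) b hml hb2
      -- The nodes added so far have depth at most `d`, so `hch` reads the next child from the
      -- original trie.
      rw [← hmod] at hcl
      simp only [treeStep, Cmd.det, e28]
      set r1 := Function.update r 28 (8 * (2 * r 19 + b)) with hr1
      have r1v : ∀ z, z ≠ 28 → r1 z = r z := fun z hz => Function.update_of_ne hz _ _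
      have a1 : AgreeReg {11, 19, 20, 21, 28, 29} reg r1 :=
        hr.trans (AgreeReg.update _ _ _) (by decide)
      rw [show (Expr.reg 28).eval p.L r1 = 8 * (2 * r 19 + b) by
        rw [eval_reg, hr1, Function.update_self]]
      set r2 := Function.update r1 29 (m' (8 * (2 * r 19 + b))) with hr2
      have r2v : ∀ z, z ≠ 28 → z ≠ 29 → r2 z = r z := fun z h1 h2 =>
        (Function.update_of_ne h2 _ _).trans (r1v z h1)
      have a2 : AgreeReg {11, 19, 20, 21, 28, 29} reg r2 :=
        a1.trans (AgreeReg.update _ _ _) (by decide)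
      have r229 : (Expr.reg 29).eval p.L r2 = m' (8 * (2 * r 19 + b)) := by
        rw [eval_reg, hr2, Function.update_self]
      have r228 : r2 28 = 8 * (2 * r 19 + b) := by
        rw [hr2, Function.update_of_ne (by norm_num), hr1, Function.update_self]
      have r221 : r2 21 = r 21 := r2v _ (by norm_num) (by norm_num)
      rw [r229]
      by_cases hz : m' (8 * (2 * r 19 + b)) = 0
      · rw [if_neg (by simpa using hz)]
        simp only [eval_reg]
        set r3 := Function.update r2 29 (r2 21) with hr3
        have r3v : ∀ z, z ≠ 29 → r3 z = r2 z := fun z h => Function.update_of_ne h _ _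
        have e28' : (Expr.reg 28 % Expr.reg 5).eval p.L r3 = 8 * (2 * r 19 + b) := by
          simp only [eval_mod, eval_reg]
          rw [r3v _ (by norm_num), r3v _ (by norm_num), r228, r2v _ (by norm_num) (by norm_num), r5,
            Nat.mod_eq_of_lt (by omega)]
        have e21' : (Expr.reg 21 + 1).eval p.L r3 = r 21 + 1 := by
          refine eval_add_of_lt ?_ (p.eval_lit (by norm_num)) (by omega)
          rw [eval_reg, r3v _ (by norm_num), r221]
        rw [e28', e21', r3v 21 (by norm_num), r221]
        set r4 := Function.update r3 21 (r 21 + 1) with hr4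
        have r4v : ∀ z, z ≠ 21 → r4 z = r3 z := fun z h => Function.update_of_ne h _ _
        rw [show (1 : Expr).eval p.L r4 = 1 from p.eval_lit (by norm_num)]
        set r5' := Function.update r4 20 1 with hr5
        have r5v : ∀ z, z ≠ 20 → r5' z = r4 z := fun z h => Function.update_of_ne h _ _
        have f29 : r5' 29 = r 21 := by
          rw [r5v _ (by norm_num), r4v _ (by norm_num), hr3, Function.update_self, r221]
        have f11 : r5' 11 = d := by
          rw [r5v _ (by norm_num), r4v _ (by norm_num), r3v _ (by norm_num),
            r2v _ (by norm_num) (by norm_num), h11]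
        rw [f29]
        set r6 := Function.update r5' 19 (r 21) with hr6
        have r6v : ∀ z, z ≠ 19 → r6 z = r5' z := fun z h => Function.update_of_ne h _ _
        rw [show (ix + 1).eval p.L r6 = d + 1 from eval_add_of_lt
          (by rw [eval_reg, r6v _ (by norm_num), f11]) (p.eval_lit (by norm_num)) (by omega)]
        set r7 := Function.update r6 11 (d + 1) with hr7
        have r7v : ∀ z, z ≠ 11 → r7 z = r6 z := fun z h => Function.update_of_ne h _ _
        have g20 : r7 20 = 1 := by
          rw [r7v _ (by norm_num), r6v _ (by norm_num), hr5, Function.update_self]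
        have g21 : r7 21 = r 21 + 1 := by
          rw [r7v _ (by norm_num), r6v _ (by norm_num), r5v _ (by norm_num), hr4,
            Function.update_self]
        have g19 : r7 19 = r 21 := by
          rw [r7v _ (by norm_num), hr6, Function.update_self]
        rw [hz] at hch
        have hν1 : ν (d + 1) (κ % 2 ^ d + b * 2 ^ d) = 0 := by
          rw [← hmod, hνe (d + 1) _ (by omega), ← hch]
        have hT' := hT.extend hml hb2 (by rw [hν19]; exact hne) hν1
        refine ⟨trivial, ?_, ?_, Function.update_self _ _ _, ?_, ?_, fun d' r' =>
          if d' = d + 1 ∧ r' = κ % 2 ^ d + b * 2 ^ d then r 21 else ν d' r', ?_, ?_, ?_, ?_⟩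
        · exact (((((a2.trans (AgreeReg.update _ _ _) (S'' := {11, 19, 20, 21, 28, 29})
            (by decide)).trans (AgreeReg.update _ _ _) (S'' := {11, 19, 20, 21, 28, 29})
            (by decide)).trans (AgreeReg.update _ _ _) (S'' := {11, 19, 20, 21, 28, 29})
            (by decide)).trans (AgreeReg.update _ _ _) (S'' := {11, 19, 20, 21, 28, 29})
            (by decide)).trans (AgreeReg.update _ _ _) (by decide))
        · intro a ha
          rw [Function.update_of_ne (by omega), hm a ha]
        · rw [g20, if_pos hch.symm]
        · rw [g20, g21]
          exact ⟨by omega, fun h => by omega⟩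
        · rw [g21]
          have : (fun i => Function.update m' (8 * (2 * r 19 + b)) (r 21) (8 * i)) =
              Function.update (fun i => m' (8 * i)) (2 * r 19 + b) (r 21) := by
            funext i
            by_cases hi : i = 2 * r 19 + b
            · rw [hi, Function.update_self, Function.update_self]
            · rw [Function.update_of_ne hi, Function.update_of_ne (by omega)]
          rw [this, ← hν19]
          exact hT'
        · simp only [hmod, g19, and_self, if_true]
        · rw [g19]; omega
        · intro d' r' hdr
          dsimp only
          rw [if_neg (fun h => hdr ⟨by omega, by rw [h.2, ← hmod, h.1]⟩)]
          exact hνe d' r' (fun h => hdr ⟨by omega, h.2⟩)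
      · rw [if_pos hz]
        simp only [eval_reg] at r229 ⊢
        rw [r229]
        set r6 := Function.update r2 19 (m' (8 * (2 * r 19 + b))) with hr6
        have r6v : ∀ z, z ≠ 19 → r6 z = r2 z := fun z h => Function.update_of_ne h _ _
        rw [show (ix + 1).eval p.L r6 = d + 1 from eval_add_of_lt
          (by rw [eval_reg, r6v _ (by norm_num), r2v _ (by norm_num) (by norm_num), h11])
          (p.eval_lit (by norm_num)) (by omega)]
        set r7 := Function.update r6 11 (d + 1) with hr7
        have r7v : ∀ z, z ≠ 11 → r7 z = r6 z := fun z h => Function.update_of_ne h _ _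
        have hz0 : ν₀ (d + 1) (κ % 2 ^ (d + 1)) ≠ 0 := by rw [← hch]; exact hz
        have hz1 : ν₀ d (κ % 2 ^ d) ≠ 0 := fun h => hz0 (hcl h)
        rw [if_neg hz1] at hr20
        have g20 : r7 20 = 0 := by
          rw [r7v _ (by norm_num), r6v _ (by norm_num), r2v _ (by norm_num) (by norm_num), hr20]
        have g21 : r7 21 = r 21 := by
          rw [r7v _ (by norm_num), r6v _ (by norm_num), r2v _ (by norm_num) (by norm_num)]
        have g19 : r7 19 = m' (8 * (2 * r 19 + b)) := by
          rw [r7v _ (by norm_num), hr6, Function.update_self]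
        refine ⟨trivial, ?_, hm, Function.update_self _ _ _, ?_, ?_, ν, ?_, ?_, ?_, ?_⟩
        · exact (a2.trans (AgreeReg.update _ _ _) (S'' := {11, 19, 20, 21, 28, 29})
            (by decide)).trans (AgreeReg.update _ _ _) (by decide)
        · rw [g20, if_neg hz0]
        · rw [g20, g21]
          exact ⟨by omega, fun _ => hf2 hr20⟩
        · rw [g21]; exact hT
        · rw [g19, hνe _ _ (by omega)]; exact hch.symm
        · rw [g19]; exact hz
        · intro d' r' hdr
          exact hνe d' r' (fun h => hdr ⟨by omega, h.2⟩))
  obtain ⟨k1, k2, k3, -, k5, k6, ν, k7, k8, k9, k10⟩ := key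
  refine ⟨_, _, ?_, k2, k3, k5, k6, ν, k7, by rw [k8]; exact k9, fun r hr => k10 _ _ fun h => hr h.2⟩
  ext1
  · rfl
  · rfl
  · exact k1

end TreeWalk

/-! ### Elements of slots and their records -/

section Record

variable {Q n : ℕ} {w : Fin n → ℕ} {p : Par} {m μ : ℕ} {reg : ℕ → ℕ} {ram : ℕ → ℕ}

/-- First component of the element that belongs to a slot. -/
def elemJ (p : Par) (μ : ℕ) (ram : ℕ → ℕ) (x : Basis Q) : ℕ :=
  if rowOf p μ x < 2 ^ p.u then rowOf p μ x else ram (8 * (rowOf p μ x - 2 ^ p.u) + 1)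

/-- Offset of the row of a slot. -/
def rowOff (p : Par) (μ : ℕ) (ram : ℕ → ℕ) (x : Basis Q) : ℕ :=
  if rowOf p μ x < 2 ^ p.u then 0 else ram (8 * (rowOf p μ x - 2 ^ p.u) + 2)

/-- Second component of the element that belongs to a slot. -/
def elemO (p : Par) (m μ : ℕ) (ram : ℕ → ℕ) (x : Basis Q) : ℕ :=
  rowOff p μ ram x + 2 ^ m - lowOf μ x

/-- What remains of the row above the element that belongs to a slot. -/
def restV (w : Fin n → ℕ) (p : Par) (m μ : ℕ) (ram : ℕ → ℕ) (x : Basis Q) : ℕ :=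
  rowVal w p ram (rowOf p μ x) - 2 ^ m

/-- From low to high, a key consists of the low bits, the three ones and the row. -/
lemma keyOf_eq (hQ : Q = 9 * p.L) (hm : m + 5 * p.u ≤ p.L) (hμ : μ ≤ m) {x : Basis Q}
    (hx : x ∈ slots Q p μ) : keyOf p μ x = lowOf μ x + 2 ^ μ * (7 + 8 * rowOf p μ x) := by
  have hu := p.u_pos
  have e : keyOf p μ x = blockVal (μ + (3 + (p.u + 1))) 0 x := by
    unfold keyOf; congr 1; ring
  rw [e, blockVal_add, blockVal_add, blockVal_one (N := 3) fun i hi => by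
    rw [slots_bit hx (by omega) (by omega), decide_eq_true_eq]; omega, zero_add]
  rfl

lemma keyOf_div (hQ : Q = 9 * p.L) (hm : m + 5 * p.u ≤ p.L) (hμ : μ ≤ m) {x : Basis Q}
    (hx : x ∈ slots Q p μ) : keyOf p μ x / (8 * 2 ^ μ) = rowOf p μ x := by
  rw [keyOf_eq hQ hm hμ hx, mul_comm 8 (2 ^ μ), ← Nat.div_div_eq_div_mul,
    Nat.add_mul_div_left _ _ (by positivity), Nat.div_eq_of_lt (show lowOf μ x < 2 ^ μ from blockVal_lt _ _ _)]
  omega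

lemma keyOf_mod (hQ : Q = 9 * p.L) (hm : m + 5 * p.u ≤ p.L) (hμ : μ ≤ m) {x : Basis Q}
    (hx : x ∈ slots Q p μ) : keyOf p μ x % 2 ^ μ = lowOf μ x := by
  rw [keyOf_eq hQ hm hμ hx, Nat.add_mul_mod_self_left, Nat.mod_eq_of_lt (show lowOf μ x < 2 ^ μ from blockVal_lt _ _ _)]

lemma keyOf_lt (hm : m + 5 * p.u ≤ p.L) (hμ : μ ≤ m) (x : Basis Q) : keyOf p μ x < 2 ^ p.L := by
  have hu := p.u_pos
  exact (blockVal_lt _ _ _).trans_le (Nat.pow_le_pow_right (by norm_num) (by omega))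

lemma keyOf_injOn {x y : Basis Q} (hx : x ∈ slots Q p μ) (hy : y ∈ slots Q p μ)
    (h : keyOf p μ x = keyOf p μ y) : x = y := by
  refine basis_ext fun i hi => ?_
  by_cases hi2 : i < μ + p.u + 4
  · have h1 := testBit_blockVal (μ + p.u + 4) 0 x i hi2
    have h2 := testBit_blockVal (μ + p.u + 4) 0 y i hi2
    unfold keyOf at h
    rw [h, h2, zero_add] at h1
    exact h1.symm
  · rw [slots_bit hx hi (by omega), slots_bit hy hi (by omega)]

/-- The remaining value goes to cell `8 c + 3` and not to the visible cell `8 c + 7`, so the search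
condition does not change during a collection. The hypothesis `ho` excludes a wraparound of the
offset, and `hrow` confines table rows to the old entries. -/
lemma det_record {c E : ℕ} (h : QReg p m μ reg) (hQ : Q = 9 * p.L) {x : Basis Q}
    (hx : x ∈ slots Q p μ) (h14 : reg 14 = c) (h16 : reg 16 = keyOf p μ x)
    (h17 : reg 17 = rowVal w p ram (rowOf p μ x)) (hc : 8 * c + 8 ≤ p.S)
    (ho : rowOff p μ ram x + 2 ^ m < 2 ^ p.L)
    (hE : E ≤ c) (hrow : rowOf p μ x < 2 ^ p.u + E) (y : Basis Q) :
    ∃ reg' ram', record.det w p.L ⟨reg, ram, y⟩ = ⟨reg', ram', y⟩ ∧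
      AgreeReg {14, 24, 25, 26} reg reg' ∧ reg' 14 = c + 1 ∧
      (∀ a, a ≠ 8 * c + 1 → a ≠ 8 * c + 2 → a ≠ 8 * c + 3 → ram' a = ram a) ∧
      ram' (8 * c + 1) = elemJ p μ ram x ∧ ram' (8 * c + 2) = elemO p m μ ram x ∧
      ram' (8 * c + 3) = restV w p m μ ram x := by
  have hb := h.bounds
  have hS := p.S_lt
  have h5u := p.five_u
  have e8 : ∀ r, (8 : Expr).eval p.L r = 8 := fun r => p.eval_lit (by norm_num)
  have ekey : (Expr.reg 16 / (8 * Expr.reg 10)).eval p.L reg = rowOf p μ x := by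
    rw [eval_div, eval_reg, h16, eval_mul_of_lt (e8 _)
      (show (Expr.reg 10).eval p.L reg = 2 ^ μ from h.r10) ?_, keyOf_div hQ hb.1 hb.2.1 hx]
    rw [show 8 = 2 ^ 3 by norm_num, ← pow_add]
    exact Nat.pow_lt_pow_right (by norm_num) (by omega)
  set r1 := Function.update reg 24 (rowOf p μ x) with hr1
  have r1v : ∀ z, z ≠ 24 → r1 z = reg z := fun z hz => Function.update_of_ne hz _ _
  have r124 : r1 24 = rowOf p μ x := Function.update_self _ _ _
  have hbr : ∃ r2, (Cmd.ite (.bin .lt (.reg 24) (.reg 6)) (.assign 25 (.reg 24) ⨾ .assign 26 0)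
      (.load 25 (8 * (.reg 24 - .reg 6) + 1) ⨾ .load 26 (8 * (.reg 24 - .reg 6) + 2))).det w p.L
      ⟨r1, ram, y⟩ = ⟨r2, ram, y⟩ ∧ AgreeReg {25, 26} r1 r2 ∧ r2 25 = elemJ p μ ram x ∧
      r2 26 = rowOff p μ ram x := by
    have e6 : r1 6 = 2 ^ p.u := (r1v 6 (by norm_num)).trans h.r6
    by_cases hlt : rowOf p μ x < 2 ^ p.u
    · have ec : (Expr.bin .lt (.reg 24) (.reg 6)).eval p.L r1 = 1 := by
        rw [eval_lt, eval_reg, eval_reg, r124, e6, if_pos hlt]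
        exact p.mod_eq (by omega)
      refine ⟨Function.update (Function.update r1 25 (rowOf p μ x)) 26 0, ?_, ?_, ?_, ?_⟩
      · have e0 : (0 : Expr).eval p.L (Function.update r1 25 (rowOf p μ x)) = 0 := by simp
        rw [Cmd.det]
        simp only [ec]
        simp only [ne_eq, one_ne_zero, not_false_eq_true, if_true, Cmd.det, eval_reg, r124, e0]
      · exact (AgreeReg.update _ _ _).trans (AgreeReg.update _ _ _) (by decide)
      · rw [Function.update_of_ne (by norm_num), Function.update_self, elemJ, if_pos hlt]
      · rw [Function.update_self, rowOff, if_pos hlt]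
    · have ec : (Expr.bin .lt (.reg 24) (.reg 6)).eval p.L r1 = 0 := by
        rw [eval_lt, eval_reg, eval_reg, r124, e6, if_neg hlt, Nat.zero_mod]
      have es : ∀ r : ℕ → ℕ, r 24 = rowOf p μ x → r 6 = 2 ^ p.u → ∀ v ≤ 10,
          (8 * (Expr.reg 24 - Expr.reg 6) + .lit v).eval p.L r =
            8 * (rowOf p μ x - 2 ^ p.u) + v := by
        intro r h24 h6 v hv
        refine eval_add_of_lt (eval_mul_of_lt (p.eval_lit (by norm_num)) ?_ (by omega))
          (p.eval_lit hv) (by omega)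
        rw [eval_sub, eval_reg, eval_reg, h24, h6]
      set e := rowOf p μ x - 2 ^ p.u
      refine ⟨Function.update (Function.update r1 25 (ram (8 * e + 1))) 26 (ram (8 * e + 2)),
        ?_, ?_, ?_, ?_⟩
      · have es1 := es r1 r124 e6 1 (by norm_num)
        have es2 := es (Function.update r1 25 (ram (8 * e + 1)))
          (by rw [Function.update_of_ne (by norm_num), r124])
          (by rw [Function.update_of_ne (by norm_num), e6]) 2 (by norm_num)
        rw [Cmd.det]
        simp only [ec]
        simp only [ne_eq, not_true_eq_false, if_false, Cmd.det]
        erw [es1, es2]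
      · exact (AgreeReg.update _ _ _).trans (AgreeReg.update _ _ _) (by decide)
      · rw [Function.update_of_ne (by norm_num), Function.update_self, elemJ, if_neg hlt]
      · rw [Function.update_self, rowOff, if_neg hlt]
  obtain ⟨r2, d2, a2, v25, v26⟩ := hbr
  have r2v : ∀ z, z ≠ 24 → z ≠ 25 → z ≠ 26 → r2 z = reg z := fun z h1 h2 h3 =>
    (a2 z (by simp [h2, h3])).trans (r1v z h1)
  have r214 : r2 14 = c := (r2v _ (by norm_num) (by norm_num) (by norm_num)).trans h14
  have q2 : QReg p m μ r2 := (h.update (x := 24) (by norm_num) _).agree (by simp) a2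
  have ea : ∀ v < 8, ∀ e : Expr, e.eval p.L r2 = v →
      ((8 * Expr.reg 14 + e) % Expr.reg 5).eval p.L r2 = 8 * c + v := by
    intro v hv e he
    rw [eval_mod, eval_add_of_lt (eval_mul_of_lt (e8 _)
      (show (Expr.reg 14).eval p.L r2 = c from r214) (by omega)) he (by omega), eval_reg, q2.r5,
      Nat.mod_eq_of_lt (by omega)]
  have ea1 := ea 1 (by norm_num) 1 (p.eval_lit (by norm_num))
  have ea2 := ea 2 (by norm_num) 2 (p.eval_lit (by norm_num))
  have ea3 := ea 3 (by norm_num) 3 (p.eval_lit (by norm_num))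
  have eo : (Expr.reg 26 + Expr.reg 8 - Expr.reg 16 % Expr.reg 10).eval p.L r2 =
      elemO p m μ ram x := by
    rw [eval_sub, eval_add_of_lt (show (Expr.reg 26).eval p.L r2 = _ from v26)
      (show (Expr.reg 8).eval p.L r2 = _ from q2.r8) ho, eval_mod, eval_reg, eval_reg, q2.r10,
      r2v 16 (by norm_num) (by norm_num) (by norm_num), h16, keyOf_mod hQ hb.1 hb.2.1 hx]
    rfl
  have et : (Expr.reg 17 - Expr.reg 8).eval p.L r2 = restV w p m μ ram x := by
    rw [eval_sub, eval_reg, eval_reg, q2.r8, r2v 17 (by norm_num) (by norm_num) (by norm_num), h17]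
    rfl
  have ec : (Expr.reg 14 + 1).eval p.L r2 = c + 1 :=
    eval_add_of_lt r214 (p.eval_lit (by norm_num)) (by omega)
  refine ⟨Function.update r2 14 (c + 1), Function.update (Function.update (Function.update ram
    (8 * c + 1) (elemJ p μ ram x)) (8 * c + 2) (elemO p m μ ram x)) (8 * c + 3)
    (restV w p m μ ram x), ?_, ?_, Function.update_self _ _ _, ?_, ?_, ?_, ?_⟩
  · unfold record
    rw [Cmd.det, Cmd.det, ekey, ← hr1, Cmd.det, d2]
    simp only [Cmd.det, ea1, ea2, ea3, eo, et, ec, eval_reg, v25]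
  · exact (((AgreeReg.update _ _ _).trans a2 (S'' := {24, 25, 26}) (by decide)).trans
      (AgreeReg.update _ _ _) (by decide))
  · intro a h1 h2 h3
    rw [Function.update_of_ne h3, Function.update_of_ne h2, Function.update_of_ne h1]
  · rw [Function.update_of_ne (by omega), Function.update_of_ne (by omega), Function.update_self]
  · rw [Function.update_of_ne (by omega), Function.update_self]
  · rw [Function.update_self]

end Record

/-! ### The set of collected slots -/

section Keep

variable {Q n : ℕ} {w : Fin n → ℕ} {p : Par} {m μ E K F : ℕ} {reg₀ ram₀ : ℕ → ℕ}

/-- The marked slots. -/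
noncomputable def marked (Q : ℕ) (w : Fin n → ℕ) (p : Par) (m μ : ℕ) (ram : ℕ → ℕ) :
    Finset (Basis Q) :=
  (slots Q p μ).filter fun x => goodBit w p m μ ram x

/-- The situation at the beginning of a collection of at most `K` slots. -/
structure Base (w : Fin n → ℕ) (p : Par) (m μ E K F : ℕ) (reg₀ ram₀ : ℕ → ℕ) : Prop where
  qreg : QReg p m μ reg₀
  tables : Tables w p ram₀
  off_lt : ∀ e, ram₀ (8 * e + 7) ≠ 0 → ram₀ (8 * e + 2) + 2 ^ m < 2 ^ p.L
  tab_E : ∀ e, E ≤ e → ram₀ (8 * e + 7) = 0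
  cap : reg₀ 15 = E + K
  free : 16 * (F + K * p.L + p.L + 1) ≤ p.S
  size : 8 * (E + K) + 8 ≤ p.S

/-- The slots in `A` have been collected. -/
structure Collected (w : Fin n → ℕ) (p : Par) (m μ E K F : ℕ) (reg₀ ram₀ : ℕ → ℕ)
    (cs : (ℕ → ℕ) × (ℕ → ℕ)) (A : Finset (Basis Q)) : Prop where
  agree : AgreeReg {11, 12, 13, 14, 16, 17, 18, 19, 20, 21, 24, 25, 26, 28, 29} reg₀ cs.1
  count : cs.1 14 = E + A.card
  free : cs.1 21 ≤ F + A.card * p.L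
  tab : ∀ e, cs.2 (8 * e + 7) = ram₀ (8 * e + 7)
  old : ∀ e < E, cs.2 (8 * e + 1) = ram₀ (8 * e + 1) ∧ cs.2 (8 * e + 2) = ram₀ (8 * e + 2)
  sub : A ⊆ marked Q w p m μ ram₀
  card : A.card ≤ K
  trie : ∃ ν, Trie (fun i => cs.2 (8 * i)) (reg₀ 30) (cs.1 21) ν ∧
    ∀ x ∈ slots Q p μ, ν p.L (keyOf p μ x) ≠ 0 ↔ x ∈ A
  list : ∃ f : ℕ → Basis Q, (Finset.range A.card).image f = A ∧ ∀ i < A.card,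
    cs.2 (8 * (E + i) + 1) = elemJ p μ ram₀ (f i) ∧
    cs.2 (8 * (E + i) + 2) = elemO p m μ ram₀ (f i) ∧
    cs.2 (8 * (E + i) + 3) = restV w p m μ ram₀ (f i)

lemma Collected.of_reg {r r' ram : ℕ → ℕ} {A : Finset (Basis Q)}
    (h : Collected w p m μ E K F reg₀ ram₀ (r, ram) A) {S : Finset ℕ} (ha : AgreeReg S r r')
    (hS : S ⊆ {11, 12, 13, 16, 17, 18, 19, 20, 24, 25, 26, 28, 29}) :
    Collected w p m μ E K F reg₀ ram₀ (r', ram) A where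
  agree := h.agree.trans ha (Finset.union_subset subset_rfl (hS.trans (by decide)))
  count := (ha 14 fun hm => by simpa using hS hm).trans h.count
  free := (ha 21 fun hm => by simpa using hS hm).trans_le h.free
  tab := h.tab
  old := h.old
  sub := h.sub
  card := h.card
  trie := by
    have e : r' 21 = r 21 := ha 21 fun hm => by simpa using hS hm
    simp only [e]
    exact h.trie
  list := h.list

lemma Collected.qreg {cs : (ℕ → ℕ) × (ℕ → ℕ)} {A : Finset (Basis Q)}
    (hB : Base w p m μ E K F reg₀ ram₀) (h : Collected w p m μ E K F reg₀ ram₀ cs A) :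
    QReg p m μ cs.1 := hB.qreg.agree (by decide) h.agree

lemma tables_congr {ram : ℕ → ℕ} (ht : Tables w p ram₀)
    (h : ∀ e, ram (8 * e + 7) = ram₀ (8 * e + 7)) : Tables w p ram where
  n_eq := ht.n_eq
  w_lt := ht.w_lt
  tab_lt e := by rw [h]; exact ht.tab_lt e
  tab_zero e he := by rw [h]; exact ht.tab_zero e he

lemma rowVal_congr {ram : ℕ → ℕ} (h : ∀ e, ram (8 * e + 7) = ram₀ (8 * e + 7)) (r : ℕ) :
    rowVal w p ram r = rowVal w p ram₀ r := by
  unfold rowVal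
  rw [h]

lemma goodBit_iff (hQ : Q = 9 * p.L) (h : QReg p m μ reg₀) (ht : Tables w p ram₀) {x : Basis Q}
    (hx : x ∈ slots Q p μ) : goodBit w p m μ ram₀ x = true ↔ good w p m μ ram₀ x :=
  bitAt_computeB_out hQ h.hm h.hμ ht hx

lemma goodBit_congr (hQ : Q = 9 * p.L) (hq : QReg p m μ reg₀) (ht : Tables w p ram₀) {ram : ℕ → ℕ}
    (h : ∀ e, ram (8 * e + 7) = ram₀ (8 * e + 7)) {x : Basis Q} (hx : x ∈ slots Q p μ) :
    goodBit w p m μ ram x = goodBit w p m μ ram₀ x := by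
  rw [Bool.eq_iff_iff, goodBit_iff hQ hq ht hx, goodBit_iff hQ hq (tables_congr ht h) hx, good, good,
    rowVal_congr h]

lemma marked_congr (hQ : Q = 9 * p.L) (hq : QReg p m μ reg₀) (ht : Tables w p ram₀) {ram : ℕ → ℕ}
    (h : ∀ e, ram (8 * e + 7) = ram₀ (8 * e + 7)) :
    marked Q w p m μ ram = marked Q w p m μ ram₀ :=
  Finset.filter_congr fun x hx => by rw [goodBit_congr hQ hq ht h hx]

/-- The low bits alone stay below `2 ^ μ`. Consequently unused rows, whose value is zero, are never
marked. -/
lemma rowVal_pos_of_good {x : Basis Q} (h : good w p m μ ram₀ x) :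
    rowVal w p ram₀ (rowOf p μ x) ≠ 0 := by
  intro h0
  rw [good, h0, Nat.zero_mod, zero_add] at h
  rcases h with h | h
  · have := Nat.two_pow_pos m; omega
  · have := blockVal_lt μ 0 x; unfold lowOf at h; omega

/-- The search does not exclude slots that are already known; the trie recognizes them. Since
inserting a known slot does not change the set, one formula covers new and repeated slots. -/
lemma det_keep (hB : Base w p m μ E K F reg₀ ram₀) (hQ : Q = 9 * p.L) {reg ram : ℕ → ℕ}
    {A : Finset (Basis Q)} (h : Collected w p m μ E K F reg₀ ram₀ (reg, ram) A) {x : Basis Q}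
    (hx : x ∈ slots Q p μ) (h16 : reg 16 = keyOf p μ x)
    (h17 : reg 17 = rowVal w p ram (rowOf p μ x))
    (h18 : reg 18 = (goodBit w p m μ ram x).toNat) (y : Basis Q) :
    ∃ reg' ram', keep.det w p.L ⟨reg, ram, y⟩ = ⟨reg', ram', y⟩ ∧
      Collected w p m μ E K F reg₀ ram₀ (reg', ram')
        (if x ∈ marked Q w p m μ ram₀ ∧ A.card < K then insert x A else A) ∧
      reg' 13 = reg 13 := by
  have hq := h.qreg hB
  have hb := hq.bounds
  have hS := p.S_lt
  have h5u := p.five_u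
  have e15 : reg 15 = E + K := (h.agree 15 (by decide)).trans hB.cap
  have e14 : reg 14 = E + A.card := h.count
  have hcond : (Expr.reg 18 * Expr.bin .lt (.reg 14) (.reg 15)).eval p.L reg =
      if x ∈ marked Q w p m μ ram₀ ∧ A.card < K then 1 else 0 := by
    have e1 : (Expr.bin .lt (.reg 14) (.reg 15)).eval p.L reg = if A.card < K then 1 else 0 := by
      simp only [eval_lt, eval_reg, e14, e15, Nat.add_lt_add_iff_left]
      exact p.mod_eq (by split_ifs <;> omega)
    have e2 : x ∈ marked Q w p m μ ram₀ ↔ goodBit w p m μ ram x = true := by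
      rw [marked, Finset.mem_filter, goodBit_congr hQ hB.qreg hB.tables h.tab hx]
      exact ⟨fun h => h.2, fun h => ⟨hx, h⟩⟩
    rw [eval_mul_of_lt (show (Expr.reg 18).eval p.L reg = _ from h18) e1]
    · simp only [e2]
      cases goodBit w p m μ ram x <;> simp
    · have := Bool.toNat_le (goodBit w p m μ ram x)
      split_ifs <;> omega
  by_cases hc : x ∈ marked Q w p m μ ram₀ ∧ A.card < K
  swap
  · rw [if_neg hc] at hcond ⊢
    refine ⟨reg, ram, ?_, h, rfl⟩
    simp only [keep, Cmd.det, hcond, ne_eq, not_true_eq_false, if_false]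
  rw [if_pos hc] at hcond ⊢
  obtain ⟨hxM, hAK⟩ := hc
  obtain ⟨ν₀, hν₀, hA⟩ := h.trie
  have hf := h.free
  have hBf := hB.free
  simp only at hν₀ hf
  have hκ := keyOf_lt hb.1 hb.2.1 x
  set r1 := Function.update reg 19 (reg₀ 30) with hr1
  set r2 := Function.update r1 20 0 with hr2
  have r2v : ∀ z, z ≠ 19 → z ≠ 20 → r2 z = reg z := fun z h1 h2 =>
    (Function.update_of_ne h2 _ _).trans (Function.update_of_ne h1 _ _)
  have a2 : AgreeReg {19, 20} reg r2 :=
    (AgreeReg.update _ _ _).trans (AgreeReg.update _ _ _) (by decide)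
  have hq2 : QReg p m μ r2 := hq.agree (by decide) a2
  have hmul : A.card * p.L ≤ K * p.L := Nat.mul_le_mul_right _ hAK.le
  obtain ⟨r3, m3, d3, a3, hm3, n3, ⟨f3, f3'⟩, ν, hν, hνx, hνe⟩ := det_walk (w := w) (p := p)
    (reg := r2) (ram := ram) (κ := keyOf p μ x) hq2.r2 hq2.r5
    ((r2v 16 (by norm_num) (by norm_num)).trans h16)
    (by rw [hr2, Function.update_of_ne (by norm_num), hr1, Function.update_self])
    (Function.update_self _ _ _) (r2v 21 (by norm_num) (by norm_num)) hν₀ (by omega) y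
  rw [Nat.mod_eq_of_lt hκ] at n3 hνx hνe
  have e30 : (Expr.reg 30).eval p.L reg = reg₀ 30 := h.agree 30 (by decide)
  have e0 : (0 : Expr).eval p.L r1 = 0 := by simp
  have b3 : AgreeReg {11, 19, 20, 21, 28, 29} reg r3 := a2.trans a3 (by decide)
  have hdet : keep.det w p.L ⟨reg, ram, y⟩ =
      (Cmd.ite (.reg 20) record .skip).det w p.L ⟨r3, m3, y⟩ := by
    unfold keep
    rw [Cmd.det]
    simp only [hcond]
    simp only [ne_eq, one_ne_zero, not_false_eq_true, if_true]
    rw [Cmd.det, Cmd.det, e30, ← hr1, Cmd.det, Cmd.det, e0, ← hr2, Cmd.det, d3]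
  have htab3 : ∀ e, m3 (8 * e + 7) = ram₀ (8 * e + 7) := fun e =>
    (hm3 _ (by omega)).trans (h.tab e)
  have hkey : ∀ z ∈ slots Q p μ, ν p.L (keyOf p μ z) ≠ 0 ↔ z ∈ insert x A := by
    intro z hz
    rw [Finset.mem_insert]
    by_cases hzx : z = x
    · simp only [hzx, true_or, iff_true]; exact hνx
    · rw [hνe _ fun he => hzx (keyOf_injOn hz hx he), hA z hz]
      simp [hzx]
  have hcnt : r3 14 = E + A.card := (b3 14 (by decide)).trans e14
  by_cases hn : ν₀ p.L (keyOf p μ x) = 0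
  swap
  · rw [if_neg hn] at n3
    have hxA : x ∈ A := (hA x hx).1 hn
    rw [Finset.insert_eq_of_mem hxA] at hkey ⊢
    refine ⟨r3, m3, ?_, ?_, b3 13 (by decide)⟩
    · rw [hdet, Cmd.det]
      simp only [eval_reg, n3]
      simp only [ne_eq, not_true_eq_false, if_false, Cmd.det]
    · have f21 : r3 21 = reg 21 := (f3' n3).trans (r2v 21 (by norm_num) (by norm_num))
      exact
        { agree := h.agree.trans b3 (by decide)
          count := hcnt
          free := by simp only [f21]; exact hf
          tab := htab3
          old := fun e he => by
            simp only [hm3 (8 * e + 1) (by omega), hm3 (8 * e + 2) (by omega)]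
            exact h.old e he
          sub := h.sub
          card := h.card
          trie := ⟨ν, hν, hkey⟩
          list := by
            obtain ⟨f, hf1, hf2⟩ := h.list
            refine ⟨f, hf1, fun i hi => ?_⟩
            simp only [hm3 (8 * (E + i) + 1) (by omega), hm3 (8 * (E + i) + 2) (by omega),
              hm3 (8 * (E + i) + 3) (by omega)]
            exact hf2 i hi }
  · rw [if_pos hn] at n3
    have hxA : x ∉ A := fun hxA => (hA x hx).2 hxA hn
    have hgood : good w p m μ ram₀ x :=
      (goodBit_iff hQ hB.qreg hB.tables hx).1 (Finset.mem_filter.1 hxM).2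
    have hpos := rowVal_pos_of_good hgood
    have hrow : rowOf p μ x < 2 ^ p.u + E := by
      by_contra hge
      apply hpos
      rw [rowVal, if_neg (by omega), hB.tab_E _ (by omega)]
    -- The row of a marked slot belongs to the first `E` entries, which the appended ones do not
    -- touch.
    have hold1 : ¬ rowOf p μ x < 2 ^ p.u → m3 (8 * (rowOf p μ x - 2 ^ p.u) + 1) =
        ram₀ (8 * (rowOf p μ x - 2 ^ p.u) + 1) := fun hge =>
      (hm3 _ (by omega)).trans (h.old _ (by omega)).1
    have hold2 : ¬ rowOf p μ x < 2 ^ p.u → m3 (8 * (rowOf p μ x - 2 ^ p.u) + 2) =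
        ram₀ (8 * (rowOf p μ x - 2 ^ p.u) + 2) := fun hge =>
      (hm3 _ (by omega)).trans (h.old _ (by omega)).2
    have hJ : elemJ p μ m3 x = elemJ p μ ram₀ x := by
      unfold elemJ
      split_ifs with h1
      · rfl
      · exact hold1 h1
    have hoff : rowOff p μ m3 x = rowOff p μ ram₀ x := by
      unfold rowOff
      split_ifs with h1
      · rfl
      · exact hold2 h1
    have hO : elemO p m μ m3 x = elemO p m μ ram₀ x := by unfold elemO; rw [hoff]
    have hR : restV w p m μ m3 x = restV w p m μ ram₀ x := by
      unfold restV; rw [rowVal_congr htab3]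
    have hmL : 2 ^ m < 2 ^ p.L := Nat.pow_lt_pow_right (by norm_num) (by omega)
    have hBs := hB.size
    obtain ⟨r4, m4, d4, a4, c4, hm4, j4, o4, t4⟩ := det_record (w := w) (p := p) (m := m) (μ := μ)
      (reg := r3) (ram := m3) (c := E + A.card) (E := E) (hq2.agree (by decide) a3) hQ hx hcnt
      ((b3 16 (by decide)).trans h16)
      ((b3 17 (by decide)).trans (h17.trans (by rw [rowVal_congr h.tab, rowVal_congr htab3])))
      (by omega) (by
        rw [hoff]
        unfold rowOff
        split_ifs with h1
        · omega
        · refine hB.off_lt _ ?_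
          rwa [rowVal, if_neg h1] at hpos) (by omega) hrow y
    have hcard : (insert x A).card = A.card + 1 := Finset.card_insert_of_notMem hxA
    have b4 : AgreeReg {11, 14, 19, 20, 21, 24, 25, 26, 28, 29} reg r4 := b3.trans a4 (by decide)
    have f21 : r4 21 = r3 21 := a4 21 (by decide)
    have f21' : r2 21 = reg 21 := r2v 21 (by norm_num) (by norm_num)
    refine ⟨r4, m4, ?_, ?_, b4 13 (by decide)⟩
    · rw [hdet, Cmd.det]
      simp only [eval_reg, n3]
      simp only [ne_eq, one_ne_zero, not_false_eq_true, if_true]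
      exact d4
    · exact
        { agree := h.agree.trans b4 (by decide)
          count := by simp only [c4, hcard]; ring
          free := by
            simp only [f21, hcard, add_mul]
            omega
          tab := fun e => by
            simp only [hm4 (8 * e + 7) (by omega) (by omega) (by omega)]
            exact htab3 e
          old := fun e he => by
            simp only [hm4 (8 * e + 1) (by omega) (by omega) (by omega),
              hm4 (8 * e + 2) (by omega) (by omega) (by omega), hm3 (8 * e + 1) (by omega),
              hm3 (8 * e + 2) (by omega)]
            exact h.old e he
          sub := Finset.insert_subset hxM h.sub
          card := by omega
          trie := ⟨ν, by
            have : (fun i => m4 (8 * i)) = fun i => m3 (8 * i) := by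
              funext i; exact hm4 _ (by omega) (by omega) (by omega)
            simp only [f21, this]
            exact hν, hkey⟩
          list := by
            obtain ⟨f, hf1, hf2⟩ := h.list
            refine ⟨Function.update f A.card x, ?_, fun i hi => ?_⟩
            · rw [hcard, Finset.range_add_one, Finset.image_insert, Function.update_self]
              congr 1
              conv_rhs => rw [← hf1]
              refine Finset.image_congr fun i hi => ?_
              rw [Finset.coe_range, Set.mem_Iio] at hi
              exact Function.update_of_ne (by omega) _ _
            · rw [hcard] at hi
              by_cases hi2 : i = A.card
              · subst hi2
                rw [Function.update_self]
                exact ⟨j4.trans hJ, o4.trans hO, t4.trans hR⟩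
              · have := hf2 i (by omega)
                simp only at this
                rw [Function.update_of_ne hi2]
                simp only [hm4 (8 * (E + i) + 1) (by omega) (by omega) (by omega),
                  hm4 (8 * (E + i) + 2) (by omega) (by omega) (by omega),
                  hm4 (8 * (E + i) + 3) (by omega) (by omega) (by omega),
                  hm3 (8 * (E + i) + 1) (by omega), hm3 (8 * (E + i) + 2) (by omega),
                  hm3 (8 * (E + i) + 3) (by omega)]
                exact this }

end Keep

/-! ### Programs that simulate random attempts -/

section Simulation

variable {Q n : ℕ} {w : Fin n → ℕ} {L K : ℕ} {M : Finset (Basis Q)}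

/-- Started in a situation `I`, the program `P` ends in the situation `J` and makes attempts with
the probabilities `qs`. -/
def Sim (w : Fin n → ℕ) (L : ℕ) (M : Finset (Basis Q)) (K : ℕ) (P : Cmd)
    (I J : (ℕ → ℕ) × (ℕ → ℕ) → Finset (Basis Q) → Prop) (qs : List ℝ) : Prop :=
  ∀ (g : Finset (Basis Q) → ℝ) (h : (ℕ → ℕ) × (ℕ → ℕ) → ℝ), (∀ cs, 0 ≤ h cs) →
    (∀ cs A, J cs A → g A ≤ h cs) → ∀ cs A, I cs A → draws M K qs g A ≤ P.ex Q w L h cs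

variable {I J I' : (ℕ → ℕ) × (ℕ → ℕ) → Finset (Basis Q) → Prop} {P R : Cmd} {qs qs' : List ℝ}

lemma Sim.seq (hP : Sim w L M K P I J qs) (hR : Sim w L M K R J I' qs') :
    Sim w L M K (P ⨾ R) I I' (qs ++ qs') := by
  intro g h hh hg cs A hA
  rw [draws_append]
  exact (hP _ _ (ex_nonneg R hh) (hR g h hh hg) cs A hA).trans (ex_seq_le P R hh cs)

lemma Sim.loop {N : ℕ} {I : ℕ → (ℕ → ℕ) × (ℕ → ℕ) → Finset (Basis Q) → Prop} {qs : ℕ → List ℝ}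
    {e : Expr} (h : ∀ j < N, Sim w L M K P (I j) (I (j + 1)) (qs j)) :
    Sim w L M K (.loop e P) (fun cs A => I 0 cs A ∧ e.eval L cs.1 = N) (I N)
      ((List.range N).flatMap qs) := by
  intro g f hf hg cs A hA
  -- Backward induction: `i` is the number of rounds still to come.
  have key : ∀ i ≤ N, (∀ cs, 0 ≤ (P.ex Q w L)^[i] f cs) ∧ ∀ cs A, I (N - i) cs A →
      draws M K ((List.range' (N - i) i).flatMap qs) g A ≤ (P.ex Q w L)^[i] f cs := by
    intro i
    induction i with
    | zero => exact fun _ => ⟨hf, fun cs A hA => hg cs A hA⟩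
    | succ i ih =>
      intro hi
      obtain ⟨ih1, ih2⟩ := ih (by omega)
      rw [Function.iterate_succ_apply']
      refine ⟨ex_nonneg P ih1, fun cs A hA => ?_⟩
      rw [List.range'_succ, List.flatMap_cons, draws_append]
      rw [show N - (i + 1) + 1 = N - i by omega]
      refine h (N - (i + 1)) (by omega) _ _ ih1 ?_ cs A hA
      rw [show N - (i + 1) + 1 = N - i by omega]
      exact ih2
  have := (key N le_rfl).2 cs A (by rw [Nat.sub_self]; exact hA.1)
  rw [Nat.sub_self, ← List.range_eq_range'] at this
  refine this.trans ?_
  rw [← hA.2]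
  exact ex_loop_le e P hf cs

lemma Sim.mono (h : Sim w L M K P I J qs) {I₁ J₁ : (ℕ → ℕ) × (ℕ → ℕ) → Finset (Basis Q) → Prop}
    (hI : ∀ cs A, I₁ cs A → I cs A) (hJ : ∀ cs A, J cs A → J₁ cs A) : Sim w L M K P I₁ J₁ qs :=
  fun g f hf hg cs A hA => h g f hf (fun cs A hA => hg cs A (hJ cs A hA)) cs A (hI cs A hA)

/-- Classical bookkeeping contributes no attempt and must preserve the collected set. -/
lemma sim_det {b : Bool} (hP : P.classical b = true) (h : ∀ cs A, I cs A → ∃ cs' : (ℕ → ℕ) × (ℕ → ℕ),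
    P.det w L (⟨cs.1, cs.2, zeroB⟩ : DState Q) = ⟨cs'.1, cs'.2, zeroB⟩ ∧ J cs' A) :
    Sim w L M K P I J [] := by
  intro g f hf hg cs A hA
  obtain ⟨cs', h1, h2⟩ := h cs A hA
  exact (hg cs' A h2).trans (le_ex_of_det (h := f) hP h1)

lemma flatMap_const_eq_rounds (N : ℕ) (qs : List ℝ) :
    (List.range N).flatMap (fun _ => qs) = rounds N qs := by
  simp [rounds, List.flatMap, List.map_const']

lemma rounds_rounds (R R' : ℕ) (qs : List ℝ) : rounds R (rounds R' qs) = rounds (R * R') qs := by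
  induction R with
  | zero => simp [rounds]
  | succ R ih =>
    simp only [rounds] at ih ⊢
    rw [List.replicate_succ, List.flatten_cons, ih, add_mul, one_mul, add_comm,
      List.replicate_add, List.flatten_append]

lemma Sim.repeat {N : ℕ} {e : Expr} (h : Sim w L M K P I I qs) :
    Sim w L M K (.loop e P) (fun cs A => I cs A ∧ e.eval L cs.1 = N) I (rounds N qs) := by
  rw [← flatMap_const_eq_rounds]
  exact Sim.loop (I := fun _ => I) (fun _ _ => h)

end Simulation

/-! ### Attempts, rounds and collections -/

section Search

variable {Q n : ℕ} {w : Fin n → ℕ} {p : Par} {m μ E K F : ℕ} {reg₀ ram₀ : ℕ → ℕ}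

/-- The probability to find a given one among `h` marked ones of `N` slots after `t` rounds. -/
noncomputable def rate (h N : ℝ) (t : ℕ) : ℝ :=
  Real.sin ((2 * t + 1) * Real.arcsin √(h / N)) ^ 2 / h

/-- The product determines the rate unless `M` is empty, and then the rate does not matter. This
absorbs the division by the number of marked slots in `rate`. -/
lemma draw_congr {M : Finset (Basis Q)} {q q' : ℝ} (h : q * M.card = q' * M.card)
    (g : Finset (Basis Q) → ℝ) (A : Finset (Basis Q)) : draw M K q g A = draw M K q' g A := by
  unfold draw
  rw [h]
  split_ifs
  · congr 1
    refine Finset.sum_congr rfl fun x hx => ?_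
    have : (0 : ℝ) < M.card := by exact_mod_cast Finset.card_pos.2 ⟨x, hx⟩
    rw [mul_right_cancel₀ this.ne' h]
  · rfl

/-- One attempt. -/
lemma sim_attempt (hB : Base w p m μ E K F reg₀ ram₀) (hQ : Q = 9 * p.L) {t : ℕ} (ht : t < p.T) :
    Sim w p.L (marked Q w p m μ ram₀) K (amplify ⨾ readout ⨾ keep)
      (fun cs A => Collected w p m μ E K F reg₀ ram₀ cs A ∧ cs.1 13 = t)
      (fun cs A => Collected w p m μ E K F reg₀ ram₀ cs A ∧ cs.1 13 = t)
      [rate (marked Q w p m μ ram₀).card (2 ^ (μ + p.u + 1)) t] := by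
  rintro g h hh hg ⟨reg, ram⟩ A ⟨hA, h13⟩
  simp only at h13
  have hq : QReg p m μ reg := hA.qreg hB
  have hb := hq.bounds
  have htab := tables_congr hB.tables hA.tab
  obtain ⟨v, hv⟩ := leads_amplify (w := w) (ram := ram) hq hQ (h13 ▸ ht)
  rw [h13] at hv
  set r1 := Function.update reg 11 v with hr1
  have hq1 : QReg p m μ r1 := hq.update (le_refl 11) v
  have hA1 : Collected w p m μ E K F reg₀ ram₀ (r1, ram) A :=
    hA.of_reg (AgreeReg.update reg 11 v) (by decide)
  obtain ⟨q, -, hq2, hq3, hq4, hq5⟩ := grover (Q := Q) (l := freeList p μ)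
    (f := goodBit w p m μ ram) (z := startBit p μ) (y := baseB p μ)
    (fun i hi => by rw [mem_freeList] at hi; omega) freeList_nodup
    (fun x hx => bitAt_and hQ hb.1 hb.2.1 hx) t
  have hM : (coset (freeList p μ) (baseB p μ)).filter (fun x => goodBit w p m μ ram x) =
      marked Q w p m μ ram₀ := marked_congr hQ hB.qreg hB.tables hA.tab
  set M := marked Q w p m μ ram₀ with hMdef
  rw [hM, length_freeList] at hq3
  set ψ := (groverStep (freeList p μ) (goodBit w p m μ ram) (startBit p μ))^[t]
    (hadList (freeList p μ) (ket (baseB p μ)) : Vec Q) with hψ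
  have hdet : ∀ x ∈ slots Q p μ, ∃ reg' ram', (readout ⨾ keep).det w p.L ⟨r1, ram, x⟩ =
      ⟨reg', ram', zeroB⟩ ∧ Collected w p m μ E K F reg₀ ram₀ (reg', ram')
        (if x ∈ M ∧ A.card < K then insert x A else A) ∧ reg' 13 = t := by
    intro x hx
    obtain ⟨r2, d2, a2, v16, v17, v18⟩ := det_readout (w := w) hq1 hQ htab hx
    have hA2 := hA1.of_reg a2 (by decide)
    obtain ⟨r3, m3, d3, hA3, v13⟩ := det_keep hB hQ hA2 hx v16 v17 v18 zeroB
    refine ⟨r3, m3, by rw [Cmd.det, d2, d3], hA3, ?_⟩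
    rw [v13, a2 13 (by decide), hr1, Function.update_of_ne (by norm_num), h13]
  have hle := le_ex_of_leads (w := w) (L := p.L) (P := amplify) (R := readout ⨾ keep) (m := true)
    rfl (h := h) (cs := (reg, ram)) hv (fun x hx => by
      obtain ⟨_, _, d, -, -⟩ := hdet x (hq5 x hx)
      rw [d])
  refine le_trans ?_ hle
  have hsub : M ⊆ slots Q p μ := Finset.filter_subset _ _
  have hstep : ∑ x ∈ slots Q p μ, ‖ψ x‖ ^ 2 * g (if x ∈ M ∧ A.card < K then insert x A else A) ≤
      ∑ x, ‖ψ x‖ ^ 2 * h (((readout ⨾ keep).det w p.L ⟨r1, ram, x⟩).reg,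
        ((readout ⨾ keep).det w p.L ⟨r1, ram, x⟩).ram) := by
    refine (Finset.sum_le_sum fun x hx => ?_).trans (Finset.sum_le_sum_of_subset_of_nonneg
      (Finset.subset_univ _) fun x _ _ => mul_nonneg (by positivity) (hh _))
    obtain ⟨r', m', d, hc, h13'⟩ := hdet x hx
    rw [d]
    exact mul_le_mul_of_nonneg_left (hg _ _ ⟨hc, h13'⟩) (by positivity)
  refine le_trans (le_of_eq ?_) hstep
  have hrate : rate M.card (2 ^ (μ + p.u + 1)) t * M.card = q * M.card := by
    rw [hq3]
    unfold rate
    by_cases h0 : (M.card : ℝ) = 0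
    · rw [h0]; simp
    · rw [div_mul_cancel₀ _ h0]
      congr 4
      rw [one_div, inv_pow, div_eq_mul_inv]
  simp only [draws]
  rw [draw_congr hrate]
  have hMgood : ∀ x ∈ M, ‖ψ x‖ ^ 2 = q := fun x hx => by
    refine hq2 x (hsub hx) ?_
    rw [← hM, Finset.mem_filter] at hx
    exact hx.2
  have hsM : ∑ x ∈ M, ‖ψ x‖ ^ 2 = q * M.card := by
    rw [Finset.sum_congr rfl hMgood, Finset.sum_const, nsmul_eq_mul, mul_comm]
  -- The weights of all slots add up to one; the share of the unmarked ones is the probability that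
  -- the attempt changes nothing.
  have hrest : ∑ x ∈ slots Q p μ \ M, ‖ψ x‖ ^ 2 = 1 - q * M.card := by
    rw [← hsM, ← hq4]
    have := Finset.sum_sdiff (f := fun x => ‖ψ x‖ ^ 2) hsub
    unfold slots at this ⊢
    linarith
  unfold draw
  by_cases hAK : A.card < K
  · rw [if_pos hAK]
    simp only [hAK, and_true]
    rw [← Finset.sum_sdiff hsub, add_comm]
    congr 1
    · rw [← hrest, Finset.sum_mul]
      refine Finset.sum_congr rfl fun x hx => ?_
      rw [if_neg (Finset.mem_sdiff.1 hx).2]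
    · refine Finset.sum_congr rfl fun x hx => ?_
      rw [if_pos hx, hMgood x hx]
  · rw [if_neg hAK]
    simp only [hAK, and_false, if_false]
    rw [← Finset.sum_mul]
    have : ∑ x ∈ slots Q p μ, ‖ψ x‖ ^ 2 = 1 := hq4
    rw [this, one_mul]

/-- The numbers of rounds of amplitude amplification that are tried. -/
def tries (T : ℕ) : ℕ → ℕ
  | 0 => 0
  | i + 1 => if 2 * tries T i + 1 < T then 2 * tries T i + 1 else tries T i

lemma tries_lt {T : ℕ} (hT : 0 < T) (i : ℕ) : tries T i < T := by
  induction i with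
  | zero => exact hT
  | succ i ih => unfold tries; split_ifs <;> assumption

lemma Par.two_T_le (p : Par) : 2 * p.T ≤ 2 ^ p.L := by
  obtain ⟨τ, h1, h2⟩ := p.T_pow
  rw [h2, ← pow_succ']
  exact Nat.pow_le_pow_right (by norm_num) h1

lemma Par.T_pos (p : Par) : 0 < p.T := by
  obtain ⟨τ, -, h2⟩ := p.T_pow
  rw [h2]; positivity

/-- The probabilities of the attempts of one round. -/
noncomputable def roundRates (p : Par) (μ h : ℕ) : List ℝ :=
  (List.range p.L).map fun i => rate h (2 ^ (μ + p.u + 1)) (tries p.T i)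

lemma sim_searchRound (hB : Base w p m μ E K F reg₀ ram₀) (hQ : Q = 9 * p.L) :
    Sim w p.L (marked Q w p m μ ram₀) K searchRound
      (fun cs A => Collected w p m μ E K F reg₀ ram₀ cs A)
      (fun cs A => Collected w p m μ E K F reg₀ ram₀ cs A)
      (roundRates p μ (marked Q w p m μ ram₀).card) := by
  have h5u := p.five_u
  have hT2 := p.two_T_le
  have hL := p.L_big
  set I : ℕ → (ℕ → ℕ) × (ℕ → ℕ) → Finset (Basis Q) → Prop := fun t cs A =>
    Collected w p m μ E K F reg₀ ram₀ cs A ∧ cs.1 13 = t with hI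
  have h1 : Sim w p.L (marked Q w p m μ ram₀) K (.assign 13 0)
      (fun cs A => Collected w p m μ E K F reg₀ ram₀ cs A)
      (fun cs A => I (tries p.T 0) cs A ∧ wl.eval p.L cs.1 = p.L) [] := by
    refine sim_det (b := true) rfl fun cs A hA => ⟨(Function.update cs.1 13 0, cs.2), ?_, ⟨?_, ?_⟩, ?_⟩
    · simp [Cmd.det]
    · exact hA.of_reg (AgreeReg.update cs.1 13 0) (by decide)
    · simp [tries]
    · simp only [eval_reg]
      rw [Function.update_of_ne (by norm_num)]
      exact (hA.qreg hB).r2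
  have h2 : ∀ i < p.L, Sim w p.L (marked Q w p m μ ram₀) K ((amplify ⨾ readout ⨾ keep) ⨾
      .ite (.bin .lt (2 * .reg 13 + 1) (.reg 4)) (.assign 13 (2 * .reg 13 + 1)) .skip)
      (I (tries p.T i)) (I (tries p.T (i + 1)))
      [rate (marked Q w p m μ ram₀).card (2 ^ (μ + p.u + 1)) (tries p.T i)] := by
    intro i hi
    have ht := tries_lt p.T_pos i
    refine (sim_attempt hB hQ ht).seq (qs' := []) (sim_det (b := true) rfl ?_)
    rintro ⟨reg, ram⟩ A ⟨hA, h13⟩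
    simp only at h13
    have hq : QReg p m μ reg := hA.qreg hB
    have e1 : (2 * Expr.reg 13 + 1).eval p.L reg = 2 * tries p.T i + 1 := by
      rw [← h13] at ht ⊢
      exact eval_add_of_lt (eval_mul_of_lt (p.eval_lit (v := 2) (by norm_num)) rfl
        (by omega)) (p.eval_lit (by norm_num)) (by omega)
    have e2 : (Expr.bin .lt (2 * .reg 13 + 1) (.reg 4)).eval p.L reg =
        if 2 * tries p.T i + 1 < p.T then 1 else 0 := by
      rw [eval_lt, e1, eval_reg, hq.r4]
      exact p.mod_eq (by split_ifs <;> omega)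
    by_cases hc : 2 * tries p.T i + 1 < p.T
    · refine ⟨(Function.update reg 13 (2 * tries p.T i + 1), ram), ?_,
        hA.of_reg (AgreeReg.update reg 13 _) (by decide), ?_⟩
      · rw [Cmd.det]
        simp only [e2, if_pos hc]
        simp only [ne_eq, one_ne_zero, not_false_eq_true, if_true, Cmd.det, e1]
      · simp only [Function.update_self, tries, if_pos hc]
    · refine ⟨(reg, ram), ?_, hA, ?_⟩
      · rw [Cmd.det]
        simp only [e2, if_neg hc]
        simp only [ne_eq, not_true_eq_false, if_false, Cmd.det]
      · simp only [tries, if_neg hc, h13]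
  have h3 := h1.seq (Sim.loop (e := wl) (I := fun i => I (tries p.T i)) h2)
  have e : ([] ++ (List.range p.L).flatMap fun i =>
      [rate (marked Q w p m μ ram₀).card (2 ^ (μ + p.u + 1)) (tries p.T i)]) =
      roundRates p μ (marked Q w p m μ ram₀).card := by
    rw [List.nil_append, roundRates, List.map_eq_flatMap]
  rw [e] at h3
  exact h3.mono (fun _ _ h => h) fun _ _ h => h.1

/-- The registers after the first instructions of a collection. -/
def collectReg (reg : ℕ → ℕ) : ℕ → ℕ :=
  Function.update (Function.update (Function.update reg 30 (reg 21)) 21 (reg 21 + 1)) 14 (reg 22)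

lemma collectReg_agree (reg : ℕ → ℕ) : AgreeReg {14, 21, 30} reg (collectReg reg) :=
  (((AgreeReg.update _ _ _).trans (AgreeReg.update _ _ _) (S'' := {21, 30}) (by decide)).trans
    (AgreeReg.update _ _ _) (by decide))

/-- The first instructions open an empty trie at the free node and let the list continue behind the
`E` old entries; this is the situation with the empty set collected, and the nested loops are rounds
in a row. -/
lemma le_ex_collect {reg ram : ℕ → ℕ} {a : ℕ} (hB : Base w p m μ E K F (collectReg reg) ram)
    (hQ : Q = 9 * p.L) (ha : a ≤ p.L) (hE : reg 22 = E) (hf0 : reg 21 ≠ 0) (hF : reg 21 + 1 ≤ F)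
    (hfresh : ∀ i, 2 * reg 21 ≤ i → ram (8 * i) = 0)
    {g : Finset (Basis Q) → ℝ} {h : (ℕ → ℕ) × (ℕ → ℕ) → ℝ} (hh : ∀ cs, 0 ≤ h cs)
    (hg : ∀ cs A, Collected w p m μ E K F (collectReg reg) ram cs A → g A ≤ h cs) :
    draws (marked Q w p m μ ram) K (rounds (p.k * (a * p.L))
      (roundRates p μ (marked Q w p m μ ram).card)) g ∅ ≤ (collect a).ex Q w p.L h (reg, ram) := by
  have h5u := p.five_u
  have hL := p.L_big
  have hS := p.S_lt
  have hfr := hB.free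
  have hk := p.one_le_k
  have haL : a * p.L < 2 ^ p.L := by
    have : a * p.L ≤ p.S := by
      unfold Par.S
      exact (Nat.mul_le_mul_right _ ha).trans (Nat.mul_le_mul_right _
        (Nat.le_mul_of_pos_left _ (by omega)))
    omega
  have s1 : Sim w p.L (marked Q w p m μ ram) K (.loop (.lit a * wl) searchRound)
      (fun cs A => Collected w p m μ E K F (collectReg reg) ram cs A)
      (fun cs A => Collected w p m μ E K F (collectReg reg) ram cs A)
      (rounds (a * p.L) (roundRates p μ (marked Q w p m μ ram).card)) := by
    refine (Sim.repeat (sim_searchRound hB hQ)).mono (fun cs A hA => ⟨hA, ?_⟩) fun _ _ h => h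
    have hal : a < 2 ^ p.L := by omega
    exact eval_mul_of_lt (Nat.mod_eq_of_lt hal) (hA.qreg hB).r2 haL
  have s2 : Sim w p.L (marked Q w p m μ ram) K (.loop (.reg 1) (.loop (.lit a * wl) searchRound))
      (fun cs A => Collected w p m μ E K F (collectReg reg) ram cs A)
      (fun cs A => Collected w p m μ E K F (collectReg reg) ram cs A)
      (rounds (p.k * (a * p.L)) (roundRates p μ (marked Q w p m μ ram).card)) := by
    rw [← rounds_rounds]
    exact (Sim.repeat s1).mono (fun cs A hA => ⟨hA, (hA.qreg hB).r1⟩) fun _ _ h => h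
  have s3 := s2 g h hh hg (collectReg reg, ram) ∅
    { agree := fun _ _ => rfl
      count := by simp [collectReg, hE]
      free := by
        simp only [collectReg, Finset.card_empty, zero_mul, add_zero]
        rw [Function.update_of_ne (by norm_num), Function.update_self]
        exact hF
      tab := fun _ => rfl
      old := fun _ _ => ⟨rfl, rfl⟩
      sub := Finset.empty_subset _
      card := by simp
      trie := by
        have e30 : collectReg reg 30 = reg 21 := by
          unfold collectReg
          rw [Function.update_of_ne (by norm_num), Function.update_of_ne (by norm_num),
            Function.update_self]
        have e21 : collectReg reg 21 = reg 21 + 1 := by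
          unfold collectReg
          rw [Function.update_of_ne (by norm_num), Function.update_self]
        simp only [e30, e21]
        refine ⟨_, trie_root hf0 hfresh, fun x hx => ?_⟩
        rw [if_neg (by omega)]
        simp
      list := ⟨fun _ => zeroB, by simp⟩ }
  refine s3.trans ?_
  unfold collect
  refine le_trans ?_ (ex_seq_le _ _ hh _)
  rw [ex_assign]
  refine le_trans ?_ (ex_seq_le _ _ hh _)
  rw [ex_assign]
  refine le_trans ?_ (ex_seq_le _ _ hh _)
  rw [ex_assign]
  have e : (Expr.reg 21 + 1).eval p.L (Function.update reg 30 (reg 21)) = reg 21 + 1 := by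
    refine eval_add_of_lt ?_ (p.eval_lit (by norm_num)) ?_
    · rw [eval_reg, Function.update_of_ne (by norm_num)]
    · omega
  simp only [eval_reg, e]
  rw [Function.update_of_ne (show (22 : ℕ) ≠ 21 by norm_num),
    Function.update_of_ne (show (22 : ℕ) ≠ 30 by norm_num)]
  exact le_rfl

end Search

/-! ### Lower bounds for the success probabilities -/

section Rates

/-- Since `T` is a power of two, doubling ends exactly at `T - 1`. The rotation angles `(2 t + 1) θ`
become `(2 * 2 ^ i - 1) θ`. -/
lemma tries_two_pow {τ i : ℕ} (hi : i ≤ τ) : tries (2 ^ τ) i = 2 ^ i - 1 := by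
  induction i with
  | zero => rfl
  | succ i ih =>
    have h1 := Nat.one_le_two_pow (n := i)
    have h2 : 2 ^ (i + 1) ≤ 2 ^ τ := Nat.pow_le_pow_right (by norm_num) hi
    rw [pow_succ] at h2
    rw [tries, ih (by omega), if_pos (by omega), pow_succ]
    omega

lemma rate_nonneg (h N : ℝ) (hh : 0 ≤ h) (t : ℕ) : 0 ≤ rate h N t := by
  unfold rate; positivity

lemma rate_mul_le (h N : ℝ) (t : ℕ) : rate h N t * h ≤ 1 := by
  unfold rate
  by_cases h0 : h = 0
  · rw [h0]; simp
  · rw [div_mul_cancel₀ _ h0]; exact Real.sin_sq_le_one _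

lemma roundRates_isRate {Q : ℕ} (p : Par) (μ : ℕ) (M : Finset (Basis Q)) :
    ∀ q ∈ roundRates p μ M.card, IsRate M q := by
  intro q hq
  simp only [roundRates, List.mem_map] at hq
  obtain ⟨i, -, rfl⟩ := hq
  exact ⟨rate_nonneg _ _ (by positivity) _, rate_mul_le _ _ _⟩

/-- Doubling the number of rounds either hits a good range of angles or never leaves the range
where the sine is almost linear. -/
lemma exists_sin_sq_ge (θ : ℝ) (h0 : 0 ≤ θ) (h1 : θ ≤ Real.pi / 2) (τ : ℕ) :
    (∃ i ≤ τ, 1 / 4 ≤ Real.sin ((2 * 2 ^ i - 1) * θ) ^ 2) ∨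
      (2 * 2 ^ τ - 1) * θ ≤ Real.pi / 2 := by
  induction τ with
  | zero => right; norm_num; exact h1
  | succ τ ih =>
    rcases ih with ⟨i, hi, h⟩ | h
    · exact Or.inl ⟨i, by omega, h⟩
    by_cases h2 : (2 * 2 ^ (τ + 1) - 1) * θ ≤ Real.pi / 2
    · exact Or.inr h2
    refine Or.inl ⟨τ, by omega, ?_⟩
    have h3 : (1 : ℝ) ≤ 2 ^ τ := one_le_pow₀ (by norm_num)
    rw [not_le, pow_succ] at h2
    -- The next angle exceeds `π / 2` and is at most three times this one.
    have h4 : Real.pi / 6 ≤ (2 * 2 ^ τ - 1) * θ := by nlinarith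
    have h5 : 1 / 2 ≤ Real.sin ((2 * 2 ^ τ - 1) * θ) := by
      rw [← Real.sin_pi_div_six]
      exact Real.sin_le_sin_of_le_of_le_pi_div_two (by linarith [Real.pi_pos]) h h4
    nlinarith

/-- If no tried angle has `sin² ≥ 1 / 4`, then `(2 T - 1) θ` is still at most `π / 2`, and `sin x ≥
2 x / π` together with `θ ≥ √(h / N)` gives success probability at least `(4 / π²) T² h / N`.
Inserting `4 T² k > 2 ^ u`, `N = 2 ^ (μ + u + 1)` and `π² ≤ 10` yields the constant `20`. -/
lemma exists_rate (p : Par) {μ h : ℕ} (hh : h ≤ 2 ^ (μ + p.u + 1)) :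
    ∃ q ∈ roundRates p μ h, min ((h : ℝ) / (20 * p.k * 2 ^ μ)) (1 / 4) ≤ q * h := by
  obtain ⟨τ, hτ, hT⟩ := p.T_pow
  have hk : (1 : ℝ) ≤ p.k := by exact_mod_cast p.one_le_k
  rcases Nat.eq_zero_or_pos h with rfl | hpos
  · refine ⟨rate (0 : ℕ) (2 ^ (μ + p.u + 1)) (tries p.T 0), ?_, by simp⟩
    simp only [roundRates, List.mem_map, List.mem_range]
    exact ⟨0, by omega, rfl⟩
  have hp : (0 : ℝ) < h := by exact_mod_cast hpos
  set N : ℝ := 2 ^ (μ + p.u + 1) with hN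
  have hN0 : 0 < N := by positivity
  set θ := Real.arcsin √(h / N) with hθ
  have hx1 : √(h / N) ≤ 1 := by
    rw [Real.sqrt_le_one, div_le_one hN0]
    rw [hN]; exact_mod_cast hh
  have hθ0 : 0 ≤ θ := Real.arcsin_nonneg.2 (Real.sqrt_nonneg _)
  have hs : Real.sin θ = √(h / N) := Real.sin_arcsin (by linarith [Real.sqrt_nonneg (h / N)]) hx1
  have hmem : ∀ i ≤ τ, ∃ q ∈ roundRates p μ h, q * h = Real.sin ((2 * 2 ^ i - 1) * θ) ^ 2 := by
    intro i hi
    refine ⟨rate h N (tries p.T i), ?_, ?_⟩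
    · simp only [roundRates, List.mem_map, List.mem_range]
      exact ⟨i, by omega, rfl⟩
    · unfold rate
      rw [div_mul_cancel₀ _ hp.ne', hT, tries_two_pow hi, ← hθ, Nat.cast_sub Nat.one_le_two_pow]
      congr 3
      push_cast
      ring
  rcases exists_sin_sq_ge θ hθ0 (Real.arcsin_le_pi_div_two _) τ with ⟨i, hi, h1⟩ | h1
  · obtain ⟨q, hq, e⟩ := hmem i hi
    exact ⟨q, hq, by rw [e]; exact (min_le_right _ _).trans h1⟩
  · obtain ⟨q, hq, e⟩ := hmem τ le_rfl
    refine ⟨q, hq, ?_⟩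
    rw [e]
    refine (min_le_left _ _).trans ?_
    have hT1 : (1 : ℝ) ≤ 2 ^ τ := one_le_pow₀ (by norm_num)
    have hT4 : (2 : ℝ) ^ p.u ≤ 4 * (2 ^ τ) ^ 2 * p.k := by
      have := p.lt_T.le
      rw [hT] at this
      have h2 : ((2 ^ p.u : ℕ) : ℝ) ≤ ((4 * 2 ^ τ * 2 ^ τ * p.k : ℕ) : ℝ) := by exact_mod_cast this
      push_cast at h2
      nlinarith
    have h2 := Real.mul_le_sin (mul_nonneg (by linarith) hθ0) h1
    have h3 : √(h / N) ≤ θ := by rw [← hs]; exact Real.sin_le hθ0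
    have hpi := Real.pi_pos
    have h4 : 2 / Real.pi * (2 ^ τ * √(h / N)) ≤ Real.sin ((2 * 2 ^ τ - 1) * θ) := by
      refine le_trans ?_ h2
      have h7 : (2 : ℝ) ^ τ ≤ 2 * 2 ^ τ - 1 := by linarith
      have h8 : (0 : ℝ) ≤ 2 * 2 ^ τ - 1 := by linarith
      gcongr
    have h5 : (2 / Real.pi * (2 ^ τ * √(h / N))) ^ 2 ≤ Real.sin ((2 * 2 ^ τ - 1) * θ) ^ 2 :=
      pow_le_pow_left₀ (by positivity) h4 2
    refine le_trans ?_ h5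
    rw [mul_pow, mul_pow, div_pow, Real.sq_sqrt (by positivity)]
    have hpi2 : Real.pi ^ 2 ≤ 10 := by
      have := Real.pi_lt_d2
      nlinarith
    have e1 : (h : ℝ) / (20 * p.k * 2 ^ μ) = 2 ^ 2 / 10 * (2 ^ p.u / (4 * p.k) * (h / N)) := by
      rw [hN, pow_add, pow_add]
      field_simp
      norm_num
    rw [e1]
    have h6 : (2 : ℝ) ^ p.u / (4 * p.k) ≤ (2 ^ τ) ^ 2 := by
      rw [div_le_iff₀ (by positivity)]
      linarith
    gcongr

end Rates

/-! ### Slots and the elements they stand for -/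

section Elements

variable {Q n : ℕ} {w : Fin n → ℕ} {p : Par} {m μ d E : ℕ} {ram : ℕ → ℕ}

/-- The first `N` entries of the lists are different pairs `(j, o)` with `d ∣ o`. -/
structure Entries (w : Fin n → ℕ) (ram : ℕ → ℕ) (d N : ℕ) : Prop where
  dvd : ∀ e < N, d ∣ ram (8 * e + 2)
  pos : ∀ e < N, 0 < ram (8 * e + 2)
  le : ∀ e < N, ram (8 * e + 2) ≤ extend w (ram (8 * e + 1))
  inj : ∀ e < N, ∀ e' < N, ram (8 * e + 1) = ram (8 * e' + 1) →
    ram (8 * e + 2) = ram (8 * e' + 2) → e = e'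

/-- The table contains all pairs `(j, o)` with `d ∣ o`. -/
structure Table (w : Fin n → ℕ) (ram : ℕ → ℕ) (d N : ℕ) : Prop extends Entries w ram d N where
  surj : ∀ j o, d ∣ o → 0 < o → o ≤ extend w j → ∃ e < N, ram (8 * e + 1) = j ∧ ram (8 * e + 2) = o
  tab : ∀ e < N, ram (8 * e + 7) = extend w (ram (8 * e + 1)) - ram (8 * e + 2)
  tab_zero : ∀ e, N ≤ e → ram (8 * e + 7) = 0

lemma lt_of_extend_pos {j : ℕ} (h : 0 < extend w j) : j < n := by
  by_contra hn
  rw [extend_of_ge w (by omega)] at h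
  exact lt_irrefl _ h

/-- For each `j` there are `⌊w_j / d⌋` positive multiples of `d` up to `w_j`, and the entries inject
into these. This turns a long list into a lower bound for `W`. -/
lemma Entries.card_le {N : ℕ} (h : Entries w ram d N) : N * d ≤ ∑ j, w j := by
  classical
  set D := (Finset.univ : Finset (Fin n)).sigma fun j => (Finset.Ioc 0 (w j)).filter (d ∣ ·)
  have hD : D.card * d ≤ ∑ j, w j := by
    rw [Finset.card_sigma, Finset.sum_mul]
    refine Finset.sum_le_sum fun j _ => ?_
    rw [Nat.Ioc_filter_dvd_card_eq_div]
    exact Nat.div_mul_le_self _ _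
  refine le_trans (Nat.mul_le_mul_right d ?_) hD
  have hlt : ∀ e : Fin N, ram (8 * e + 1) < n := fun e =>
    lt_of_extend_pos ((h.pos e e.2).trans_le (h.le e e.2))
  have := Finset.card_le_card_of_injOn (s := (Finset.univ : Finset (Fin N))) (t := D)
    (fun e => ⟨⟨ram (8 * e + 1), hlt e⟩, ram (8 * e + 2)⟩) (fun e _ => by
      have hl := h.le e e.2
      rw [extend, dif_pos (hlt e)] at hl
      simp only [D, Finset.coe_sigma, Set.mem_sigma_iff, Finset.coe_univ, Set.mem_univ, true_and,
        Finset.coe_filter, Finset.mem_Ioc, Set.mem_ofPred_eq]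
      exact ⟨⟨h.pos e e.2, hl⟩, h.dvd e e.2⟩) (fun e _ e' _ he => by
      simp only [Sigma.mk.injEq, Fin.mk.injEq, heq_eq_eq] at he
      exact Fin.ext (h.inj e e.2 e' e'.2 he.1 he.2))
  simpa using this

lemma exists_slot (hQ : Q = 9 * p.L) (hm : m + 5 * p.u ≤ p.L) (hμ : μ ≤ m) {r l : ℕ}
    (hr : r < 2 ^ (p.u + 1)) (hl : l < 2 ^ μ) :
    ∃ x ∈ slots Q p μ, rowOf p μ x = r ∧ lowOf μ x = l := by
  have hu := p.u_pos
  set x : Basis Q := fun i => if (i : ℕ) < μ then l.testBit i else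
    if μ + 3 ≤ (i : ℕ) ∧ (i : ℕ) < μ + p.u + 4 then r.testBit (i - (μ + 3)) else baseB p μ i with hx
  have hb : ∀ i < Q, bitAt x i = if i < μ then l.testBit i else
      if μ + 3 ≤ i ∧ i < μ + p.u + 4 then r.testBit (i - (μ + 3)) else
        bitAt (baseB p μ : Basis Q) i := by
    intro i hi
    simp only [bitAt, hi, hx, dif_pos]
  refine ⟨x, mem_coset.2 fun i hi => ?_, ?_, ?_⟩
  · rw [mem_freeList, not_or] at hi
    by_cases hiQ : i < Q
    · rw [hb i hiQ, if_neg hi.1, if_neg hi.2]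
    · simp [bitAt, hiQ]
  · refine blockVal_eq_of_testBit hr fun i hi => ?_
    rw [hb _ (by omega), if_neg (by omega), if_pos (by omega), Nat.add_sub_cancel_left]
  · refine blockVal_eq_of_testBit hl fun i hi => ?_
    rw [zero_add, hb _ (by omega), if_pos hi]

/-- The two stages of the algorithm. -/
def Stage (m μ d : ℕ) : Prop := μ = 0 ∧ d = 2 ^ (m + 1) ∨ μ = m ∧ d = 2 ^ m

lemma Stage.le (h : Stage m μ d) : μ ≤ m := by
  rcases h with ⟨h, -⟩ | ⟨h, -⟩ <;> omega

/-- Oracle rows behave like table rows with offset zero, and a nonzero value rules out the rows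
behind the table. -/
lemma row_spec (ht : Table w ram d E) {x : Basis Q} (hv : rowVal w p ram (rowOf p μ x) ≠ 0) :
    d ∣ rowOff p μ ram x ∧ rowOff p μ ram x ≤ extend w (elemJ p μ ram x) ∧
      rowVal w p ram (rowOf p μ x) = extend w (elemJ p μ ram x) - rowOff p μ ram x := by
  unfold rowOff elemJ
  unfold rowVal at hv ⊢
  split_ifs at hv ⊢ with h
  · simp
  · have he : rowOf p μ x - 2 ^ p.u < E := by
      by_contra hE
      exact hv (ht.tab_zero _ (by omega))
    exact ⟨ht.dvd _ he, ht.le _ he, ht.tab _ he⟩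

lemma lowOf_lt (μ : ℕ) (x : Basis Q) : lowOf μ x < 2 ^ μ := blockVal_lt _ _ _

/-- Being marked says that the value of the row is at least `2 ^ m` minus the low bits, which is the
distance of the element from the offset. -/
lemma elem_le (ht : Table w ram d E) (hs : Stage m μ d) {x : Basis Q} (hx : good w p m μ ram x) :
    elemO p m μ ram x ≤ extend w (elemJ p μ ram x) ∧ rowOff p μ ram x < elemO p m μ ram x := by
  obtain ⟨-, h2, h3⟩ := row_spec ht (rowVal_pos_of_good hx)
  have hl := lowOf_lt μ x
  have hle : 2 ^ μ ≤ 2 ^ m := Nat.pow_le_pow_right (by norm_num) hs.le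
  refine ⟨?_, by unfold elemO; omega⟩
  have h2m := Nat.two_pow_pos m
  unfold elemO
  rw [good, h3] at hx
  rcases hs with ⟨rfl, -⟩ | ⟨rfl, -⟩
  · rw [pow_zero, Nat.mod_one, zero_add] at hx
    rw [pow_zero] at hl
    omega
  · by_cases hc : 2 ^ μ ≤ extend w (elemJ p μ ram x) - rowOff p μ ram x
    · omega
    · rw [Nat.mod_eq_of_lt (by omega)] at hx
      omega

/-- Without low bits the element is the offset plus `2 ^ m`. With them it lies in the interval `(o,
o + 2 ^ m]` above an offset `o` that is a multiple of `2 ^ m`, and these intervals are disjoint. -/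
lemma rowOff_eq_of_elemO_eq (ht : Table w ram d E) (hs : Stage m μ d) {x y : Basis Q}
    (hx : good w p m μ ram x) (hy : good w p m μ ram y)
    (h : elemO p m μ ram x = elemO p m μ ram y) : rowOff p μ ram x = rowOff p μ ram y := by
  have hlx := lowOf_lt μ x
  have hly := lowOf_lt μ y
  obtain ⟨dx, -, -⟩ := row_spec ht (rowVal_pos_of_good hx)
  obtain ⟨dy, -, -⟩ := row_spec ht (rowVal_pos_of_good hy)
  have h2m := Nat.two_pow_pos m
  unfold elemO at h
  rcases hs with ⟨rfl, -⟩ | ⟨rfl, rfl⟩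
  · rw [pow_zero] at hlx hly
    omega
  · obtain ⟨a, ha⟩ := dx
    obtain ⟨b, hb⟩ := dy
    rw [ha, hb] at h ⊢
    have : a = b := by
      rcases lt_trichotomy a b with hab | hab | hab
      · have : 2 ^ μ * (a + 1) ≤ 2 ^ μ * b := Nat.mul_le_mul_left _ hab
        rw [mul_add] at this
        omega
      · exact hab
      · have : 2 ^ μ * (b + 1) ≤ 2 ^ μ * a := Nat.mul_le_mul_left _ hab
        rw [mul_add] at this
        omega
    rw [this]

/-- The second component determines the offset and hence the low bits. Table rows have positive
offset and oracle rows offset zero, so the kinds cannot mix, and within each kind `j` and the offset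
determine the row. -/
lemma elem_inj (hQ : Q = 9 * p.L) (hm : m + 5 * p.u ≤ p.L) (ht : Table w ram d E)
    (hs : Stage m μ d) {x y : Basis Q} (hxs : x ∈ slots Q p μ) (hys : y ∈ slots Q p μ)
    (hx : good w p m μ ram x) (hy : good w p m μ ram y)
    (hJ : elemJ p μ ram x = elemJ p μ ram y) (hO : elemO p m μ ram x = elemO p m μ ram y) :
    x = y := by
  have ho := rowOff_eq_of_elemO_eq ht hs hx hy hO
  have hlx := lowOf_lt μ x
  have hly := lowOf_lt μ y
  have hle : 2 ^ μ ≤ 2 ^ m := Nat.pow_le_pow_right (by norm_num) hs.le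
  have hlow : lowOf μ x = lowOf μ y := by
    unfold elemO at hO
    omega
  have htab : ∀ z : Basis Q, good w p m μ ram z → ¬ rowOf p μ z < 2 ^ p.u →
      rowOf p μ z - 2 ^ p.u < E := by
    intro z hz hge
    by_contra hE
    refine rowVal_pos_of_good hz ?_
    rw [rowVal, if_neg hge]
    exact ht.tab_zero _ (by omega)
  have hrow : rowOf p μ x = rowOf p μ y := by
    have tx := htab x hx
    have ty := htab y hy
    unfold rowOff at ho
    unfold elemJ at hJ
    split_ifs at ho hJ with h1 h2 h2
    · exact hJ
    · have := ht.pos _ (ty h2); omega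
    · have := ht.pos _ (tx h1); omega
    · have := ht.inj _ (tx h1) _ (ty h2) hJ ho; omega
  exact keyOf_injOn hxs hys (by
    rw [keyOf_eq hQ hm hs.le hxs, keyOf_eq hQ hm hs.le hys, hrow, hlow])

/-- The offset `o` has to be the largest multiple of `d` strictly below `l`, and the low bits `o + 2
^ m - l`. In the first stage this leaves no low bits only if `l` is an odd multiple of `2 ^ m`; the
premise `d = 2 ^ (m + 1)` is needed to recognize that stage, since `μ = 0` also occurs in the last
stage at level `0`. -/
lemma elem_surj (hQ : Q = 9 * p.L) (hm : m + 5 * p.u ≤ p.L) (hn : n = p.n) (hE : E ≤ p.k)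
    (ht : Table w ram d E) (hs : Stage m μ d) {j l : ℕ} (hl : 0 < l) (hlw : l ≤ extend w j)
    (h1 : μ = 0 → d = 2 ^ (m + 1) → l % 2 ^ (m + 1) = 2 ^ m) :
    ∃ x ∈ slots Q p μ, good w p m μ ram x ∧ elemJ p μ ram x = j ∧ elemO p m μ ram x = l := by
  have hnu := p.n_lt
  have hkn := p.k_le_n
  have h2m := Nat.two_pow_pos m
  have hj : j < n := lt_of_extend_pos (hl.trans_le hlw)
  obtain ⟨o, hdo, hol, hlo, hlow⟩ : ∃ o, d ∣ o ∧ o < l ∧ l ≤ o + 2 ^ m ∧ o + 2 ^ m - l < 2 ^ μ := by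
    rcases hs with ⟨rfl, rfl⟩ | ⟨rfl, rfl⟩
    · have h := h1 rfl rfl
      have hd := Nat.div_add_mod l (2 ^ (m + 1))
      have hdv := Dvd.intro (l / 2 ^ (m + 1)) (rfl : 2 ^ (m + 1) * _ = _)
      rw [h] at hd
      generalize 2 ^ (m + 1) * (l / 2 ^ (m + 1)) = o at hd hdv
      refine ⟨o, hdv, by omega, by omega, ?_⟩
      rw [pow_zero]; omega
    · have hd := Nat.div_add_mod (l - 1) (2 ^ μ)
      have hd2 := Nat.mod_lt (l - 1) h2m
      have hdv := Dvd.intro ((l - 1) / 2 ^ μ) (rfl : 2 ^ μ * _ = _)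
      generalize 2 ^ μ * ((l - 1) / 2 ^ μ) = o at hd hdv
      exact ⟨o, hdv, by omega, by omega, by omega⟩
  obtain ⟨r, hr, hrJ⟩ : ∃ r < 2 ^ (p.u + 1), (if r < 2 ^ p.u then r else
        ram (8 * (r - 2 ^ p.u) + 1)) = j ∧ (if r < 2 ^ p.u then 0 else
        ram (8 * (r - 2 ^ p.u) + 2)) = o ∧ rowVal w p ram r = extend w j - o := by
    rw [pow_succ]
    rcases Nat.eq_zero_or_pos o with rfl | ho
    · refine ⟨j, by omega, ?_, ?_, ?_⟩
      · rw [if_pos (by omega)]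
      · rw [if_pos (by omega)]
      · rw [rowVal, if_pos (by omega), Nat.sub_zero]
    · obtain ⟨e, he, hJ, hO⟩ := ht.surj j o hdo ho (by omega)
      refine ⟨2 ^ p.u + e, by omega, ?_, ?_, ?_⟩
      · rw [if_neg (by omega), Nat.add_sub_cancel_left, hJ]
      · rw [if_neg (by omega), Nat.add_sub_cancel_left, hO]
      · rw [rowVal, if_neg (by omega), Nat.add_sub_cancel_left, ht.tab e he, hJ, hO]
  obtain ⟨x, hx, hxr, hxl⟩ := exists_slot hQ hm hs.le hr hlow
  refine ⟨x, hx, ?_, ?_, ?_⟩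
  · rw [good, hxr, hrJ.2.2, hxl]
    rcases hs with ⟨rfl, -⟩ | ⟨rfl, -⟩
    · rw [pow_zero] at hlow
      left; omega
    · by_cases hc : 2 ^ μ ≤ extend w j - o
      · exact Or.inl hc
      · right
        rw [Nat.mod_eq_of_lt (by omega)]
        omega
  · rw [elemJ, hxr]; exact hrJ.1
  · rw [elemO, rowOff, hxr, hrJ.2.1, hxl]; omega

end Elements

/-! ### From one table to the next -/

section Extension

variable {Q n : ℕ} {w : Fin n → ℕ} {p : Par} {m μ d E K F : ℕ} {reg₀ ram₀ : ℕ → ℕ}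
  {cs : (ℕ → ℕ) × (ℕ → ℕ)} {A : Finset (Basis Q)}

lemma injOn_range_card {f : ℕ → Basis Q}
    (hf : (Finset.range A.card).image f = A) {i j : ℕ} (hi : i < A.card) (hj : j < A.card)
    (hij : f i = f j) : i = j := by
  have : Set.InjOn f (Finset.range A.card) := by
    rw [← Finset.card_image_iff, hf, Finset.card_range]
  exact this (by simpa using hi) (by simpa using hj) hij

/-- Old entries are even multiples of `2 ^ m`, new ones are such a multiple (possibly zero) plus `2
^ m`, hence odd. So the two parts of the list are disjoint, and the new part is free of repetitions
because different slots stand for different elements. -/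
lemma Collected.entries (hB : Base w p m 0 E K F reg₀ ram₀) (hQ : Q = 9 * p.L)
    (ht : Table w ram₀ (2 ^ (m + 1)) E) (h : Collected w p m 0 E K F reg₀ ram₀ cs A) :
    Entries w cs.2 (2 ^ m) (E + A.card) := by
  obtain ⟨f, hf1, hf2⟩ := h.list
  have hs : Stage m 0 (2 ^ (m + 1)) := Or.inl ⟨rfl, rfl⟩
  have hfA : ∀ i < A.card, f i ∈ slots Q p 0 ∧ good w p m 0 ram₀ (f i) := by
    intro i hi
    have : f i ∈ marked Q w p m 0 ram₀ := h.sub (by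
      rw [← hf1]; exact Finset.mem_image_of_mem _ (Finset.mem_range.2 hi))
    rw [marked, Finset.mem_filter] at this
    exact ⟨this.1, (goodBit_iff hQ hB.qreg hB.tables this.1).1 this.2⟩
  have hdvd : (2 : ℕ) ^ m ∣ 2 ^ (m + 1) := pow_dvd_pow _ (by omega)
  have hnew : ∀ i < A.card, ∃ o, 2 ^ (m + 1) ∣ o ∧ elemO p m 0 ram₀ (f i) = o + 2 ^ m := by
    intro i hi
    obtain ⟨h1, -, -⟩ := row_spec ht (rowVal_pos_of_good (hfA i hi).2)
    refine ⟨_, h1, ?_⟩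
    have := lowOf_lt 0 (f i)
    rw [pow_zero] at this
    unfold elemO
    omega
  have cases : ∀ e < E + A.card, (e < E ∧ cs.2 (8 * e + 1) = ram₀ (8 * e + 1) ∧
      cs.2 (8 * e + 2) = ram₀ (8 * e + 2)) ∨ ∃ i < A.card, e = E + i ∧
      cs.2 (8 * e + 1) = elemJ p 0 ram₀ (f i) ∧ cs.2 (8 * e + 2) = elemO p m 0 ram₀ (f i) := by
    intro e he
    by_cases heE : e < E
    · exact Or.inl ⟨heE, h.old e heE⟩
    · right
      refine ⟨e - E, by omega, by omega, ?_⟩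
      have := hf2 (e - E) (by omega)
      rw [show E + (e - E) = e by omega] at this
      exact ⟨this.1, this.2.1⟩
  have hodd : ∀ e < E, ∀ i < A.card, ram₀ (8 * e + 2) ≠ elemO p m 0 ram₀ (f i) := by
    intro e he i hi heq
    obtain ⟨o, h1, h2⟩ := hnew i hi
    rw [h2] at heq
    have h3 := (Nat.dvd_add_right h1).1 (heq ▸ ht.dvd e he)
    have := Nat.le_of_dvd (by positivity) h3
    rw [pow_succ] at this
    have := Nat.two_pow_pos m
    omega
  refine ⟨fun e he => ?_, fun e he => ?_, fun e he => ?_, fun e he e' he' => ?_⟩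
  · rcases cases e he with ⟨h1, -, h3⟩ | ⟨i, hi, -, -, h3⟩
    · rw [h3]; exact hdvd.trans (ht.dvd e h1)
    · obtain ⟨o, h4, h5⟩ := hnew i hi
      rw [h3, h5]
      exact dvd_add (hdvd.trans h4) dvd_rfl
  · rcases cases e he with ⟨h1, -, h3⟩ | ⟨i, hi, -, -, h3⟩
    · rw [h3]; exact ht.pos e h1
    · rw [h3]
      have := (elem_le ht hs (hfA i hi).2).2
      omega
  · rcases cases e he with ⟨h1, h2, h3⟩ | ⟨i, hi, -, h2, h3⟩
    · rw [h2, h3]; exact ht.le e h1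
    · rw [h2, h3]
      exact (elem_le ht hs (hfA i hi).2).1
  · rcases cases e he with ⟨h1, h2, h3⟩ | ⟨i, hi, hei, h2, h3⟩ <;>
    rcases cases e' he' with ⟨h1', h2', h3'⟩ | ⟨i', hi', hei', h2', h3'⟩
    · rw [h2, h3, h2', h3']; exact ht.inj e h1 e' h1'
    · rw [h3, h3']; exact fun _ h => absurd h (hodd e h1 i' hi')
    · rw [h3, h3']; exact fun _ h => absurd h.symm (hodd e' h1' i hi)
    · rw [h2, h3, h2', h3']
      intro hJ hO
      have := elem_inj hQ hB.qreg.hm ht hs (hfA i hi).1 (hfA i' hi').1 (hfA i hi).2 (hfA i' hi').2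
        hJ hO
      rw [hei, hei', injOn_range_card hf1 hi hi' this]

/-- After everything has been collected and the new values are visible, the table is complete for
the next level. -/
lemma Collected.table (hB : Base w p m 0 E K F reg₀ ram₀) (hQ : Q = 9 * p.L) (hE : E ≤ p.k)
    (ht : Table w ram₀ (2 ^ (m + 1)) E) (h : Collected w p m 0 E K F reg₀ ram₀ cs A)
    (hA : A = marked Q w p m 0 ram₀) {ram : ℕ → ℕ}
    (hJ : ∀ e, ram (8 * e + 1) = cs.2 (8 * e + 1)) (hO : ∀ e, ram (8 * e + 2) = cs.2 (8 * e + 2))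
    (hold : ∀ e < E, ram (8 * e + 7) = cs.2 (8 * e + 7))
    (hnew : ∀ e, E ≤ e → e < E + A.card → ram (8 * e + 7) = cs.2 (8 * e + 3))
    (hz : ∀ e, E + A.card ≤ e → ram (8 * e + 7) = cs.2 (8 * e + 7)) :
    Table w ram (2 ^ m) (E + A.card) := by
  have he := h.entries hB hQ ht
  have hs : Stage m 0 (2 ^ (m + 1)) := Or.inl ⟨rfl, rfl⟩
  obtain ⟨f, hf1, hf2⟩ := h.list
  refine ⟨⟨fun e h => ?_, fun e h => ?_, fun e h => ?_, fun e h e' h' => ?_⟩, ?_, ?_, ?_⟩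
  · rw [hO]; exact he.dvd e h
  · rw [hO]; exact he.pos e h
  · rw [hO, hJ]; exact he.le e h
  · rw [hO, hJ, hO, hJ]; exact he.inj e h e' h'
  · intro j o hd ho hl
    simp only [hJ, hO]
    -- Even multiples are in the old table; an odd one belongs to a marked slot, and all of these
    -- have been collected.
    by_cases hd2 : 2 ^ (m + 1) ∣ o
    · obtain ⟨e, h1, h2, h3⟩ := ht.surj j o hd2 ho hl
      exact ⟨e, by omega, by rw [(h.old e h1).1, h2], by rw [(h.old e h1).2, h3]⟩
    · have hmod : o % 2 ^ (m + 1) = 2 ^ m := by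
        obtain ⟨a, rfl⟩ := hd
        rw [pow_succ, Nat.mul_mod_mul_left]
        rcases Nat.mod_two_eq_zero_or_one a with h0 | h0
        · exfalso
          apply hd2
          rw [pow_succ]
          exact Nat.mul_dvd_mul_left _ (Nat.dvd_of_mod_eq_zero h0)
        · rw [h0, mul_one]
      obtain ⟨x, hxs, hxg, hxJ, hxO⟩ := elem_surj hQ hB.qreg.hm hB.tables.n_eq hE ht hs ho hl
        fun _ _ => hmod
      have hxA : x ∈ A := by
        rw [hA, marked, Finset.mem_filter]
        exact ⟨hxs, (goodBit_iff hQ hB.qreg hB.tables hxs).2 hxg⟩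
      rw [← hf1, Finset.mem_image] at hxA
      obtain ⟨i, hi, rfl⟩ := hxA
      rw [Finset.mem_range] at hi
      exact ⟨E + i, by omega, by rw [(hf2 i hi).1, hxJ], by rw [(hf2 i hi).2.1, hxO]⟩
  · intro e hlt
    by_cases heE : e < E
    · rw [hold e heE, hJ, hO, h.tab, (h.old e heE).1, (h.old e heE).2]
      exact ht.tab e heE
    · have := hf2 (e - E) (by omega)
      rw [show E + (e - E) = e by omega] at this
      rw [hnew e (by omega) hlt, hJ, hO, this.1, this.2.1, this.2.2]
      have hx : f (e - E) ∈ marked Q w p m 0 ram₀ := h.sub (by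
        rw [← hf1]; exact Finset.mem_image_of_mem _ (Finset.mem_range.2 (by omega)))
      rw [marked, Finset.mem_filter] at hx
      have hg := (goodBit_iff hQ hB.qreg hB.tables hx.1).1 hx.2
      obtain ⟨-, -, h3⟩ := row_spec ht (rowVal_pos_of_good hg)
      have hl := lowOf_lt 0 (f (e - E))
      have h2m := Nat.two_pow_pos m
      rw [pow_zero] at hl
      unfold restV elemO
      rw [h3]
      omega
  · intro e hge
    rw [hz e hge, h.tab]
    exact ht.tab_zero e (by omega)

end Extension

/-! ### Success probability of consecutive levels -/

section Reach

variable {Q n : ℕ} {w : Fin n → ℕ} {L : ℕ} {I J I' : (ℕ → ℕ) × (ℕ → ℕ) → Prop} {P R : Cmd}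
  {β β' : ℝ}

/-- Started in a situation `I`, the program reaches `J` with probability at least `β`. -/
def Reach (Q : ℕ) (w : Fin n → ℕ) (L : ℕ) (P : Cmd) (I J : (ℕ → ℕ) × (ℕ → ℕ) → Prop) (β : ℝ) :
    Prop :=
  ∀ h : (ℕ → ℕ) × (ℕ → ℕ) → ℝ, (∀ cs, 0 ≤ h cs) → ∀ v, 0 ≤ v → (∀ cs, J cs → v ≤ h cs) →
    ∀ cs, I cs → β * v ≤ P.ex Q w L h cs

lemma Reach.loop {N : ℕ} {I : ℕ → (ℕ → ℕ) × (ℕ → ℕ) → Prop} {e : Expr} (h0 : 0 ≤ β)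
    (h : ∀ j < N, Reach Q w L P (I j) (I (j + 1)) β) :
    Reach Q w L (.loop e P) (fun cs => I 0 cs ∧ e.eval L cs.1 = N) (I N) (β ^ N) := by
  intro f hf v hv hJ cs hI
  have key : ∀ i ≤ N, (∀ cs, 0 ≤ (P.ex Q w L)^[i] f cs) ∧ ∀ cs, I (N - i) cs →
      β ^ i * v ≤ (P.ex Q w L)^[i] f cs := by
    intro i
    induction i with
    | zero => exact fun _ => ⟨hf, fun cs hA => by simpa using hJ cs hA⟩
    | succ i ih =>
      intro hi
      obtain ⟨ih1, ih2⟩ := ih (by omega)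
      rw [Function.iterate_succ_apply']
      refine ⟨ex_nonneg P ih1, fun cs hA => ?_⟩
      rw [pow_succ', mul_assoc]
      refine h (N - (i + 1)) (by omega) _ ih1 _ (by positivity) ?_ cs hA
      rw [show N - (i + 1) + 1 = N - i by omega]
      exact ih2
  have := (key N le_rfl).2 cs (by rw [Nat.sub_self]; exact hI.1)
  refine this.trans ?_
  rw [← hI.2]
  exact ex_loop_le e P hf cs

end Reach

/-! ### Publishing the new rows -/

section Commit

variable {Q n : ℕ} {w : Fin n → ℕ} {p : Par} {reg ram : ℕ → ℕ}

/-- The loop always makes `k` rounds, a bound visible in the syntax, and idles once the index has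
reached `c`; hence the `min` in the invariant. -/
lemma det_commit {E c : ℕ} (h1 : reg 1 = p.k) (h5 : reg 5 = p.S) (h22 : reg 22 = E)
    (h14 : reg 14 = c) (hc : c ≤ E + p.k) (hE : E ≤ c) (hS : 8 * c + 8 ≤ p.S) (y : Basis Q) :
    ∃ reg' ram', commit.det w p.L ⟨reg, ram, y⟩ = ⟨reg', ram', y⟩ ∧
      AgreeReg {11, 22, 28} reg reg' ∧ reg' 22 = c ∧
      (∀ a, a % 8 ≠ 7 → ram' a = ram a) ∧
      (∀ e, E ≤ e → e < c → ram' (8 * e + 7) = ram (8 * e + 3)) ∧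
      ∀ e, (e < E ∨ c ≤ e) → ram' (8 * e + 7) = ram (8 * e + 7) := by
  have hSL := p.S_lt
  have h5u := p.five_u
  set r1 := Function.update reg 11 E with hr1
  have key := det_loop (w := w) (L := p.L) (e := .reg 1) (p := .ite (.bin .lt ix (.reg 14))
    (.load 28 (8 * ix + 3) ⨾ .store ((8 * ix + 7) % .reg 5) (.reg 28) ⨾ .assign 11 (ix + 1)) .skip)
    (fun j s => s.lab = y ∧ AgreeReg {11, 28} reg s.reg ∧ s.reg 11 = min (E + j) c ∧
      (∀ a, a % 8 ≠ 7 → s.ram a = ram a) ∧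
      (∀ e, E ≤ e → e < min (E + j) c → s.ram (8 * e + 7) = ram (8 * e + 3)) ∧
      ∀ e, (e < E ∨ min (E + j) c ≤ e) → s.ram (8 * e + 7) = ram (8 * e + 7))
    (⟨r1, ram, y⟩ : DState Q)
    ⟨rfl, (AgreeReg.update reg 11 E).trans (S' := ∅) (fun _ _ => rfl) (by decide), by
      simp only [hr1, Function.update_self]; omega, fun _ _ => rfl, fun e _ h => by omega,
      fun _ _ => rfl⟩ (by
      rintro j hj ⟨r, m', y'⟩ ⟨hy, ha, h11, hm, hn, ho⟩
      simp only at hy ha h11 hm hn ho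
      subst hy
      have e14 : r 14 = c := (ha 14 (by decide)).trans h14
      have e5 : r 5 = p.S := (ha 5 (by decide)).trans h5
      have e8 : ∀ r, (8 : Expr).eval p.L r = 8 := fun r => p.eval_lit (by norm_num)
      have hcond : (Expr.bin .lt ix (.reg 14)).eval p.L r = if E + j < c then 1 else 0 := by
        rw [eval_lt, eval_reg, eval_reg, h11, e14]
        by_cases hjc : E + j < c
        · rw [if_pos (by omega), if_pos hjc]; exact p.mod_eq (by omega)
        · rw [if_neg (by omega), if_neg hjc]; exact Nat.zero_mod _
      rw [Cmd.det]
      simp only [hcond]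
      by_cases hjc : E + j < c
      · simp only [if_pos hjc, ne_eq, one_ne_zero, not_false_eq_true, if_true]
        have h11' : r 11 = E + j := by rw [h11]; omega
        have e1 : (8 * ix + 3).eval p.L r = 8 * (E + j) + 3 :=
          eval_add_of_lt (eval_mul_of_lt (e8 _) h11' (by omega)) (p.eval_lit (by norm_num)) (by omega)
        set v := m' (8 * (E + j) + 3) with hv
        have e2 : ((8 * ix + 7) % .reg 5).eval p.L (Function.update r 28 v) = 8 * (E + j) + 7 := by
          have h11'' : ix.eval p.L (Function.update r 28 v) = E + j := by
            rw [eval_reg, Function.update_of_ne (by norm_num), h11']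
          rw [eval_mod, eval_add_of_lt (eval_mul_of_lt (e8 _) h11'' (by omega))
            (show (7 : Expr).eval p.L _ = 7 from p.eval_lit (by norm_num)) (by omega), eval_reg,
            Function.update_of_ne (by norm_num), e5, Nat.mod_eq_of_lt (by omega)]
        have e3 : (ix + 1).eval p.L (Function.update r 28 v) = E + j + 1 := by
          refine eval_add_of_lt ?_ (p.eval_lit (by norm_num)) (by omega)
          rw [eval_reg, Function.update_of_ne (by norm_num), h11']
        simp only [Cmd.det, e1, ← hv, e2, e3, eval_reg, Function.update_self]
        refine ⟨trivial, ?_, by omega, ?_, ?_, ?_⟩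
        · exact (ha.trans (AgreeReg.update _ _ _) (S'' := {11, 28}) (by decide)).trans
            (AgreeReg.update _ _ _) (by decide)
        · intro a ha'
          rw [Function.update_of_ne (by omega), hm a ha']
        · intro e he1 he2
          by_cases he : e = E + j
          · rw [he, Function.update_self, hv, hm _ (by omega)]
          · rw [Function.update_of_ne (by omega), hn e he1 (by omega)]
        · intro e he
          rw [Function.update_of_ne (by omega), ho e (by omega)]
      · simp only [if_neg hjc, ne_eq, not_true_eq_false, if_false, Cmd.det]
        exact ⟨trivial, ha, by omega, hm, fun e h1 h2 => hn e h1 (by omega),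
          fun e he => ho e (by omega)⟩)
  have hk : (Expr.reg 1).eval p.L r1 = p.k := by
    rw [eval_reg, hr1, Function.update_of_ne (by norm_num), h1]
  simp only [hk] at key
  obtain ⟨k1, k2, -, k4, k5, k6⟩ := key
  have hmin : min (E + p.k) c = c := by omega
  rw [hmin] at k5 k6
  set s := (Cmd.loop (.reg 1) (.ite (.bin .lt ix (.reg 14))
    (.load 28 (8 * ix + 3) ⨾ .store ((8 * ix + 7) % .reg 5) (.reg 28) ⨾ .assign 11 (ix + 1))
    .skip)).det w p.L (⟨r1, ram, y⟩ : DState Q) with hs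
  refine ⟨Function.update s.reg 22 c, s.ram, ?_, ?_, Function.update_self _ _ _, k4, k5, k6⟩
  · have e22 : (Expr.reg 22).eval p.L reg = E := h22
    have e14 : (Expr.reg 14).eval p.L s.reg = c := (k2 14 (by decide)).trans h14
    unfold commit
    rw [Cmd.det, Cmd.det, e22, ← hr1, Cmd.det, ← hs, Cmd.det, e14, k1]
  · exact k2.trans (AgreeReg.update _ _ _) (by decide)

end Commit

/-! ### Success probability of a collection -/

section Collections

variable {Q n : ℕ} {w : Fin n → ℕ} {p : Par} {m μ E K F a : ℕ} {reg ram : ℕ → ℕ}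

/-- The probability that an element is missed in all rounds. -/
noncomputable def missProb (p : Par) (a : ℕ) : ℝ := (1 - 1 / (40 * p.k)) ^ (p.k * (a * p.L))

lemma rateBound_mem (p : Par) : 0 ≤ 1 / (40 * p.k : ℝ) ∧ 1 / (40 * p.k : ℝ) ≤ 1 := by
  have hk : (1 : ℝ) ≤ p.k := by exact_mod_cast p.one_le_k
  refine ⟨by positivity, ?_⟩
  rw [div_le_one (by positivity)]
  linarith

lemma missProb_nonneg (p : Par) (a : ℕ) : 0 ≤ missProb p a :=
  pow_nonneg (by linarith [rateBound_mem p]) _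

lemma card_marked_le (Q : ℕ) (w : Fin n → ℕ) (p : Par) (m μ : ℕ) (ram : ℕ → ℕ)
    (hQ : Q = 9 * p.L) (hm : m + 5 * p.u ≤ p.L) (hμ : μ ≤ m) :
    (marked Q w p m μ ram).card ≤ 2 ^ (μ + p.u + 1) := by
  have hu := p.u_pos
  have h1 := Finset.card_le_card_of_injOn (s := marked Q w p m μ ram)
    (t := (Finset.range (2 ^ μ)) ×ˢ (Finset.range (2 ^ (p.u + 1))))
    (fun x => (lowOf μ x, rowOf p μ x)) (fun x _ => by
      simp only [Finset.coe_product, Finset.coe_range, Set.mem_prod, Set.mem_Iio]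
      exact ⟨lowOf_lt μ x, rowOf_lt x⟩) (fun x hx y hy h => by
      simp only [Prod.mk.injEq] at h
      have hx' := (Finset.mem_filter.1 hx).1
      have hy' := (Finset.mem_filter.1 hy).1
      exact keyOf_injOn hx' hy' (by
        rw [keyOf_eq hQ hm hμ hx', keyOf_eq hQ hm hμ hy', h.1, h.2]))
  rw [Finset.card_product, Finset.card_range, Finset.card_range, ← pow_add] at h1
  exact h1

/-- The rates suffice if few elements are wanted, or there are many of them. -/
lemma exists_rate_ge (p : Par) {h : ℕ} (hh : h ≤ 2 ^ (μ + p.u + 1)) (hK : K ≤ 2 * p.k)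
    (hc : μ = 0 ∨ K = p.k ∧ p.k * 2 ^ μ ≤ 2 * h) :
    ∃ q ∈ roundRates p μ h, 1 / (40 * p.k : ℝ) * (min K h : ℕ) ≤ q * h := by
  obtain ⟨q, hq, hle⟩ := exists_rate p hh
  -- The linear bound uses `min K h ≤ h` without low bits, and `min K h ≤ k` with `k * 2 ^ μ ≤ 2 h`
  -- otherwise. For the constant bound, `K ≤ 2 k` makes the left side at most `1 / 20`.
  refine ⟨q, hq, le_trans (le_min ?_ ?_) hle⟩
  · have hk : (1 : ℝ) ≤ p.k := by exact_mod_cast p.one_le_k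
    rw [div_mul_eq_mul_div, one_mul, div_le_div_iff₀ (by positivity) (by positivity)]
    rcases hc with rfl | ⟨rfl, hc⟩
    · have h1 : ((min K h : ℕ) : ℝ) ≤ h := by exact_mod_cast min_le_right K h
      rw [pow_zero, mul_one]
      nlinarith [(Nat.cast_nonneg h : (0 : ℝ) ≤ h)]
    · have h1 : ((min p.k h : ℕ) : ℝ) ≤ p.k := by exact_mod_cast min_le_left p.k h
      have h2 : (p.k * 2 ^ μ : ℝ) ≤ 2 * h := by exact_mod_cast hc
      have h3 : ((min p.k h : ℕ) : ℝ) * 2 ^ μ ≤ 2 * h :=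
        (mul_le_mul_of_nonneg_right h1 (by positivity)).trans h2
      nlinarith
  · have hk : (1 : ℝ) ≤ p.k := by exact_mod_cast p.one_le_k
    have h1 : ((min K h : ℕ) : ℝ) ≤ 2 * p.k := by exact_mod_cast (min_le_left K h).trans hK
    rw [div_mul_eq_mul_div, one_mul, div_le_div_iff₀ (by positivity) (by norm_num)]
    linarith

lemma le_ex_collect_full (hB : Base w p m μ E K F (collectReg reg) ram) (hQ : Q = 9 * p.L)
    (ha : a ≤ p.L) (hE : reg 22 = E) (hf0 : reg 21 ≠ 0) (hF : reg 21 + 1 ≤ F)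
    (hfresh : ∀ i, 2 * reg 21 ≤ i → ram (8 * i) = 0) (hK : K ≤ 2 * p.k)
    (hc : μ = 0 ∨ K = p.k ∧ p.k * 2 ^ μ ≤ 2 * (marked Q w p m μ ram).card)
    {h : (ℕ → ℕ) × (ℕ → ℕ) → ℝ} (hh : ∀ cs, 0 ≤ h cs) {v : ℝ} (hv : 0 ≤ v)
    (hg : ∀ cs (A : Finset (Basis Q)), Collected w p m μ E K F (collectReg reg) ram cs A →
      min K (marked Q w p m μ ram).card ≤ A.card → v ≤ h cs) :
    (1 - missProb p a * K) * v ≤ (collect a).ex Q w p.L h (reg, ram) := by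
  have hb := hB.qreg.bounds
  have h1 := draws_rounds_full (M := marked Q w p m μ ram) (K := K)
    (roundRates_isRate p μ (marked Q w p m μ ram)) (rateBound_mem p).1 (rateBound_mem p).2
    (exists_rate_ge p (card_marked_le Q w p m μ ram hQ hb.1 hb.2.1) hK hc) (p.k * (a * p.L))
  refine (mul_le_mul_of_nonneg_right h1 hv).trans ?_
  have h2 := draws_linear (M := marked Q w p m μ ram) (K := K) (rounds (p.k * (a * p.L))
    (roundRates p μ (marked Q w p m μ ram).card)) (fun A =>
      if min K (marked Q w p m μ ram).card ≤ A.card then 1 else 0) (fun _ => 0) v 0 ∅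
  simp only [zero_mul, add_zero] at h2
  rw [mul_comm, ← h2]
  refine le_ex_collect hB hQ ha hE hf0 hF hfresh hh fun cs A hA => ?_
  split_ifs with hm
  · rw [mul_one]; exact hg cs A hA hm
  · rw [mul_zero]; exact hh cs

lemma le_ex_collect_uniform (hB : Base w p m μ E K F (collectReg reg) ram) (hQ : Q = 9 * p.L)
    (ha : a ≤ p.L) (hE : reg 22 = E) (hf0 : reg 21 ≠ 0) (hF : reg 21 + 1 ≤ F)
    (hfresh : ∀ i, 2 * reg 21 ≤ i → ram (8 * i) = 0) (hK : K ≤ 2 * p.k)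
    (hc : μ = 0 ∨ K = p.k ∧ p.k * 2 ^ μ ≤ 2 * (marked Q w p m μ ram).card)
    (hKM : K ≤ (marked Q w p m μ ram).card) {B : Finset (Basis Q)}
    (hBM : B ∈ (marked Q w p m μ ram).powersetCard K)
    {h : (ℕ → ℕ) × (ℕ → ℕ) → ℝ} (hh : ∀ cs, 0 ≤ h cs) {v : ℝ} (hv : 0 ≤ v)
    (hg : ∀ cs, Collected w p m μ E K F (collectReg reg) ram cs B → v ≤ h cs) :
    (1 - missProb p a * K) / ((marked Q w p m μ ram).powersetCard K).card * v ≤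
      (collect a).ex Q w p.L h (reg, ram) := by
  have hb := hB.qreg.bounds
  have h1 := draws_rounds_uniform (M := marked Q w p m μ ram) (K := K)
    (roundRates_isRate p μ (marked Q w p m μ ram)) (rateBound_mem p).1 (rateBound_mem p).2
    (exists_rate_ge p (card_marked_le Q w p m μ ram hQ hb.1 hb.2.1) hK hc) (p.k * (a * p.L))
    hKM hBM
  refine (mul_le_mul_of_nonneg_right h1 hv).trans ?_
  have h2 := draws_linear (M := marked Q w p m μ ram) (K := K) (rounds (p.k * (a * p.L))
    (roundRates p μ (marked Q w p m μ ram).card)) (fun A => if A = B then 1 else 0)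
    (fun _ => 0) v 0 ∅
  simp only [zero_mul, add_zero] at h2
  rw [mul_comm, ← h2]
  refine le_ex_collect hB hQ ha hE hf0 hF hfresh hh fun cs A hA => ?_
  split_ifs with hm
  · rw [mul_one]; subst hm; exact hg cs hA
  · rw [mul_zero]; exact hh cs

end Collections

/-! ### Lowering the level -/

section Levels

variable {Q n : ℕ} {w : Fin n → ℕ} {p : Par} {m μ d E K f a m₀ : ℕ} {reg ram : ℕ → ℕ}

/-- The registers that the preamble has set. -/
structure Consts (p : Par) (r : ℕ → ℕ) : Prop where
  r1 : r 1 = p.k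
  r2 : r 2 = p.L
  r3 : r 3 = p.u
  r4 : r 4 = p.T
  r5 : r 5 = p.S
  r6 : r 6 = 2 ^ p.u

/-- The situation between two levels: the table contains the multiples of `2 ^ m`, and `σ` says
whether the search for the right level is over. -/
structure Level (w : Fin n → ℕ) (p : Par) (f m E σ : ℕ) (cs : (ℕ → ℕ) × (ℕ → ℕ)) : Prop where
  consts : Consts p cs.1
  r7 : cs.1 7 = m
  r8 : cs.1 8 = 2 ^ m
  r22 : cs.1 22 = E
  r23 : cs.1 23 = σ
  hm : m + 5 * p.u ≤ p.L
  free_ne : cs.1 21 ≠ 0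
  free_le : cs.1 21 ≤ f
  fresh : ∀ i, 2 * cs.1 21 ≤ i → cs.2 (8 * i) = 0
  table : Table w cs.2 (2 ^ m) E
  le : E ≤ p.k

/-- Bound for the number of tree nodes after `i` levels. -/
def nodeBound (p : Par) (i : ℕ) : ℕ := 1 + i * (1 + (p.k + 1) * p.L)

lemma Par.six_le_L (p : Par) : 6 ≤ p.L := by have := p.five_u; have := p.u_pos; omega

lemma nodeBound_le (p : Par) {i : ℕ} (hi : i ≤ p.L) (hK : K ≤ p.k + 1) :
    16 * (nodeBound p i + 1 + K * p.L + p.L + 1) ≤ p.S := by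
  have hL := p.six_le_L
  have hk := p.one_le_k
  have h1 : nodeBound p i ≤ 1 + p.L * (1 + (p.k + 1) * p.L) :=
    Nat.add_le_add_left (Nat.mul_le_mul_right _ hi) 1
  have h2 : K * p.L ≤ (p.k + 1) * p.L := Nat.mul_le_mul_right _ hK
  unfold Par.S
  nlinarith [Nat.mul_le_mul hk hL, Nat.mul_le_mul (Nat.mul_le_mul hk hL) (le_refl p.L),
    Nat.mul_le_mul hL (le_refl p.L)]

lemma size_le (p : Par) (hE : E ≤ p.k) (hK : K ≤ p.k + 1) : 8 * (E + K) + 8 ≤ p.S := by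
  have hL := p.six_le_L
  have hk := p.one_le_k
  unfold Par.S
  nlinarith [Nat.mul_le_mul hk hL, Nat.mul_le_mul (Nat.mul_le_mul hk hL) hL]

/-- Values below `2 ^ (L - 1)` leave one spare bit, so that an offset plus `2 ^ m` still fits into a
word. -/
lemma base_of_table (hq : QReg p m μ reg) (ht : Table w ram d E) (hn : n = p.n)
    (hw : ∀ j, extend w j < 2 ^ (p.L - 1)) (hE : E ≤ p.k) (h15 : reg 15 = E + K)
    (hK : K ≤ p.k + 1) {i : ℕ} (hi : i ≤ p.L) (hf : f ≤ nodeBound p i) :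
    Base w p m μ E K (f + 1) (collectReg reg) ram := by
  have hb := hq.bounds
  have h2 : 2 ^ p.L = 2 ^ (p.L - 1) * 2 := by
    rw [← pow_succ]; congr 1; have := p.six_le_L; omega
  refine ⟨hq.agree (by decide) (collectReg_agree reg), ⟨hn, fun j => ?_, fun e => ?_, fun e he => ?_⟩,
    fun e he => ?_, ht.tab_zero, (collectReg_agree reg 15 (by decide)).trans h15, ?_, size_le p hE hK⟩
  · have := hw j; omega
  · by_cases heE : e < E
    · rw [ht.tab e heE]
      have := hw (ram (8 * e + 1)); omega
    · rw [ht.tab_zero e (by omega)]; positivity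
  · exact ht.tab_zero e (by omega)
  · have heE : e < E := by
      by_contra hge
      exact he (ht.tab_zero e (by omega))
    have h3 := ht.le e heE
    have h4 := hw (ram (8 * e + 1))
    have h5 : 2 ^ m ≤ 2 ^ (p.L - 1) := Nat.pow_le_pow_right (by norm_num) (by omega)
    omega
  · exact le_trans (by gcongr) (nodeBound_le p hi hK)

lemma Table.congr {ram' : ℕ → ℕ} (h : Table w ram d E)
    (hJ : ∀ e < E, ram' (8 * e + 1) = ram (8 * e + 1))
    (hO : ∀ e < E, ram' (8 * e + 2) = ram (8 * e + 2))
    (hT : ∀ e, ram' (8 * e + 7) = ram (8 * e + 7)) : Table w ram' d E where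
  dvd e he := by rw [hO e he]; exact h.dvd e he
  pos e he := by rw [hO e he]; exact h.pos e he
  le e he := by rw [hO e he, hJ e he]; exact h.le e he
  inj e he e' he' := by rw [hO e he, hJ e he, hO e' he', hJ e' he']; exact h.inj e he e' he'
  surj j o h1 h2 h3 := by
    obtain ⟨e, he, h4, h5⟩ := h.surj j o h1 h2 h3
    exact ⟨e, he, by rw [hJ e he, h4], by rw [hO e he, h5]⟩
  tab e he := by rw [hT, hJ e he, hO e he]; exact h.tab e he
  tab_zero e he := by rw [hT]; exact h.tab_zero e he

/-- The situation after `i` levels. -/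
def LevelInv (w : Fin n → ℕ) (p : Par) (m₀ i : ℕ) (cs : (ℕ → ℕ) × (ℕ → ℕ)) : Prop :=
  ∃ m E σ, Level w p (nodeBound p i) m E σ cs ∧
    (σ = 0 ∧ m = m₀ - i ∨ σ = 1 ∧ p.k * 2 ^ m ≤ 2 * ∑ j, w j)

/-- The instructions that prepare the collection of a level. -/
def levelStart : Cmd :=
  .assign 7 (.reg 7 - 1) ⨾ .assign 8 (.reg 8 / 2) ⨾ .assign 9 0 ⨾ .assign 10 1 ⨾
    .assign 15 (.reg 1 + 1)

/-- The instructions after the collection of a level. -/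
def levelEnd : Cmd :=
  .ite (.bin .lt (.reg 14) (.reg 1 + 1)) commit
    (.assign 23 1 ⨾ .assign 7 (.reg 7 + 1) ⨾ .assign 8 (.reg 8 * 2))

lemma levelStep_eq (a : ℕ) : levelStep a =
    .ite (.reg 7 * (1 - .reg 23)) (levelStart ⨾ collect a ⨾ levelEnd) .skip := rfl

lemma det_levelStart {cs : (ℕ → ℕ) × (ℕ → ℕ)} (h : Level w p f (m + 1) E 0 cs) (y : Basis Q) :
    ∃ reg, levelStart.det w p.L ⟨cs.1, cs.2, y⟩ = ⟨reg, cs.2, y⟩ ∧ QReg p m 0 reg ∧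
      reg 15 = p.k + 1 ∧ AgreeReg {7, 8, 9, 10, 15} cs.1 reg := by
  have hS := p.S_lt
  have hm := h.hm
  have h5u := p.five_u
  have hkS := size_le (K := 0) p (le_refl p.k) (by omega)
  obtain ⟨r, ram⟩ := cs
  have c := h.consts
  have h7 := h.r7
  have h8 := h.r8
  simp only at c h7 h8
  have e1 : ∀ r, (1 : Expr).eval p.L r = 1 := fun r => p.eval_lit (by norm_num)
  have e2 : ∀ r, (2 : Expr).eval p.L r = 2 := fun r => p.eval_lit (by norm_num)
  have e0 : ∀ r, (0 : Expr).eval p.L r = 0 := fun r => p.eval_lit (by norm_num)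
  set r' := Function.update (Function.update (Function.update (Function.update (Function.update r
    7 m) 8 (2 ^ m)) 9 0) 10 1) 15 (p.k + 1) with hr'
  have ha : AgreeReg {7, 8, 9, 10, 15} r r' := by
    intro z hz
    simp only [Finset.mem_insert, Finset.mem_singleton, not_or] at hz
    simp only [hr', Function.update_apply, hz, if_false]
  refine ⟨r', ?_, ⟨?_, ?_, ?_, ?_, ?_, ?_, ?_, ?_, ?_, ?_, by omega, by omega⟩, ?_, ha⟩
  · simp only [levelStart, Cmd.det, eval_sub, eval_div, eval_reg, e0, e1, e2, eval_add, h7]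
    rw [Function.update_of_ne (show (8 : ℕ) ≠ 7 by norm_num), h8, Nat.add_sub_cancel, pow_succ,
      Nat.mul_div_cancel _ (by norm_num)]
    simp only [hr', Function.update_apply, c.r1, DState.mk.injEq, and_true]
    norm_num
    rw [Nat.mod_eq_of_lt (by omega)]
  · rw [ha 1 (by decide)]; exact c.r1
  · rw [ha 2 (by decide)]; exact c.r2
  · rw [ha 3 (by decide)]; exact c.r3
  · rw [ha 4 (by decide)]; exact c.r4
  · rw [ha 5 (by decide)]; exact c.r5
  · rw [ha 6 (by decide)]; exact c.r6
  all_goals simp [hr']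

/-- If fewer than `K` slots were collected, they are all the marked ones, and the completed table
still has at most `k` entries. Otherwise `k + 1` multiples of `2 ^ m` are known, so `k * 2 ^ m ≤ W`.
The level then returns to `m + 1`, whose table is intact because the new values were never made
visible. -/
lemma det_levelEnd (hB : Base w p m 0 E K (f + 1) (collectReg reg) ram) (hQ : Q = 9 * p.L)
    (hE : E ≤ p.k) (hK : E + K = p.k + 1) (ht : Table w ram (2 ^ (m + 1)) E)
    (hm : m + 1 + 5 * p.u ≤ p.L)
    (h22 : reg 22 = E) (h23 : reg 23 = 0)
    {cs : (ℕ → ℕ) × (ℕ → ℕ)} {A : Finset (Basis Q)}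
    (hA : Collected w p m 0 E K (f + 1) (collectReg reg) ram cs A)
    (hfull : min K (marked Q w p m 0 ram).card ≤ A.card) (y : Basis Q) :
    ∃ cs', levelEnd.det w p.L ⟨cs.1, cs.2, y⟩ = ⟨cs'.1, cs'.2, y⟩ ∧
      ∃ m' E' σ, Level w p (f + (1 + (p.k + 1) * p.L)) m' E' σ cs' ∧
        (σ = 0 ∧ m' = m ∨ σ = 1 ∧ p.k * 2 ^ m' ≤ 2 * ∑ j, w j) := by
  have hS := p.S_lt
  have h5u := p.five_u
  have hkS := size_le (K := 0) p (le_refl p.k) (by omega)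
  have hq : QReg p m 0 cs.1 := hA.qreg hB
  have h14 := hA.count
  have hcard := hA.card
  have h22' : cs.1 22 = E := (hA.agree 22 (by decide)).trans
    ((collectReg_agree reg 22 (by decide)).trans h22)
  have h23' : cs.1 23 = 0 := (hA.agree 23 (by decide)).trans
    ((collectReg_agree reg 23 (by decide)).trans h23)
  obtain ⟨ν, hν, -⟩ := hA.trie
  have hfree := hA.free
  have hAL : A.card * p.L ≤ (p.k + 1) * p.L := Nat.mul_le_mul_right _ (by omega)
  have e1 : ∀ r, (1 : Expr).eval p.L r = 1 := fun r => p.eval_lit (by norm_num)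
  have hcond : (Expr.bin .lt (.reg 14) (.reg 1 + 1)).eval p.L cs.1 =
      if A.card < K then 1 else 0 := by
    rw [eval_lt, eval_reg, h14, eval_add_of_lt (show (Expr.reg 1).eval p.L cs.1 = _ from hq.r1)
      (e1 _) (by omega)]
    by_cases hc : A.card < K
    · rw [if_pos (by omega), if_pos hc]; exact p.mod_eq (by omega)
    · rw [if_neg (by omega), if_neg hc]; exact Nat.zero_mod _
  have hent := hA.entries hB hQ ht
  have hsz := hB.size
  unfold levelEnd
  rw [Cmd.det]
  simp only [hcond]
  by_cases hc : A.card < K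
  · have hAM : A = marked Q w p m 0 ram := Finset.eq_of_subset_of_card_le hA.sub (by omega)
    obtain ⟨r', m', d', a', v22, hm1, hm2, hm3⟩ := det_commit (w := w) (p := p) (ram := cs.2) (E := E)
      hq.r1 hq.r5 h22' h14 (by omega) (by omega) (by omega) y
    refine ⟨(r', m'), ?_, m, E + A.card, 0, ?_, Or.inl ⟨rfl, rfl⟩⟩
    · simp only [if_pos hc, ne_eq, one_ne_zero, not_false_eq_true, if_true]
      exact d'
    · have hr : ∀ z, z ∉ ({11, 22, 28} : Finset ℕ) → r' z = cs.1 z := a'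
      exact
        { consts := ⟨(hr 1 (by decide)).trans hq.r1, (hr 2 (by decide)).trans hq.r2,
            (hr 3 (by decide)).trans hq.r3, (hr 4 (by decide)).trans hq.r4,
            (hr 5 (by decide)).trans hq.r5, (hr 6 (by decide)).trans hq.r6⟩
          r7 := (hr 7 (by decide)).trans hq.r7
          r8 := (hr 8 (by decide)).trans hq.r8
          r22 := v22
          r23 := (hr 23 (by decide)).trans h23'
          hm := hq.hm
          free_ne := by
            have := hν.lt 0 0
            simp only [hr 21 (by decide)]
            omega
          free_le := by
            simp only [hr 21 (by decide)]
            omega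
          fresh := fun i hi => by
            simp only [hr 21 (by decide)] at hi
            simp only [hm1 (8 * i) (by omega)]
            exact hν.fresh i hi
          table := hA.table hB hQ hE ht hAM (fun e => hm1 _ (by omega)) (fun e => hm1 _ (by omega))
            (fun e he => hm3 e (Or.inl he)) (fun e h1 h2 => hm2 e h1 h2)
            (fun e he => hm3 e (Or.inr he))
          le := by omega }
  · have hcE : A.card = K := by omega
    set r' := Function.update (Function.update (Function.update cs.1 23 1) 7 (m + 1)) 8 (2 ^ (m + 1))
      with hr'
    have ha : AgreeReg {7, 8, 23} cs.1 r' := by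
      intro z hz
      simp only [Finset.mem_insert, Finset.mem_singleton, not_or] at hz
      simp only [hr', Function.update_apply, hz, if_false]
    refine ⟨(r', cs.2), ?_, m + 1, E, 1, ?_, Or.inr ⟨rfl, ?_⟩⟩
    · have e2 : ∀ r, (2 : Expr).eval p.L r = 2 := fun r => p.eval_lit (by norm_num)
      have hpw : 2 ^ (m + 1) < 2 ^ p.L := Nat.pow_lt_pow_right (by norm_num) (by have := p.u_pos; omega)
      simp only [if_neg hc, ne_eq, not_true_eq_false, if_false, Cmd.det, eval_add, eval_mul,
        eval_reg, e1, e2]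
      rw [Function.update_of_ne (show (7 : ℕ) ≠ 23 by norm_num), hq.r7,
        Function.update_of_ne (show (8 : ℕ) ≠ 7 by norm_num),
        Function.update_of_ne (show (8 : ℕ) ≠ 23 by norm_num), hq.r8, ← pow_succ,
        Nat.mod_eq_of_lt hpw, p.mod_eq (v := m + 1) (by omega)]
    · exact
        { consts := ⟨(ha 1 (by decide)).trans hq.r1, (ha 2 (by decide)).trans hq.r2,
            (ha 3 (by decide)).trans hq.r3, (ha 4 (by decide)).trans hq.r4,
            (ha 5 (by decide)).trans hq.r5, (ha 6 (by decide)).trans hq.r6⟩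
          r7 := by simp [hr']
          r8 := by simp [hr']
          r22 := (ha 22 (by decide)).trans h22'
          r23 := by simp [hr']
          hm := hm
          free_ne := by
            have := hν.lt 0 0
            simp only [ha 21 (by decide)]
            omega
          free_le := by
            simp only [ha 21 (by decide)]
            omega
          fresh := fun i hi => by
            simp only [ha 21 (by decide)] at hi
            exact hν.fresh i hi
          table := ht.congr (fun e he => (hA.old e he).1) (fun e he => (hA.old e he).2) hA.tab
          le := hE }
    · have h1 := hent.card_le
      have h2 : p.k * 2 ^ m ≤ (E + A.card) * 2 ^ m := Nat.mul_le_mul_right _ (by omega)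
      rw [pow_succ, ← mul_assoc]
      omega

lemma Level.mono {cs : (ℕ → ℕ) × (ℕ → ℕ)} {σ f' : ℕ} (h : Level w p f m E σ cs) (hf : f ≤ f') :
    Level w p f' m E σ cs := { h with free_le := h.free_le.trans hf }

lemma nodeBound_succ (p : Par) (i : ℕ) :
    nodeBound p (i + 1) = nodeBound p i + (1 + (p.k + 1) * p.L) := by
  unfold nodeBound; ring

/-- Probability bound for one level. -/
noncomputable def levelProb (p : Par) (a : ℕ) : ℝ := 1 - missProb p a * (p.k + 1)

/-- Capacity `k + 1 - E` is what is needed to notice that the next table would have more than `k`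
entries. At level `0`, or once the search for the level is over, the step does nothing. -/
lemma reach_levelStep (hQ : Q = 9 * p.L) (ha : a ≤ p.L) (hn : n = p.n)
    (hw : ∀ j, extend w j < 2 ^ (p.L - 1)) {i : ℕ} (hi : i < p.L) :
    Reach Q w p.L (levelStep a) (LevelInv w p m₀ i) (LevelInv w p m₀ (i + 1)) (levelProb p a) := by
  have hmiss := missProb_nonneg p a
  have hS := p.S_lt
  have h5u := p.five_u
  rintro h hh v hv hJ ⟨r, ram⟩ ⟨m, E, σ, hl, hσ⟩
  have hskip : v ≤ h (r, ram) → levelProb p a * v ≤ h (r, ram) := fun hle => by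
    refine le_trans ?_ hle
    unfold levelProb
    nlinarith [mul_nonneg (mul_nonneg hmiss (by positivity : (0 : ℝ) ≤ p.k + 1)) hv]
  have hnb : nodeBound p i ≤ nodeBound p (i + 1) := by rw [nodeBound_succ]; omega
  have h7 := hl.r7
  have h23 := hl.r23
  simp only at h7 h23
  have hmL := hl.hm
  have hcond : (Expr.reg 7 * (1 - Expr.reg 23)).eval p.L r = m * (1 - σ) := by
    have : m * (1 - σ) ≤ m * 1 := Nat.mul_le_mul_left _ (by omega)
    refine eval_mul_of_lt h7 ?_ (by omega)
    rw [eval_sub, eval_reg, h23]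
    congr 1
    exact p.eval_lit (by norm_num)
  rw [levelStep_eq, ex_ite]
  simp only [hcond]
  by_cases h0 : m * (1 - σ) = 0
  · rw [if_neg (not_not.2 h0), ex_skip]
    refine hskip (hJ _ ⟨m, E, σ, hl.mono hnb, ?_⟩)
    rcases hσ with ⟨rfl, rfl⟩ | hσ
    · left
      have : m₀ - i = 0 := by simpa using h0
      exact ⟨rfl, by omega⟩
    · exact Or.inr hσ
  rw [if_pos h0]
  have hσ0 : σ = 0 ∧ m = m₀ - i := by
    rcases hσ with hσ | ⟨rfl, -⟩
    · exact hσ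
    · simp at h0
  obtain ⟨rfl, hmi⟩ := hσ0
  obtain ⟨m', rfl⟩ : ∃ m', m = m' + 1 := Nat.exists_eq_succ_of_ne_zero (by
    rintro rfl; simp at h0)
  obtain ⟨reg, hd, hq, h15, hag⟩ := det_levelStart (w := w) hl (zeroB : Basis Q)
  have hE := hl.le
  have h22 : reg 22 = E := (hag 22 (by decide)).trans hl.r22
  have h23 : reg 23 = 0 := (hag 23 (by decide)).trans hl.r23
  have h21 : reg 21 = r 21 := hag 21 (by decide)
  have hB : Base w p m' 0 E (p.k + 1 - E) (nodeBound p i + 1) (collectReg reg) ram :=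
    base_of_table hq hl.table hn hw hE (by omega) (by omega) hi.le le_rfl
  have hfle := hl.free_le
  have hfne := hl.free_ne
  simp only at hfle hfne
  refine le_trans ?_ (ex_seq_le _ _ hh _)
  refine le_trans ?_ (le_ex_of_det (m := true) (h := (collect a ⨾ levelEnd).ex Q w p.L h) rfl hd)
  refine le_trans ?_ (ex_seq_le _ _ hh _)
  refine le_trans (mul_le_mul_of_nonneg_right ?_ hv) (le_ex_collect_full hB hQ ha h22 (by omega)
    (by omega) (by rw [h21]; exact hl.fresh) (by have := p.one_le_k; omega) (Or.inl rfl)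
    (ex_nonneg _ hh) hv ?_)
  · unfold levelProb
    have : ((p.k + 1 - E : ℕ) : ℝ) ≤ (p.k : ℝ) + 1 := by
      have : p.k + 1 - E ≤ p.k + 1 := Nat.sub_le _ _
      exact_mod_cast this
    nlinarith
  · intro cs A hA hfull
    obtain ⟨cs', hd', m'', E', σ, hl', hσ'⟩ := det_levelEnd hB hQ hE (by omega) hl.table hmL h22 h23
      hA hfull (zeroB : Basis Q)
    refine (hJ cs' ⟨m'', E', σ, by rw [nodeBound_succ]; exact hl', ?_⟩).trans
      (le_ex_of_det (m := true) (h := h) rfl hd')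
    rcases hσ' with ⟨rfl, rfl⟩ | hσ'
    · exact Or.inl ⟨rfl, by omega⟩
    · exact Or.inr hσ'

end Levels

/-! ### Marked slots of the last stage and the elements of `S_w` -/

section PairSet

variable {Q n : ℕ} {w : Fin n → ℕ} {p : Par} {m E K F : ℕ} {reg₀ ram₀ : ℕ → ℕ}

lemma mem_pairSet {z : ℕ × ℕ} : z ∈ pairSet w ↔ 0 < z.2 ∧ z.2 ≤ extend w z.1 := by
  obtain ⟨j, l⟩ := z
  simp only [pairSet, Finset.mem_biUnion, Finset.mem_univ, true_and, Finset.mem_image,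
    Finset.mem_Icc, Prod.mk.injEq]
  constructor
  · rintro ⟨i, a, h, rfl, rfl⟩
    rw [extend, dif_pos i.2]
    exact ⟨h.1, h.2⟩
  · rintro ⟨h1, h2⟩
    have hj : j < n := lt_of_extend_pos (h1.trans_le h2)
    rw [extend, dif_pos hj] at h2
    exact ⟨⟨j, hj⟩, l, ⟨h1, h2⟩, rfl, rfl⟩

lemma card_pairSet (w : Fin n → ℕ) : (pairSet w).card = ∑ j, w j := by
  rw [pairSet, Finset.card_biUnion]
  · refine Finset.sum_congr rfl fun j _ => ?_
    rw [Finset.card_image_of_injective _ (fun a b h => (Prod.mk.inj h).2), Nat.card_Icc,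
      Nat.add_sub_cancel]
  · intro i _ j _ hij
    rw [Function.onFun, Finset.disjoint_left]
    intro z h1 h2
    rw [Finset.mem_image] at h1 h2
    obtain ⟨a, -, rfl⟩ := h1
    obtain ⟨b, -, h⟩ := h2
    exact hij (Fin.ext (Prod.mk.inj h).1.symm)

/-- The element that belongs to a slot. -/
def elemP (p : Par) (m : ℕ) (ram : ℕ → ℕ) (x : Basis Q) : ℕ × ℕ :=
  (elemJ p m ram x, elemO p m m ram x)

/-- This carries uniformity over from subsets of marked slots to subsets of `S_w`. -/
lemma marked_bijection (hB : Base w p m m E K F reg₀ ram₀) (hQ : Q = 9 * p.L) (hE : E ≤ p.k)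
    (ht : Table w ram₀ (2 ^ m) E) :
    Set.InjOn (elemP p m ram₀) (marked Q w p m m ram₀ : Set (Basis Q)) ∧
      (marked Q w p m m ram₀).image (elemP p m ram₀) = pairSet w := by
  have hs : Stage m m (2 ^ m) := Or.inr ⟨rfl, rfl⟩
  have hM : ∀ x, x ∈ marked Q w p m m ram₀ ↔ x ∈ slots Q p m ∧ good w p m m ram₀ x := by
    intro x
    rw [marked, Finset.mem_filter]
    exact and_congr_right fun hx => goodBit_iff hQ hB.qreg hB.tables hx
  constructor
  · intro x hx y hy h
    obtain ⟨hxs, hxg⟩ := (hM x).1 hx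
    obtain ⟨hys, hyg⟩ := (hM y).1 hy
    simp only [elemP, Prod.mk.injEq] at h
    exact elem_inj hQ hB.qreg.hm ht hs hxs hys hxg hyg h.1 h.2
  · ext ⟨j, l⟩
    rw [Finset.mem_image, mem_pairSet]
    constructor
    · rintro ⟨x, hx, hxe⟩
      obtain ⟨-, hxg⟩ := (hM x).1 hx
      have := elem_le ht hs hxg
      simp only [elemP, Prod.mk.injEq] at hxe
      rw [hxe.1, hxe.2] at this
      exact ⟨by omega, this.1⟩
    · rintro ⟨h1, h2⟩
      obtain ⟨x, hx, hg, hJ, hO⟩ := elem_surj hQ hB.qreg.hm hB.tables.n_eq hE ht hs h1 h2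
        -- The premise `2 ^ m = 2 ^ (m + 1)` of the other stage cannot hold.
        (fun h0 hd => by
          subst h0
          norm_num at hd)
      exact ⟨x, (hM x).2 ⟨hx, hg⟩, by rw [elemP, hJ, hO]⟩

end PairSet

/-! ### Writing the output -/

section Output

variable {Q n : ℕ} {w : Fin n → ℕ} {p : Par} {E : ℕ} {reg ram : ℕ → ℕ}

/-- Copying in place is safe: round `j` reads cells beyond `8 (E + j)`, while the earlier rounds
have only written below `2 j`. -/
lemma det_output (h1 : reg 1 = p.k) (h5 : reg 5 = p.S) (h22 : reg 22 = E) (hE : E ≤ p.k)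
    (y : Basis Q) :
    ∃ reg' ram', output.det w p.L ⟨reg, ram, y⟩ = ⟨reg', ram', y⟩ ∧
      ∀ i < p.k, ram' (2 * i) = ram (8 * (E + i) + 1) ∧ ram' (2 * i + 1) = ram (8 * (E + i) + 2) := by
  have hS := p.S_lt
  have h5u := p.five_u
  have hsz := size_le p hE (Nat.le_succ p.k)
  have e8 : ∀ r, (8 : Expr).eval p.L r = 8 := fun r => p.eval_lit (by norm_num)
  have e1 : ∀ r, (1 : Expr).eval p.L r = 1 := fun r => p.eval_lit (by norm_num)
  have e2 : ∀ r, (2 : Expr).eval p.L r = 2 := fun r => p.eval_lit (by norm_num)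
  have key := det_up (w := w) (L := p.L) (len := .reg 1) (N := p.k)
    (p := .load 25 (8 * (.reg 22 + ix) + 1) ⨾ .load 26 (8 * (.reg 22 + ix) + 2) ⨾
      .store ((2 * ix) % .reg 5) (.reg 25) ⨾ .store ((2 * ix + 1) % .reg 5) (.reg 26))
    (fun j s => s.lab = y ∧ AgreeReg {11, 25, 26} reg s.reg ∧ s.reg 11 = j ∧
      (∀ i < j, s.ram (2 * i) = ram (8 * (E + i) + 1) ∧
        s.ram (2 * i + 1) = ram (8 * (E + i) + 2)) ∧ ∀ a, 2 * j ≤ a → s.ram a = ram a)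
    (⟨reg, ram, y⟩ : DState Q)
    (by simp only [eval_reg]; rw [Function.update_of_ne (by norm_num), h1])
    ⟨rfl, (AgreeReg.update reg 11 0).trans (S' := ∅) (fun _ _ => rfl) (by decide), by
      simp only [Function.update_self], fun i hi => by omega, fun _ _ => rfl⟩ (by
      rintro j hj ⟨r, m', y'⟩ ⟨hy, ha, h11, hi, hm⟩
      simp only at hy ha h11 hi hm
      subst hy
      have r22 : r 22 = E := (ha 22 (by decide)).trans h22
      have r5 : r 5 = p.S := (ha 5 (by decide)).trans h5
      have hadd : ∀ r' : ℕ → ℕ, r' 22 = E → r' 11 = j → ∀ v ≤ 10,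
          (8 * (Expr.reg 22 + ix) + .lit v).eval p.L r' = 8 * (E + j) + v := by
        intro r' h1' h2' v hv
        exact eval_add_of_lt (eval_mul_of_lt (e8 _) (eval_add_of_lt h1' h2' (by omega)) (by omega))
          (p.eval_lit hv) (by omega)
      have a1 : (8 * (Expr.reg 22 + ix) + 1).eval p.L r = 8 * (E + j) + 1 :=
        hadd r r22 h11 1 (by norm_num)
      set v1 := m' (8 * (E + j) + 1) with hv1
      set r1 := Function.update r 25 v1 with hr1
      have a2 : (8 * (Expr.reg 22 + ix) + 2).eval p.L r1 = 8 * (E + j) + 2 :=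
        hadd r1 (by rw [hr1, Function.update_of_ne (by norm_num), r22])
          (by rw [hr1, Function.update_of_ne (by norm_num), h11]) 2 (by norm_num)
      set v2 := m' (8 * (E + j) + 2) with hv2
      set r2 := Function.update r1 26 v2 with hr2
      have r2v : ∀ z, z ≠ 25 → z ≠ 26 → r2 z = r z := fun z h1 h2 =>
        (Function.update_of_ne h2 _ _).trans (Function.update_of_ne h1 _ _)
      have r211 : ix.eval p.L r2 = j := (r2v 11 (by norm_num) (by norm_num)).trans h11
      have r25' : (Expr.reg 5).eval p.L r2 = p.S := (r2v 5 (by norm_num) (by norm_num)).trans r5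
      have a3 : ((2 * ix) % .reg 5).eval p.L r2 = 2 * j := by
        rw [eval_mod, eval_mul_of_lt (e2 _) r211 (by omega), r25', Nat.mod_eq_of_lt (by omega)]
      have a4 : ((2 * ix + 1) % .reg 5).eval p.L r2 = 2 * j + 1 := by
        rw [eval_mod, eval_add_of_lt (eval_mul_of_lt (e2 _) r211 (by omega)) (e1 _) (by omega), r25',
          Nat.mod_eq_of_lt (by omega)]
      have a5 : (ix + 1).eval p.L r2 = j + 1 := eval_add_of_lt r211 (e1 _) (by omega)
      have v25 : (Expr.reg 25).eval p.L r2 = v1 := by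
        rw [eval_reg, hr2, Function.update_of_ne (by norm_num), hr1, Function.update_self]
      have v26 : (Expr.reg 26).eval p.L r2 = v2 := by rw [eval_reg, hr2, Function.update_self]
      simp only [Cmd.det, a1, ← hv1, ← hr1, a2, ← hv2, ← hr2, a3, a4, a5, v25, v26]
      refine ⟨trivial, ?_, Function.update_self _ _ _, ?_, ?_⟩
      · exact ((ha.trans (AgreeReg.update _ _ _) (S'' := {11, 25, 26}) (by decide)).trans
          (AgreeReg.update _ _ _) (S'' := {11, 25, 26}) (by decide)).trans
          (AgreeReg.update _ _ _) (by decide)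
      · intro i hij
        by_cases he : i = j
        · subst he
          rw [Function.update_of_ne (by omega), Function.update_self, Function.update_self, hv1, hv2,
            hm _ (by omega), hm _ (by omega)]
          exact ⟨rfl, rfl⟩
        · rw [Function.update_of_ne (by omega), Function.update_of_ne (by omega),
            Function.update_of_ne (by omega), Function.update_of_ne (by omega)]
          exact hi i (by omega)
      · intro a ha'
        rw [Function.update_of_ne (by omega), Function.update_of_ne (by omega), hm a (by omega)])
  obtain ⟨k1, -, -, k4, -⟩ := key
  refine ⟨(output.det w p.L (⟨reg, ram, y⟩ : DState Q)).reg,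
    (output.det w p.L (⟨reg, ram, y⟩ : DState Q)).ram, ?_, k4⟩
  exact DState.ext rfl rfl k1

end Output

/-! ### The main part -/

section MainPart

variable {Q n : ℕ} {w : Fin n → ℕ} {p : Par} {a b : ℕ} {reg : ℕ → ℕ}

lemma det_start (hL : p.L = b * p.u) (hb : 5 ≤ b) (hc : Consts p reg) (ram : ℕ → ℕ) (y : Basis Q) :
    ∃ reg', (start b).det w p.L ⟨reg, ram, y⟩ = ⟨reg', ram, y⟩ ∧ Consts p reg' ∧
      reg' 7 = (b - 5) * p.u ∧ reg' 8 = 2 ^ ((b - 5) * p.u) ∧ reg' 22 = 0 ∧ reg' 23 = 0 ∧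
      reg' 21 = 1 := by
  have hu := p.u_pos
  have hLb := p.L_big
  have hbL : b ≤ p.L := by rw [hL]; exact Nat.le_mul_of_pos_right _ hu
  have hmL : (b - 5) * p.u ≤ p.L := by rw [hL]; exact Nat.mul_le_mul_right _ (by omega)
  have hmL' : (b - 5) * p.u < p.L := by
    rw [hL]; exact (Nat.mul_lt_mul_right hu).2 (by omega)
  have h6 := p.six_le_L
  have e0 : ∀ r, (0 : Expr).eval p.L r = 0 := fun r => p.eval_lit (by norm_num)
  have e1 : ∀ r, (1 : Expr).eval p.L r = 1 := fun r => p.eval_lit (by norm_num)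
  have em : ∀ r : ℕ → ℕ, r 3 = p.u → (.lit (b - 5) * .reg 3 : Expr).eval p.L r = (b - 5) * p.u :=
    fun r hr => eval_mul_of_lt (p.mod_eq (by omega)) hr (by omega)
  set r1 := Function.update (Function.update reg 7 ((b - 5) * p.u)) 8 1 with hr1
  have r13 : r1 3 = p.u := by simp [hr1, hc.r3]
  have key := det_loop (w := w) (L := p.L) (e := .lit (b - 5) * .reg 3) (p := .assign 8 (2 * .reg 8))
    (fun j s => s = ⟨Function.update r1 8 (2 ^ j), ram, y⟩) (⟨r1, ram, y⟩ : DState Q)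
    (by simp [hr1]) (by
      rintro j hj s rfl
      simp only [em r1 r13] at hj
      have : (2 * Expr.reg 8).eval p.L (Function.update r1 8 (2 ^ j)) = 2 ^ (j + 1) := by
        rw [pow_succ', eval_mul_of_lt (show (2 : Expr).eval p.L _ = 2 from p.eval_lit (by norm_num))
          (show (Expr.reg 8).eval p.L _ = 2 ^ j by rw [eval_reg, Function.update_self])]
        rw [← pow_succ']
        exact Nat.pow_lt_pow_right (by norm_num) (by omega)
      simp only [Cmd.det, this, Function.update_idem])
  simp only [em r1 r13] at key
  set r2 := Function.update (Function.update (Function.update (Function.update r1 8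
    (2 ^ ((b - 5) * p.u))) 22 0) 23 0) 21 1 with hr2
  have ha : ∀ z, z ≤ 6 → r2 z = reg z := fun z hz => by
    simp only [hr2, hr1]
    repeat rw [Function.update_of_ne (by omega)]
  refine ⟨r2, ?_, ⟨(ha 1 (by norm_num)).trans hc.r1, (ha 2 (by norm_num)).trans hc.r2,
    (ha 3 (by norm_num)).trans hc.r3, (ha 4 (by norm_num)).trans hc.r4,
    (ha 5 (by norm_num)).trans hc.r5, (ha 6 (by norm_num)).trans hc.r6⟩, ?_, ?_, ?_, ?_, ?_⟩
  · unfold start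
    rw [Cmd.det, Cmd.det, em reg hc.r3, Cmd.det, Cmd.det, e1, ← hr1, Cmd.det, key]
    simp only [Cmd.det, e0, e1, ← hr2]
  all_goals simp [hr2, hr1]

/-- The registers after the instructions that prepare the last collection. -/
def finalReg (p : Par) (m E : ℕ) (reg : ℕ → ℕ) : ℕ → ℕ :=
  Function.update (Function.update (Function.update reg 9 m) 10 (2 ^ m)) 15 (E + p.k)

/-- The sets `S` of `k` elements correspond to the sets of `k` marked slots, and each of the latter
is collected with almost the uniform probability. The density condition of the last collection comes
from the invariant of the levels. -/
lemma le_ex_final {Wm : ℕ} (hQ : Q = 9 * p.L) (ha : a ≤ p.L) (hn : n = p.n)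
    (hw : ∀ j, extend w j < 2 ^ (p.L - 1)) (hk : p.k ≤ ∑ j, w j) 
    (hWm : Wm ≤ p.L)
    {S : Finset (ℕ × ℕ)} (hS : S ∈ (pairSet w).powersetCard p.k)
    {h : (ℕ → ℕ) × (ℕ → ℕ) → ℝ} (hh : ∀ cs, 0 ≤ h cs)
    (hv : ∀ cs, (Finset.range p.k).image (fun i => (cs.2 (2 * i), cs.2 (2 * i + 1))) = S → 1 ≤ h cs)
    {cs : (ℕ → ℕ) × (ℕ → ℕ)} (hl : LevelInv w p Wm p.L cs) :
    (1 - missProb p a * p.k) / ((pairSet w).powersetCard p.k).card ≤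
      ((.assign 9 (.reg 7) ⨾ .assign 10 (.reg 8) ⨾ .assign 15 (.reg 22 + .reg 1)) ⨾
        collect a ⨾ output : Cmd).ex Q w p.L h cs := by
  obtain ⟨m, E, σ, hl, hσ⟩ := hl
  obtain ⟨r, ram⟩ := cs
  have hSL := p.S_lt
  have c := hl.consts
  have h7 := hl.r7
  have h8 := hl.r8
  have h22 := hl.r22
  simp only at c h7 h8 h22
  have hE := hl.le
  have hsz := size_le p hE (Nat.le_succ p.k)
  set reg := finalReg p m E r with hreg
  have hag : AgreeReg {9, 10, 15} r reg := by
    intro z hz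
    simp only [Finset.mem_insert, Finset.mem_singleton, not_or] at hz
    simp only [hreg, finalReg, Function.update_apply, hz, if_false]
  have hd : (.assign 9 (.reg 7) ⨾ .assign 10 (.reg 8) ⨾ .assign 15 (.reg 22 + .reg 1) : Cmd).det w
      p.L (⟨r, ram, zeroB⟩ : DState Q) = ⟨reg, ram, zeroB⟩ := by
    simp only [Cmd.det, eval_reg, h7]
    rw [Function.update_of_ne (show (8 : ℕ) ≠ 9 by norm_num), h8,
      eval_add_of_lt (x := E) (y := p.k) (by simp [h22]) (by simp [c.r1]) (by omega)]
    rfl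
  have hq : QReg p m m reg := by
    refine ⟨?_, ?_, ?_, ?_, ?_, ?_, ?_, ?_, ?_, ?_, hl.hm, le_rfl⟩
    · rw [hag 1 (by decide)]; exact c.r1
    · rw [hag 2 (by decide)]; exact c.r2
    · rw [hag 3 (by decide)]; exact c.r3
    · rw [hag 4 (by decide)]; exact c.r4
    · rw [hag 5 (by decide)]; exact c.r5
    · rw [hag 6 (by decide)]; exact c.r6
    · rw [hag 7 (by decide)]; exact h7
    · rw [hag 8 (by decide)]; exact h8
    all_goals simp [hreg, finalReg]
  have hB : Base w p m m E p.k (nodeBound p p.L + 1) (collectReg reg) ram :=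
    base_of_table hq hl.table hn hw hE (by simp [hreg, finalReg]) (Nat.le_succ _) le_rfl le_rfl
  obtain ⟨hinj, himg⟩ := marked_bijection (Q := Q) hB hQ hE hl.table
  set M := marked Q w p m m ram with hM
  have hcard : M.card = ∑ j, w j := by
    rw [← card_pairSet, ← himg, Finset.card_image_of_injOn hinj]
  have hr21 : reg 21 = r 21 := hag 21 (by decide)
  have hne := hl.free_ne
  have hfl := hl.free_le
  simp only at hne hfl
  -- Either all levels were passed and `m = 0`, where `k ≤ W` suffices, or the search stopped at a
  -- level that satisfies the inequality.
  have hkm : p.k * 2 ^ m ≤ 2 * ∑ j, w j := by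
    rcases hσ with ⟨-, hm⟩ | ⟨-, h⟩
    · have hm0 : m = 0 := by omega
      rw [hm0]; omega
    · exact h
  refine le_trans ?_ (ex_seq_le _ _ hh _)
  refine le_trans ?_ (le_ex_of_det (m := true) (h := (collect a ⨾ output).ex Q w p.L h) rfl hd)
  refine le_trans ?_ (ex_seq_le _ _ hh _)
  obtain ⟨hSsub, hScard⟩ := Finset.mem_powersetCard.1 hS
  set B := M.filter fun x => elemP p m ram x ∈ S with hBdef
  have hBimg : B.image (elemP p m ram) = S := by
    ext z
    rw [Finset.mem_image]
    constructor
    · rintro ⟨x, hx, rfl⟩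
      exact (Finset.mem_filter.1 hx).2
    · intro hz
      have := hSsub hz
      rw [← himg, Finset.mem_image] at this
      obtain ⟨x, hx, rfl⟩ := this
      exact ⟨x, Finset.mem_filter.2 ⟨hx, hz⟩, rfl⟩
  have hBcard : B.card = p.k := by
    rw [← hScard, ← hBimg, Finset.card_image_of_injOn (hinj.mono (by
      exact_mod_cast Finset.filter_subset _ _))]
  have hBM : B ∈ M.powersetCard p.k :=
    Finset.mem_powersetCard.2 ⟨Finset.filter_subset _ _, hBcard⟩
  have hfin := le_ex_collect_uniform (a := a) hB hQ ha (hag 22 (by decide) |>.trans h22) (by omega)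
    (by omega) (by rw [hr21]; exact hl.fresh) (by omega) (Or.inr ⟨rfl, by rw [← hM, hcard]; exact hkm⟩)
    (by rw [← hM, hcard]; exact hk) hBM (ex_nonneg output hh) zero_le_one (fun cs' hA => by
      have hqA := hA.qreg hB
      have h22A : cs'.1 22 = E := (hA.agree 22 (by decide)).trans
        ((collectReg_agree reg 22 (by decide)).trans ((hag 22 (by decide)).trans h22))
      obtain ⟨r', m', d', hout⟩ := det_output (w := w) (ram := cs'.2) hqA.r1 hqA.r5 h22A hE
        (zeroB : Basis Q)
      refine (hv (r', m') ?_).trans (le_ex_of_det (m := true) (h := h) rfl d')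
      obtain ⟨f, hf1, hf2⟩ := hA.list
      rw [hBcard] at hf1 hf2
      rw [← hBimg, ← hf1, Finset.image_image]
      refine Finset.image_congr fun i hi => ?_
      rw [Finset.coe_range, Set.mem_Iio] at hi
      simp only [Function.comp, elemP]
      rw [(hout i hi).1, (hout i hi).2, (hf2 i hi).1, (hf2 i hi).2.1])
  rw [mul_one, ← hM, Finset.card_powersetCard, hcard, ← card_pairSet, ← Finset.card_powersetCard]
    at hfin
  exact hfin

/-- The main part returns every `k`-subset with almost the uniform probability. -/
lemma le_ex_mainPart (hQ : Q = 9 * p.L) (ha : a ≤ p.L) (hn : n = p.n) (hL : p.L = b * p.u)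
    (hb : 5 ≤ b) (hW : ∑ j, w j < 2 ^ ((b - 5) * p.u)) (hk : p.k ≤ ∑ j, w j)
    (hprob : 0 ≤ levelProb p a) (hc : Consts p reg)
    {S : Finset (ℕ × ℕ)} (hS : S ∈ (pairSet w).powersetCard p.k)
    {h : (ℕ → ℕ) × (ℕ → ℕ) → ℝ} (hh : ∀ cs, 0 ≤ h cs)
    (hv : ∀ cs, (Finset.range p.k).image (fun i => (cs.2 (2 * i), cs.2 (2 * i + 1))) = S → 1 ≤ h cs) :
    levelProb p a ^ p.L *
        ((1 - missProb p a * p.k) / ((pairSet w).powersetCard p.k).card) ≤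
      (mainPart a b).ex Q w p.L h (reg, fun _ => 0) := by
  have hu := p.u_pos
  have hmL : (b - 5) * p.u + 5 * p.u = p.L := by
    rw [hL, ← add_mul]; congr 1; omega
  have hwj : ∀ j, extend w j < 2 ^ ((b - 5) * p.u) := by
    intro j
    refine lt_of_le_of_lt ?_ hW
    unfold extend
    split_ifs with hj
    · exact Finset.single_le_sum (f := w) (fun _ _ => Nat.zero_le _) (Finset.mem_univ _)
    · exact Nat.zero_le _
  have hw : ∀ j, extend w j < 2 ^ (p.L - 1) := fun j =>
    (hwj j).trans_le (Nat.pow_le_pow_right (by norm_num) (by omega))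
  have hmiss0 := missProb_nonneg p a
  have hmiss : missProb p a * p.k ≤ 1 := by
    unfold levelProb at hprob
    nlinarith
  obtain ⟨reg', hd, hc', h7, h8, h22, h23, h21⟩ := det_start (w := w) (Q := Q) hL hb hc
    (fun _ => 0) zeroB
  unfold mainPart
  refine le_trans ?_ (ex_seq_le _ _ hh _)
  refine le_trans ?_ (le_ex_of_det (m := true) (h := Cmd.ex Q w p.L _ h) rfl hd)
  refine le_trans ?_ (ex_seq_le _ _ hh _)
  refine Reach.loop (e := wl) (I := LevelInv w p ((b - 5) * p.u)) hprob
    (fun i hi => reach_levelStep hQ ha hn hw hi) _ (ex_nonneg _ hh) _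
    (div_nonneg (by linarith) (by positivity))
    (fun cs hcs => le_ex_final hQ ha hn hw hk (by omega) hS hh hv hcs) _
    ⟨⟨(b - 5) * p.u, 0, 0, ?_, Or.inl ⟨rfl, by simp⟩⟩, hc'.r2⟩
  exact
    { consts := hc'
      r7 := h7
      r8 := h8
      r22 := h22
      r23 := h23
      hm := by omega
      free_ne := by simp [h21]
      free_le := by simp [h21, nodeBound]
      fresh := fun _ _ => rfl
      table :=
        { dvd := fun e he => by omega
          pos := fun e he => by omega
          le := fun e he => by omega
          inj := fun e he => by omega
          -- The empty table is complete, because no `w_j` reaches `2 ^ m` at the initial level.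
          surj := fun j o hd ho hle => by
            have h1 := Nat.le_of_dvd ho hd
            have h2 := hwj j
            omega
          tab := fun e he => by omega
          tab_zero := fun _ _ => rfl }
      le := Nat.zero_le _ }

end MainPart

/-! ### Existence and computation of the parameters -/

section Preamble

variable {Q n : ℕ} {w : Fin n → ℕ}

lemma sq_le_two_pow {M : ℕ} (h : 9 ≤ M) : (2 * M + 1) ^ 2 ≤ 2 ^ M := by
  induction M, h using Nat.le_induction with
  | base => norm_num
  | succ M hM ih =>
    rw [pow_succ 2 M]
    nlinarith

/-- `T` is the largest power of two with `T² k ≤ 2 ^ u`, so doubling it violates the bound. That `b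
≥ 64` makes words long enough to address the whole memory. -/
lemma exists_par {n k b : ℕ} (hk : 1 ≤ k) (hkn : k ≤ n) (hb : 64 ≤ b) :
    ∃ p : Par, p.n = n ∧ p.k = k ∧ p.u = Nat.log 2 n + 1 ∧ p.L = wordLength b n := by
  set u := Nat.log 2 n + 1 with hu
  have hu1 : 1 ≤ u := Nat.le_add_left _ _
  have hnu : n < 2 ^ u := Nat.lt_pow_succ_log_self (by norm_num) n
  have hun : 2 ^ u ≤ 2 * n := by
    rw [hu, pow_succ']
    exact Nat.mul_le_mul_left _ (Nat.pow_log_le_self 2 (by omega))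
  have hL : wordLength b n = b * u := rfl
  set L := wordLength b n with hLdef
  have hL1 : 64 * u ≤ L := hL ▸ Nat.mul_le_mul_right _ hb
  -- With `L² ≤ 2 ^ (L / 2)` and `k < 2 ^ u`, the left side is below `2 ^ (8 + u + L / 2)`, and `L ≥
  -- 64 u` leaves room.
  have hbig : 128 * k * L * L + 64 * L < 2 ^ L := by
    have h1 : L * L ≤ 2 ^ (L / 2) := by
      refine le_trans ?_ (sq_le_two_pow (M := L / 2) (by omega))
      rw [sq]
      exact Nat.mul_le_mul (by omega) (by omega)
    have h2 : 128 * k * L * L + 64 * L ≤ 2 ^ 8 * k * (L * L) := by nlinarith [Nat.mul_le_mul hk hk]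
    have h3 : 2 ^ 8 * k * (L * L) < 2 ^ 8 * 2 ^ u * 2 ^ (L / 2) := by
      refine lt_of_le_of_lt (Nat.mul_le_mul_left _ h1) ?_
      exact Nat.mul_lt_mul_of_pos_right (Nat.mul_lt_mul_of_pos_left (by omega) (by norm_num))
        (by positivity)
    rw [← pow_add, ← pow_add] at h3
    exact (h2.trans_lt h3).trans_le (Nat.pow_le_pow_right (by norm_num) (by omega))
  set P : ℕ → Prop := fun τ => 2 ^ τ * 2 ^ τ * k ≤ 2 ^ u with hP
  have hP0 : P 0 := by simp only [hP]; omega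
  -- So the greatest exponent up to `u` is the greatest one altogether.
  have hle : ∀ τ, P τ → τ ≤ u := fun τ h => by
    have : 2 ^ τ ≤ 2 ^ u := le_trans (by nlinarith [Nat.one_le_two_pow (n := τ)]) h
    exact (Nat.pow_le_pow_iff_right (by norm_num)).1 this
  set τ := Nat.findGreatest P u with hτ
  have hPτ : P τ := Nat.findGreatest_spec (Nat.zero_le _) hP0
  have hnP : ¬ P (τ + 1) := fun h => by
    have := Nat.le_findGreatest (hle _ h) h
    omega
  exact ⟨⟨n, k, u, L, 2 ^ τ, hk, hkn, hnu, hun, hu1, by omega, hbig,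
    ⟨τ, by have := hle τ hPτ; omega, rfl⟩, hPτ, by
      simp only [hP, not_le] at hnP
      refine hnP.trans_eq ?_
      rw [pow_succ 2 τ]
      ring⟩, rfl, rfl, rfl, rfl⟩

/-- No logarithm is computed: `u` is the word length divided by the constant `b`. Register `4` is
doubled while `4 T² k ≤ 2 ^ u`, so after `j` rounds it holds `2 ^ min j τ`; since `τ < L`, the `L`
rounds suffice. -/
lemma det_preamble {p : Par} {b : ℕ} (hL : p.L = b * p.u) (hb : 1 ≤ b) {reg : ℕ → ℕ}
    (h1 : reg 1 = p.k) (h2 : reg 2 = p.L) (ram : ℕ → ℕ) (y : Basis Q) :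
    ∃ reg', (preamble b).det w p.L ⟨reg, ram, y⟩ = ⟨reg', ram, y⟩ ∧ Consts p reg' := by
  have hu := p.u_pos
  have hLb := p.L_big
  have h5u := p.five_u
  have hbL : b ≤ p.L := by rw [hL]; exact Nat.le_mul_of_pos_right _ hu
  have e1 : ∀ r, (1 : Expr).eval p.L r = 1 := fun r => p.eval_lit (by norm_num)
  have e2 : ∀ r, (2 : Expr).eval p.L r = 2 := fun r => p.eval_lit (by norm_num)
  have e4 : ∀ r, (4 : Expr).eval p.L r = 4 := fun r => p.eval_lit (by norm_num)
  have ed : ∀ r : ℕ → ℕ, r 2 = p.L → (wl / .lit b : Expr).eval p.L r = p.u := fun r hr => by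
    rw [eval_div, eval_reg, hr, eval_lit, p.mod_eq (by omega), hL, Nat.mul_div_cancel_left _ hb]
  set r1 := Function.update (Function.update reg 3 p.u) 6 1 with hr1
  have r12 : r1 2 = p.L := by simp [hr1, h2]
  have key := det_loop (w := w) (L := p.L) (e := wl / .lit b) (p := .assign 6 (.reg 6 * 2))
    (fun j s => s = ⟨Function.update r1 6 (2 ^ j), ram, y⟩) (⟨r1, ram, y⟩ : DState Q)
    (by simp [hr1]) (by
      rintro j hj s rfl
      simp only [ed r1 r12] at hj
      have : (Expr.reg 6 * 2).eval p.L (Function.update r1 6 (2 ^ j)) = 2 ^ (j + 1) := by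
        rw [pow_succ, eval_mul_of_lt (show (Expr.reg 6).eval p.L _ = 2 ^ j by
          rw [eval_reg, Function.update_self]) (e2 _)]
        rw [← pow_succ]
        exact Nat.pow_lt_pow_right (by norm_num) (by omega)
      simp only [Cmd.det, this, Function.update_idem])
  simp only [ed r1 r12] at key
  obtain ⟨τ, hτL, hτ⟩ := p.T_pow
  have hTk := p.T_le
  have hTk' := p.lt_T
  set r2 := Function.update (Function.update r1 6 (2 ^ p.u)) 4 1 with hr2
  have r22 : r2 2 = p.L := by simp [hr2, hr1, h2]
  have key2 := det_loop (w := w) (L := p.L) (e := wl)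
    (p := .ite (.bin .lt (.reg 6) (4 * .reg 4 * .reg 4 * .reg 1)) .skip (.assign 4 (2 * .reg 4)))
    (fun j s => s = ⟨Function.update r2 4 (2 ^ min j τ), ram, y⟩) (⟨r2, ram, y⟩ : DState Q)
    (by simp [hr2]) (by
      rintro j hj s rfl
      set t := 2 ^ min j τ with ht
      set r3 := Function.update r2 4 t with hr3
      have htT : t ≤ p.T := hτ ▸ Nat.pow_le_pow_right (by norm_num) (min_le_right _ _)
      have h34 : (Expr.reg 4).eval p.L r3 = t := by rw [eval_reg, hr3, Function.update_self]
      have h31 : (Expr.reg 1).eval p.L r3 = p.k := by simp [hr3, hr2, hr1, h1]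
      have h36 : (Expr.reg 6).eval p.L r3 = 2 ^ p.u := by simp [hr3, hr2]
      have hk := p.one_le_k
      have htk : t * t * p.k ≤ 2 ^ p.u := le_trans (by gcongr) hTk
      have hpow : 4 * 2 ^ p.u < 2 ^ p.L := by
        rw [show 4 * 2 ^ p.u = 2 ^ (p.u + 2) by ring]
        exact Nat.pow_lt_pow_right (by norm_num) (by omega)
      have ht1 : 1 ≤ t := Nat.one_le_two_pow
      have hprod : 4 * t * t * p.k < 2 ^ p.L := lt_of_le_of_lt (by nlinarith) hpow
      have hprod' : 4 * t * t < 2 ^ p.L := lt_of_le_of_lt (Nat.le_mul_of_pos_right _ hk) hprod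
      have hprod'' : 4 * t < 2 ^ p.L := lt_of_le_of_lt (Nat.le_mul_of_pos_right _ ht1) hprod'
      have he : (4 * .reg 4 * .reg 4 * .reg 1 : Expr).eval p.L r3 = 4 * t * t * p.k :=
        eval_mul_of_lt (eval_mul_of_lt (eval_mul_of_lt (e4 _) h34 hprod'') h34 hprod') h31 hprod
      have hc : (Expr.bin .lt (.reg 6) (4 * .reg 4 * .reg 4 * .reg 1)).eval p.L r3 =
          if 2 ^ p.u < 4 * t * t * p.k then 1 else 0 := by
        rw [eval_lt, h36, he]
        split_ifs
        · exact p.mod_eq (by omega)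
        · exact Nat.zero_mod _
      simp only [Cmd.det, hc]
      rcases lt_or_ge j τ with hjt | hjt
      · have hlt : t * 2 ≤ p.T := by
          rw [ht, min_eq_left hjt.le, ← pow_succ, hτ]
          exact Nat.pow_le_pow_right (by norm_num) hjt
        have : 4 * t * t * p.k ≤ 2 ^ p.u :=
          le_trans (by
            calc 4 * t * t * p.k = (t * 2) * (t * 2) * p.k := by ring
              _ ≤ p.T * p.T * p.k := by gcongr) hTk
        rw [if_neg (by rw [if_neg (not_lt.2 this)]; simp),
          eval_mul_of_lt (e2 _) h34 (by linarith)]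
        rw [hr3, Function.update_idem, ht, min_eq_left hjt.le, min_eq_left (by omega), pow_succ']
      · have : t = p.T := by rw [ht, min_eq_right hjt, hτ]
        rw [if_pos (by rw [this, if_pos hTk']; norm_num), hr3, ht, min_eq_right hjt,
          min_eq_right (by omega)])
  simp only [eval_reg, r22, min_eq_right hτL.le, ← hτ] at key2
  set r4 := Function.update r2 4 p.T with hr4
  have h41 : (Expr.reg 1).eval p.L r4 = p.k := by simp [hr4, hr2, hr1, h1]
  have h42 : wl.eval p.L r4 = p.L := by simp [hr4, hr2, hr1, h2]
  have hS : (128 * .reg 1 * wl * wl : Expr).eval p.L r4 = p.S := by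
    have hbig := p.big
    have hL1 : 1 ≤ p.L := by omega
    have a1 : 128 * p.k * p.L * p.L < 2 ^ p.L := by omega
    have a2 := lt_of_le_of_lt (Nat.le_mul_of_pos_right _ hL1) a1
    have a3 := lt_of_le_of_lt (Nat.le_mul_of_pos_right _ hL1) a2
    have a4 : 128 < 2 ^ p.L := lt_of_le_of_lt (Nat.le_mul_of_pos_right _ p.one_le_k) a3
    exact eval_mul_of_lt (eval_mul_of_lt (eval_mul_of_lt
      ((eval_128 _).trans (Nat.mod_eq_of_lt a4)) h41 a3) h42 a2) h42 a1
  refine ⟨Function.update r4 5 p.S, ?_, ?_⟩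
  · unfold preamble
    rw [Cmd.det, Cmd.det, ed reg h2, Cmd.det, Cmd.det, e1, ← hr1, Cmd.det, key, Cmd.det, Cmd.det,
      e1, ← hr2, Cmd.det, key2, Cmd.det, hS]
  · constructor <;> simp [hr4, hr2, hr1, h1, h2]

/-- Resource bounds concern each branch separately, which weighted sums do not see. The registers
left by the preamble bound the loops of the main part, so they must be known on every branch. -/
lemma run_eq_det {L : ℕ} {P : Cmd} (hP : P.classical false = true) {s s' : Config Q}
    {D : DState Q} (hr : s.reg = D.reg) (hm : s.ram = D.ram) (hs : s' ∈ P.run w L s) :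
    s'.reg = (P.det w L D).reg ∧ s'.ram = (P.det w L D).ram := by
  induction P generalizing s s' D with
  | gate γ i => cases γ <;> simp_all [Cmd.classical, Cmd.run, Cmd.det]
  | measure x i => simp [Cmd.classical] at hP
  | seq p q hp hq =>
    simp only [Cmd.classical, Bool.and_eq_true] at hP
    simp only [Cmd.run, List.mem_flatMap] at hs
    obtain ⟨s₁, h1, h2⟩ := hs
    obtain ⟨a1, a2⟩ := hp hP.1 hr hm h1
    exact hq hP.2 a1 a2 h2
  | ite e p q hp hq =>
    simp only [Cmd.classical, Bool.and_eq_true] at hP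
    simp only [Cmd.run, hr] at hs
    simp only [Cmd.det]
    split_ifs at hs ⊢
    · exact hp hP.1 (s := s.tick _) hr hm hs
    · exact hq hP.2 (s := s.tick _) hr hm hs
  | loop e p hp =>
    simp only [Cmd.run, hr] at hs
    simp only [Cmd.det]
    have : ∀ N, ∀ l : List (Config Q), ∀ D : DState Q, (∀ x ∈ l, x.reg = D.reg ∧ x.ram = D.ram) →
        ∀ x ∈ (fun l : List (Config Q) => l.flatMap fun s' => p.run w L (s'.tick 1))^[N] l,
          x.reg = ((p.det w L)^[N] D).reg ∧ x.ram = ((p.det w L)^[N] D).ram := by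
      intro N
      induction N with
      | zero => exact fun l D h => h
      | succ N ih =>
        intro l D h x hx
        rw [Function.iterate_succ_apply] at hx ⊢
        refine ih _ _ (fun z hz => ?_) x hx
        rw [List.mem_flatMap] at hz
        obtain ⟨z₀, hz₀, hz⟩ := hz
        exact hp hP (s := z₀.tick 1) (h z₀ hz₀).1 (h z₀ hz₀).2 hz
    refine this _ _ D (fun x hx => ?_) s' hs
    rw [List.mem_singleton] at hx
    subst hx
    exact ⟨hr, hm⟩
  | _ =>
    simp only [Cmd.run, List.mem_singleton] at hs
    subst hs
    simp [Cmd.det, Config.tick, hr, hm]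

end Preamble

/-! ### Numerical estimates -/

section Numerics

variable (p : Par) (c : ℕ)

/-- By `1 - x ≤ exp (-x)` the factor `40` cancels and the exponent becomes `-(c + 4) L`; then `exp
(-1) ≤ 1 / 2`. -/
lemma missProb_le : missProb p (40 * (c + 4)) ≤ 1 / (2 ^ p.L : ℝ) ^ (c + 4) := by
  have hk : (1 : ℝ) ≤ p.k := by exact_mod_cast p.one_le_k
  have h0 : (0 : ℝ) ≤ 1 - 1 / (40 * p.k) := by
    rw [sub_nonneg, div_le_one (by positivity)]; linarith
  unfold missProb
  calc (1 - 1 / (40 * (p.k : ℝ))) ^ (p.k * (40 * (c + 4) * p.L))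
      ≤ (Real.exp (-(1 / (40 * p.k)))) ^ (p.k * (40 * (c + 4) * p.L)) := by
        refine pow_le_pow_left₀ h0 ?_ _
        have := Real.add_one_le_exp (-(1 / (40 * (p.k : ℝ))))
        linarith
    _ = (Real.exp (-1)) ^ (p.L * (c + 4)) := by
        rw [← Real.exp_nat_mul, ← Real.exp_nat_mul]
        congr 1
        push_cast
        field_simp
    _ ≤ (1 / 2) ^ (p.L * (c + 4)) := by
        refine pow_le_pow_left₀ (Real.exp_pos _).le ?_ _
        rw [Real.exp_neg, one_div]
        exact inv_anti₀ (by norm_num) (by have := Real.add_one_le_exp (1 : ℝ); linarith)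
    _ = 1 / (2 ^ p.L : ℝ) ^ (c + 4) := by rw [one_div_pow, pow_mul]

/-- `L + 1`, `k + 1` and `n + 1` are all at most `2 ^ L`. Two of the surplus powers absorb the first
two factors. -/
lemma missProb_mul_le :
    (p.L + 1) * (p.k + 1) * missProb p (40 * (c + 4)) ≤ 1 / ((p.n : ℝ) + 1) ^ c := by
  have hN : (p.L : ℝ) + 1 ≤ 2 ^ p.L := by exact_mod_cast Nat.lt_two_pow_self (n := p.L)
  have hn : (p.n : ℝ) + 1 ≤ 2 ^ p.L := by
    have := p.n_lt.trans_le (Nat.pow_le_pow_right (n := 2) (by norm_num)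
      (show p.u ≤ p.L by have := p.five_u; omega))
    exact_mod_cast this
  have hk : (p.k : ℝ) + 1 ≤ 2 ^ p.L := by
    refine le_trans ?_ hn
    have : (p.k : ℝ) ≤ p.n := by exact_mod_cast p.k_le_n
    linarith
  have hm := missProb_le p c
  have h0 := missProb_nonneg p (40 * (c + 4))
  set N : ℝ := 2 ^ p.L with hNdef
  have hN1 : 1 ≤ N := one_le_pow₀ (by norm_num)
  calc (p.L + 1) * (p.k + 1) * missProb p (40 * (c + 4))
      ≤ N * N * (1 / N ^ (c + 4)) := by gcongr
    _ = 1 / N ^ (c + 2) := by field_simp; ring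
    _ ≤ 1 / N ^ c := by
        refine one_div_le_one_div_of_le (by positivity) ?_
        exact pow_le_pow_right₀ hN1 (by omega)
    _ ≤ 1 / ((p.n : ℝ) + 1) ^ c := by gcongr

lemma missProb_mul_le_one : missProb p (40 * (c + 4)) * (p.k + 1) ≤ 1 := by
  have h := missProb_mul_le p c
  have h0 := missProb_nonneg p (40 * (c + 4))
  have h1 : 1 / ((p.n : ℝ) + 1) ^ c ≤ 1 := by
    rw [div_le_one (by positivity)]
    exact one_le_pow₀ (by have : (0 : ℝ) ≤ p.n := Nat.cast_nonneg _; linarith)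
  have : 0 ≤ p.L * ((p.k + 1) * missProb p (40 * (c + 4))) := by positivity
  nlinarith

lemma levelProb_nonneg : 0 ≤ levelProb p (40 * (c + 4)) :=
  sub_nonneg.2 (missProb_mul_le_one p c)

/-- Bernoulli's inequality for the `L` levels, followed by the last collection: a union bound over
`L + 1` collections. -/
lemma le_levelProb_pow : 1 - 1 / ((p.n : ℝ) + 1) ^ c ≤
    levelProb p (40 * (c + 4)) ^ p.L * (1 - missProb p (40 * (c + 4)) * p.k) := by
  have h := missProb_mul_le p c
  have h1 := missProb_mul_le_one p c
  have h0 := missProb_nonneg p (40 * (c + 4))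
  unfold levelProb
  set X := missProb p (40 * (c + 4)) with hX
  have hk : (0 : ℝ) ≤ p.k := Nat.cast_nonneg _
  have hB := one_add_mul_le_pow (a := -(X * (p.k + 1))) (by linarith) p.L
  rw [← sub_eq_add_neg] at hB
  have hy : 0 ≤ 1 - X * p.k := by nlinarith
  have hXk : 0 ≤ X * p.k := by positivity
  have hz : 0 ≤ p.L * (X * (p.k + 1)) := by positivity
  calc 1 - 1 / ((p.n : ℝ) + 1) ^ c ≤ 1 - (p.L + 1) * (p.k + 1) * X := by linarith
    _ ≤ (1 + p.L * -(X * (p.k + 1))) * (1 - X * p.k) := by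
        nlinarith [mul_nonneg hz hXk]
    _ ≤ _ := mul_le_mul_of_nonneg_right hB hy

end Numerics

end QMachine

namespace QMachine

/-! ### The probability of an output -/

section Correctness

variable {n : ℕ} {w : Fin n → ℕ}

lemma init_reg {k L Q : ℕ} {p : Par} (hk : p.k = k) (hL : p.L = L) :
    (init n k L Q).reg 1 = p.k ∧ (init n k L Q).reg 2 = p.L := by
  have h1 := p.k_le_n.trans_lt (p.n_lt.trans_le (Nat.pow_le_pow_right (n := 2) (by norm_num)
    (show p.u ≤ p.L by have := p.five_u; omega)))
  have h2 := p.L_big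
  subst hk hL
  exact ⟨Nat.mod_eq_of_lt h1, Nat.mod_eq_of_lt (by
    show p.L < 2 ^ p.L
    omega)⟩

/-- The probability of an output, bounded below by an expectation over the branches that end with
all qubits zero. -/
lemma ex_le_outputProb (P : Cmd) (k L Q : ℕ) (S : Finset (ℕ × ℕ)) :
    P.ex Q w L (fun cs => if (Finset.range k).image (fun i => (cs.2 (2 * i), cs.2 (2 * i + 1))) = S
      then 1 else 0) ((init n k L Q).reg, fun _ => 0) ≤ P.outputProb w k L Q S := by
  have h := sum_run (w := w) (L := L) P (fun s : Core Q =>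
    if (Finset.range k).image (fun i => (s.ram (2 * i), s.ram (2 * i + 1))) = S then normSq s.psi
      else 0) (init n k L Q)
  refine le_of_le_of_eq ?_ h.symm
  refine wp_mono w L P (fun s => ?_) _
  unfold lift
  have hz : ‖s.psi zeroB‖ ^ 2 ≤ normSq s.psi :=
    Finset.single_le_sum (f := fun x => ‖s.psi x‖ ^ 2) (fun _ _ => sq_nonneg _)
      (Finset.mem_univ _)
  split_ifs with h1 h2 h2
  · simpa [h2] using hz
  · simp [h2]
  · exact le_trans (sq_nonneg _) hz
  · exact le_rfl

/-- Each of `C` and `n ^ C` costs `C u` bits. The remaining `5 u` bits of a word are kept for the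
row and its companions. -/
lemma sum_lt_two_pow {C b W : ℕ} {p : Par} (hn : p.n = n) (hW : W ≤ C * n ^ C)
    (hb : 2 * C + 5 ≤ b) : W < 2 ^ ((b - 5) * p.u) := by
  have h1 : C < 2 ^ (C * p.u) := Nat.lt_two_pow_self.trans_le
    (Nat.pow_le_pow_right (by norm_num) (Nat.le_mul_of_pos_right _ p.u_pos))
  have h2 : n ^ C ≤ 2 ^ (C * p.u) := by
    rw [mul_comm, pow_mul, ← hn]
    exact Nat.pow_le_pow_left p.n_lt.le _
  calc W ≤ C * n ^ C := hW
    _ ≤ C * 2 ^ (C * p.u) := Nat.mul_le_mul_left _ h2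
    _ < 2 ^ (C * p.u) * 2 ^ (C * p.u) := Nat.mul_lt_mul_of_pos_right h1 (by positivity)
    _ = 2 ^ ((2 * C) * p.u) := by rw [← pow_add]; congr 1; ring
    _ ≤ 2 ^ ((b - 5) * p.u) :=
        Nat.pow_le_pow_right (by norm_num) (Nat.mul_le_mul_right _ (by omega))

lemma le_outputProb {C c b k : ℕ} {p : Par} (hpn : p.n = n) (hpk : p.k = k)
    (hL : p.L = b * p.u) (hb : 2 * C + 40 * (c + 4) + 5 ≤ b) (hW : ∑ j, w j ≤ C * n ^ C)
    (hk : k ≤ ∑ j, w j) {S : Finset (ℕ × ℕ)} (hS : S ∈ (pairSet w).powersetCard k) :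
    (1 - 1 / ((n : ℝ) + 1) ^ c) / (((pairSet w).powersetCard k).card : ℝ) ≤
      (multiSample (40 * (c + 4)) b).outputProb w k p.L (9 * p.L) S := by
  have hbL : b ≤ p.L := by rw [hL]; exact Nat.le_mul_of_pos_right _ p.u_pos
  obtain ⟨h1, h2⟩ := init_reg (n := n) (Q := 9 * p.L) hpk rfl
  subst hpk
  refine le_trans ?_ (ex_le_outputProb _ _ _ _ _)
  set h : (ℕ → ℕ) × (ℕ → ℕ) → ℝ := fun cs =>
    if (Finset.range p.k).image (fun i => (cs.2 (2 * i), cs.2 (2 * i + 1))) = S then 1 else 0 with hh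
  have hh0 : ∀ cs, 0 ≤ h cs := fun cs => by simp only [hh]; split_ifs <;> norm_num
  obtain ⟨reg', hd, hc⟩ := det_preamble (w := w) (Q := 9 * p.L) hL (by omega) h1 h2 (fun _ => 0) zeroB
  refine le_trans ?_ (ex_seq_le _ _ hh0 _)
  refine le_trans ?_ (le_ex_of_det (m := true) (h := Cmd.ex _ w p.L _ h) rfl hd)
  refine le_trans ?_ (le_ex_mainPart rfl (by omega) hpn.symm hL (by omega)
    (sum_lt_two_pow hpn hW (by omega)) hk (levelProb_nonneg p c) hc hS hh0
    (fun cs hcs => by simp only [hh, hcs, if_true, le_refl]))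
  have hl := le_levelProb_pow p c
  rw [hpn] at hl
  rw [← mul_div_assoc]
  gcongr

end Correctness

/-! ### Resources in terms of `n` and `k` -/

section Resources

lemma wordLength_le {b n : ℕ} (hn : 1 ≤ n) :
    (wordLength b n : ℝ) ≤ 2 * b * (1 + Real.log n) := by
  have h : (Nat.log 2 n : ℝ) * Real.log 2 ≤ Real.log n := by
    rw [← Real.log_pow]
    exact Real.log_le_log (by positivity) (by exact_mod_cast Nat.pow_log_le_self 2 (by omega))
  have h2 := Real.log_two_gt_d9
  have h3 : (0 : ℝ) ≤ Nat.log 2 n := Nat.cast_nonneg _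
  have : (Nat.log 2 n : ℝ) ≤ 2 * Real.log n := by nlinarith
  have h4 : (Nat.log 2 n : ℝ) + 1 ≤ 2 * (1 + Real.log n) := by linarith
  unfold wordLength
  push_cast
  calc (b : ℝ) * (Nat.log 2 n + 1) ≤ b * (2 * (1 + Real.log n)) := by gcongr
    _ = _ := by ring

/-- The square of `k T` is `k` times `T² k ≤ 2 ^ u ≤ 2 n`. -/
lemma Par.k_mul_T_le (p : Par) : (p.k * p.T : ℝ) ≤ 2 * √((p.n : ℝ) * p.k) := by
  have h : p.T * p.T * p.k ≤ 2 * p.n := p.T_le.trans p.pow_le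
  have h' : (p.T * p.T * p.k : ℝ) ≤ 2 * p.n := by exact_mod_cast h
  refine abs_le_of_sq_le_sq' ?_ (by positivity) |>.2
  rw [mul_pow 2, Real.sq_sqrt (by positivity)]
  have hk : (0 : ℝ) ≤ p.k := Nat.cast_nonneg _
  nlinarith [mul_le_mul_of_nonneg_right h' hk]

lemma Par.k_le_sqrt (p : Par) : (p.k : ℝ) ≤ √((p.n : ℝ) * p.k) := by
  refine Real.le_sqrt_of_sq_le ?_
  rw [sq]
  have : (p.k : ℝ) ≤ p.n := by exact_mod_cast p.k_le_n
  gcongr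

/-- The bounds of the preamble refer to `k` and `L` only, so `T = 1` is put there; those of the main
part use the registers that the preamble leaves on each branch. -/
lemma multiSample_within (a b : ℕ) (hb : 1 ≤ b) : ∃ e d : ℕ, ∀ (n : ℕ) (w : Fin n → ℕ) (p : Par),
    p.L = b * p.u → ∀ s ∈ (multiSample a b).branches w p.k p.L (9 * p.L),
      s.queries ≤ s.time ∧ s.time ≤ e * p.L ^ d * (p.k * p.T) ∧ s.space ≤ p.S := by
  obtain ⟨a₁, d₁, h₁⟩ := Cmd.within 3 (preamble b) (preamble_wf b)
  obtain ⟨a₂, d₂, h₂⟩ := Cmd.within 7 (mainPart a b) (mainPart_wf a b)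
  refine ⟨a₁ + a₂, d₁ + d₂, fun n w p hL s hs => ?_⟩
  have hL1 : 1 ≤ p.L := by have := p.five_u; omega
  have hT1 : 1 ≤ p.T := by
    obtain ⟨τ, -, hτ⟩ := p.T_pow
    rw [hτ]
    exact Nat.one_le_two_pow
  have hS1 : 1 ≤ p.S := Nat.mul_pos (Nat.mul_pos (Nat.mul_pos (by norm_num) p.one_le_k) hL1) hL1
  obtain ⟨i1, i2⟩ := init_reg (n := n) (Q := 9 * p.L) (p := p) rfl rfl
  simp only [Cmd.branches, multiSample, Cmd.run, List.mem_flatMap] at hs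
  obtain ⟨s₁, hs₁, hs⟩ := hs
  obtain ⟨reg', hd, hc⟩ := det_preamble (w := w) (Q := 9 * p.L) hL hb i1 i2 (fun _ => 0) zeroB
  have hr := (run_eq_det (D := ⟨(init n p.k p.L (9 * p.L)).reg, fun _ => 0, zeroB⟩)
    (show (preamble b).classical false = true from rfl) rfl rfl hs₁).1
  rw [hd] at hr
  have w₁ := h₁ n w p.L (9 * p.L) p.k 1 p.S _ hL1 p.one_le_k le_rfl (by
    intro x hx hx1 _
    interval_cases x
    · rw [i1]; simp [p.one_le_k]
    · rw [i2]; simp [hL1]) s₁ hs₁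
  have w₂ := h₂ n w p.L (9 * p.L) p.k p.T p.S s₁ hL1 p.one_le_k hT1 (by
    intro x _ hx1 hx5
    rw [hr]
    have hu := p.u_pos
    have h5 := p.five_u
    interval_cases x
    · simp [hc.r1, p.one_le_k]
    · simp [hc.r2, hL1]
    · simp only [hc.r3]; norm_num; omega
    · simp [hc.r4, hT1]
    · simp [hc.r5, hS1]) s hs
  rw [(preamble_deg b).1, (preamble_deg b).2, pow_zero, pow_zero, mul_one, mul_one] at w₁
  rw [(mainPart_deg a b).1, (mainPart_deg a b).2, pow_one, pow_one] at w₂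
  obtain ⟨-, -, t₁, q₁, sp₁⟩ := w₁
  obtain ⟨-, -, t₂, q₂, sp₂⟩ := w₂
  have e0 : (init n p.k p.L (9 * p.L)).time = 0 := rfl
  have e1 : (init n p.k p.L (9 * p.L)).queries = 0 := rfl
  have e2 : (init n p.k p.L (9 * p.L)).space = 0 := rfl
  rw [e0] at t₁ q₁
  rw [e1] at q₁
  rw [e2] at sp₁
  refine ⟨by omega, ?_, by omega⟩
  have hkT : 1 ≤ p.k * p.T := Nat.mul_pos p.one_le_k hT1
  calc s.time ≤ a₁ * p.L ^ d₁ + a₂ * p.L ^ d₂ * p.k * p.T := by omega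
    _ ≤ a₁ * p.L ^ (d₁ + d₂) * (p.k * p.T) + a₂ * p.L ^ (d₁ + d₂) * (p.k * p.T) := by
        refine add_le_add ?_ ?_
        · refine le_trans ?_ (Nat.le_mul_of_pos_right _ hkT)
          exact Nat.mul_le_mul_left _ (Nat.pow_le_pow_right hL1 (by omega))
        · rw [mul_assoc (a₂ * _)]
          exact Nat.mul_le_mul_right _ (Nat.mul_le_mul_left _ (Nat.pow_le_pow_right hL1 (by omega)))
    _ = _ := by ring

end Resources

end QMachine

theorem mainTheorem4 (C c : ℕ) :
    ∃ (P : QMachine.Cmd) (b q d : ℕ) (A : ℝ),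
      ∀ (n k : ℕ) (w : Fin n → ℕ), 1 ≤ k → k ≤ n →
        ∑ j, w j ≤ C * n ^ C → k ≤ ∑ j, w j →
        -- the output is a uniformly random `k`-subset with probability `≥ 1 - (n + 1) ^ (-c)`
        (∀ S ∈ (QMachine.pairSet w).powersetCard k,
          (1 - 1 / ((n : ℝ) + 1) ^ c) / (((QMachine.pairSet w).powersetCard k).card : ℝ) ≤
            P.outputProb w k (QMachine.wordLength b n) (q * QMachine.wordLength b n) S) ∧
        -- queries, time and bits of memory on every branch that occurs
        ∀ s ∈ P.branches w k (QMachine.wordLength b n) (q * QMachine.wordLength b n),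
          s.psi ≠ 0 →
            (s.queries : ℝ) ≤ A * √((n : ℝ) * k) * (1 + Real.log n) ^ d ∧
            (s.time : ℝ) ≤ A * √((n : ℝ) * k) * (1 + Real.log n) ^ d ∧
            ((s.space * QMachine.wordLength b n : ℕ) : ℝ) ≤
              A * √((n : ℝ) * k) * (1 + Real.log n) ^ d := by
  -- The word length must hold `W` with `5 u` bits to spare, which takes `2 C + 5`, and the constant
  -- `40 (c + 4)` of the repetitions has to fit into a word and below `L`.
  set b := 2 * C + 40 * (c + 4) + 5 with hb
  obtain ⟨e, d, h⟩ := QMachine.multiSample_within (40 * (c + 4)) b (by omega)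
  set B : ℝ := 2 * b with hB
  -- Here `L ≤ B (1 + log n)`. The first summand of the constant bounds the time `e L ^ d k T`
  -- through `k T ≤ 2 √(nk)`; the second bounds the memory of `128 k L²` words of `L` bits through
  -- `k ≤ √(nk)`, whence the three additional powers of the logarithm.
  refine ⟨QMachine.multiSample (40 * (c + 4)) b, b, 9, d + 3, 2 * e * B ^ d + 128 * B ^ 3,
    fun n k w hk hkn hW hkW => ?_⟩
  obtain ⟨p, hpn, hpk, hpu, hpL⟩ := QMachine.exists_par (b := b) hk hkn (by omega)
  have hL : p.L = b * p.u := by rw [hpL, hpu]; rfl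
  rw [← hpL]
  refine ⟨fun S hS => QMachine.le_outputProb hpn hpk hL le_rfl hW hkW hS, fun s hs _ => ?_⟩
  rw [← hpk] at hs
  obtain ⟨hq, ht, hS⟩ := h n w p hL s hs
  have hLle : (p.L : ℝ) ≤ B * (1 + Real.log n) := by
    rw [hpL]; exact QMachine.wordLength_le (hk.trans hkn)
  have hkT := p.k_mul_T_le
  have hks := p.k_le_sqrt
  rw [hpn] at hkT hks
  rw [hpk] at hkT hks
  set X := √((n : ℝ) * k) with hX
  have hX0 : 0 ≤ X := Real.sqrt_nonneg _
  set l := 1 + Real.log n with hl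
  have hl1 : 1 ≤ l := by
    have := Real.log_natCast_nonneg n
    linarith
  have hB0 : 0 ≤ B := by positivity
  have ht' : (s.time : ℝ) ≤ (2 * e * B ^ d + 128 * B ^ 3) * X * l ^ (d + 3) := by
    calc (s.time : ℝ) ≤ e * p.L ^ d * (p.k * p.T) := by exact_mod_cast ht
      _ ≤ e * (B * l) ^ d * (2 * X) := by rw [hpk]; gcongr
      _ = 2 * e * B ^ d * X * l ^ d := by rw [mul_pow]; ring
      _ ≤ (2 * e * B ^ d + 128 * B ^ 3) * X * l ^ (d + 3) := by
        gcongr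
        · exact le_add_of_nonneg_right (by positivity)
        · omega
  refine ⟨le_trans (by exact_mod_cast hq) ht', ht', ?_⟩
  calc ((s.space * p.L : ℕ) : ℝ) ≤ ((p.S * p.L : ℕ) : ℝ) := by
        exact_mod_cast Nat.mul_le_mul_right _ hS
    _ = 128 * p.k * (p.L : ℝ) ^ 3 := by unfold QMachine.Par.S; push_cast; ring
    _ ≤ 128 * X * (B * l) ^ 3 := by rw [hpk]; gcongr
    _ = 128 * B ^ 3 * X * l ^ 3 := by rw [mul_pow]; ring
    _ ≤ (2 * e * B ^ d + 128 * B ^ 3) * X * l ^ (d + 3) := by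
        gcongr
        · exact le_add_of_nonneg_left (by positivity)
        · omega
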